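/- **Conventions.** A quantum algorithm is a family of quantum circuits, one for each size $n$ (and each value of $E$ where indicated), made of arbitrary one- and two-qubit unitary gates on the input qubits and on ancillas initialized to $|0\rangle$, followed by a measurement in the computational basis; its time complexity is the number of gates. Elements of $\mathbb{Z}_q$ are written in binary on $\lceil\log_2 q\rceil$ qubits. Put $\rho_s(\mathbf x)=\exp(-\pi\|\mathbf x\|^2/s^2)$ and, for positive definite $\mathbf S$, $\rho_{\sqrt{\mathbf S}}(\mathbf x)=\exp(-\pi\,\mathbf x^T\mathbf S^{-1}\mathbf x)$; norms are Euclidean. Asymptotic notation refers to $n\to\infty$, $\log$ is the natural logarithm. **Parameters.** Let $m=m(n)$, $q=q(n)$, $\ell=\ell(n)$ be positive integers, $\alpha=\Omega(\sqrt n)$ and $\beta,\gamma\in(0,1)$ real, with $\beta q>1$ and $$m\ge n\log q,\qquad \alpha\gamma\sqrt m<\beta<\frac1{16\sqrt{m\log(\beta q)}},\qquad m\gamma^2q^2\ge 1 .$$ For $\mathbf A\in\mathbb{Z}_q^{n\times m}$ let $\mathcal L=\mathcal L_q(\mathbf A)=\{\mathbf x\in\mathbb{Z}^m:\mathbf x\equiv\mathbf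 A^T\mathbf s \bmod q\text{ for some }\mathbf s\in\mathbb{Z}_q^n\}$, let $\lambda_1(\mathcal L)$ be the length of its shortest nonzero vector, and let $B_{\mathcal L}=\{\mathbf y\in\mathbb{R}^m:\mathrm{dist}(\mathbf y,\mathcal L)<\lambda_1(\mathcal L)/2\}$. For $\mathbf y\in B_{\mathcal L}$ put $\mathbf y'=\mathbf y-\kappa_{\mathcal L}(\mathbf y)$, where $\kappa_{\mathcal L}(\mathbf y)$ is the lattice vector closest to $\mathbf y$. For an integer $E\ge1$ and $\mathbf e\in\mathbb{Z}^m$ define * $f_E(x)=\rho_{q/\sigma(E)}(x)$ for $x\in\mathbb{Z}$, where $\sigma(E)=\dfrac{\alpha\beta q}{\sqrt{\alpha^2E+\beta^2q^2}}$; * $D_{\theta,\mathbf e,\mathbf A}$, the distribution on $\mathbb{Z}_q^m\cap B_{\mathcal L}$ with $\Pr(\mathbf y)\propto\rho_{\beta q\sqrt{\mathbf\Sigma/2}}(\mathbf y')$, where $\mathbf\Sigma=\mathbf I_m+\frac{\alpha^2}{\beta^2q^2}\mathbf e\mathbf e^T$; * $\theta_{\mathbf e,\mathbf A}(\mathbf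 y)=-\dfrac{\alpha^2\langle\mathbf y',\mathbf e\rangle}{q(\alpha^2\|\mathbf e\|^2+\beta^2q^2)}$ for $\mathbf y\in\mathbb{Z}_q^m\cap B_{\mathcal L}$. **Problem.** An algorithm solves $\mathsf{S|LWE\rangle}^{\mathsf{phase}}_{n,\ell,q,f,\theta,D}$ if for every $\mathbf s\in\mathbb{Z}_q^n$ it outputs $\mathbf s$ with probability at least $1-2^{-\Omega(n)}$ when given $\ell$ independent samples, each consisting of $\mathbf a\leftarrow\mathcal U(\mathbb{Z}_q^n)$, $\mathbf y\leftarrow D$, and the normalized state proportional to $\sum_{x\in\mathbb{Z}}f(x)\,e^{2\pi i x\theta(\mathbf y)}\,|(\langle\mathbf a,\mathbf s\rangle+x)\bmod q\rangle$. **Theorem.** Let $\ell=2^{o(n)}$ and $T=2^{o(n)}$. Assume that for every integer $E$ with $1\le E\le m\gamma^2q^2$ there is a quantum algorithm of time complexity at most $T$ that takes $\mathbf A$ as input and, with probability at least $1-2^{-\Omega(n)}$ over $\mathbf A\leftarrow\mathcal U(\mathbb{Z}_q^{n\times m})$, solves $\mathsf{S|LWE\rangle}^{\mathsf{phase}}_{n,\ell,q,f_E,\theta_{\mathbf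 e,\mathbf A},D_{\theta,\mathbf e,\mathbf A}}$ for every $\mathbf e\in\mathbb{Z}^m$ with $\|\mathbf e\|^2=E$ (the constants in $\Omega(n)$ do not depend on $E$). Then there is a quantum algorithm of time complexity $$O\big((T+\ell\cdot\mathrm{poly}(n,q))\cdot m\gamma^2q^2\big)$$ that, for every $\mathbf s\in\mathbb{Z}_q^n$, on input $(\mathbf A,\ \mathbf A^T\mathbf s+\mathbf e\bmod q)$ with $\mathbf A\leftarrow\mathcal U(\mathbb{Z}_q^{n\times m})$ and $\mathbf e$ drawn from the discrete Gaussian on $\mathbb{Z}^m$ with $\Pr(\mathbf e)\propto\rho_{\gamma q}(\mathbf e)$, outputs $\mathbf s$ with probability $1-2^{-\Omega(n)}$. The constant in $O(\cdot)$ and the polynomial are absolute. -/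

import Mathlib

noncomputable section

namespace QLWE

/-! ### Quantum circuits

A state of a system of qubits indexed by `W` is a vector of amplitudes `(W → Bool) → ℂ`. -/

/-- An elementary gate: an arbitrary unitary acting on two distinct qubits
(one-qubit unitaries are included, as `U ⊗ 1`). -/
structure Gate (W : Type) where
  fst : W
  snd : W
  ne : fst ≠ snd
  U : Matrix.unitaryGroup (Bool × Bool) ℂ

/-- The action of a gate on a state: `U` on the two chosen qubits, identity on the others. -/
def Gate.apply {W : Type} [DecidableEq W] (g : Gate W) (ψ : (W → Bool) → ℂ) :
    (W → Bool) → ℂ := fun b =>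
  ∑ c : Bool × Bool, (g.U : Matrix (Bool × Bool) (Bool × Bool) ℂ) (b g.fst, b g.snd) c *
    ψ (Function.update (Function.update b g.fst c.1) g.snd c.2)

/-- A quantum circuit whose input qubits are indexed by `I` and whose output bits are indexed
by `O`: it adds `anc` ancilla qubits in state `|0⟩`, applies a list of gates, and finally measures
in the computational basis; the output bit `j` is the outcome of the qubit `out j`. -/
structure Circuit (I O : Type) where
  anc : ℕ
  gates : List (Gate (I ⊕ Fin anc))
  out : O → I ⊕ Fin anc

namespace Circuit

variable {I O : Type}

/-- Running time: the number of elementary gates. -/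
def size (C : Circuit I O) : ℕ := C.gates.length

/-- The input state together with the ancillas in state `|0⟩`. -/
def init (C : Circuit I O) (ψ : (I → Bool) → ℂ) : (I ⊕ Fin C.anc → Bool) → ℂ := fun b =>
  if ∀ k, b (Sum.inr k) = false then ψ (fun i => b (Sum.inl i)) else 0

/-- The state before the final measurement. -/
def final [DecidableEq I] (C : Circuit I O) (ψ : (I → Bool) → ℂ) :
    (I ⊕ Fin C.anc → Bool) → ℂ :=
  C.gates.foldl (fun φ g => g.apply φ) (C.init ψ)

/-- The probability that the circuit, run on the (unit) input state `ψ`, outputs `o`. -/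
def prob [Fintype I] [DecidableEq I] [Fintype O] (C : Circuit I O)
    (ψ : (I → Bool) → ℂ) (o : O → Bool) : ℝ :=
  ∑ b : I ⊕ Fin C.anc → Bool, if (fun j => b (C.out j)) = o then ‖C.final ψ b‖ ^ 2 else 0

end Circuit

/-! ### Encoding residues modulo `q` in qubits -/

/-- The qubits of a register that holds an element of `ℤ_q`. -/
abbrev ZReg (q : ℕ) : Type := Fin (Nat.clog 2 q)

/-- Binary encoding of an element of `ℤ_q`. -/
def enc {q : ℕ} (x : ZMod q) : ZReg q → Bool := fun k => x.val.testBit k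

/-- Binary encoding of a vector over `ℤ_q`, coordinate by coordinate. -/
def encVec {q : ℕ} {ι : Type} (v : ι → ZMod q) : ι × ZReg q → Bool := fun p => enc (v p.1) p.2

/-- Binary encoding of a matrix over `ℤ_q`, entry by entry. -/
def encMat {q n m : ℕ} (A : Matrix (Fin n) (Fin m) (ZMod q)) :
    (Fin n × Fin m) × ZReg q → Bool :=
  encVec fun p => A p.1 p.2

/-- Probability of an event under the uniform distribution on a finite type. -/
def unifProb {Ω : Type} (S : Set Ω) : ℝ := (S.ncard : ℝ) / Nat.card Ω

/-! ### Gaussians and lattices -/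

/-- `ρ_s(x) = exp(-π ‖x‖² / s²)`. -/
def rho {V : Type} [Norm V] (s : ℝ) (x : V) : ℝ := Real.exp (-Real.pi * ‖x‖ ^ 2 / s ^ 2)

/-- `ρ_{√S}(x) = exp(-π xᵀ S⁻¹ x)` for a positive definite matrix `S`. -/
def rhoCov {m : ℕ} (S : Matrix (Fin m) (Fin m) ℝ) (x : EuclideanSpace ℝ (Fin m)) : ℝ :=
  Real.exp (-Real.pi * (x.ofLp ⬝ᵥ S⁻¹.mulVec x.ofLp))

/-- An integer vector as a vector of the Euclidean space. -/
def toE {m : ℕ} (z : Fin m → ℤ) : EuclideanSpace ℝ (Fin m) := WithLp.toLp 2 fun j => (z j : ℝ)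

/-- The discrete Gaussian distribution `D_{ℤ^m, s}`. -/
def discreteGaussian {m : ℕ} (s : ℝ) (z : Fin m → ℤ) : ℝ :=
  rho s (toE z) / ∑' z' : Fin m → ℤ, rho s (toE z')

/-- The `q`-ary lattice `L_q(A) = {x ∈ ℤ^m : x = Aᵀ s mod q for some s}`. -/
def qLattice {q n m : ℕ} (A : Matrix (Fin n) (Fin m) (ZMod q)) :
    Set (EuclideanSpace ℝ (Fin m)) :=
  {x | ∃ z : Fin m → ℤ, x = toE z ∧
    ∃ s : Fin n → ZMod q, (fun j => (z j : ZMod q)) = A.transpose.mulVec s}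

/-- Minimum distance `λ₁(L)`. -/
def lambda1 {m : ℕ} (L : Set (EuclideanSpace ℝ (Fin m))) : ℝ :=
  sInf {r | ∃ x ∈ L, x ≠ 0 ∧ ‖x‖ = r}

/-- `B_L`, the set of points at distance less than `λ₁(L) / 2` from `L`. -/
def latticeBall {m : ℕ} (L : Set (EuclideanSpace ℝ (Fin m))) :
    Set (EuclideanSpace ℝ (Fin m)) :=
  {y | Metric.infDist y L < lambda1 L / 2}

/-- `κ_L(y)`, a closest vector to `y` in `L` (the unique one if `y ∈ B_L`). -/
def closest {m : ℕ} (L : Set (EuclideanSpace ℝ (Fin m))) (y : EuclideanSpace ℝ (Fin m)) :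
    EuclideanSpace ℝ (Fin m) :=
  Classical.epsilon fun x => x ∈ L ∧ ∀ z ∈ L, ‖y - x‖ ≤ ‖y - z‖

/-- The representative in `{0, …, q-1}^m` of a vector of `ℤ_q^m`. -/
def lift {q m : ℕ} (y : Fin m → ZMod q) : EuclideanSpace ℝ (Fin m) :=
  toE fun j => ((y j).val : ℤ)

/-- `y' = y - κ_{L_q(A)}(y)`. -/
def residual {q n m : ℕ} (A : Matrix (Fin n) (Fin m) (ZMod q)) (y : Fin m → ZMod q) :
    EuclideanSpace ℝ (Fin m) :=
  lift y - closest (qLattice A) (lift y)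

/-! ### Solving classical LWE -/

/-- Input qubits of an algorithm for LWE: the matrix `A` and the vector `Aᵀ s + e`. -/
abbrev LWEWires (n m q : ℕ) : Type := ((Fin n × Fin m) × ZReg q) ⊕ (Fin m × ZReg q)

/-- The computational basis state that holds `(A, b)`. -/
def lweInput {n m q : ℕ} (A : Matrix (Fin n) (Fin m) (ZMod q)) (b : Fin m → ZMod q) :
    (LWEWires n m q → Bool) → ℂ := fun w =>
  if w = Sum.elim (encMat A) (encVec b) then 1 else 0

/-- The probability that the circuit outputs `s` on input `(A, Aᵀ s + e mod q)`, over uniform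
`A ∈ ℤ_q^{n×m}`, `e ← D_{ℤ^m, γ q}`, and the measurement. -/
def lweSuccess {n m q : ℕ} [NeZero q] (C : Circuit (LWEWires n m q) (Fin n × ZReg q)) (γ : ℝ)
    (s : Fin n → ZMod q) : ℝ :=
  ∑' e : Fin m → ℤ, discreteGaussian (γ * q) e *
    ((∑ A : Matrix (Fin n) (Fin m) (ZMod q),
      C.prob (lweInput A (A.transpose.mulVec s + fun j => (e j : ZMod q))) (encVec s)) /
        (q : ℝ) ^ (n * m))

/-! ### Solving `S|LWE⟩^phase` -/

/-- Unnormalized amplitudes of `∑_{e ∈ ℤ} f(e) exp(2πi e t) |(u + e) mod q⟩`. -/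
def phaseAmp {q : ℕ} (f : ℤ → ℝ) (t : ℝ) (u b : ZMod q) : ℂ :=
  ∑' e : ℤ, if u + (e : ZMod q) = b then
    (f e : ℂ) * Complex.exp (2 * Real.pi * Complex.I * e * t) else 0

/-- The normalized state `∑_{e ∈ ℤ} f(e) exp(2πi e t) |(u + e) mod q⟩` on a register. -/
def phaseState {q : ℕ} [NeZero q] (f : ℤ → ℝ) (t : ℝ) (u : ZMod q) : (ZReg q → Bool) → ℂ :=
  fun w => ∑ b : ZMod q, if enc b = w then
    phaseAmp f t u b / (Real.sqrt (∑ b' : ZMod q, ‖phaseAmp f t u b'‖ ^ 2) : ℂ) else 0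

/-- Qubits of one sample: the vector `a`, the vector `y`, and the quantum register. -/
abbrev SampleWires (n m q : ℕ) : Type := (Fin n × ZReg q) ⊕ (Fin m × ZReg q) ⊕ ZReg q

/-- Input qubits of an algorithm for `S|LWE⟩^phase`: the matrix `A` and `ℓ` samples. -/
abbrev SLWEWires (n m q ℓ : ℕ) : Type :=
  ((Fin n × Fin m) × ZReg q) ⊕ (Fin ℓ × SampleWires n m q)

/-- The state of one sample with classical part `(a, y)` and secret `s`. -/
def sampleState {n m q : ℕ} [NeZero q] (f : ℤ → ℝ) (θ : (Fin m → ZMod q) → ℝ)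
    (s a : Fin n → ZMod q) (y : Fin m → ZMod q) : (SampleWires n m q → Bool) → ℂ := fun w =>
  if (fun p => w (Sum.inl p)) = encVec a ∧ (fun p => w (Sum.inr (Sum.inl p))) = encVec y then
    phaseState f (θ y) (a ⬝ᵥ s) (fun k => w (Sum.inr (Sum.inr k)))
  else 0

/-- The product of the basis state `|A⟩` and the `ℓ` sample states. -/
def slweInput {n m q ℓ : ℕ} [NeZero q] (A : Matrix (Fin n) (Fin m) (ZMod q)) (f : ℤ → ℝ)
    (θ : (Fin m → ZMod q) → ℝ) (s : Fin n → ZMod q) (a : Fin ℓ → Fin n → ZMod q)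
    (y : Fin ℓ → Fin m → ZMod q) : (SLWEWires n m q ℓ → Bool) → ℂ := fun w =>
  if (fun p => w (Sum.inl p)) = encMat A then
    ∏ i : Fin ℓ, sampleState f θ s (a i) (y i) (fun p => w (Sum.inr (i, p)))
  else 0

/-- The circuit, given `A`, solves `S|LWE⟩^phase_{n,ℓ,q,f,θ,D}` with error `ε`: for every secret
`s` it outputs `s` with probability at least `1 - ε`, over `ℓ` independent samples with uniform
`a_i ∈ ℤ_q^n` and `y_i` distributed according to the probability mass function `D`, and over the
measurement. -/
def SolvesSLWEPhase {n m q ℓ : ℕ} [NeZero q] (C : Circuit (SLWEWires n m q ℓ) (Fin n × ZReg q))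
    (A : Matrix (Fin n) (Fin m) (ZMod q)) (f : ℤ → ℝ) (θ D : (Fin m → ZMod q) → ℝ)
    (ε : ℝ) : Prop :=
  ∀ s : Fin n → ZMod q,
    1 - ε ≤ ∑ a : Fin ℓ → Fin n → ZMod q, ∑ y : Fin ℓ → Fin m → ZMod q,
      (∏ i, ((1 / (q : ℝ) ^ n) * D (y i))) * C.prob (slweInput A f θ s a y) (encVec s)

/-! ### The amplitude, the phase and the distribution -/

/-- `σ(E) = α β q / √(α² E + β² q²)`. -/
def sigma (α β : ℝ) (q : ℕ) (E : ℝ) : ℝ := α * β * q / Real.sqrt (α ^ 2 * E + β ^ 2 * q ^ 2)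

/-- `f_E(e) = ρ_{q/σ(E)}(e)`. -/
def amplitude (α β : ℝ) (q : ℕ) (E : ℝ) (e : ℤ) : ℝ := rho (q / sigma α β q E) (e : ℝ)

/-- `Σ = I_m + (α² / (β² q²)) e eᵀ`. -/
def covariance {m : ℕ} (α β : ℝ) (q : ℕ) (e : Fin m → ℤ) : Matrix (Fin m) (Fin m) ℝ :=
  1 + (α ^ 2 / (β ^ 2 * q ^ 2)) • Matrix.vecMulVec (toE e).ofLp (toE e).ofLp

open Classical in
/-- `ρ_{β q √(Σ/2)}(y')` for `y ∈ ℤ_q^m ∩ B_{L_q(A)}`, and `0` for the other `y`. -/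
def weight {n m q : ℕ} (α β : ℝ) (A : Matrix (Fin n) (Fin m) (ZMod q)) (e : Fin m → ℤ)
    (y : Fin m → ZMod q) : ℝ :=
  if lift y ∈ latticeBall (qLattice A) then
    rhoCov ((β ^ 2 * q ^ 2 / 2) • covariance α β q e) (residual A y)
  else 0

/-- The distribution `D_{θ,e,A}`: `Pr(y) ∝ ρ_{β q √(Σ/2)}(y')` on `ℤ_q^m ∩ B_{L_q(A)}`. -/
def distribution {n m q : ℕ} [NeZero q] (α β : ℝ) (A : Matrix (Fin n) (Fin m) (ZMod q))
    (e : Fin m → ℤ) (y : Fin m → ZMod q) : ℝ :=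
  weight α β A e y / ∑ y' : Fin m → ZMod q, weight α β A e y'

/-- The phase `θ_{e,A}(y) = - α² ⟨y', e⟩ / (q (α² ‖e‖² + β² q²))`. -/
def phase {n m q : ℕ} (α β : ℝ) (A : Matrix (Fin n) (Fin m) (ZMod q)) (e : Fin m → ℤ)
    (y : Fin m → ZMod q) : ℝ :=
  -(α ^ 2 * inner ℝ (residual A y) (toE e)) / (q * (α ^ 2 * ‖toE e‖ ^ 2 + β ^ 2 * q ^ 2))

end QLWE

end

/-!
# From `S|LWE⟩` with phase to LWE

Given `A` and `b = Aᵀ s + e`, samples with unknown phase are prepared as follows. Start from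
the state `∑ ρ_α(k) ρ_{βq}(v) |k⟩|u⟩|v⟩` with `u` uniform, add `Aᵀ u + k b` to the last register
`y`, and apply the inverse Fourier transform over `ℤ_q` to the registers `u` and `k`. Since
`Aᵀ u + k b + v = Aᵀ (u + k s) + (k e + v)`, the vector `y` determines `u + k s` and the
residual `z = k e + v` as long as `z` stays within the decoding radius, and completing the square
turns `ρ_α(k) ρ_{βq}(z - k e)` into a weight of `z` times a Gaussian in `k` of width `σ` around
a centre proportional to `⟨z, e⟩` (`wt_mul_gauss`; `rhoCov_eq` identifies the weight). Measuring
`a`, the transform of `u`, and `y` therefore leaves the `k` register in the Fourier transform of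
a shifted Gaussian, translated by `⟨a, s⟩`. By Poisson summation (`phaseAmp_eq`), this is the state
with amplitude `f_E`, where `E = ‖e‖²`, and phase `θ(y)`. A state for which this holds exactly is
`idealAmp`, see `fourierSample_idealAmp` and `jointProb_ideal`.

The prepared state has real overlap close to `1` with the ideal one (`le_overlap`, `overlap_ge`): up
to the tails of the Gaussians, all that enters is that shifting a Gaussian much wider than `1` hardly
changes its sum, and that folding a Gaussian much narrower than `q` hardly changes its norm. The
loss is exponentially small in `n`, hence so is the loss for `ℓ = 2^{o(n)}` samples
(`jointProb_prod_ge`). The argument needs that `Aᵀ s` is short for no `s ≠ 0`, which fails with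
exponentially small probability over `A` (`unifProb_short_le`).

Since `E` is unknown, the solver is run for each `E` from `1` to `m γ² q²`, and once more on an input
shifted by a unit vector, which takes care of `e = 0`. A candidate `s'` is kept if `b - Aᵀ s'` is
small; by the bound on short images, only the secret passes this test, so that the combined circuit
succeeds at least as often as the trial with the right `E` (`exists_combine_family`,
`lweChecker_decides`, `exists_reduction`).

Everything is done by explicit circuits of two-qubit gates. An arbitrary unitary on `k` qubits takes
`72 ^ k` gates (`synth_unitary`); with `k` a multiple of `⌈log₂ q⌉`, this is polynomial in `q`, and
it suffices for Fourier transforms, preparations of Gaussian states, modular additions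
(`exists_prepare`) and the test, which is evaluated by a Boolean network (`exists_gates_network`).
The measurement of `a` and `y` is replaced by copying them (`exists_trial`).
-/


noncomputable section

set_option linter.unusedSectionVars false

namespace QLWE

/-! ### Gate lists -/

section GateLists

variable {S W : Type} [DecidableEq S] [DecidableEq W]

/-- The state obtained by applying the gates of a list one after the other. -/
def run (gs : List (Gate W)) (ψ : (W → Bool) → ℂ) : (W → Bool) → ℂ :=
  gs.foldl (fun φ g => g.apply φ) ψ

@[simp] theorem run_nil (ψ : (W → Bool) → ℂ) : run [] ψ = ψ := rfl

@[simp] theorem run_cons (g : Gate W) (gs : List (Gate W)) (ψ : (W → Bool) → ℂ) :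
    run (g :: gs) ψ = run gs (g.apply ψ) := rfl

theorem run_append (gs hs : List (Gate W)) (ψ : (W → Bool) → ℂ) :
    run (gs ++ hs) ψ = run hs (run gs ψ) := by
  simp [run, List.foldl_append]

theorem Gate.apply_smul (g : Gate W) (a : ℂ) (ψ : (W → Bool) → ℂ) :
    g.apply (a • ψ) = a • g.apply ψ := by
  funext b
  simp only [Gate.apply, Pi.smul_apply, smul_eq_mul, Finset.mul_sum]
  exact Finset.sum_congr rfl fun c _ => by ring

theorem Gate.apply_sub (g : Gate W) (φ ψ : (W → Bool) → ℂ) :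
    g.apply (φ - ψ) = g.apply φ - g.apply ψ := by
  funext b
  simp only [Gate.apply, Pi.sub_apply, mul_sub, Finset.sum_sub_distrib]

theorem run_smul (gs : List (Gate W)) (a : ℂ) (ψ : (W → Bool) → ℂ) :
    run gs (a • ψ) = a • run gs ψ := by
  induction gs generalizing ψ with
  | nil => rfl
  | cons g gs ih => rw [run_cons, run_cons, Gate.apply_smul, ih]

theorem run_sub (gs : List (Gate W)) (φ ψ : (W → Bool) → ℂ) :
    run gs (φ - ψ) = run gs φ - run gs ψ := by
  induction gs generalizing φ ψ with
  | nil => rfl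
  | cons g gs ih => rw [run_cons, run_cons, run_cons, Gate.apply_sub, ih]

/-- The same gate, on the wires relabelled along an injection. -/
def Gate.map (e : S → W) (he : Function.Injective e) (g : Gate S) : Gate W :=
  ⟨e g.fst, e g.snd, fun h => g.ne (he h), g.U⟩

/-- The restriction of a state to the wires in the image of `e`, the others being fixed
to the values they have in `b`. -/
def slice (e : S → W) (b : W → Bool) (ψ : (W → Bool) → ℂ) : (S → Bool) → ℂ :=
  fun c => ψ (Function.extend e c b)

theorem extend_extend {e : S → W} (he : Function.Injective e) (c d : S → Bool) (b : W → Bool) :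
    Function.extend e d (Function.extend e c b) = Function.extend e d b := by
  funext w
  by_cases h : ∃ s, e s = w
  · obtain ⟨s, rfl⟩ := h
    rw [he.extend_apply, he.extend_apply]
  · rw [Function.extend_apply' _ _ _ h, Function.extend_apply' _ _ _ h,
      Function.extend_apply' _ _ _ h]

theorem extend_comp_self {e : S → W} (he : Function.Injective e) (b : W → Bool) :
    Function.extend e (b ∘ e) b = b := by
  funext w
  by_cases h : ∃ s, e s = w
  · obtain ⟨s, rfl⟩ := h
    rw [he.extend_apply]; rfl
  · rw [Function.extend_apply' _ _ _ h]

theorem extend_update {e : S → W} (he : Function.Injective e) (c : S → Bool) (b : W → Bool)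
    (s : S) (x : Bool) :
    Function.extend e (Function.update c s x) b =
      Function.update (Function.extend e c b) (e s) x := by
  funext w
  by_cases h : ∃ s, e s = w
  · obtain ⟨s', rfl⟩ := h
    rw [he.extend_apply]
    by_cases hs : s' = s
    · subst hs; simp
    · rw [Function.update_of_ne hs, Function.update_of_ne (fun h => hs (he h)), he.extend_apply]
  · have : w ≠ e s := fun h' => h ⟨s, h'.symm⟩
    rw [Function.extend_apply' _ _ _ h, Function.update_of_ne this,
      Function.extend_apply' _ _ _ h]

theorem Gate.map_apply (e : S → W) (he : Function.Injective e) (g : Gate S)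
    (ψ : (W → Bool) → ℂ) (b : W → Bool) (c : S → Bool) :
    (g.map e he).apply ψ (Function.extend e c b) = g.apply (slice e b ψ) c := by
  simp only [Gate.apply, Gate.map, slice, he.extend_apply, extend_update he]

/-- Gates on the image of `e` act on each slice separately. -/
theorem run_map (e : S → W) (he : Function.Injective e) (gs : List (Gate S))
    (ψ : (W → Bool) → ℂ) (b : W → Bool) :
    run (gs.map (Gate.map e he)) ψ b = run gs (slice e b ψ) (b ∘ e) := by
  induction gs generalizing ψ with
  | nil => simp [slice, extend_comp_self he]
  | cons g gs ih =>
    rw [List.map_cons, run_cons, run_cons, ih]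
    congr 1
    funext c
    exact Gate.map_apply e he g ψ b c

end GateLists

/-! ### Unitarity of the gates -/

section Norm

variable {W : Type} [DecidableEq W] [Fintype W]

/-- The gate that undoes `g`. -/
def Gate.inv (g : Gate W) : Gate W := ⟨g.fst, g.snd, g.ne, star g.U⟩

theorem update_pair_idem (b : W → Bool) {i j : W} (h : i ≠ j) (c d : Bool × Bool) :
    Function.update (Function.update (Function.update (Function.update b i c.1) j c.2) i d.1) j d.2
      = Function.update (Function.update b i d.1) j d.2 := by
  rw [Function.update_comm h, Function.update_idem, Function.update_comm h.symm,
    Function.update_idem]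

theorem Gate.inv_apply_apply (g : Gate W) (ψ : (W → Bool) → ℂ) :
    g.inv.apply (g.apply ψ) = ψ := by
  funext b
  have h1 : ∀ c : Bool × Bool,
      g.apply ψ (Function.update (Function.update b g.fst c.1) g.snd c.2) =
      ∑ d : Bool × Bool, (g.U : Matrix (Bool × Bool) (Bool × Bool) ℂ) c d *
        ψ (Function.update (Function.update b g.fst d.1) g.snd d.2) := by
    intro c
    simp only [Gate.apply]
    refine Finset.sum_congr rfl fun d _ => ?_
    rw [update_pair_idem _ g.ne, Function.update_of_ne g.ne, Function.update_self,
      Function.update_self]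
  have hU : star (g.U : Matrix (Bool × Bool) (Bool × Bool) ℂ) * g.U = 1 :=
    Unitary.coe_star_mul_self g.U
  have h2 : g.inv.apply (g.apply ψ) b = ∑ d : Bool × Bool,
      (star (g.U : Matrix (Bool × Bool) (Bool × Bool) ℂ) * g.U) (b g.fst, b g.snd) d *
        ψ (Function.update (Function.update b g.fst d.1) g.snd d.2) := by
    show ∑ c : Bool × Bool, (star (g.U : Matrix (Bool × Bool) (Bool × Bool) ℂ))
        (b g.fst, b g.snd) c *
        g.apply ψ (Function.update (Function.update b g.fst c.1) g.snd c.2) = _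
    simp only [h1, Finset.mul_sum, Matrix.mul_apply, Finset.sum_mul]
    rw [Finset.sum_comm]
    exact Finset.sum_congr rfl fun c _ => Finset.sum_congr rfl fun d _ => by ring
  rw [h2, hU, Finset.sum_eq_single (b g.fst, b g.snd)]
  · simp
  · intro d _ hd
    rw [Matrix.one_apply_ne hd.symm, zero_mul]
  · simp

theorem Gate.adjoint (g : Gate W) (φ ψ : (W → Bool) → ℂ) :
    ∑ b, star (g.apply φ b) * ψ b = ∑ b, star (φ b) * g.inv.apply ψ b := by
  have hl : ∑ b, star (g.apply φ b) * ψ b = ∑ p : (W → Bool) × (Bool × Bool),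
      star ((g.U : Matrix (Bool × Bool) (Bool × Bool) ℂ) (p.1 g.fst, p.1 g.snd) p.2) *
      star (φ (Function.update (Function.update p.1 g.fst p.2.1) g.snd p.2.2)) * ψ p.1 := by
    rw [Fintype.sum_prod_type]
    simp only [Gate.apply, star_sum, star_mul', Finset.sum_mul]
  have hr : ∑ b, star (φ b) * g.inv.apply ψ b = ∑ p : (W → Bool) × (Bool × Bool),
      star (φ p.1) * (star ((g.U : Matrix (Bool × Bool) (Bool × Bool) ℂ) p.2
        (p.1 g.fst, p.1 g.snd)) *
      ψ (Function.update (Function.update p.1 g.fst p.2.1) g.snd p.2.2)) := by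
    rw [Fintype.sum_prod_type]
    simp only [Gate.apply, Finset.mul_sum]
    rfl
  have hinv : Function.Involutive (fun p : (W → Bool) × (Bool × Bool) =>
      (Function.update (Function.update p.1 g.fst p.2.1) g.snd p.2.2,
        (p.1 g.fst, p.1 g.snd))) := by
    rintro ⟨b, c⟩
    simp only [Prod.mk.injEq]
    refine ⟨?_, ?_⟩
    · rw [update_pair_idem b g.ne c (b g.fst, b g.snd)]
      simp
    · rw [Function.update_of_ne g.ne, Function.update_self, Function.update_self]
  rw [hl, hr]
  refine Fintype.sum_equiv hinv.toPerm _ _ fun p => ?_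
  simp only [Function.Involutive.coe_toPerm]
  rw [update_pair_idem p.1 g.ne p.2 (p.1 g.fst, p.1 g.snd), Function.update_of_ne g.ne,
    Function.update_self, Function.update_self]
  simp only [Function.update_eq_self, Prod.mk.eta]
  ring

theorem Gate.norm_apply (g : Gate W) (ψ : (W → Bool) → ℂ) :
    ∑ b, ‖g.apply ψ b‖ ^ 2 = ∑ b, ‖ψ b‖ ^ 2 := by
  have h := Gate.adjoint g ψ (g.apply ψ)
  rw [Gate.inv_apply_apply] at h
  have key : ∀ φ : (W → Bool) → ℂ, ∑ b, star (φ b) * φ b = ((∑ b, ‖φ b‖ ^ 2 : ℝ) : ℂ) := by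
    intro φ
    push_cast
    exact Finset.sum_congr rfl fun b _ => RCLike.conj_mul (φ b)
  rw [key, key] at h
  exact_mod_cast h

theorem norm_run (gs : List (Gate W)) (ψ : (W → Bool) → ℂ) :
    ∑ b, ‖run gs ψ b‖ ^ 2 = ∑ b, ‖ψ b‖ ^ 2 := by
  induction gs generalizing ψ with
  | nil => rfl
  | cons g gs ih => rw [run_cons, ih, Gate.norm_apply]

end Norm

/-! ### Unitaries supported on a subset of the basis -/

section Lift

variable {ι κ : Type} [Fintype ι] [DecidableEq ι] [Fintype κ] [DecidableEq κ]

/-- The isometry `ℂ^κ → ℂ^ι` that relabels the basis along `f`. -/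
def inclMat (f : κ → ι) : Matrix ι κ ℂ := fun i k => if i = f k then 1 else 0

/-- The matrix that acts as `U` on the basis vectors in the image of `f` and as the identity on
the other ones. -/
def liftMat (f : κ → ι) (U : Matrix κ κ ℂ) : Matrix ι ι ℂ :=
  1 + inclMat f * (U - 1) * (inclMat f).conjTranspose

theorem inclMat_isometry {f : κ → ι} (hf : Function.Injective f) :
    (inclMat f).conjTranspose * inclMat f = 1 := by
  ext k l
  simp only [Matrix.mul_apply, Matrix.conjTranspose_apply, inclMat, Matrix.one_apply]
  rw [Finset.sum_eq_single (f k)]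
  · simp [hf.eq_iff]
  · intro i _ hi
    simp [hi]
  · simp

theorem liftMat_mul {f : κ → ι} (hf : Function.Injective f) (U V : Matrix κ κ ℂ) :
    liftMat f U * liftMat f V = liftMat f (U * V) := by
  have h := inclMat_isometry hf
  have : inclMat f * (U - 1) * (inclMat f).conjTranspose *
      (inclMat f * (V - 1) * (inclMat f).conjTranspose) =
      inclMat f * ((U - 1) * (V - 1)) * (inclMat f).conjTranspose := by
    calc _ = inclMat f * (U - 1) * ((inclMat f).conjTranspose * inclMat f) * (V - 1) *
          (inclMat f).conjTranspose := by simp only [Matrix.mul_assoc]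
      _ = _ := by rw [h]; simp only [Matrix.mul_assoc, Matrix.one_mul]
  simp only [liftMat, add_mul, mul_add, one_mul, mul_one, this]
  have e : U * V - 1 = (U - 1) + (V - 1) + (U - 1) * (V - 1) := by noncomm_ring
  rw [e]
  simp only [Matrix.mul_add, Matrix.add_mul]
  abel

theorem liftMat_one (f : κ → ι) : liftMat f (1 : Matrix κ κ ℂ) = 1 := by
  simp [liftMat]

theorem liftMat_star (f : κ → ι) (U : Matrix κ κ ℂ) :
    star (liftMat f U) = liftMat f (star U) := by
  simp [liftMat, Matrix.star_eq_conjTranspose, Matrix.conjTranspose_mul, Matrix.mul_assoc]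

theorem liftMat_mem_unitary {f : κ → ι} (hf : Function.Injective f) {U : Matrix κ κ ℂ}
    (hU : U ∈ Matrix.unitaryGroup κ ℂ) : liftMat f U ∈ Matrix.unitaryGroup ι ℂ := by
  rw [Matrix.mem_unitaryGroup_iff] at hU ⊢
  rw [liftMat_star, liftMat_mul hf, hU, liftMat_one]

theorem inclMat_mulVec_apply {f : κ → ι} (hf : Function.Injective f) (φ : κ → ℂ) (k : κ) :
    (inclMat f).mulVec φ (f k) = φ k := by
  simp [Matrix.mulVec, dotProduct, inclMat, hf.eq_iff]

theorem inclMat_mulVec_of_notMem {f : κ → ι} (φ : κ → ℂ) {i : ι} (hi : ∀ k, f k ≠ i) :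
    (inclMat f).mulVec φ i = 0 := by
  have : ∀ k, i ≠ f k := fun k h => hi k h.symm
  simp [Matrix.mulVec, dotProduct, inclMat, this]

theorem inclMat_conjTranspose_mulVec (f : κ → ι) (ψ : ι → ℂ) :
    (inclMat f).conjTranspose.mulVec ψ = ψ ∘ f := by
  funext k
  simp [Matrix.mulVec, dotProduct, inclMat]

theorem liftMat_mulVec_apply {f : κ → ι} (hf : Function.Injective f) (U : Matrix κ κ ℂ)
    (ψ : ι → ℂ) (k : κ) : (liftMat f U).mulVec ψ (f k) = U.mulVec (ψ ∘ f) k := by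
  rw [liftMat, Matrix.add_mulVec, Matrix.one_mulVec, ← Matrix.mulVec_mulVec,
    ← Matrix.mulVec_mulVec, inclMat_conjTranspose_mulVec, Pi.add_apply,
    inclMat_mulVec_apply hf, Matrix.sub_mulVec, Matrix.one_mulVec]
  simp

theorem liftMat_mulVec_of_notMem {f : κ → ι} (U : Matrix κ κ ℂ)
    (ψ : ι → ℂ) {i : ι} (hi : ∀ k, f k ≠ i) : (liftMat f U).mulVec ψ i = ψ i := by
  rw [liftMat, Matrix.add_mulVec, Matrix.one_mulVec, ← Matrix.mulVec_mulVec,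
    ← Matrix.mulVec_mulVec, Pi.add_apply, inclMat_mulVec_of_notMem _ hi, add_zero]

end Lift

/-! ### Decomposing unitaries into two-qubit gates -/

section Synthesis

variable {S : Type} [DecidableEq S]

/-- The operator `L` on states is realized by at most `N` gates. -/
def Synth (N : ℕ) (L : ((S → Bool) → ℂ) → ((S → Bool) → ℂ)) : Prop :=
  ∃ gs : List (Gate S), gs.length ≤ N ∧ ∀ ψ, run gs ψ = L ψ

theorem Synth.comp {N M : ℕ} {L L' : ((S → Bool) → ℂ) → ((S → Bool) → ℂ)}
    (h : Synth N L) (h' : Synth M L') : Synth (N + M) (fun ψ => L' (L ψ)) := by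
  obtain ⟨gs, hg, hL⟩ := h
  obtain ⟨hs, hh, hL'⟩ := h'
  refine ⟨gs ++ hs, by simp; omega, fun ψ => ?_⟩
  rw [run_append, hL, hL']

theorem Synth.mono {N M : ℕ} {L : ((S → Bool) → ℂ) → ((S → Bool) → ℂ)}
    (h : Synth N L) (hNM : N ≤ M) : Synth M L := by
  obtain ⟨gs, hg, hL⟩ := h
  exact ⟨gs, hg.trans hNM, hL⟩

theorem Synth.congr {N : ℕ} {L L' : ((S → Bool) → ℂ) → ((S → Bool) → ℂ)}
    (h : Synth N L) (e : ∀ ψ, L ψ = L' ψ) : Synth N L' := by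
  obtain ⟨gs, hg, hL⟩ := h
  exact ⟨gs, hg, fun ψ => (hL ψ).trans (e ψ)⟩

theorem Synth.id : Synth 0 (fun ψ : (S → Bool) → ℂ => ψ) := ⟨[], le_rfl, fun _ => rfl⟩

/-- The one-qubit operator `V` on the qubit `t`. -/
def oneOp (t : S) (V : Matrix Bool Bool ℂ) (ψ : (S → Bool) → ℂ) : (S → Bool) → ℂ :=
  fun b => ∑ x, V (b t) x * ψ (Function.update b t x)

theorem oneOp_comp (t : S) (V V' : Matrix Bool Bool ℂ) (ψ : (S → Bool) → ℂ) :
    oneOp t V (oneOp t V' ψ) = oneOp t (V * V') ψ := by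
  funext b
  simp only [oneOp, Function.update_self, Function.update_idem, Matrix.mul_apply,
    Finset.mul_sum, Finset.sum_mul]
  rw [Finset.sum_comm]
  exact Finset.sum_congr rfl fun _ _ => Finset.sum_congr rfl fun _ _ => by ring

theorem oneOp_one (t : S) (ψ : (S → Bool) → ℂ) : oneOp t 1 ψ = ψ := by
  funext b
  rw [oneOp, Finset.sum_eq_single (b t)]
  · simp
  · intro x _ hx
    rw [Matrix.one_apply_ne hx.symm, zero_mul]
  · simp

/-- The operator `V` on the qubit `t`, controlled on the qubits of `P` agreeing with the
pattern `a`. -/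
def patOp (P : Finset S) (a : S → Bool) (t : S) (V : Matrix Bool Bool ℂ)
    (ψ : (S → Bool) → ℂ) : (S → Bool) → ℂ :=
  fun b => if ∀ i ∈ P, b i = a i then oneOp t V ψ b else ψ b

/-- A one-qubit operator that depends on the value of one other qubit is a single gate. -/
theorem exists_gate_of_block {t c : S} (h : t ≠ c)
    (M : Bool → Matrix Bool Bool ℂ) (hM : ∀ k, M k ∈ Matrix.unitaryGroup Bool ℂ) :
    ∃ g : Gate S, ∀ ψ b, g.apply ψ b = oneOp t (M (b c)) ψ b := by
  have hU : Matrix.blockDiagonal M ∈ Matrix.unitaryGroup (Bool × Bool) ℂ := by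
    rw [Matrix.mem_unitaryGroup_iff, Matrix.star_eq_conjTranspose,
      Matrix.blockDiagonal_conjTranspose, ← Matrix.blockDiagonal_mul]
    have : (fun k => M k * (M k).conjTranspose) = 1 := by
      funext k
      exact Matrix.mem_unitaryGroup_iff.1 (hM k)
    rw [this, Matrix.blockDiagonal_one]
  refine ⟨⟨t, c, h, ⟨_, hU⟩⟩, fun ψ b => ?_⟩
  simp only [Gate.apply, oneOp, Fintype.sum_prod_type, Matrix.blockDiagonal_apply]
  refine Finset.sum_congr rfl fun x _ => ?_
  rw [Finset.sum_eq_single (b c)]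
  · have : Function.update (Function.update b t x) c (b c) = Function.update b t x := by
      rw [Function.update_eq_self_iff, Function.update_of_ne h.symm]
    simp [this]
  · intro k _ hk
    simp [hk.symm]
  · simp

/-- The Pauli matrix `X`. -/
def notMat : Matrix Bool Bool ℂ := fun y x => if x = !y then 1 else 0

theorem notMat_mem : notMat ∈ Matrix.unitaryGroup Bool ℂ := by
  rw [Matrix.mem_unitaryGroup_iff]
  ext i j
  cases i <;> cases j <;> simp [Matrix.mul_apply, notMat, Matrix.star_apply]

theorem oneOp_notMat (t : S) (ψ : (S → Bool) → ℂ) (b : S → Bool) :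
    oneOp t notMat ψ b = ψ (Function.update b t (!b t)) := by
  cases h : b t <;> simp [oneOp, notMat, h]

open scoped Matrix.Norms.L2Operator in
theorem exists_unitary_sqrt {U : Matrix Bool Bool ℂ} (hU : U ∈ Matrix.unitaryGroup Bool ℂ) :
    ∃ V ∈ Matrix.unitaryGroup Bool ℂ, V * V = U := by
  have hfin : (spectrum ℂ U).Finite := Matrix.finite_spectrum U
  have hn : IsStarNormal U := by
    constructor
    show star U * U = U * star U
    rw [Matrix.mem_unitaryGroup_iff.1 hU, Matrix.mem_unitaryGroup_iff'.1 hU]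
  choose f hf using fun z : ℂ => IsAlgClosed.exists_pow_nat_eq z (n := 2) (by norm_num)
  have hc : ContinuousOn f (spectrum ℂ U) := hfin.continuousOn f
  refine ⟨cfc f U, ?_, ?_⟩
  · show cfc f U ∈ unitary _
    rw [cfc_unitary_iff f U]
    intro z hz
    have hz1 : ‖z‖ = 1 := by
      have := spectrum.subset_circle_of_unitary (E := Matrix Bool Bool ℂ) hU hz
      simpa using this
    have h1 : ‖f z‖ ^ 2 = 1 := by rw [← norm_pow, hf, hz1]
    have : star (f z) * f z = ((‖f z‖ ^ 2 : ℝ) : ℂ) := by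
      push_cast; exact RCLike.conj_mul (f z)
    rw [this, h1]; simp
  · rw [← cfc_mul f f U hc hc]
    have : (fun x => f x * f x) = fun x => x := by
      funext z; rw [← sq, hf]
    rw [this, cfc_id' ℂ U]

theorem patOp_not (P : Finset S) (a : S → Bool) (c : S) (ψ : (S → Bool) → ℂ) (b : S → Bool)
    (h : ∀ i ∈ P, b i = a i) : patOp P a c notMat ψ b = ψ (Function.update b c (!b c)) := by
  rw [patOp, if_pos h, oneOp_notMat]

/-- The recursion behind the multiply controlled gates: with `V * V = U`, one more control
on `U` costs two gates and three operations with one control less. -/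
theorem patOp_insert {P : Finset S} (a : S → Bool) {t c : S} (htc : t ≠ c) (htP : t ∉ P)
    (hcP : c ∉ P) {V : Matrix Bool Bool ℂ} (hV : V ∈ Matrix.unitaryGroup Bool ℂ)
    (ψ : (S → Bool) → ℂ) :
    patOp P a t V (patOp P a c notMat (patOp {c} a t (star V) (patOp P a c notMat
      (patOp {c} a t V ψ)))) = patOp (insert c P) a t (V * V) ψ := by
  have hVl : V * star V = 1 := Matrix.mem_unitaryGroup_iff.1 hV
  have hVr : star V * V = 1 := Matrix.mem_unitaryGroup_iff'.1 hV
  have hPt : ∀ b x, (∀ i ∈ P, Function.update b t x i = a i) ↔ ∀ i ∈ P, b i = a i := fun b x =>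
    forall₂_congr fun i hi => by
      rw [Function.update_of_ne (show i ≠ t from fun h => htP (h ▸ hi))]
  have hPc : ∀ b x, (∀ i ∈ P, Function.update b c x i = a i) ↔ ∀ i ∈ P, b i = a i := fun b x =>
    forall₂_congr fun i hi => by
      rw [Function.update_of_ne (show i ≠ c from fun h => hcP (h ▸ hi))]
  funext b
  by_cases hP : ∀ i ∈ P, b i = a i
  · have key : ∀ b : S → Bool, (∀ i ∈ P, b i = a i) →
        (patOp P a c notMat (patOp {c} a t (star V) (patOp P a c notMat
          (patOp {c} a t V ψ)))) b =
        if b c = a c then oneOp t V ψ b else oneOp t (star V) ψ b := by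
      intro b hP
      rw [patOp_not _ _ _ _ _ hP]
      by_cases hc : b c = a c
      · rw [if_pos hc, patOp, if_neg (by simp [hc]), patOp_not _ _ _ _ _ ((hPc _ _).2 hP)]
        rw [Function.update_self, Bool.not_not, Function.update_idem, Function.update_eq_self,
          patOp, if_pos (by simpa using hc)]
      · have hc' : (!b c) = a c := by cases h1 : b c <;> cases h2 : a c <;> simp_all
        rw [if_neg hc, patOp, if_pos (by simp [hc'])]
        simp only [oneOp]
        refine Finset.sum_congr rfl fun x _ => ?_
        rw [patOp_not _ _ _ _ _ ((hPt _ _).2 ((hPc _ _).2 hP)), Function.update_of_ne htc,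
          Function.update_of_ne htc.symm, Function.update_self, Bool.not_not,
          Function.update_comm htc, Function.update_idem]
        have hb : Function.update (Function.update b t x) c (b c) = Function.update b t x := by
          rw [Function.update_eq_self_iff, Function.update_of_ne htc.symm]
        rw [Function.update_comm htc.symm, hb, patOp, if_neg]
        simpa [Function.update_of_ne htc.symm] using hc
    rw [patOp, if_pos hP]
    have h2 : oneOp t V (patOp P a c notMat (patOp {c} a t (star V) (patOp P a c notMat
          (patOp {c} a t V ψ)))) b =
        if b c = a c then oneOp t V (oneOp t V ψ) b else oneOp t V (oneOp t (star V) ψ) b := by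
      rw [oneOp, Finset.sum_congr rfl fun x _ => by rw [key _ ((hPt b x).2 hP)]]
      simp only [Function.update_of_ne htc.symm]
      split_ifs <;> rfl
    rw [h2, oneOp_comp, oneOp_comp, hVl, oneOp_one]
    by_cases hc : b c = a c
    · rw [if_pos hc, patOp, if_pos (by simpa [hc] using hP)]
    · rw [if_neg hc, patOp, if_neg (by simp [hc])]
  · have hX : ∀ (φ : (S → Bool) → ℂ) (b : S → Bool), ¬ (∀ i ∈ P, b i = a i) →
        patOp P a c notMat φ b = φ b := fun φ b hb => by rw [patOp, if_neg hb]
    rw [patOp, if_neg hP, hX _ _ hP]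
    have hR : patOp (insert c P) a t (V * V) ψ b = ψ b := by
      rw [patOp, if_neg]
      intro h
      exact hP fun i hi => h i (Finset.mem_insert_of_mem hi)
    rw [hR, patOp]
    by_cases hc : b c = a c
    · rw [if_pos (by simpa using hc)]
      have : oneOp t (star V) (patOp P a c notMat (patOp {c} a t V ψ)) b =
          oneOp t (star V) (oneOp t V ψ) b := by
        simp only [oneOp]
        refine Finset.sum_congr rfl fun x _ => ?_
        rw [hX _ _ (fun h => hP ((hPt _ _).1 h)), patOp, if_pos]
        · rfl
        · simpa [Function.update_of_ne htc.symm] using hc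
      rw [this, oneOp_comp, hVr, oneOp_one]
    · rw [if_neg (by simpa using hc), hX _ _ hP, patOp, if_neg (by simpa using hc)]

/-- Multiply controlled operators, by induction on the set of controls: for `U = V * V`, each new
control triples the number of gates, up to an additive constant. -/
theorem synth_patOp [Nontrivial S] (P : Finset S) (a : S → Bool) :
    ∀ (t : S) (_ : t ∉ P) {V : Matrix Bool Bool ℂ} (_ : V ∈ Matrix.unitaryGroup Bool ℂ),
      Synth (2 * 3 ^ P.card - 1) (patOp P a t V) := by
  have hone : (1 : Matrix Bool Bool ℂ) ∈ Matrix.unitaryGroup Bool ℂ := one_mem _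
  induction P using Finset.induction_on with
  | empty =>
    intro t _ V hV
    obtain ⟨c, hc⟩ := exists_ne t
    obtain ⟨g, hg⟩ := exists_gate_of_block hc.symm (fun _ => V) (fun _ => hV)
    refine ⟨[g], by simp, fun ψ => ?_⟩
    funext b
    simp [patOp, hg]
  | insert c P hcP ih =>
    intro t ht U hU
    have htc : t ≠ c := fun h => ht (h ▸ Finset.mem_insert_self _ _)
    have htP : t ∉ P := fun h => ht (Finset.mem_insert_of_mem h)
    obtain ⟨V, hV, rfl⟩ := exists_unitary_sqrt hU
    have hctrl : ∀ {V : Matrix Bool Bool ℂ}, V ∈ Matrix.unitaryGroup Bool ℂ →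
        Synth 1 (patOp {c} a t V) := by
      intro V hV
      obtain ⟨g, hg⟩ := exists_gate_of_block htc (fun k => if k = a c then V else 1)
        (fun k => by split_ifs; exacts [hV, hone])
      refine ⟨[g], by simp, fun ψ => ?_⟩
      funext b
      simp only [run_cons, run_nil, hg, patOp, Finset.mem_singleton, forall_eq]
      split_ifs
      · rfl
      · rw [oneOp_one]
    have h := ((((hctrl hV).comp (ih c hcP notMat_mem)).comp (hctrl (Unitary.star_mem hV))).comp
      (ih c hcP notMat_mem)).comp (ih t htP hV)
    refine (h.congr fun ψ => patOp_insert a htc htP hcP hV ψ).mono ?_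
    rw [Finset.card_insert_of_notMem hcP, pow_succ]
    have : 1 ≤ 3 ^ P.card := Nat.one_le_pow _ _ (by norm_num)
    omega

end Synthesis

section TwoLevel

variable {ι κ : Type} [Fintype ι] [DecidableEq ι] [Fintype κ] [DecidableEq κ]

theorem liftMat_mulVec_comp_perm {f : κ → ι} (hf : Function.Injective f) (σ : Equiv.Perm κ)
    (U : Matrix κ κ ℂ) (ψ : ι → ℂ) :
    (liftMat (f ∘ σ) U).mulVec ψ = (liftMat f (U.submatrix σ.symm σ.symm)).mulVec ψ := by
  funext i
  by_cases h : ∃ k, f k = i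
  · obtain ⟨k, rfl⟩ := h
    rw [liftMat_mulVec_apply hf]
    have h1 := liftMat_mulVec_apply (hf.comp σ.injective) U ψ (σ.symm k)
    simp only [Function.comp_apply, Equiv.apply_symm_apply] at h1
    rw [h1, Matrix.submatrix_mulVec_equiv]
    rfl
  · push Not at h
    rw [liftMat_mulVec_of_notMem _ _ h,
      liftMat_mulVec_of_notMem (f := f ∘ σ) _ _ fun k => h (σ k)]

theorem liftMat_perm_comp_mulVec {f : κ → ι} (hf : Function.Injective f) (σ : Equiv.Perm ι)
    (U : Matrix κ κ ℂ) (ψ : ι → ℂ) :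
    (liftMat (σ ∘ f) U).mulVec ψ ∘ σ = (liftMat f U).mulVec (ψ ∘ σ) := by
  funext i
  by_cases h : ∃ k, f k = i
  · obtain ⟨k, rfl⟩ := h
    rw [liftMat_mulVec_apply hf]
    exact liftMat_mulVec_apply (σ.injective.comp hf) U ψ k
  · push Not at h
    rw [Function.comp_apply, liftMat_mulVec_of_notMem _ _ h, liftMat_mulVec_of_notMem]
    · rfl
    · exact fun k hk => h k (σ.injective hk)

/-- The pair of basis vectors `x`, `y`, as a family indexed by `Bool`. -/
def pair (x y : ι) : Bool → ι := fun β => bif β then y else x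

theorem pair_injective {x y : ι} (h : x ≠ y) : Function.Injective (pair x y) := by
  intro a b hab
  cases a <;> cases b <;> simp_all [pair]

theorem pair_ne {x y i : ι} (hx : i ≠ x) (hy : i ≠ y) : ∀ β, pair x y β ≠ i := by
  intro β
  cases β
  · exact hx.symm
  · exact hy.symm

theorem liftMat_pair_not {x y : ι} (h : x ≠ y) (ψ : ι → ℂ) :
    (liftMat (pair x y) notMat).mulVec ψ = ψ ∘ Equiv.swap x y := by
  funext i
  by_cases hx : i = x
  · subst hx
    have := liftMat_mulVec_apply (pair_injective h) notMat ψ false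
    simpa [pair, Matrix.mulVec, dotProduct, notMat] using this
  · by_cases hy : i = y
    · subst hy
      have := liftMat_mulVec_apply (pair_injective h) notMat ψ true
      simpa [pair, Matrix.mulVec, dotProduct, notMat] using this
    · rw [liftMat_mulVec_of_notMem _ _ (pair_ne hx hy), Function.comp_apply,
        Equiv.swap_apply_of_ne_of_ne hx hy]

end TwoLevel

section Adjacent

variable {S : Type} [DecidableEq S] [Fintype S]

/-- Two-level unitaries on basis vectors that differ in a single qubit are multiply controlled
operators. -/
theorem synth_adjacent [Nontrivial S] (x : S → Bool) (t : S) {V : Matrix Bool Bool ℂ}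
    (hV : V ∈ Matrix.unitaryGroup Bool ℂ) :
    Synth (2 * 3 ^ Fintype.card S) (liftMat (fun β => Function.update x t β) V).mulVec := by
  have hf : Function.Injective (fun β => Function.update x t β) := Function.update_injective x t
  refine ((synth_patOp (Finset.univ.erase t) x t (by simp) hV).congr fun ψ => ?_).mono ?_
  · funext b
    by_cases h : ∃ β, Function.update x t β = b
    · obtain ⟨β, rfl⟩ := h
      have h1 := liftMat_mulVec_apply hf V ψ β
      rw [h1, patOp, if_pos]
      · simp only [oneOp, Function.update_self, Function.update_idem, Matrix.mulVec, dotProduct,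
          Function.comp_apply]
      · intro i hi
        rw [Function.update_of_ne (Finset.ne_of_mem_erase hi)]
    · push Not at h
      rw [liftMat_mulVec_of_notMem _ _ h, patOp, if_neg]
      intro hb
      refine h (b t) ?_
      funext i
      by_cases hi : i = t
      · subst hi; simp
      · rw [Function.update_of_ne hi, hb i (by simp [hi])]
  · have : 3 ^ (Finset.univ.erase t).card ≤ 3 ^ Fintype.card S :=
      Nat.pow_le_pow_right (by norm_num) (Finset.card_le_univ _)
    omega

theorem submatrix_mem_unitary (σ : Equiv.Perm Bool) {V : Matrix Bool Bool ℂ}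
    (hV : V ∈ Matrix.unitaryGroup Bool ℂ) :
    V.submatrix σ σ ∈ Matrix.unitaryGroup Bool ℂ := by
  rw [Matrix.mem_unitaryGroup_iff] at hV ⊢
  rw [Matrix.star_eq_conjTranspose, Matrix.conjTranspose_submatrix, Matrix.submatrix_mul_equiv,
    ← Matrix.star_eq_conjTranspose, hV, Matrix.submatrix_one_equiv]

/-- Two-level unitaries on arbitrary pairs, by induction on the Hamming distance: conjugation with
a swap of two adjacent basis vectors decreases the distance by one. -/
theorem synth_twoLevel [Nontrivial S] (d : ℕ) :
    ∀ (x y : S → Bool) (_ : hammingDist x y = d + 1) {V : Matrix Bool Bool ℂ}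
      (_ : V ∈ Matrix.unitaryGroup Bool ℂ),
      Synth ((2 * d + 1) * (2 * 3 ^ Fintype.card S)) (liftMat (pair x y) V).mulVec := by
  induction d with
  | zero =>
    intro x y hxy V hV
    obtain ⟨t, ht⟩ := Finset.card_eq_one.1 hxy
    have ht' : ∀ i, x i ≠ y i ↔ i = t := fun i => by
      simpa using congrArg (fun s => i ∈ s) ht
    have hy : y = Function.update x t (!x t) := by
      funext i
      by_cases hi : i = t
      · subst hi
        have := (ht' i).2 rfl
        rw [Function.update_self]
        cases h1 : x i <;> cases h2 : y i <;> simp_all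
      · rw [Function.update_of_ne hi]
        by_contra h
        exact hi ((ht' i).1 (Ne.symm h))
    have hf : Function.Injective (fun β => Function.update x t β) :=
      Function.update_injective x t
    cases hb : x t with
    | false =>
      have : pair x y = fun β => Function.update x t β := by
        funext β
        cases β
        · show x = _
          rw [← hb, Function.update_eq_self]
        · show y = _
          rw [hy, hb]; rfl
      rw [this]
      simpa using synth_adjacent x t hV
    | true =>
      have : pair x y = (fun β => Function.update x t β) ∘ Equiv.boolNot := by
        funext β
        cases β
        · show x = Function.update x t true
          rw [← hb, Function.update_eq_self]
        · show y = Function.update x t false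
          rw [hy, hb]; rfl
      rw [this]
      refine ((synth_adjacent x t (submatrix_mem_unitary Equiv.boolNot.symm hV)).congr
        fun ψ => ?_).mono (by simp)
      rw [liftMat_mulVec_comp_perm hf]
  | succ d ih =>
    intro x y hxy V hV
    obtain ⟨t, ht⟩ : ∃ t, x t ≠ y t := by
      by_contra h
      push Not at h
      rw [show x = y from funext h, hammingDist_self] at hxy
      omega
    set x' := Function.update x t (y t) with hx'
    have hd : hammingDist x' y = d + 1 := by
      have h1 : (Finset.univ.filter fun i => x i ≠ y i) =
          insert t (Finset.univ.filter fun i => x' i ≠ y i) := by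
        ext i
        by_cases hi : i = t
        · subst hi; simp [ht]
        · simp [hx', hi]
      have h2 : hammingDist x y = hammingDist x' y + 1 := by
        unfold hammingDist
        rw [h1, Finset.card_insert_of_notMem (by simp [hx'])]
      omega
    have hx'y : x' ≠ y := by
      intro h
      rw [h, hammingDist_self] at hd
      omega
    have hxx' : x ≠ x' := by
      intro h
      have := congrFun h t
      rw [hx', Function.update_self] at this
      exact ht this
    have hxny : x ≠ y := fun h => ht (congrFun h t)
    have h1 : hammingDist x x' = 0 + 1 := by
      have : (Finset.univ.filter fun i => x i ≠ x' i) = {t} := by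
        ext i
        by_cases hi : i = t
        · subst hi; simpa [hx'] using ht
        · simp [hx', hi]
      unfold hammingDist
      rw [this]; rfl
    have hswap : Synth (2 * 3 ^ Fintype.card S)
        (fun ψ : (S → Bool) → ℂ => ψ ∘ Equiv.swap x x') := by
      have hx'' : x' = Function.update x t (!x t) := by
        rw [hx']; congr 1
        cases h1 : x t <;> cases h2 : y t <;> simp_all
      have hf : Function.Injective (fun β => Function.update x t β) :=
        Function.update_injective x t
      cases hb : x t with
      | false =>
        refine (synth_adjacent x t notMat_mem).congr fun ψ => ?_
        have : (fun β => Function.update x t β) = pair x x' := by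
          funext β
          cases β
          · show _ = x
            rw [← hb, Function.update_eq_self]
          · show _ = x'
            rw [hx'', hb]; rfl
        rw [this, liftMat_pair_not hxx']
      | true =>
        refine (synth_adjacent x t notMat_mem).congr fun ψ => ?_
        have : (fun β => Function.update x t β) = pair x' x := by
          funext β
          cases β
          · show _ = x'
            rw [hx'', hb]; rfl
          · show _ = x
            rw [← hb, Function.update_eq_self]
        rw [this, liftMat_pair_not hxx'.symm, Equiv.swap_comm]
    refine (((hswap.comp (ih x' y hd hV)).comp hswap).congr fun ψ => ?_).mono ?_
    · have hpair : pair x y = Equiv.swap x x' ∘ pair x' y := by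
        funext β
        cases β
        · show x = Equiv.swap x x' x'
          rw [Equiv.swap_apply_right]
        · show y = Equiv.swap x x' y
          rw [Equiv.swap_apply_of_ne_of_ne hxny.symm hx'y.symm]
      rw [hpair, ← liftMat_perm_comp_mulVec (pair_injective hx'y)]
      funext b
      simp
    · have : (2 * (d + 1) + 1) * (2 * 3 ^ Fintype.card S) =
          (2 * d + 1) * (2 * 3 ^ Fintype.card S) + 2 * 3 ^ Fintype.card S +
          2 * 3 ^ Fintype.card S := by ring
      omega

end Adjacent

section Givens

variable {S : Type} [DecidableEq S] [Fintype S]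

/-- A `2 × 2` unitary that maps a given vector to a multiple of the first basis vector. -/
theorem exists_rotation (p r : ℂ) : ∃ V ∈ Matrix.unitaryGroup Bool ℂ,
    V.mulVec (fun β => bif β then r else p) true = 0 := by
  by_cases h : p = 0 ∧ r = 0
  · refine ⟨1, one_mem _, ?_⟩
    simp [h.2]
  · set n : ℝ := Real.sqrt (‖p‖ ^ 2 + ‖r‖ ^ 2) with hn
    have hpos : 0 < ‖p‖ ^ 2 + ‖r‖ ^ 2 := by
      by_contra hle
      apply h
      have h1 := sq_nonneg ‖p‖
      have h2 := sq_nonneg ‖r‖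
      constructor
      · have : ‖p‖ ^ 2 = 0 := by linarith
        simpa using this
      · have : ‖r‖ ^ 2 = 0 := by linarith
        simpa using this
    have hn2 : (n : ℂ) * n = p * star p + r * star r := by
      have h1 : p * star p = ((‖p‖ ^ 2 : ℝ) : ℂ) := by push_cast; exact RCLike.mul_conj p
      have h2 : r * star r = ((‖r‖ ^ 2 : ℝ) : ℂ) := by push_cast; exact RCLike.mul_conj r
      rw [h1, h2, ← Complex.ofReal_mul, ← Complex.ofReal_add, hn, Real.mul_self_sqrt hpos.le]
    have hn0 : (n : ℂ) ≠ 0 := by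
      have : 0 < n := Real.sqrt_pos.2 hpos
      exact_mod_cast this.ne'
    refine ⟨Matrix.of fun y x => (bif y then (bif x then p else -r) else
      (bif x then star r else star p)) / n, ?_, ?_⟩
    · rw [Matrix.mem_unitaryGroup_iff]
      ext i j
      have hs : star (n : ℂ) = n := Complex.conj_ofReal n
      cases i <;> cases j <;>
        simp only [Matrix.mul_apply, Matrix.star_apply, Matrix.of_apply, Fintype.sum_bool, cond_true, cond_false,
          star_div₀, star_neg, star_star, hs, Matrix.one_apply, if_true, reduceCtorEq, if_false]
        <;> field_simp <;> (try linear_combination -hn2)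
        <;> (try ring)
    · simp only [Matrix.mulVec, dotProduct, Matrix.of_apply, Fintype.sum_bool, cond_true, cond_false]
      ring

/-- The number of gates spent on a two-level unitary. -/
abbrev twoLevelCost (S : Type) [Fintype S] : ℕ :=
  (2 * Fintype.card S + 1) * (2 * 3 ^ Fintype.card S)

theorem synth_pair [Nontrivial S] {x y : S → Bool} (h : x ≠ y) {V : Matrix Bool Bool ℂ}
    (hV : V ∈ Matrix.unitaryGroup Bool ℂ) :
    Synth (twoLevelCost S) (liftMat (pair x y) V).mulVec := by
  have hpos : 0 < hammingDist x y := hammingDist_pos.2 h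
  obtain ⟨d, hd⟩ := Nat.exists_eq_add_of_lt hpos
  rw [zero_add] at hd
  refine (synth_twoLevel d x y hd hV).mono (Nat.mul_le_mul_right _ ?_)
  have : hammingDist x y ≤ Fintype.card S := hammingDist_le_card_fintype
  omega

theorem norm_mulVec_of_unitary {ι : Type} [Fintype ι] [DecidableEq ι] {U : Matrix ι ι ℂ}
    (hU : U ∈ Matrix.unitaryGroup ι ℂ) (φ ψ : ι → ℂ) :
    star (U.mulVec φ) ⬝ᵥ U.mulVec ψ = star φ ⬝ᵥ ψ := by
  rw [Matrix.star_mulVec, ← Matrix.dotProduct_mulVec, Matrix.mulVec_mulVec,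
    ← Matrix.star_eq_conjTranspose, Matrix.mem_unitaryGroup_iff'.1 hU, Matrix.one_mulVec]

theorem mulVec_synth_comp {N M : ℕ} {U V : Matrix (S → Bool) (S → Bool) ℂ}
    (hU : Synth N U.mulVec) (hV : Synth M V.mulVec) : Synth (N + M) (V * U).mulVec :=
  (hU.comp hV).congr fun ψ => by rw [Matrix.mulVec_mulVec]

/-- A unit vector supported on `insert j T` is rotated to the basis vector `j` by at most
`|T| + 1` two-level unitaries that fix the basis vectors outside `insert j T`. -/
theorem exists_rotate_to_basis [Nontrivial S] (j : S → Bool) (T : Finset (S → Bool)) :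
    ∀ (_ : j ∉ T) (v : (S → Bool) → ℂ) (_ : ∀ k, k ∉ insert j T → v k = 0)
      (_ : star v ⬝ᵥ v = 1),
      ∃ P ∈ Matrix.unitaryGroup (S → Bool) ℂ,
        Synth ((T.card + 1) * twoLevelCost S) (star P).mulVec ∧
        P.mulVec v = Pi.single j 1 ∧
        ∀ k, k ∉ insert j T → P.mulVec (Pi.single k 1) = Pi.single k 1 := by
  induction T using Finset.induction_on with
  | empty =>
    intro _ v hv hnorm
    obtain ⟨k, hk⟩ := exists_ne j
    have hv' : v = Pi.single j (v j) := by
      funext i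
      by_cases hi : i = j
      · subst hi; simp
      · rw [Pi.single_eq_of_ne hi]; exact hv i (by simpa using hi)
    have hz : star (v j) * v j = 1 := by
      rw [hv'] at hnorm
      simpa [dotProduct, Pi.single_apply] using hnorm
    set V : Matrix Bool Bool ℂ := Matrix.diagonal (fun β => bif β then 1 else star (v j)) with hVdef
    have hV : V ∈ Matrix.unitaryGroup Bool ℂ := by
      rw [Matrix.mem_unitaryGroup_iff, Matrix.star_eq_conjTranspose, hVdef,
        Matrix.diagonal_conjTranspose, Matrix.diagonal_mul_diagonal, ← Matrix.diagonal_one]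
      congr 1
      funext β
      cases β
      · simpa using hz
      · simp
    have hinj := pair_injective hk.symm
    refine ⟨liftMat (pair j k) V, liftMat_mem_unitary hinj hV, ?_, ?_, ?_⟩
    · rw [liftMat_star]
      simpa using synth_pair hk.symm (Unitary.star_mem hV)
    · funext i
      by_cases hi : ∃ β, pair j k β = i
      · obtain ⟨β, rfl⟩ := hi
        rw [liftMat_mulVec_apply hinj, hVdef, Matrix.mulVec_diagonal]
        cases β
        · simpa [pair] using hz
        · have : v k = 0 := hv k (by simpa using hk)
          simp [pair, this, hk]
      · push Not at hi
        rw [liftMat_mulVec_of_notMem _ _ hi]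
        have hij : i ≠ j := fun h => hi false h.symm
        rw [hv i (by simpa using hij), Pi.single_eq_of_ne hij]
    · intro l hl
      have hlj : l ≠ j := by simpa using hl
      funext i
      by_cases hi : ∃ β, pair j k β = i
      · obtain ⟨β, rfl⟩ := hi
        rw [liftMat_mulVec_apply hinj, hVdef, Matrix.mulVec_diagonal]
        cases β
        · simp [pair, hlj.symm]
        · simp [pair]
      · push Not at hi
        rw [liftMat_mulVec_of_notMem _ _ hi]
  | insert x T hxT ih =>
    intro hj v hv hnorm
    have hjx : j ≠ x := fun h => hj (h ▸ Finset.mem_insert_self _ _)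
    have hjT : j ∉ T := fun h => hj (Finset.mem_insert_of_mem h)
    obtain ⟨V, hV, hVx⟩ := exists_rotation (v j) (v x)
    have hinj := pair_injective hjx
    have hLu := liftMat_mem_unitary hinj hV
    have hfix : ∀ k, k ≠ j → k ≠ x →
        (liftMat (pair j x) V).mulVec (Pi.single k 1) = Pi.single k 1 := by
      intro k hkj hkx
      funext i
      by_cases hi : ∃ β, pair j x β = i
      · obtain ⟨β, rfl⟩ := hi
        rw [liftMat_mulVec_apply hinj]
        have : (Pi.single k 1 : (S → Bool) → ℂ) ∘ pair j x = 0 := by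
          funext β
          cases β
          · simp [pair, hkj.symm]
          · simp [pair, hkx.symm]
        rw [this, Matrix.mulVec_zero]
        cases β
        · simp [pair, hkj.symm]
        · simp [pair, hkx.symm]
      · push Not at hi
        rw [liftMat_mulVec_of_notMem _ _ hi]
    obtain ⟨P, hP, hPs, hPv, hPf⟩ := ih hjT ((liftMat (pair j x) V).mulVec v)
      (fun k hk => by
        by_cases hkx : k = x
        · subst hkx
          have : (liftMat (pair j k) V).mulVec v k = V.mulVec (v ∘ pair j k) true :=
            liftMat_mulVec_apply hinj V v true
          rw [this]
          convert hVx using 2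
          funext β
          cases β <;> rfl
        · have hkj : k ≠ j := fun h => hk (by simp [h])
          rw [liftMat_mulVec_of_notMem _ _ (pair_ne hkj hkx)]
          exact hv k (by
            simp only [Finset.mem_insert, not_or] at hk ⊢
            exact ⟨hk.1, hkx, hk.2⟩))
      (by rw [norm_mulVec_of_unitary hLu, hnorm])
    refine ⟨P * liftMat (pair j x) V, mul_mem hP hLu, ?_, ?_, ?_⟩
    · rw [star_mul, liftMat_star, Finset.card_insert_of_notMem hxT]
      refine (mulVec_synth_comp hPs (synth_pair hjx (Unitary.star_mem hV))).mono (le_of_eq ?_)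
      ring
    · rw [← Matrix.mulVec_mulVec, hPv]
    · intro k hk
      have h1 : k ≠ j := fun h => hk (by simp [h])
      have h2 : k ≠ x := fun h => hk (by simp [h])
      rw [← Matrix.mulVec_mulVec, hfix k h1 h2]
      exact hPf k (by
        simp only [Finset.mem_insert, not_or] at hk ⊢
        exact ⟨hk.1, hk.2.2⟩)

/-- Elimination column by column: a unitary that fixes the basis vectors outside `T` is turned,
by two-level unitaries, into one that also fixes some basis vector of `T`. -/
theorem synth_unitary_aux [Nontrivial S] (T : Finset (S → Bool)) :
    ∀ U ∈ Matrix.unitaryGroup (S → Bool) ℂ,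
      (∀ k, k ∉ T → U.mulVec (Pi.single k 1) = Pi.single k 1) →
      Synth (T.card * (Fintype.card (S → Bool) * twoLevelCost S)) U.mulVec := by
  induction T using Finset.induction_on with
  | empty =>
    intro U _ hU
    have : U = 1 := by
      ext i k
      have := congrFun (hU k (Finset.notMem_empty k)) i
      rw [Matrix.mulVec_single_one] at this
      simpa [Matrix.one_apply, Pi.single_apply] using this
    subst this
    exact ((Synth.id (S := S)).congr fun ψ => (Matrix.one_mulVec ψ).symm).mono (Nat.zero_le _)
  | insert j T hj ih =>
    intro U hU hfix
    have hsingle : ∀ k l : S → Bool, star (Pi.single k 1 : (S → Bool) → ℂ) ⬝ᵥ Pi.single l 1 =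
        if k = l then 1 else 0 := by
      intro k l
      rw [dotProduct_single_one, Pi.star_apply, Pi.single_apply]
      by_cases h : k = l
      · simp [h]
      · simp [h, Ne.symm h]
    -- rotate the column of `j`, which is orthogonal to the basis vectors already fixed
    obtain ⟨P, hP, hPs, hPv, hPf⟩ := exists_rotate_to_basis j T hj (U.mulVec (Pi.single j 1))
      (fun k hk => by
        have h1 := norm_mulVec_of_unitary hU (Pi.single k 1) (Pi.single j 1)
        have hkj : k ≠ j := fun h => hk (by simp [h])
        rw [hfix k hk, hsingle, if_neg hkj] at h1
        have : star (Pi.single k 1 : (S → Bool) → ℂ) = Pi.single k 1 := by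
          funext i; by_cases h : i = k <;> simp [h]
        rwa [this, single_one_dotProduct] at h1)
      (by rw [norm_mulVec_of_unitary hU, hsingle j j, if_pos rfl])
    have h2 := ih (P * U) (mul_mem hP hU) (fun k hk => by
      by_cases hkj : k = j
      · subst hkj
        rw [← Matrix.mulVec_mulVec, hPv]
      · have : k ∉ insert j T := by simp [hk, hkj]
        rw [← Matrix.mulVec_mulVec, hfix k this, hPf k this])
    have h3 := mulVec_synth_comp h2 hPs
    rw [← Matrix.mul_assoc (star P) P U, Matrix.mem_unitaryGroup_iff'.1 hP,
      Matrix.one_mul] at h3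
    refine h3.mono ?_
    have hc := Finset.card_le_univ (insert j T)
    rw [Finset.card_insert_of_notMem hj] at hc ⊢
    calc _ ≤ T.card * (Fintype.card (S → Bool) * twoLevelCost S) +
          Fintype.card (S → Bool) * twoLevelCost S :=
          Nat.add_le_add_left (Nat.mul_le_mul_right _ hc) _
      _ = _ := by ring

/-- Every unitary on a set `S` of qubits is a product of at most `72 ^ |S|` two-qubit gates. -/
theorem synth_unitary [Nontrivial S] {U : Matrix (S → Bool) (S → Bool) ℂ}
    (hU : U ∈ Matrix.unitaryGroup (S → Bool) ℂ) : Synth (72 ^ Fintype.card S) U.mulVec := by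
  refine (synth_unitary_aux Finset.univ U hU
    fun k hk => absurd (Finset.mem_univ k) hk).mono ?_
  simp only [Finset.card_univ, Fintype.card_pi, Fintype.card_bool, Finset.prod_const]
  set s := Fintype.card S
  have h1 : 2 * s + 1 ≤ 3 ^ s := by
    have := one_add_mul_le_pow (a := (2 : ℤ)) (by norm_num) s
    norm_num at this
    zify
    linarith
  have hs : 1 ≤ s := Fintype.card_pos
  have h2 : 2 ≤ 2 ^ s := by
    calc 2 = 2 ^ 1 := rfl
      _ ≤ 2 ^ s := Nat.pow_le_pow_right (by norm_num) hs
  calc 2 ^ s * (2 ^ s * ((2 * s + 1) * (2 * 3 ^ s)))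
      ≤ 2 ^ s * (2 ^ s * (3 ^ s * (2 ^ s * 3 ^ s))) := by gcongr
    _ = 72 ^ s := by
      rw [show (72 : ℕ) = 2 * (2 * (3 * (2 * 3))) by norm_num]
      simp only [mul_pow]

end Givens

/-! ### Local operations on registers -/

section Registers

theorem permMatrix_mem_unitary {ι : Type} [Fintype ι] [DecidableEq ι] (σ : Equiv.Perm ι) :
    σ.permMatrix ℂ ∈ Matrix.unitaryGroup ι ℂ := by
  rw [Matrix.mem_unitaryGroup_iff, Matrix.star_eq_conjTranspose, Matrix.conjTranspose_permMatrix,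
    ← Matrix.permMatrix_mul]
  simp

theorem exists_gates_local {S W : Type} [Fintype S] [DecidableEq S] [DecidableEq W]
    [Nontrivial S] (e : S → W) (he : Function.Injective e)
    {U : Matrix (S → Bool) (S → Bool) ℂ} (hU : U ∈ Matrix.unitaryGroup (S → Bool) ℂ) :
    ∃ gs : List (Gate W), gs.length ≤ 72 ^ Fintype.card S ∧
      ∀ ψ b, run gs ψ b = U.mulVec (slice e b ψ) (b ∘ e) := by
  obtain ⟨gs, hl, hgs⟩ := synth_unitary hU
  exact ⟨gs.map (Gate.map e he), by simpa using hl, fun ψ b => by rw [run_map, hgs]⟩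

variable {q : ℕ} [NeZero q]

theorem enc_injective : Function.Injective (enc : ZMod q → ZReg q → Bool) := by
  intro x y h
  apply ZMod.val_injective q
  apply Nat.eq_of_testBit_eq
  intro i
  by_cases hi : i < Nat.clog 2 q
  · exact congrFun h ⟨i, hi⟩
  · have hb : ∀ z : ZMod q, z.val.testBit i = false := fun z => by
      apply Nat.testBit_lt_two_pow
      calc z.val < q := ZMod.val_lt z
        _ ≤ 2 ^ Nat.clog 2 q := Nat.le_pow_clog (by norm_num) q
        _ ≤ 2 ^ i := Nat.pow_le_pow_right (by norm_num) (not_lt.1 hi)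
    rw [hb, hb]

theorem encVec_injective {ι : Type} :
    Function.Injective (encVec : (ι → ZMod q) → ι × ZReg q → Bool) := by
  intro v w h
  funext i
  apply enc_injective
  funext k
  exact congrFun h (i, k)

theorem enc_zero (k : ZReg q) : enc (0 : ZMod q) k = false := by
  simp [enc]

variable {R κ : Type} [Fintype R] [DecidableEq R] [Fintype κ] [DecidableEq κ]

/-- The state of qubits that encodes a state of `ℤ_q`-valued registers. -/
def encState (F : (R → ZMod q) → ℂ) : (R × ZReg q → Bool) → ℂ :=
  (inclMat (encVec (ι := R))).mulVec F

theorem encState_apply (F : (R → ZMod q) → ℂ) (x : R → ZMod q) :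
    encState F (encVec x) = F x := inclMat_mulVec_apply encVec_injective F x

theorem encState_of_notMem (F : (R → ZMod q) → ℂ) {b : R × ZReg q → Bool}
    (h : ∀ x : R → ZMod q, encVec x ≠ b) : encState F b = 0 := inclMat_mulVec_of_notMem F h

theorem extend_encVec {e : κ → R} (he : Function.Injective e) (c : κ → ZMod q)
    (x : R → ZMod q) :
    Function.extend (Prod.map e id) (encVec c) (encVec x) = encVec (Function.extend e c x) := by
  have hi : Function.Injective (Prod.map e (id : ZReg q → ZReg q)) := he.prodMap fun _ _ h => h
  funext ⟨r, k⟩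
  by_cases h : ∃ s, e s = r
  · obtain ⟨s, rfl⟩ := h
    have := hi.extend_apply (encVec c) (encVec x) (s, k)
    simp only [Prod.map_apply, id] at this
    rw [this]
    simp [encVec, he.extend_apply]
  · rw [Function.extend_apply']
    · simp [encVec, Function.extend_apply' _ _ _ h]
    · rintro ⟨⟨s, k'⟩, hs⟩
      exact h ⟨s, congrArg Prod.fst hs⟩

/-- The operator `L` on states of `ℤ_q`-valued registers is realized by at most `N` gates. -/
def QSynth (N : ℕ) (L : ((R → ZMod q) → ℂ) → ((R → ZMod q) → ℂ)) : Prop :=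
  ∃ gs : List (Gate (R × ZReg q)), gs.length ≤ N ∧
    ∀ F, run gs (encState F) = encState (L F)

theorem QSynth.comp {N M : ℕ} {L L' : ((R → ZMod q) → ℂ) → ((R → ZMod q) → ℂ)}
    (h : QSynth N L) (h' : QSynth M L') : QSynth (N + M) (fun ψ => L' (L ψ)) := by
  obtain ⟨gs, hg, hL⟩ := h
  obtain ⟨hs, hh, hL'⟩ := h'
  refine ⟨gs ++ hs, by simp; omega, fun ψ => ?_⟩
  rw [run_append, hL, hL']

theorem QSynth.mono {N M : ℕ} {L : ((R → ZMod q) → ℂ) → ((R → ZMod q) → ℂ)}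
    (h : QSynth N L) (hNM : N ≤ M) : QSynth M L := by
  obtain ⟨gs, hg, hL⟩ := h
  exact ⟨gs, hg.trans hNM, hL⟩

theorem QSynth.congr {N : ℕ} {L L' : ((R → ZMod q) → ℂ) → ((R → ZMod q) → ℂ)}
    (h : QSynth N L) (e : ∀ ψ, L ψ = L' ψ) : QSynth N L' := by
  obtain ⟨gs, hg, hL⟩ := h
  exact ⟨gs, hg, fun ψ => by rw [hL, e]⟩

theorem QSynth.id : QSynth 0 (fun F : (R → ZMod q) → ℂ => F) := ⟨[], le_rfl, fun _ => rfl⟩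

theorem qsynth_local [Nonempty κ] (hq : 2 < q) (e : κ → R) (he : Function.Injective e)
    {U : Matrix (κ → ZMod q) (κ → ZMod q) ℂ} (hU : U ∈ Matrix.unitaryGroup (κ → ZMod q) ℂ) :
    QSynth (72 ^ (Fintype.card κ * Nat.clog 2 q))
      (fun F x => U.mulVec (fun c => F (Function.extend e c x)) (x ∘ e)) := by
  have hcl : 1 < Nat.clog 2 q := by
    rw [Nat.lt_clog_iff_pow_lt (by norm_num)]; simpa using hq
  have : Nontrivial (ZReg q) := Fin.nontrivial_iff_two_le.2 hcl
  have hi : Function.Injective (Prod.map e (id : ZReg q → ZReg q)) := he.prodMap fun _ _ h => h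
  have hv := encVec_injective (q := q) (ι := κ)
  obtain ⟨gs, hl, hgs⟩ := exists_gates_local (Prod.map e (id : ZReg q → ZReg q)) hi
    (liftMat_mem_unitary hv hU)
  refine ⟨gs, by simpa using hl, fun F => ?_⟩
  funext b
  rw [hgs]
  by_cases hb : ∃ x : R → ZMod q, encVec x = b
  · obtain ⟨x, rfl⟩ := hb
    rw [encState_apply]
    have h1 : (encVec x : R × ZReg q → Bool) ∘ Prod.map e id = encVec (x ∘ e) := rfl
    rw [h1, liftMat_mulVec_apply hv]
    congr 1
    funext c
    rw [Function.comp_apply, slice, extend_encVec he, encState_apply]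
  · push Not at hb
    rw [encState_of_notMem _ hb]
    by_cases hc : ∃ c : κ → ZMod q, encVec c = b ∘ Prod.map e id
    · obtain ⟨c₀, hc₀⟩ := hc
      rw [← hc₀, liftMat_mulVec_apply hv]
      have : slice (Prod.map e (id : ZReg q → ZReg q)) b (encState F) ∘ encVec = 0 := by
        funext c
        rw [Function.comp_apply, slice]
        refine encState_of_notMem _ fun x hx => hb (Function.extend e c₀ x) ?_
        rw [← extend_encVec he, hx, extend_extend hi, hc₀, extend_comp_self hi]
      rw [this, Matrix.mulVec_zero]; rfl
    · push Not at hc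
      rw [liftMat_mulVec_of_notMem _ _ hc, slice, extend_comp_self hi, encState_of_notMem _ hb]

/-! ### Product operators -/

/-- The tensor product of operators on the individual registers. -/
def tens (U : R → Matrix (ZMod q) (ZMod q) ℂ) : Matrix (R → ZMod q) (R → ZMod q) ℂ :=
  fun x c => ∏ r, U r (x r) (c r)

theorem tens_mul (U V : R → Matrix (ZMod q) (ZMod q) ℂ) :
    tens U * tens V = tens (fun r => U r * V r) := by
  ext x z
  simp only [Matrix.mul_apply, tens, ← Finset.prod_mul_distrib]
  rw [Finset.prod_univ_sum, Fintype.piFinset_univ]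

theorem tens_one : tens (fun _ : R => (1 : Matrix (ZMod q) (ZMod q) ℂ)) = 1 := by
  ext x z
  simp only [tens, Matrix.one_apply]
  by_cases h : x = z
  · subst h; simp
  · obtain ⟨r, hr⟩ := Function.ne_iff.1 h
    rw [if_neg h]
    exact Finset.prod_eq_zero (Finset.mem_univ r) (by simp [hr])

theorem tens_star (U : R → Matrix (ZMod q) (ZMod q) ℂ) :
    star (tens U) = tens (fun r => star (U r)) := by
  ext x z
  simp [tens, Matrix.star_apply]

theorem tens_mem_unitary {U : R → Matrix (ZMod q) (ZMod q) ℂ}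
    (hU : ∀ r, U r ∈ Matrix.unitaryGroup (ZMod q) ℂ) :
    tens U ∈ Matrix.unitaryGroup (R → ZMod q) ℂ := by
  rw [Matrix.mem_unitaryGroup_iff, tens_star, tens_mul, ← tens_one]
  congr 1
  funext r
  exact Matrix.mem_unitaryGroup_iff.1 (hU r)

theorem qsynth_single (hq : 2 < q) (r : R) {V : Matrix (ZMod q) (ZMod q) ℂ}
    (hV : V ∈ Matrix.unitaryGroup (ZMod q) ℂ) :
    QSynth (72 ^ Nat.clog 2 q) (tens (Function.update (fun _ : R => 1) r V)).mulVec := by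
  have h := qsynth_local (κ := Unit) (R := R) hq (fun _ => r) (fun _ _ _ => rfl)
    (tens_mem_unitary (R := Unit) (U := fun _ => V) fun _ => hV)
  refine (h.congr fun F => ?_).mono (by simp)
  funext x
  simp only [Matrix.mulVec, dotProduct]
  have hx : ∀ c : R → ZMod q, tens (Function.update (fun _ : R => 1) r V) x c =
      V (x r) (c r) * if ∀ s, s ≠ r → x s = c s then 1 else 0 := by
    intro c
    rw [tens, ← Finset.mul_prod_erase _ _ (Finset.mem_univ r), Function.update_self]
    congr 1
    by_cases hc : ∀ s, s ≠ r → x s = c s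
    · rw [if_pos hc]
      refine Finset.prod_eq_one fun s hs => ?_
      rw [Function.update_of_ne (Finset.ne_of_mem_erase hs), hc s (Finset.ne_of_mem_erase hs),
        Matrix.one_apply_eq]
    · rw [if_neg hc]
      push Not at hc
      obtain ⟨s, hs, hsc⟩ := hc
      refine Finset.prod_eq_zero (Finset.mem_erase.2 ⟨hs, Finset.mem_univ s⟩) ?_
      rw [Function.update_of_ne hs, Matrix.one_apply_ne hsc]
  have hext : ∀ c : Unit → ZMod q, Function.extend (fun _ : Unit => r) c x =
      Function.update x r (c ()) := by
    intro c
    funext s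
    by_cases hs : s = r
    · subst hs
      rw [Function.update_self]
      exact Function.Injective.extend_apply (f := fun _ : Unit => s) (fun _ _ _ => rfl) c x ()
    · rw [Function.update_of_ne hs, Function.extend_apply']
      rintro ⟨_, h⟩
      exact hs h.symm
  simp only [hx, hext, mul_assoc, ite_mul, one_mul, zero_mul, mul_ite, mul_zero]
  rw [← Finset.sum_filter]
  refine Finset.sum_bij' (fun c _ => Function.update x r (c ())) (fun c _ => fun _ => c r)
    ?_ ?_ ?_ ?_ ?_
  · intro c _
    simp only [Finset.mem_filter, Finset.mem_univ, true_and]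
    intro s hs
    rw [Function.update_of_ne hs]
  · intros; simp
  · intro c _
    funext u
    simp
  · intro c hc
    simp only [Finset.mem_filter, Finset.mem_univ, true_and] at hc
    funext s
    by_cases hs : s = r
    · subst hs; simp
    · rw [Function.update_of_ne hs, hc s hs]
  · intro c _
    simp [tens]

theorem qsynth_tens (hq : 2 < q) {U : R → Matrix (ZMod q) (ZMod q) ℂ}
    (hU : ∀ r, U r ∈ Matrix.unitaryGroup (ZMod q) ℂ) :
    QSynth (Fintype.card R * 72 ^ Nat.clog 2 q) (tens U).mulVec := by
  have key : ∀ T : Finset R, QSynth (T.card * 72 ^ Nat.clog 2 q)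
      (tens (fun r => if r ∈ T then U r else 1)).mulVec := by
    intro T
    induction T using Finset.induction_on with
    | empty =>
      refine (QSynth.id.congr fun F => ?_).mono (Nat.zero_le _)
      simp only [Finset.notMem_empty, if_false, tens_one, Matrix.one_mulVec]
    | insert r T hr ih =>
      refine ((ih.comp (qsynth_single hq r (hU r))).congr fun F => ?_).mono (le_of_eq ?_)
      · rw [Matrix.mulVec_mulVec, tens_mul]
        congr 2
        funext s
        by_cases hs : s = r
        · subst hs; simp [hr]
        · simp [hs]
      · rw [Finset.card_insert_of_notMem hr]; ring
  simpa using key Finset.univ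

/-! ### Reversible additions -/

/-- An addition `x_tgt ← x_tgt + g(x_fst, x_snd)` on `ℤ_q`-valued registers. -/
structure AddInstr (R : Type) (q : ℕ) where
  fst : R
  snd : R
  tgt : R
  g : ZMod q → ZMod q → ZMod q

/-- The amount that a list of additions subtracts from the register `r`, read off from the
source registers. -/
def totalAdd (ps : List (AddInstr R q)) (x : R → ZMod q) (r : R) : ZMod q :=
  (ps.map fun p => if p.tgt = r then p.g (x p.fst) (x p.snd) else 0).sum

theorem qsynth_add_single (hq : 2 < q) (p : AddInstr R q) (h1 : p.fst ≠ p.tgt)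
    (h2 : p.snd ≠ p.tgt) :
    QSynth (72 ^ (3 * Nat.clog 2 q)) (fun (F : (R → ZMod q) → ℂ) x =>
      F (Function.update x p.tgt (x p.tgt - p.g (x p.fst) (x p.snd)))) := by
  set T : Finset R := {p.fst, p.snd, p.tgt} with hT
  have m1 : p.fst ∈ T := by simp [hT]
  have m2 : p.snd ∈ T := by simp [hT]
  have m3 : p.tgt ∈ T := by simp [hT]
  have n1 : (⟨p.fst, m1⟩ : T) ≠ ⟨p.tgt, m3⟩ := fun h => h1 (congrArg Subtype.val h)
  have n2 : (⟨p.snd, m2⟩ : T) ≠ ⟨p.tgt, m3⟩ := fun h => h2 (congrArg Subtype.val h)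
  let σ : Equiv.Perm (T → ZMod q) :=
    { toFun := fun c => Function.update c ⟨p.tgt, m3⟩
        (c ⟨p.tgt, m3⟩ - p.g (c ⟨p.fst, m1⟩) (c ⟨p.snd, m2⟩))
      invFun := fun c => Function.update c ⟨p.tgt, m3⟩
        (c ⟨p.tgt, m3⟩ + p.g (c ⟨p.fst, m1⟩) (c ⟨p.snd, m2⟩))
      left_inv := fun c => by simp [Function.update_of_ne n1, Function.update_of_ne n2]
      right_inv := fun c => by simp [Function.update_of_ne n1, Function.update_of_ne n2] }
  have : Nonempty T := ⟨⟨p.fst, m1⟩⟩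
  refine ((qsynth_local hq (Subtype.val : T → R) Subtype.val_injective
    (permMatrix_mem_unitary σ)).congr fun F => ?_).mono ?_
  · funext x
    rw [Matrix.permMatrix_mulVec, Function.comp_apply]
    congr 1
    funext r
    by_cases hr : ∃ s : T, s.1 = r
    · obtain ⟨s, rfl⟩ := hr
      rw [Subtype.val_injective.extend_apply]
      by_cases hs : s = ⟨p.tgt, m3⟩
      · subst hs; simp [σ]
      · have : s.1 ≠ p.tgt := fun h => hs (Subtype.ext h)
        rw [Function.update_of_ne this]
        simp [σ, Function.update_of_ne hs]
    · rw [Function.extend_apply' _ _ _ hr, Function.update_of_ne]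
      rintro rfl
      exact hr ⟨⟨_, m3⟩, rfl⟩
  · refine Nat.pow_le_pow_right (by norm_num) (Nat.mul_le_mul_right _ ?_)
    rw [Fintype.card_coe]
    exact Finset.card_le_three

/-- Additions whose source registers are not changed by any of them can be read off from the
final values. -/
theorem qsynth_add (hq : 2 < q) (src : R → Prop) (ps : List (AddInstr R q))
    (h1 : ∀ p ∈ ps, src p.fst) (h2 : ∀ p ∈ ps, src p.snd) (h3 : ∀ p ∈ ps, ¬ src p.tgt) :
    QSynth (ps.length * 72 ^ (3 * Nat.clog 2 q)) (fun (F : (R → ZMod q) → ℂ) x =>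
      F (x - totalAdd ps x)) := by
  induction ps with
  | nil =>
    refine (QSynth.id.congr fun F => ?_).mono (Nat.zero_le _)
    funext x
    congr 1
    funext r
    simp [totalAdd]
  | cons p ps ih =>
    have hp1 := h1 p (by simp)
    have hp2 := h2 p (by simp)
    have hp3 := h3 p (by simp)
    have := (ih (fun p hp => h1 p (by simp [hp])) (fun p hp => h2 p (by simp [hp]))
      (fun p hp => h3 p (by simp [hp]))).comp
      (qsynth_add_single hq p (fun h => hp3 (h ▸ hp1)) (fun h => hp3 (h ▸ hp2)))
    refine (this.congr fun F => ?_).mono (le_of_eq ?_)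
    · funext x
      simp only
      congr 1
      have hsame : ∀ r, src r →
          Function.update x p.tgt (x p.tgt - p.g (x p.fst) (x p.snd)) r = x r :=
        fun r hr => Function.update_of_ne (show r ≠ p.tgt from fun h => hp3 (h ▸ hr)) _ _
      have ht : totalAdd ps (Function.update x p.tgt (x p.tgt - p.g (x p.fst) (x p.snd))) =
          totalAdd ps x := by
        funext r
        unfold totalAdd
        congr 1
        refine List.map_congr_left fun p' hp' => ?_
        rw [hsame _ (h1 p' (by simp [hp'])), hsame _ (h2 p' (by simp [hp']))]
      rw [ht]
      funext r
      simp only [Pi.sub_apply, totalAdd, List.map_cons, List.sum_cons]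
      by_cases hr : r = p.tgt
      · subst hr; simp [sub_sub]
      · rw [Function.update_of_ne hr, if_neg (Ne.symm hr), zero_add]
    · rw [List.length_cons]; ring

end Registers

/-! ### Reversible evaluation of Boolean networks -/

section Networks

variable {W : Type} [DecidableEq W] [Fintype W]

/-- The instruction that adds a Boolean function `f` of the wires in `src` to the wire `tgt`. -/
structure BoolInstr (W : Type) where
  src : Finset W
  tgt : W
  f : (W → Bool) → Bool
  nonempty : src.Nonempty
  notMem : tgt ∉ src
  loc : ∀ b b' : W → Bool, (∀ w ∈ src, b w = b' w) → f b = f b'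

/-- The permutation of the basis states performed by an instruction. -/
def BoolInstr.perm (p : BoolInstr W) : Equiv.Perm (W → Bool) :=
  Function.Involutive.toPerm (fun b => Function.update b p.tgt (xor (b p.tgt) (p.f b))) (by
    intro b
    have : p.f (Function.update b p.tgt (xor (b p.tgt) (p.f b))) = p.f b :=
      p.loc _ _ fun w hw => Function.update_of_ne
        (show w ≠ p.tgt from fun h => p.notMem (h ▸ hw)) _ _
    simp [this])

theorem BoolInstr.perm_apply (p : BoolInstr W) (b : W → Bool) :
    p.perm b = Function.update b p.tgt (xor (b p.tgt) (p.f b)) := rfl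

theorem BoolInstr.perm_perm (p : BoolInstr W) (b : W → Bool) : p.perm (p.perm b) = b :=
  Function.Involutive.toPerm_involutive _ b

theorem BoolInstr.f_perm (p : BoolInstr W) (b : W → Bool) : p.f (p.perm b) = p.f b :=
  p.loc _ _ fun w hw => Function.update_of_ne
    (show w ≠ p.tgt from fun h => p.notMem (h ▸ hw)) _ _

/-- An instruction depends on few qubits, so it is a permutation matrix on them. -/
theorem exists_gates_instr (p : BoolInstr W) :
    ∃ gs : List (Gate W), gs.length ≤ 72 ^ (p.src.card + 1) ∧
      ∀ ψ b, run gs ψ b = ψ (p.perm b) := by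
  set T : Finset W := insert p.tgt p.src with hT
  have mt : p.tgt ∈ T := Finset.mem_insert_self _ _
  have ms : ∀ w ∈ p.src, w ∈ T := fun w hw => Finset.mem_insert_of_mem hw
  obtain ⟨w₀, hw₀⟩ := p.nonempty
  have : Nontrivial T := ⟨⟨⟨p.tgt, mt⟩, ⟨w₀, ms _ hw₀⟩, fun h =>
    p.notMem (by rw [show p.tgt = w₀ from congrArg Subtype.val h]; exact hw₀)⟩⟩
  -- the function `f` read off from the wires in `T` alone
  let fT : (T → Bool) → Bool := fun c => p.f (Function.extend Subtype.val c fun _ => false)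
  have hfT : ∀ b : W → Bool, fT (b ∘ Subtype.val) = p.f b := fun b => by
    refine p.loc _ _ fun w hw => ?_
    exact Subtype.val_injective.extend_apply (b ∘ Subtype.val) (fun _ => false) ⟨w, ms w hw⟩
  have hfT' : ∀ (c : T → Bool) (x : Bool), fT (Function.update c ⟨p.tgt, mt⟩ x) = fT c := by
    intro c x
    refine p.loc _ _ fun w hw => ?_
    have hne : (⟨w, ms w hw⟩ : T) ≠ ⟨p.tgt, mt⟩ := fun h =>
      p.notMem (by rw [← show w = p.tgt from congrArg Subtype.val h]; exact hw)
    have h1 := Subtype.val_injective.extend_apply (Function.update c ⟨p.tgt, mt⟩ x)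
      (fun _ => false) ⟨w, ms w hw⟩
    have h2 := Subtype.val_injective.extend_apply c (fun _ => false) ⟨w, ms w hw⟩
    rw [Function.update_of_ne hne] at h1
    exact h1.trans h2.symm
  let σ : Equiv.Perm (T → Bool) := Function.Involutive.toPerm
    (fun c => Function.update c ⟨p.tgt, mt⟩ (xor (c ⟨p.tgt, mt⟩) (fT c)))
    (fun c => by simp [hfT'])
  obtain ⟨gs, hl, hgs⟩ := exists_gates_local (Subtype.val : T → W) Subtype.val_injective
    (permMatrix_mem_unitary σ)
  refine ⟨gs, ?_, fun ψ b => ?_⟩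
  · rw [Fintype.card_coe, hT, Finset.card_insert_of_notMem p.notMem] at hl
    exact hl
  · rw [hgs, Matrix.permMatrix_mulVec, Function.comp_apply, slice]
    congr 1
    show Function.extend Subtype.val (Function.update (b ∘ Subtype.val) ⟨p.tgt, mt⟩
      (xor (b p.tgt) (fT (b ∘ Subtype.val)))) b = _
    rw [extend_update Subtype.val_injective, extend_comp_self Subtype.val_injective, hfT]
    rfl

/-- A family of instructions with distinct targets, in which a target is only read by
instructions of higher rank, is evaluated by a permutation of the basis states. -/
theorem exists_gates_network {P : Type} [Fintype P] [DecidableEq P] (I : P → BoolInstr W)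
    (hinj : ∀ p p', (I p).tgt = (I p').tgt → p = p') (rank : P → ℕ)
    (hrank : ∀ p p', (I p').tgt ∈ (I p).src → rank p' < rank p) (L : ℕ)
    (hL : ∀ p, (I p).src.card ≤ L) :
    ∃ (gs : List (Gate W)) (π : Equiv.Perm (W → Bool)),
      gs.length ≤ Fintype.card P * 72 ^ (L + 1) ∧ (∀ ψ b, run gs ψ (π b) = ψ b) ∧
      (∀ b w, (∀ p, (I p).tgt ≠ w) → π b w = b w) ∧
      ∀ b p, π b (I p).tgt = xor (b (I p).tgt) ((I p).f (π b)) := by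
  have key : ∀ T : Finset P, ∃ (gs : List (Gate W)) (π : Equiv.Perm (W → Bool)),
      gs.length ≤ T.card * 72 ^ (L + 1) ∧ (∀ ψ b, run gs ψ (π b) = ψ b) ∧
      (∀ b w, (∀ p ∈ T, (I p).tgt ≠ w) → π b w = b w) ∧
      ∀ b, ∀ p ∈ T, π b (I p).tgt = xor (b (I p).tgt) ((I p).f (π b)) := by
    intro T
    refine Finset.induction_on_max_value rank T ⟨[], 1, by simp⟩ ?_
    · intro a T ha hmax ih
      obtain ⟨gs, π, hl, hrun, hfix, heq⟩ := ih
      obtain ⟨hs, hhl, hhs⟩ := exists_gates_instr (I a)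
      refine ⟨gs ++ hs, π.trans (I a).perm, ?_, fun ψ b => ?_, fun b w hw => ?_,
        fun b p hp => ?_⟩
      · rw [List.length_append, Finset.card_insert_of_notMem ha, add_mul, one_mul]
        exact Nat.add_le_add hl (hhl.trans (Nat.pow_le_pow_right (by norm_num)
          (Nat.add_le_add_right (hL a) 1)))
      · rw [run_append, hhs, Equiv.trans_apply, BoolInstr.perm_perm, hrun]
      · rw [Equiv.trans_apply, BoolInstr.perm_apply,
          Function.update_of_ne (hw a (Finset.mem_insert_self _ _)).symm]
        exact hfix b w fun p hp => hw p (Finset.mem_insert_of_mem hp)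
      · rw [Equiv.trans_apply]
        rcases Finset.mem_insert.1 hp with rfl | hpT
        · rw [BoolInstr.f_perm, BoolInstr.perm_apply, Function.update_self,
            hfix b _ fun p' hp' h => ha (by rw [← hinj _ _ h]; exact hp')]
        · have hne : (I p).tgt ≠ (I a).tgt := fun h => ha (hinj _ _ h ▸ hpT)
          have hf : (I p).f ((I a).perm (π b)) = (I p).f (π b) := by
            refine (I p).loc _ _ fun w hw => ?_
            rw [BoolInstr.perm_apply, Function.update_of_ne]
            rintro rfl
            exact absurd (hrank p a hw) (not_lt.2 (hmax p hpT))
          rw [hf, BoolInstr.perm_apply, Function.update_of_ne hne, heq b p hpT]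
  obtain ⟨gs, π, hl, hrun, hfix, heq⟩ := key Finset.univ
  exact ⟨gs, π, hl, hrun, fun b w hw => hfix b w fun p _ => hw p,
    fun b p => heq b p (Finset.mem_univ p)⟩

end Networks

/-! ### Circuits with an arbitrary set of ancillas -/

section OfGates

variable {I K O : Type} [Fintype I] [DecidableEq I] [Fintype K] [DecidableEq K] [Fintype O]

/-- A state of the input wires, with ancillas in state `|0⟩`. -/
def withZero (ψ : (I → Bool) → ℂ) : (I ⊕ K → Bool) → ℂ := fun b =>
  if ∀ k, b (Sum.inr k) = false then ψ (fun i => b (Sum.inl i)) else 0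

theorem Circuit.final_eq_run (C : Circuit I O) (ψ : (I → Bool) → ℂ) :
    C.final ψ = run C.gates (withZero ψ) := by
  have : C.init ψ = withZero ψ := by
    funext b
    simp only [Circuit.init, withZero]
    congr
  rw [← this]
  rfl

/-- The circuit with ancillas indexed by an arbitrary finite type. -/
def ofGates (gs : List (Gate (I ⊕ K))) (out : O → I ⊕ K) : Circuit I O where
  anc := Fintype.card K
  gates := gs.map (Gate.map (Sum.map id (Fintype.equivFin K))
    (Sum.map_injective.2 ⟨fun _ _ h => h, (Fintype.equivFin K).injective⟩))
  out := fun o => Sum.map id (Fintype.equivFin K) (out o)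

theorem size_ofGates (gs : List (Gate (I ⊕ K))) (out : O → I ⊕ K) :
    (ofGates gs out).size = gs.length := by
  simp [ofGates, Circuit.size]

theorem prob_ofGates (gs : List (Gate (I ⊕ K))) (out : O → I ⊕ K) (ψ : (I → Bool) → ℂ)
    (o : O → Bool) :
    (ofGates gs out).prob ψ o =
      ∑ b : I ⊕ K → Bool, if (fun j => b (out j)) = o then ‖run gs (withZero ψ) b‖ ^ 2 else 0 := by
  set e : I ⊕ K ≃ I ⊕ Fin (Fintype.card K) := Equiv.sumCongr (Equiv.refl I) (Fintype.equivFin K)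
  unfold Circuit.prob
  refine Fintype.sum_equiv (Equiv.arrowCongr e.symm (Equiv.refl Bool)) _ _ fun b => ?_
  have hb : Equiv.arrowCongr e.symm (Equiv.refl Bool) b = b ∘ e := by
    funext i; simp [Equiv.arrowCongr]
  rw [hb]
  have h1 : (fun j => b ((ofGates gs out).out j)) = fun j => (b ∘ e) (out j) := rfl
  rw [h1]
  congr 3
  have hf : (ofGates gs out).final ψ b =
      run (gs.map (Gate.map e e.injective)) (withZero ψ) b :=
    congrFun (Circuit.final_eq_run (ofGates gs out) ψ) b
  rw [hf, run_map]
  congr 1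
  funext c
  have hc : Function.extend e c b = c ∘ e.symm := by
    funext w
    obtain ⟨v, rfl⟩ := e.surjective w
    simp [e.injective.extend_apply]
  rw [slice, hc]
  simp only [withZero]
  have hk : (∀ k, (c ∘ e.symm) (Sum.inr k) = false) ↔ ∀ k, c (Sum.inr k) = false := by
    constructor
    · intro h k
      have := h (Fintype.equivFin K k)
      simpa [e] using this
    · intro h k
      simpa [e] using h ((Fintype.equivFin K).symm k)
  simp only [hk]
  rfl

end OfGates

section Basic

variable {I O : Type} [Fintype I] [DecidableEq I] [Fintype O]

theorem sum_norm_withZero {K : Type} [Fintype K] [DecidableEq K] (ψ : (I → Bool) → ℂ) :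
    ∑ b : I ⊕ K → Bool, ‖withZero ψ b‖ ^ 2 = ∑ x, ‖ψ x‖ ^ 2 := by
  rw [← (Equiv.sumArrowEquivProdArrow I K Bool).symm.sum_comp, Fintype.sum_prod_type]
  refine Finset.sum_congr rfl fun x _ => ?_
  rw [Finset.sum_eq_single (fun _ => false)]
  · simp [withZero, Equiv.sumArrowEquivProdArrow]
  · intro z _ hz
    have : ¬ ∀ k, z k = false := fun h => hz (funext h)
    simp [withZero, Equiv.sumArrowEquivProdArrow, this]
  · simp

theorem Circuit.prob_nonneg (C : Circuit I O) (ψ : (I → Bool) → ℂ) (o : O → Bool) :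
    0 ≤ C.prob ψ o :=
  Finset.sum_nonneg fun b _ => by split_ifs <;> positivity

theorem Circuit.sum_norm_final (C : Circuit I O) (ψ : (I → Bool) → ℂ) :
    ∑ b, ‖C.final ψ b‖ ^ 2 = ∑ x, ‖ψ x‖ ^ 2 := by
  rw [Circuit.final_eq_run, norm_run, sum_norm_withZero]

theorem Circuit.prob_le (C : Circuit I O) (ψ : (I → Bool) → ℂ) (o : O → Bool) :
    C.prob ψ o ≤ ∑ x, ‖ψ x‖ ^ 2 := by
  rw [← Circuit.sum_norm_final C ψ]
  refine Finset.sum_le_sum fun b _ => ?_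
  split_ifs
  · exact le_rfl
  · positivity

end Basic

/-! ### Selecting among the outputs of several circuits -/

section Combine

variable {I O : Type} [Fintype I] [DecidableEq I] [Fintype O] [DecidableEq O]

/-- The computational basis state `x`. -/
def basisState {X : Type} [DecidableEq X] [Fintype X] (x : X → Bool) : (X → Bool) → ℂ :=
  fun w => if w = x then 1 else 0

/-- A Boolean network that decides a relation between an input and an output. -/
structure Checker (I O : Type) where
  P : Type
  fin : Fintype P
  dec : DecidableEq P
  src : P → Finset ((I ⊕ O) ⊕ P)
  f : P → ((I ⊕ O) ⊕ P → Bool) → Bool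
  nonempty : ∀ p, (src p).Nonempty
  loc : ∀ p (b b' : (I ⊕ O) ⊕ P → Bool), (∀ w ∈ src p, b w = b' w) → f p b = f p b'
  rank : P → ℕ
  rank_lt : ∀ p p', Sum.inr p' ∈ src p → rank p' < rank p
  flag : P

/-- The checker accepts exactly the pairs in the relation `χ`. -/
def Checker.Decides (N : Checker I O) (χ : (I → Bool) → (O → Bool) → Prop) : Prop :=
  ∀ v : (I ⊕ O) ⊕ N.P → Bool, (∀ p, v (Sum.inr p) = N.f p v) →
    (v (Sum.inr N.flag) = true ↔
      χ (fun i => v (Sum.inl (Sum.inl i))) (fun o => v (Sum.inl (Sum.inr o))))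

/-- Wires for two circuits with `a₁` and `a₂` ancillas, with a checker and an output register. -/
abbrev CombWires (I O : Type) (a₁ a₂ : ℕ) (P : Type) : Type :=
  I ⊕ ((I ⊕ Fin a₁) ⊕ ((I ⊕ Fin a₂) ⊕ (P ⊕ O)))

/-- Two circuits are run on copies of the same classical input; the output of the second one is
selected if the checker accepts it, and that of the first one otherwise. -/
theorem exists_combine (N : Checker I O) {χ : (I → Bool) → (O → Bool) → Prop}
    (hN : N.Decides χ) (L : ℕ) (hL3 : 3 ≤ L) (hL : ∀ p, (N.src p).card ≤ L)
    (C₁ C₂ : Circuit I O) :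
    ∃ C : Circuit I O,
      C.size ≤ C₁.size + C₂.size +
        (2 * Fintype.card I + (@Fintype.card N.P N.fin + Fintype.card O)) * 72 ^ (L + 1) ∧
      ∀ (x : I → Bool) (s : O → Bool), χ x s → (∀ s', χ x s' → s' = s) →
        C₁.prob (basisState x) s ≤ C.prob (basisState x) s ∧
        C₂.prob (basisState x) s ≤ C.prob (basisState x) s := by
  obtain ⟨P, finP, decP, src, f, hne, hloc, rank, hrank, flag⟩ := N
  simp only [Checker.Decides] at hN hL ⊢
  let e₁ : I ⊕ Fin C₁.anc → (CombWires I O C₁.anc C₂.anc P) := fun w => Sum.inr (Sum.inl w)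
  let e₂ : I ⊕ Fin C₂.anc → (CombWires I O C₁.anc C₂.anc P) := fun w => Sum.inr (Sum.inr (Sum.inl w))
  let eP : P → (CombWires I O C₁.anc C₂.anc P) := fun p => Sum.inr (Sum.inr (Sum.inr (Sum.inl p)))
  let eO : O → (CombWires I O C₁.anc C₂.anc P) := fun o => Sum.inr (Sum.inr (Sum.inr (Sum.inr o)))
  have he₁ : Function.Injective e₁ := fun a b h => by simpa [e₁] using h
  have he₂ : Function.Injective e₂ := fun a b h => by simpa [e₂] using h
  -- copies of the input
  let IC : I ⊕ I → BoolInstr (CombWires I O C₁.anc C₂.anc P) := fun i => Sum.elim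
    (fun i => ⟨{Sum.inl i}, e₁ (Sum.inl i), fun b => b (Sum.inl i), by simp, by simp [e₁],
      fun b b' h => h _ (by simp)⟩)
    (fun i => ⟨{Sum.inl i}, e₂ (Sum.inl i), fun b => b (Sum.inl i), by simp, by simp [e₂],
      fun b b' h => h _ (by simp)⟩) i
  obtain ⟨gc, πc, hgcl, hgc, hπc, hπc'⟩ := exists_gates_network IC
    (by rintro (i | i) (j | j) h <;> simp [IC, e₁, e₂] at h <;> simp [h])
    (fun _ => 0) (by rintro (i | i) (j | j) h <;> simp [IC, e₁, e₂] at h) L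
    (by rintro (i | i) <;> simp [IC] <;> omega)
  -- the checker on the input and the output of `C₂`, and the selection
  let m : (I ⊕ O) ⊕ P → (CombWires I O C₁.anc C₂.anc P) := Sum.elim (Sum.elim Sum.inl fun o => e₂ (C₂.out o)) eP
  let IP : P ⊕ O → BoolInstr (CombWires I O C₁.anc C₂.anc P) := fun p => Sum.elim
    (fun p => ⟨(src p).image m, eP p, fun b => f p (b ∘ m), (hne p).image m, by
        rw [Finset.mem_image]
        rintro ⟨(i | o) | p', hw, h⟩
        · simp [m, eP] at h
        · simp [m, eP, e₂] at h
        · have : p' = p := by simpa [m, eP] using h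
          subst this
          exact lt_irrefl _ (hrank p' p' hw),
      fun b b' h => hloc p _ _ fun w hw => h _ (Finset.mem_image_of_mem m hw)⟩)
    (fun o => ⟨{e₁ (C₁.out o), e₂ (C₂.out o), eP flag}, eO o,
      fun b => if b (eP flag) then b (e₂ (C₂.out o)) else b (e₁ (C₁.out o)), by simp,
      by simp [e₁, e₂, eP, eO], fun b b' h => by
        rw [h (eP flag) (by simp), h (e₁ (C₁.out o)) (by simp), h (e₂ (C₂.out o)) (by simp)]⟩) p
  obtain ⟨gp, πp, hgpl, hgp, hπp, hπp'⟩ := exists_gates_network IP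
    (by rintro (i | i) (j | j) h <;> simp [IP, eP, eO] at h <;> simp [h])
    (Sum.elim rank fun _ => (Finset.univ.sup rank) + 1)
    (by
      rintro (p | o) (p' | o') h
      · simp only [IP, Sum.elim_inl, Finset.mem_image] at h
        obtain ⟨(i | o) | p'', hw, h⟩ := h
        · simp [m, eP] at h
        · simp [m, eP, e₂] at h
        · have : p'' = p' := by simpa [m, eP] using h
          subst this
          exact hrank _ _ hw
      · simp only [IP, Sum.elim_inl, Sum.elim_inr, Finset.mem_image] at h
        obtain ⟨(i | o) | p'', hw, h⟩ := h
        · simp [m, eO] at h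
        · simp [m, eO, e₂] at h
        · simp [m, eP, eO] at h
      · exact Nat.lt_succ_of_le (Finset.le_sup (f := rank) (Finset.mem_univ p'))
      · simp [IP, e₁, e₂, eP, eO] at h) L
    (by
      rintro (p | o)
      · exact Finset.card_image_le.trans (hL p)
      · exact Finset.card_le_three.trans hL3)
  let gs : List (Gate (CombWires I O C₁.anc C₂.anc P)) := ((gc ++ C₁.gates.map (Gate.map e₁ he₁)) ++
    C₂.gates.map (Gate.map e₂ he₂)) ++ gp
  refine ⟨ofGates gs eO, ?_, fun x s hxs huniq => ?_⟩
  · rw [size_ofGates]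
    simp only [gs, List.length_append, List.length_map, Circuit.size]
    simp only [Fintype.card_sum] at hgcl hgpl
    have : (2 * Fintype.card I + (Fintype.card P + Fintype.card O)) * 72 ^ (L + 1) =
      (Fintype.card I + Fintype.card I) * 72 ^ (L + 1) +
      (Fintype.card P + Fintype.card O) * 72 ^ (L + 1) := by ring
    omega
  let emb : (I ⊕ Fin C₁.anc → Bool) → (I ⊕ Fin C₂.anc → Bool) → ((CombWires I O C₁.anc C₂.anc P) → Bool) := fun b₁ b₂ =>
    Sum.elim x (Sum.elim b₁ (Sum.elim b₂ fun _ => false))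
  have hext₁ : ∀ b₁ b₂ d, Function.extend e₁ d (emb b₁ b₂) = emb d b₂ := by
    intro b₁ b₂ d
    funext w
    rcases w with i | w | w
    · rw [Function.extend_apply' _ _ _ (by simp [e₁])]; rfl
    · exact he₁.extend_apply d _ w
    · rw [Function.extend_apply' _ _ _ (by simp [e₁])]; rfl
  have hext₂ : ∀ b₁ b₂ d, Function.extend e₂ d (emb b₁ b₂) = emb b₁ d := by
    intro b₁ b₂ d
    funext w
    rcases w with i | w | w | w
    · rw [Function.extend_apply' _ _ _ (by simp [e₂])]; rfl
    · rw [Function.extend_apply' _ _ _ (by simp [e₂])]; rfl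
    · exact he₂.extend_apply d _ w
    · rw [Function.extend_apply' _ _ _ (by simp [e₂])]; rfl
  have hembinj : ∀ b₁ b₂ d₁ d₂, emb b₁ b₂ = emb d₁ d₂ → b₁ = d₁ ∧ b₂ = d₂ := by
    intro b₁ b₂ d₁ d₂ h
    exact ⟨funext fun w => congrFun h (e₁ w), funext fun w => congrFun h (e₂ w)⟩
  let x₁ : I ⊕ Fin C₁.anc → Bool := Sum.elim x fun _ => false
  let x₂ : I ⊕ Fin C₂.anc → Bool := Sum.elim x fun _ => false
  have hzero : ∀ {K : Type} [Fintype K] [DecidableEq K],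
      withZero (K := K) (basisState x) = basisState (Sum.elim x fun _ => false) := by
    intro K _ _
    funext b
    simp only [withZero, basisState]
    by_cases h : b = Sum.elim x fun _ => false
    · subst h; simp
    · rw [if_neg h]
      split_ifs with h1 h2
      · exact absurd (funext fun w => by rcases w with i | k; exacts [congrFun h2 i, h1 k]) h
      · rfl
      · rfl
  -- the state after copying the input
  have hπx : πc (Sum.elim x fun _ => false) = emb x₁ x₂ := by
    have hI : ∀ i, πc (Sum.elim x fun _ => false) (Sum.inl i) = x i := fun i =>
      hπc _ _ (by rintro (j | j) <;> simp [IC, e₁, e₂])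
    funext w
    rcases w with i | (i | k) | (i | k) | w
    · exact hI i
    · have := hπc' (Sum.elim x fun _ => false) (Sum.inl i)
      simpa [IC, e₁, hI, emb, x₁] using this
    · exact hπc _ _ (by rintro (j | j) <;> simp [IC, e₁, e₂])
    · have := hπc' (Sum.elim x fun _ => false) (Sum.inr i)
      simpa [IC, e₂, hI, emb, x₂] using this
    · exact hπc _ _ (by rintro (j | j) <;> simp [IC, e₁, e₂])
    · exact hπc _ _ (by rintro (j | j) <;> simp [IC, e₁, e₂])
  have hψ₁ : run gc (withZero (basisState x)) = basisState (emb x₁ x₂) := by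
    funext b
    obtain ⟨b, rfl⟩ := πc.surjective b
    rw [hgc, hzero, ← hπx]
    simp [basisState]
  set f₁ := C₁.final (basisState x) with hf₁
  set f₂ := C₂.final (basisState x) with hf₂
  have hψ₂ : ∀ b₁ b₂, run (C₁.gates.map (Gate.map e₁ he₁)) (basisState (emb x₁ x₂))
      (emb b₁ b₂) = (if b₂ = x₂ then 1 else 0) * f₁ b₁ := by
    intro b₁ b₂
    rw [run_map]
    have : slice e₁ (emb b₁ b₂) (basisState (emb x₁ x₂)) =
        (if b₂ = x₂ then (1 : ℂ) else 0) • basisState x₁ := by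
      funext d
      rw [slice, hext₁]
      simp only [basisState, Pi.smul_apply, smul_eq_mul]
      by_cases h : d = x₁ ∧ b₂ = x₂
      · obtain ⟨rfl, rfl⟩ := h; simp
      · rw [if_neg fun h' => h (hembinj _ _ _ _ h')]
        by_cases hd : d = x₁
        · have hb : b₂ ≠ x₂ := fun hb => h ⟨hd, hb⟩
          rw [if_neg hb, zero_mul]
        · rw [if_neg hd, mul_zero]
    rw [this, run_smul, hf₁, Circuit.final_eq_run, hzero]
    rfl
  have hψ₃ : ∀ b₁ b₂, run (C₂.gates.map (Gate.map e₂ he₂))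
      (run (C₁.gates.map (Gate.map e₁ he₁)) (basisState (emb x₁ x₂))) (emb b₁ b₂) =
      f₁ b₁ * f₂ b₂ := by
    intro b₁ b₂
    rw [run_map]
    have : slice e₂ (emb b₁ b₂)
        (run (C₁.gates.map (Gate.map e₁ he₁)) (basisState (emb x₁ x₂))) =
        f₁ b₁ • basisState x₂ := by
      funext d
      rw [slice, hext₂, hψ₂]
      simp [basisState, mul_comm]
    rw [this, run_smul, hf₂, Circuit.final_eq_run, hzero]
    rfl
  -- the selected output
  have hout : ∀ b₁ b₂, (fun o => f₁ b₁ * f₂ b₂) = (fun o : O => f₁ b₁ * f₂ b₂) ∧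
      ((fun o => b₂ (C₂.out o)) = s ∨ (fun o => b₁ (C₁.out o)) = s →
        (fun o => πp (emb b₁ b₂) (eO o)) = s) := by
    intro b₁ b₂
    refine ⟨rfl, fun hs => ?_⟩
    set v := πp (emb b₁ b₂) with hv
    have hvI : ∀ i, v (Sum.inl i) = x i := fun i =>
      hπp _ _ (by rintro (p | o) <;> simp [IP, eP, eO])
    have hv₁ : ∀ w, v (e₁ w) = b₁ w := fun w =>
      hπp _ _ (by rintro (p | o) <;> simp [IP, eP, eO, e₁])
    have hv₂ : ∀ w, v (e₂ w) = b₂ w := fun w =>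
      hπp _ _ (by rintro (p | o) <;> simp [IP, eP, eO, e₂])
    have hflag : v (eP flag) = true ↔ χ x fun o => b₂ (C₂.out o) := by
      have := hN (v ∘ m) fun p => by
        have := hπp' (emb b₁ b₂) (Sum.inl p)
        have h0 : emb b₁ b₂ (eP p) = false := rfl
        simp only [IP, Sum.elim_inl] at this
        rw [h0, Bool.false_xor] at this
        exact this
      simpa [m, hvI, hv₂] using this
    have hO : ∀ o, v (eO o) = if v (eP flag) then b₂ (C₂.out o) else b₁ (C₁.out o) := by
      intro o
      have := hπp' (emb b₁ b₂) (Sum.inr o)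
      have h0 : emb b₁ b₂ (eO o) = false := rfl
      simp only [IP, Sum.elim_inr] at this
      rw [h0, Bool.false_xor, ← hv, hv₁, hv₂] at this
      exact this
    by_cases hfl : v (eP flag) = true
    · rw [← huniq _ (hflag.1 hfl)]
      funext o
      rw [hO, if_pos hfl]
    · have h1 : (fun o => b₁ (C₁.out o)) = s := by
        rcases hs with hs | hs
        · exact absurd (hflag.2 (hs ▸ hxs)) hfl
        · exact hs
      rw [← h1]
      funext o
      rw [hO, if_neg hfl]
  have hprob : ∑ b₁, ∑ b₂, (if (fun o => b₂ (C₂.out o)) = s ∨ (fun o => b₁ (C₁.out o)) = s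
      then ‖f₁ b₁‖ ^ 2 * ‖f₂ b₂‖ ^ 2 else 0) ≤ (ofGates gs eO).prob (basisState x) s := by
    rw [prob_ofGates, ← Equiv.sum_comp πp]
    have hrun : ∀ b, run gs (withZero (basisState x)) (πp b) =
        run (C₂.gates.map (Gate.map e₂ he₂))
          (run (C₁.gates.map (Gate.map e₁ he₁)) (basisState (emb x₁ x₂))) b := by
      intro b
      simp only [gs, run_append]
      rw [hgp, hψ₁]
    simp only [hrun]
    rw [← Fintype.sum_prod_type']
    let E : (I ⊕ Fin C₁.anc → Bool) × (I ⊕ Fin C₂.anc → Bool) ↪ ((CombWires I O C₁.anc C₂.anc P) → Bool) :=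
      ⟨fun p => emb p.1 p.2, fun p p' h => Prod.ext (hembinj _ _ _ _ h).1 (hembinj _ _ _ _ h).2⟩
    refine le_trans ?_ (Finset.sum_le_sum_of_subset_of_nonneg
      (Finset.subset_univ (Finset.univ.map E)) fun b _ _ => by split_ifs <;> positivity)
    rw [Finset.sum_map]
    refine Finset.sum_le_sum fun p _ => ?_
    split_ifs with h1 h2 h2
    · show _ ≤ ‖run _ _ (emb p.1 p.2)‖ ^ 2
      rw [hψ₃, norm_mul, mul_pow]
    · exact absurd ((hout p.1 p.2).2 h1) h2
    · positivity
    · exact le_rfl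
  have hnorm : ∑ y, ‖basisState x y‖ ^ 2 = 1 := by
    simp [basisState, apply_ite]
  have hn₁ : ∑ b, ‖f₁ b‖ ^ 2 = 1 := by rw [hf₁, Circuit.sum_norm_final, hnorm]
  have hn₂ : ∑ b, ‖f₂ b‖ ^ 2 = 1 := by rw [hf₂, Circuit.sum_norm_final, hnorm]
  constructor
  · refine le_trans ?_ hprob
    have : C₁.prob (basisState x) s = ∑ b₁, ∑ b₂, (if (fun o => b₁ (C₁.out o)) = s
        then ‖f₁ b₁‖ ^ 2 * ‖f₂ b₂‖ ^ 2 else 0) := by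
      refine Finset.sum_congr rfl fun b _ => ?_
      split_ifs
      · rw [← Finset.mul_sum, hn₂, mul_one]
      · simp
    rw [this]
    refine Finset.sum_le_sum fun b₁ _ => Finset.sum_le_sum fun b₂ _ => ?_
    split_ifs with h1 h2 h2
    · exact le_rfl
    · exact absurd (Or.inr h1) h2
    · positivity
    · exact le_rfl
  · refine le_trans ?_ hprob
    have : C₂.prob (basisState x) s = ∑ b₁, ∑ b₂, (if (fun o => b₂ (C₂.out o)) = s
        then ‖f₁ b₁‖ ^ 2 * ‖f₂ b₂‖ ^ 2 else 0) := by
      rw [Finset.sum_comm]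
      refine Finset.sum_congr rfl fun b _ => ?_
      split_ifs
      · rw [← Finset.sum_mul, hn₁, one_mul]
      · simp
    rw [this]
    refine Finset.sum_le_sum fun b₁ _ => Finset.sum_le_sum fun b₂ _ => ?_
    split_ifs with h1 h2 h2
    · exact le_rfl
    · exact absurd (Or.inl h1) h2
    · positivity
    · exact le_rfl

/-- The outputs of several circuits are combined into one: if the checker accepts exactly one
output on a given input, this output is found at least as often as by each single circuit. -/
theorem exists_combine_family (N : Checker I O) {χ : (I → Bool) → (O → Bool) → Prop}
    (hN : N.Decides χ) (L : ℕ) (hL3 : 3 ≤ L) (hL : ∀ p, (N.src p).card ≤ L) (B : ℕ) (M : ℕ)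
    (C : ℕ → Circuit I O) (hB : ∀ t ≤ M, (C t).size ≤ B) :
    ∃ R : Circuit I O,
      R.size ≤ (M + 1) * (B +
        (2 * Fintype.card I + (@Fintype.card N.P N.fin + Fintype.card O)) * 72 ^ (L + 1)) ∧
      ∀ (x : I → Bool) (s : O → Bool), χ x s → (∀ s', χ x s' → s' = s) →
        ∀ t ≤ M, (C t).prob (basisState x) s ≤ R.prob (basisState x) s := by
  induction M with
  | zero =>
    refine ⟨C 0, ?_, fun x s _ _ t ht => ?_⟩
    · have := hB 0 le_rfl
      omega
    · obtain rfl : t = 0 := by omega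
      exact le_rfl
  | succ M ih =>
    obtain ⟨R, hR, hprob⟩ := ih fun t ht => hB t (by omega)
    obtain ⟨R', hR', hprob'⟩ := exists_combine N hN L hL3 hL R (C (M + 1))
    refine ⟨R', ?_, fun x s hxs hu t ht => ?_⟩
    · have h1 := hB (M + 1) le_rfl
      rw [add_mul _ 1, one_mul]
      omega
    · rcases Nat.lt_or_ge t (M + 1) with h | h
      · exact (hprob x s hxs hu t (by omega)).trans (hprob' x s hxs hu).1
      · obtain rfl : t = M + 1 := by omega
        exact (hprob' x s hxs hu).2

end Combine

/-! ### Verifying a candidate secret -/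

section Check

variable {n m q : ℕ} [NeZero q]

/-- The residue encoded by the bits of a register; arbitrary for bit strings that encode none. -/
def dec (w : ZReg q → Bool) : ZMod q := Function.invFun enc w

theorem dec_enc (x : ZMod q) : dec (enc x) = x := Function.leftInverse_invFun enc_injective x

/-- The relation between an LWE input and a candidate output that the candidate is the encoding
of a vector `s` for which all entries of `b - Aᵀ s` satisfy `good`. -/
def Accepts (good : ZMod q → Prop) (x : LWEWires n m q → Bool) (c : Fin n × ZReg q → Bool) :
    Prop :=
  (∀ i, enc (dec fun k => c (i, k)) = fun k => c (i, k)) ∧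
    ∀ j, good (dec (fun k => x (Sum.inr (j, k))) -
      ∑ i, dec (fun k => x (Sum.inl ((i, j), k))) * dec (fun k => c (i, k)))

theorem accepts_iff (good : ZMod q → Prop) (A : Matrix (Fin n) (Fin m) (ZMod q))
    (b : Fin m → ZMod q) (c : Fin n × ZReg q → Bool) :
    Accepts good (Sum.elim (encMat A) (encVec b)) c ↔
      ∃ s : Fin n → ZMod q, c = encVec s ∧ ∀ j, good ((b - A.transpose.mulVec s) j) := by
  have key : ∀ s : Fin n → ZMod q, (∀ j, good (dec (fun k => Sum.elim (encMat A) (encVec b)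
      (Sum.inr (j, k))) - ∑ i, dec (fun k => Sum.elim (encMat A) (encVec b)
      (Sum.inl ((i, j), k))) * dec (fun k => (encVec s : Fin n × ZReg q → Bool) (i, k)))) ↔
      ∀ j, good ((b - A.transpose.mulVec s) j) := by
    intro s
    refine forall_congr' fun j => ?_
    have h1 : dec (fun k => Sum.elim (encMat A) (encVec b) (Sum.inr (j, k))) = b j :=
      dec_enc (b j)
    have h2 : ∀ i, dec (fun k => Sum.elim (encMat A) (encVec b) (Sum.inl ((i, j), k))) = A i j :=
      fun i => dec_enc (A i j)
    have h3 : ∀ i, dec (fun k => (encVec s : Fin n × ZReg q → Bool) (i, k)) = s i :=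
      fun i => dec_enc (s i)
    simp only [h1, h2, h3]
    rfl
  constructor
  · rintro ⟨h1, h2⟩
    refine ⟨fun i => dec fun k => c (i, k), ?_, ?_⟩
    · funext ⟨i, k⟩
      exact (congrFun (h1 i) k).symm
    · have hc : c = encVec fun i => dec fun k => c (i, k) := by
        funext ⟨i, k⟩
        exact (congrFun (h1 i) k).symm
      refine (key _).1 ?_
      rw [← hc]
      exact h2
  · rintro ⟨s, rfl, hs⟩
    exact ⟨fun i => congrArg enc (dec_enc (s i)), (key s).2 hs⟩

/-- The wires of the network that verifies a candidate: the partial sums of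
`b_j - ∑ i, A_ij s_i`, and two chains of conjunctions. -/
abbrev CheckWires (n m q : ℕ) : Type := (Fin m × Fin (n + 1) × ZReg q) ⊕ (Fin (n + 1) ⊕ Fin (m + 1))

/-- All wires that the verification network works with. -/
abbrev CheckAll (n m q : ℕ) : Type :=
  (LWEWires n m q ⊕ (Fin n × ZReg q)) ⊕ CheckWires n m q

/-- The wires that hold the partial sum `b_j - ∑_{i' < i} A_i'j s_i'`. -/
def accW (j : Fin m) (i : Fin (n + 1)) (k : ZReg q) : CheckAll n m q := Sum.inr (Sum.inl (j, i, k))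

/-- The wires that hold `A_ij`. -/
def matW (i : Fin n) (j : Fin m) (k : ZReg q) : CheckAll n m q :=
  Sum.inl (Sum.inl (Sum.inl ((i, j), k)))

/-- The wires that hold `b_j`. -/
def vecW (j : Fin m) (k : ZReg q) : CheckAll n m q := Sum.inl (Sum.inl (Sum.inr (j, k)))

/-- The wires that hold the `i`-th entry of the candidate. -/
def candW (i : Fin n) (k : ZReg q) : CheckAll n m q := Sum.inl (Sum.inr (i, k))

/-- The wires that hold the conjunctions of the validity of the first entries of the candidate. -/
def validW (i : Fin (n + 1)) : CheckAll n m q := Sum.inr (Sum.inr (Sum.inl i))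

/-- The wires that hold the conjunctions over the first entries of `b - Aᵀ s`. -/
def goodW (j : Fin (m + 1)) : CheckAll n m q := Sum.inr (Sum.inr (Sum.inr j))

open Classical in
/-- The instructions of the verification network: the source wires and the function computed. -/
def checkInstr (good : ZMod q → Prop) (w₀ : CheckAll n m q) :
    CheckWires n m q → Finset (CheckAll n m q) × ((CheckAll n m q → Bool) → Bool)
  | Sum.inl (j, i, k) => Fin.cases (motive := fun _ => _)
      ({vecW j k}, fun v => v (vecW j k))
      (fun i' => (Finset.univ.image (accW j i'.castSucc) ∪ (Finset.univ.image (matW i' j) ∪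
          Finset.univ.image (candW i')),
        fun v => enc (dec (v ∘ accW j i'.castSucc) - dec (v ∘ matW i' j) * dec (v ∘ candW i')) k)) i
  | Sum.inr (Sum.inl i) => Fin.cases (motive := fun _ => _)
      ({w₀}, fun _ => true)
      (fun i' => (insert (validW i'.castSucc) (Finset.univ.image (candW i')),
        fun v => v (validW i'.castSucc) && decide (enc (dec (v ∘ candW i')) = v ∘ candW i'))) i
  | Sum.inr (Sum.inr j) => Fin.cases (motive := fun _ => _)
      ({validW (Fin.last n)}, fun v => v (validW (Fin.last n)))
      (fun j' => (insert (goodW j'.castSucc) (Finset.univ.image (accW j' (Fin.last n))),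
        fun v => v (goodW j'.castSucc) && decide (good (dec (v ∘ accW j' (Fin.last n)))))) j

/-- The order in which the verification network is evaluated. -/
def checkRank : CheckWires n m q → ℕ
  | Sum.inl (_, i, _) => i
  | Sum.inr (Sum.inl i) => i
  | Sum.inr (Sum.inr j) => n + 1 + j

open Classical in
/-- The network that verifies a candidate secret. -/
def lweChecker (good : ZMod q → Prop) (w₀ : LWEWires n m q) :
    Checker (LWEWires n m q) (Fin n × ZReg q) where
  P := CheckWires n m q
  fin := inferInstance
  dec := inferInstance
  src p := (checkInstr good (Sum.inl (Sum.inl w₀)) p).1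
  f p := (checkInstr good (Sum.inl (Sum.inl w₀)) p).2
  nonempty p := by
    rcases p with ⟨j, i, k⟩ | i | j
    · refine Fin.cases ?_ (fun i' => ?_) i
      · exact Finset.singleton_nonempty _
      · exact ⟨accW j i'.castSucc k, Finset.mem_union_left _ (Finset.mem_image_of_mem _
          (Finset.mem_univ k))⟩
    · refine Fin.cases ?_ (fun i' => ?_) i
      · exact Finset.singleton_nonempty _
      · exact Finset.insert_nonempty _ _
    · refine Fin.cases ?_ (fun j' => ?_) j
      · exact Finset.singleton_nonempty _
      · exact Finset.insert_nonempty _ _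
  loc p b b' := by
    have hcomp : ∀ (g : ZReg q → CheckAll n m q), (∀ k, b (g k) = b' (g k)) → b ∘ g = b' ∘ g :=
      fun g h => funext h
    rcases p with ⟨j, i, k⟩ | i | j
    · refine Fin.cases (fun h => ?_) (fun i' h => ?_) i
      · exact h _ (Finset.mem_singleton_self _)
      · simp only [checkInstr, Fin.cases_succ] at h ⊢
        rw [hcomp (accW j i'.castSucc) fun k => h _ (by simp),
          hcomp (matW i' j) fun k => h _ (by simp), hcomp (candW i') fun k => h _ (by simp)]
    · refine Fin.cases (fun h => rfl) (fun i' h => ?_) i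
      simp only [checkInstr, Fin.cases_succ] at h ⊢
      rw [hcomp (candW i') fun k => h _ (by simp), h (validW i'.castSucc) (by simp)]
    · refine Fin.cases (fun h => ?_) (fun j' h => ?_) j
      · exact h _ (Finset.mem_singleton_self _)
      · simp only [checkInstr, Fin.cases_succ] at h ⊢
        rw [hcomp (accW j' (Fin.last n)) fun k => h _ (by simp), h (goodW j'.castSucc) (by simp)]
  rank := checkRank
  rank_lt p p' := by
    rcases p with ⟨j, i, k⟩ | i | j
    · refine Fin.cases (fun h => ?_) (fun i' h => ?_) i
      · simp [checkInstr, vecW] at h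
      · simp only [checkInstr, Fin.cases_succ, Finset.mem_union, Finset.mem_image, accW, matW,
          candW, Finset.mem_univ, true_and, reduceCtorEq, exists_false, or_false,
          Sum.inr.injEq] at h
        obtain ⟨k', rfl⟩ := h
        simp [checkRank]
    · refine Fin.cases (fun h => ?_) (fun i' h => ?_) i
      · simp [checkInstr] at h
      · simp only [checkInstr, Fin.cases_succ, Finset.mem_insert, Finset.mem_image, validW,
          candW, Finset.mem_univ, true_and, reduceCtorEq, exists_false, or_false,
          Sum.inr.injEq] at h
        subst h
        simp [checkRank]
    · refine Fin.cases (fun h => ?_) (fun j' h => ?_) j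
      · simp only [checkInstr, Fin.cases_zero, Finset.mem_singleton, validW,
          Sum.inr.injEq] at h
        subst h
        simp [checkRank]
      · simp only [checkInstr, Fin.cases_succ, Finset.mem_insert, Finset.mem_image, goodW,
          accW, Finset.mem_univ, true_and, Sum.inr.injEq] at h
        rcases h with rfl | ⟨k', rfl⟩
        · simp [checkRank]
        · simp [checkRank]; omega
  flag := Sum.inr (Sum.inr (Fin.last m))

theorem lweChecker_src_card (good : ZMod q → Prop) (w₀ : LWEWires n m q)
    (p : CheckWires n m q) :
    ((lweChecker good w₀).src p).card ≤ 3 * Nat.clog 2 q + 1 := by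
  have him : ∀ g : ZReg q → CheckAll n m q, (Finset.univ.image g).card ≤ Nat.clog 2 q :=
    fun g => Finset.card_image_le.trans (by simp)
  simp only [lweChecker]
  rcases p with ⟨j, i, k⟩ | i | j
  · refine Fin.cases ?_ (fun i' => ?_) i
    · simp [checkInstr]
    · simp only [checkInstr, Fin.cases_succ]
      have h1 := Finset.card_union_le (Finset.univ.image (accW (q := q) j i'.castSucc))
        (Finset.univ.image (matW i' j) ∪ Finset.univ.image (candW i'))
      have h2 := Finset.card_union_le (Finset.univ.image (matW (q := q) i' j))
        (Finset.univ.image (candW i'))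
      have h3 := him (accW j i'.castSucc)
      have h4 := him (matW i' j)
      have h5 := him (candW i')
      omega
  · refine Fin.cases ?_ (fun i' => ?_) i
    · simp [checkInstr]
    · simp only [checkInstr, Fin.cases_succ]
      have h1 := Finset.card_insert_le (validW i'.castSucc)
        (Finset.univ.image (candW (m := m) (q := q) i'))
      have h5 := him (candW i')
      omega
  · refine Fin.cases ?_ (fun j' => ?_) j
    · simp [checkInstr]
    · simp only [checkInstr, Fin.cases_succ]
      have h1 := Finset.card_insert_le (goodW j'.castSucc)
        (Finset.univ.image (accW (q := q) j' (Fin.last n)))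
      have h5 := him (accW j' (Fin.last n))
      omega

theorem checkInstr_correct (good : ZMod q → Prop) (w₀ : CheckAll n m q)
    (v : CheckAll n m q → Bool)
    (hv' : ∀ p, v (Sum.inr p) = (checkInstr good w₀ p).2 v) :
    v (goodW (Fin.last m)) = true ↔ Accepts good (fun i => v (Sum.inl (Sum.inl i)))
      (fun o => v (Sum.inl (Sum.inr o))) := by
  have hacc : ∀ j (i : Fin (n + 1)), dec (fun k => v (accW j i k)) =
      dec (fun k => v (vecW j k)) -
        ∑ i' : Fin n, if i'.castSucc < i then dec (v ∘ matW i' j) * dec (v ∘ candW i') else 0 := by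
    intro j i
    induction i using Fin.induction with
    | zero =>
      have : (fun k => v (accW j 0 k)) = fun k => v (vecW j k) := by
        funext k
        rw [accW, hv' (Sum.inl (j, 0, k))]
        rfl
      rw [this]
      simp
    | succ i ih =>
      have : (fun k => v (accW j i.succ k)) = enc (dec (v ∘ accW j i.castSucc) -
          dec (v ∘ matW i j) * dec (v ∘ candW i)) := by
        funext k
        rw [accW, hv' (Sum.inl (j, i.succ, k))]
        rfl
      rw [this, dec_enc]
      have h1 : dec (v ∘ accW j i.castSucc) = _ := ih
      rw [h1, sub_sub]
      congr 1
      have h2 : ∀ i' : Fin n, (if i'.castSucc < i.succ then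
          dec (v ∘ matW i' j) * dec (v ∘ candW i') else 0) =
          (if i'.castSucc < i.castSucc then dec (v ∘ matW i' j) * dec (v ∘ candW i') else 0) +
          (if i' = i then dec (v ∘ matW i' j) * dec (v ∘ candW i') else 0) := by
        intro i'
        rcases lt_trichotomy i' i with h | h | h
        · rw [if_pos, if_pos, if_neg h.ne, add_zero]
          · exact Fin.castSucc_lt_castSucc_iff.2 h
          · exact (Fin.castSucc_lt_castSucc_iff.2 h).trans Fin.castSucc_lt_succ
        · subst h
          simp
        · rw [if_neg, if_neg, if_neg h.ne', add_zero]
          · exact not_lt.2 (Fin.castSucc_le_castSucc_iff.2 h.le)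
          · exact not_lt.2 (Fin.succ_le_castSucc_iff.2 h)
      rw [Finset.sum_congr rfl fun i' _ => h2 i', Finset.sum_add_distrib]
      simp
  have hvalid : ∀ i : Fin (n + 1), v (validW i) = true ↔
      ∀ i' : Fin n, i'.castSucc < i → enc (dec (v ∘ candW i')) = v ∘ candW i' := by
    intro i
    induction i using Fin.induction with
    | zero =>
      rw [validW, hv' (Sum.inr (Sum.inl 0))]
      simp [checkInstr]
    | succ i ih =>
      rw [validW, hv' (Sum.inr (Sum.inl i.succ))]
      simp only [checkInstr, Fin.cases_succ, Bool.and_eq_true, decide_eq_true_eq, ih]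
      constructor
      · rintro ⟨h1, h2⟩ i' hi'
        rcases lt_or_eq_of_le (Fin.castSucc_lt_succ_iff.1 hi') with h | h
        · exact h1 i' (Fin.castSucc_lt_castSucc_iff.2 h)
        · rw [h]; exact h2
      · intro h
        exact ⟨fun i' hi' => h i' (hi'.trans Fin.castSucc_lt_succ), h i Fin.castSucc_lt_succ⟩
  have hgood : ∀ j : Fin (m + 1), v (goodW j) = true ↔ v (validW (Fin.last n)) = true ∧
      ∀ j' : Fin m, j'.castSucc < j → good (dec (v ∘ accW j' (Fin.last n))) := by
    intro j
    induction j using Fin.induction with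
    | zero =>
      rw [goodW, hv' (Sum.inr (Sum.inr 0))]
      simp [checkInstr]
    | succ j ih =>
      rw [goodW, hv' (Sum.inr (Sum.inr j.succ))]
      simp only [checkInstr, Fin.cases_succ, Bool.and_eq_true, decide_eq_true_eq, ih, and_assoc]
      refine and_congr_right fun _ => ?_
      constructor
      · rintro ⟨h1, h2⟩ j' hj'
        rcases lt_or_eq_of_le (Fin.castSucc_lt_succ_iff.1 hj') with h | h
        · exact h1 j' (Fin.castSucc_lt_castSucc_iff.2 h)
        · rw [h]; exact h2
      · intro h
        exact ⟨fun j' hj' => h j' (hj'.trans Fin.castSucc_lt_succ), h j Fin.castSucc_lt_succ⟩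
  rw [hgood, hvalid]
  simp only [Fin.castSucc_lt_last, forall_const]
  refine and_congr Iff.rfl (forall_congr' fun j => ?_)
  have h1 : dec (v ∘ accW j (Fin.last n)) = _ := hacc j (Fin.last n)
  rw [h1]
  simp only [Fin.castSucc_lt_last, if_true]
  rfl

theorem lweChecker_decides (good : ZMod q → Prop) (w₀ : LWEWires n m q) :
    (lweChecker good w₀).Decides (Accepts good) :=
  fun v hv => checkInstr_correct good (Sum.inl (Sum.inl w₀)) v hv

end Check

/-! ### Preparing the samples on registers -/

section Prepare

variable {q : ℕ} [NeZero q]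

/-- Every unit vector can be prepared from the basis vector `0`. -/
theorem exists_unitary_first_column (v : ZMod q → ℂ) (hv : ∑ x, ‖v x‖ ^ 2 = 1) :
    ∃ U ∈ Matrix.unitaryGroup (ZMod q) ℂ, ∀ x, U x 0 = v x := by
  let V : EuclideanSpace ℂ (ZMod q) := WithLp.toLp 2 v
  have hV : ‖V‖ = 1 := by
    rw [EuclideanSpace.norm_eq, Real.sqrt_eq_one]
    exact hv
  have ho : Orthonormal ℂ (({0} : Set (ZMod q)).domRestrict fun _ : ZMod q => V) := by
    rw [orthonormal_iff_ite]
    rintro ⟨i, hi⟩ ⟨j, hj⟩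
    obtain rfl : i = 0 := hi
    obtain rfl : j = 0 := hj
    rw [if_pos rfl]
    show inner ℂ V V = 1
    rw [inner_self_eq_norm_sq_to_K, hV]
    simp
  obtain ⟨b, hb⟩ := ho.exists_orthonormalBasis_extension_of_card_eq
    (by rw [finrank_euclideanSpace])
  refine ⟨(EuclideanSpace.basisFun (ZMod q) ℂ).toBasis.toMatrix b, ?_, fun x => ?_⟩
  · exact (EuclideanSpace.basisFun (ZMod q) ℂ).toMatrix_orthonormalBasis_mem_unitary b
  · rw [Module.Basis.toMatrix_apply, hb 0 rfl]
    simp [V]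

/-- The additive character `x ↦ exp(2πi x / q)` of `ℤ_q`. -/
abbrev chi (x : ZMod q) : ℂ := ZMod.stdAddChar x

theorem chi_star (x : ZMod q) : star (chi x) = chi (-x) := by
  have h1 : ‖chi x‖ = 1 := AddChar.norm_apply _ _
  rw [chi, chi, AddChar.map_neg_eq_inv, Complex.inv_def, Complex.normSq_eq_norm_sq]
  rw [show ‖ZMod.stdAddChar x‖ = 1 from h1]
  simp

theorem sum_chi_mul (a : ZMod q) : ∑ x : ZMod q, chi (a * x) = if a = 0 then (q : ℂ) else 0 := by
  have := AddChar.sum_mulShift (R := ZMod q) (R' := ℂ) a (ZMod.isPrimitive_stdAddChar q)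
  rw [ZMod.card] at this
  rw [Nat.cast_ite, Nat.cast_zero] at this
  rw [← this]
  exact Finset.sum_congr rfl fun x _ => by rw [mul_comm]

/-- The inverse Fourier transform over `ℤ_q`. -/
def fourierMat (q : ℕ) [NeZero q] : Matrix (ZMod q) (ZMod q) ℂ :=
  fun x c => chi (-(x * c)) / (Real.sqrt q : ℂ)

theorem fourierMat_mem : fourierMat q ∈ Matrix.unitaryGroup (ZMod q) ℂ := by
  have hq : (0 : ℝ) < q := by exact_mod_cast NeZero.pos q
  have hs : (Real.sqrt q : ℂ) * (Real.sqrt q : ℂ) = q := by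
    rw [← Complex.ofReal_mul, Real.mul_self_sqrt hq.le, Complex.ofReal_natCast]
  have hq0 : (q : ℂ) ≠ 0 := by exact_mod_cast hq.ne'
  rw [Matrix.mem_unitaryGroup_iff]
  ext x y
  have : ∀ c, fourierMat q x c * star (fourierMat q) c y = chi ((y - x) * c) / q := by
    intro c
    rw [Matrix.star_apply, fourierMat, fourierMat, star_div₀, chi_star, div_mul_div_comm,
      show star (Real.sqrt q : ℂ) = Real.sqrt q from Complex.conj_ofReal _, hs]
    congr 1
    rw [chi, chi, ← AddChar.map_add_eq_mul]
    congr 1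
    ring
  rw [Matrix.mul_apply, Finset.sum_congr rfl fun c _ => this c, ← Finset.sum_div, sum_chi_mul,
    Matrix.one_apply]
  by_cases h : x = y
  · subst h; simp [hq0]
  · rw [if_neg (fun h' => h (sub_eq_zero.1 h').symm), if_neg h, zero_div]

theorem tens_sum_mulVec {R R' : Type} [Fintype R] [DecidableEq R] [Fintype R'] [DecidableEq R']
    (U : R → Matrix (ZMod q) (ZMod q) ℂ) (V : R' → Matrix (ZMod q) (ZMod q) ℂ)
    (f : (R → ZMod q) → ℂ) (g : (R' → ZMod q) → ℂ) (x : R ⊕ R' → ZMod q) :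
    (tens (Sum.elim U V)).mulVec (fun x => f (x ∘ Sum.inl) * g (x ∘ Sum.inr)) x =
      (tens U).mulVec f (x ∘ Sum.inl) * (tens V).mulVec g (x ∘ Sum.inr) := by
  simp only [Matrix.mulVec, dotProduct]
  rw [← (Equiv.sumArrowEquivProdArrow R R' (ZMod q)).symm.sum_comp, Fintype.sum_prod_type,
    Finset.sum_mul_sum]
  refine Finset.sum_congr rfl fun c _ => Finset.sum_congr rfl fun d _ => ?_
  have h1 : (Equiv.sumArrowEquivProdArrow R R' (ZMod q)).symm (c, d) ∘ Sum.inl = c := rfl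
  have h2 : (Equiv.sumArrowEquivProdArrow R R' (ZMod q)).symm (c, d) ∘ Sum.inr = d := rfl
  rw [h1, h2, tens, Fintype.prod_sum_type]
  show (∏ r, U r (x (Sum.inl r)) (c r)) * (∏ r, V r (x (Sum.inr r)) (d r)) * (f c * g d) = _
  simp only [tens, Function.comp_apply]
  ring

theorem tens_family_mulVec {R : Type} [Fintype R] [DecidableEq R] {ℓ : ℕ}
    (U : R → Matrix (ZMod q) (ZMod q) ℂ) (f : (R → ZMod q) → ℂ) (x : Fin ℓ × R → ZMod q) :
    (tens (fun p : Fin ℓ × R => U p.2)).mulVec (fun x => ∏ i, f fun r => x (i, r)) x =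
      ∏ i, (tens U).mulVec f fun r => x (i, r) := by
  simp only [Matrix.mulVec, dotProduct]
  rw [Finset.prod_univ_sum, Fintype.piFinset_univ,
    ← (Equiv.curry (Fin ℓ) R (ZMod q)).symm.sum_comp]
  refine Finset.sum_congr rfl fun c _ => ?_
  rw [Finset.prod_mul_distrib]
  congr 1
  simp only [tens]
  rw [Fintype.prod_prod_type]
  rfl

/-- The registers of one sample: the vectors `a` and `y`, and the quantum register. Before the
inverse Fourier transform, the first one holds a superposition of secrets and the last one
the multiplier of the LWE vector. -/
abbrev SampleReg (n m : ℕ) : Type := Fin n ⊕ (Fin m ⊕ Unit)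

/-- The registers that keep classical values: the input `A`, `b`, a copy of `A`, and copies
of the parts `a` and `y` of the samples. -/
abbrev ClassReg (n m ℓ : ℕ) : Type :=
  ((Fin n × Fin m) ⊕ Fin m) ⊕ ((Fin n × Fin m) ⊕ (Fin ℓ × (Fin n ⊕ Fin m)))

/-- All registers used to prepare `ℓ` samples. -/
abbrev PrepReg (n m ℓ : ℕ) : Type := ClassReg n m ℓ ⊕ (Fin ℓ × SampleReg n m)

variable {n m ℓ : ℕ}

/-- The additions `y_j ← y_j + ∑ l, A_lj u_l + k (b_j + δ_j)`. -/
def mixInstr (δ : Fin m → ZMod q) :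
    Fin ℓ × (Fin m × Option (Fin n)) → AddInstr (PrepReg n m ℓ) q
  | (i, j, none) => ⟨Sum.inr (i, Sum.inr (Sum.inr ())), Sum.inl (Sum.inl (Sum.inr j)),
      Sum.inr (i, Sum.inr (Sum.inl j)), fun k b => k * (b + δ j)⟩
  | (i, j, some l) => ⟨Sum.inl (Sum.inl (Sum.inl (l, j))), Sum.inr (i, Sum.inl l),
      Sum.inr (i, Sum.inr (Sum.inl j)), fun a u => a * u⟩

/-- The additions that copy `A` and the classical parts of the samples. -/
def copyInstr : (Fin n × Fin m) ⊕ (Fin ℓ × (Fin n ⊕ Fin m)) → AddInstr (PrepReg n m ℓ) q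
  | Sum.inl p => ⟨Sum.inl (Sum.inl (Sum.inl p)), Sum.inl (Sum.inl (Sum.inl p)),
      Sum.inl (Sum.inr (Sum.inl p)), fun a _ => a⟩
  | Sum.inr (i, Sum.inl l) => ⟨Sum.inr (i, Sum.inl l), Sum.inr (i, Sum.inl l),
      Sum.inl (Sum.inr (Sum.inr (i, Sum.inl l))), fun a _ => a⟩
  | Sum.inr (i, Sum.inr j) => ⟨Sum.inr (i, Sum.inr (Sum.inl j)), Sum.inr (i, Sum.inr (Sum.inl j)),
      Sum.inl (Sum.inr (Sum.inr (i, Sum.inr j))), fun a _ => a⟩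

/-- All instructions of a finite family. -/
def allInstr {R P : Type} [Fintype P] (I : P → AddInstr R q) : List (AddInstr R q) :=
  Finset.univ.toList.map I

theorem totalAdd_allInstr {R P : Type} [DecidableEq R] [Fintype R] [Fintype P]
    (I : P → AddInstr R q) (x : R → ZMod q) (r : R) :
    totalAdd (allInstr I) x r =
      ∑ p, if (I p).tgt = r then (I p).g (x (I p).fst) (x (I p).snd) else 0 := by
  rw [totalAdd, allInstr, List.map_map, ← Finset.sum_map_toList]
  rfl

theorem totalAdd_mix_inl (δ : Fin m → ZMod q) (x : PrepReg n m ℓ → ZMod q)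
    (r : ClassReg n m ℓ) : totalAdd (allInstr (mixInstr δ)) x (Sum.inl r) = 0 := by
  rw [totalAdd_allInstr]
  refine Finset.sum_eq_zero fun p _ => ?_
  rcases p with ⟨i, j, _ | l⟩ <;> simp [mixInstr]

theorem totalAdd_mix_k (δ : Fin m → ZMod q) (x : PrepReg n m ℓ → ZMod q) (i : Fin ℓ)
    (u : Unit) : totalAdd (allInstr (mixInstr δ)) x (Sum.inr (i, Sum.inr (Sum.inr u))) = 0 := by
  rw [totalAdd_allInstr]
  refine Finset.sum_eq_zero fun p _ => ?_
  rcases p with ⟨i, j, _ | l⟩ <;> simp [mixInstr]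

theorem totalAdd_mix_y (δ : Fin m → ZMod q) (x : PrepReg n m ℓ → ZMod q) (i : Fin ℓ)
    (j : Fin m) : totalAdd (allInstr (mixInstr δ)) x (Sum.inr (i, Sum.inr (Sum.inl j))) =
      x (Sum.inr (i, Sum.inr (Sum.inr ()))) * (x (Sum.inl (Sum.inl (Sum.inr j))) + δ j) +
      ∑ l, x (Sum.inl (Sum.inl (Sum.inl (l, j)))) * x (Sum.inr (i, Sum.inl l)) := by
  rw [totalAdd_allInstr, Fintype.sum_prod_type, Finset.sum_eq_single i, Fintype.sum_prod_type,
    Finset.sum_eq_single j, Fintype.sum_option]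
  · simp [mixInstr]
  · intro j' _ hj'
    refine Finset.sum_eq_zero fun o _ => ?_
    rcases o with _ | l <;> simp [mixInstr, hj']
  · simp
  · intro i' _ hi'
    refine Finset.sum_eq_zero fun o _ => ?_
    rcases o with ⟨j, _ | l⟩ <;> simp [mixInstr, hi']
  · simp

theorem totalAdd_copy_of_ne (x : PrepReg n m ℓ → ZMod q) {r : PrepReg n m ℓ}
    (hr : ∀ p, r ≠ Sum.inl (Sum.inr p)) : totalAdd (allInstr copyInstr) x r = 0 := by
  rw [totalAdd_allInstr]
  refine Finset.sum_eq_zero fun p _ => ?_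
  rcases p with p | ⟨i, l | j⟩ <;> exact if_neg (hr _).symm

theorem totalAdd_copy (x : PrepReg n m ℓ → ZMod q)
    (p : (Fin n × Fin m) ⊕ (Fin ℓ × (Fin n ⊕ Fin m))) :
    totalAdd (allInstr copyInstr) x (Sum.inl (Sum.inr p)) =
      x (copyInstr (q := q) (ℓ := ℓ) (n := n) (m := m) p).fst := by
  have ht : ∀ p', (copyInstr (q := q) (ℓ := ℓ) (n := n) (m := m) p').tgt =
      Sum.inl (Sum.inr p') := by rintro (p' | ⟨i, l | j⟩) <;> rfl
  rw [totalAdd_allInstr, Finset.sum_eq_single p]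
  · rw [if_pos (ht p)]
    rcases p with p | ⟨i, l | j⟩ <;> rfl
  · intro p' _ hp'
    rw [if_neg]
    rw [ht]
    simpa using hp'
  · simp

/-- The operator on one sample that is applied after the additions. -/
def fourierSample (n m q : ℕ) [NeZero q] : Matrix (SampleReg n m → ZMod q)
    (SampleReg n m → ZMod q) ℂ :=
  tens (Sum.elim (fun _ => fourierMat q) (Sum.elim (fun _ => 1) fun _ => fourierMat q))

/-- The state of one sample after the additions, where `b` is the vector multiplied by `k`. -/
def mixedSample (g h : ZMod q → ℂ) (A : Matrix (Fin n) (Fin m) (ZMod q)) (b : Fin m → ZMod q)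
    (w : SampleReg n m → ZMod q) : ℂ :=
  (∏ _l : Fin n, (1 / Real.sqrt q : ℂ)) *
    ((∏ j, h (w (Sum.inr (Sum.inl j)) - (w (Sum.inr (Sum.inr ())) * b j +
      ∑ l, A l j * w (Sum.inl l)))) * g (w (Sum.inr (Sum.inr ()))))

/-- The content of the registers before the preparation. -/
def startReg (A : Matrix (Fin n) (Fin m) (ZMod q)) (b : Fin m → ZMod q) :
    PrepReg n m ℓ → ZMod q :=
  Sum.elim (Sum.elim (Sum.elim (fun p => A p.1 p.2) b) fun _ => 0) fun _ => 0

/-- The classical registers hold `A`, `b`, a copy of `A`, and copies of the classical parts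
of the samples. -/
def Consistent (A : Matrix (Fin n) (Fin m) (ZMod q)) (b : Fin m → ZMod q)
    (x : PrepReg n m ℓ → ZMod q) : Prop :=
  (∀ p, x (Sum.inl (Sum.inl (Sum.inl p))) = A p.1 p.2) ∧
  (∀ j, x (Sum.inl (Sum.inl (Sum.inr j))) = b j) ∧
  (∀ p, x (Sum.inl (Sum.inr (Sum.inl p))) = A p.1 p.2) ∧
  (∀ i l, x (Sum.inl (Sum.inr (Sum.inr (i, Sum.inl l)))) = x (Sum.inr (i, Sum.inl l))) ∧
  (∀ i j, x (Sum.inl (Sum.inr (Sum.inr (i, Sum.inr j)))) = x (Sum.inr (i, Sum.inr (Sum.inl j))))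

open Classical in
/-- The samples are prepared, on registers, by polynomially many gates. -/
theorem exists_prepare (hq : 2 < q) (g h : ZMod q → ℂ) (hg : ∑ x, ‖g x‖ ^ 2 = 1)
    (hh : ∑ x, ‖h x‖ ^ 2 = 1) (δ : Fin m → ZMod q) :
    ∃ gs : List (Gate (PrepReg n m ℓ × ZReg q)),
      gs.length ≤ (2 * Fintype.card (PrepReg n m ℓ) + (ℓ * (m * (n + 1)) +
        (n * m + ℓ * (n + m)))) * 72 ^ (3 * Nat.clog 2 q) ∧
      ∀ A b, run gs (encState fun x => if x = startReg A b then 1 else 0) =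
        encState fun x => if Consistent A b x then
          ∏ i, (fourierSample n m q).mulVec (mixedSample g h A (b + δ)) fun r => x (Sum.inr (i, r))
          else 0 := by
  have hq0 : (0 : ℝ) < q := by exact_mod_cast NeZero.pos q
  obtain ⟨Ug, hUg, hUg'⟩ := exists_unitary_first_column g hg
  obtain ⟨Uh, hUh, hUh'⟩ := exists_unitary_first_column h hh
  obtain ⟨Uu, hUu, hUu'⟩ := exists_unitary_first_column (fun _ : ZMod q => (1 / Real.sqrt q : ℂ))
    (by
      have : ‖(1 / Real.sqrt q : ℂ)‖ ^ 2 = 1 / q := by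
        rw [norm_div, norm_one, Complex.norm_real, Real.norm_of_nonneg (Real.sqrt_nonneg _),
          div_pow, one_pow, Real.sq_sqrt hq0.le]
      simp only [this, Finset.sum_const, Finset.card_univ, ZMod.card, nsmul_eq_mul]
      field_simp)
  let Up : SampleReg n m → Matrix (ZMod q) (ZMod q) ℂ :=
    Sum.elim (fun _ => Uu) (Sum.elim (fun _ => Uh) fun _ => Ug)
  let UX : SampleReg n m → Matrix (ZMod q) (ZMod q) ℂ :=
    Sum.elim (fun _ => fourierMat q) (Sum.elim (fun _ => 1) fun _ => fourierMat q)
  have hUp : ∀ r, Up r ∈ Matrix.unitaryGroup (ZMod q) ℂ := by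
    rintro (l | j | u)
    exacts [hUu, hUh, hUg]
  have hUX : ∀ r, UX r ∈ Matrix.unitaryGroup (ZMod q) ℂ := by
    rintro (l | j | u)
    exacts [fourierMat_mem, one_mem _, fourierMat_mem]
  have hext : ∀ {V : SampleReg n m → Matrix (ZMod q) (ZMod q) ℂ},
      (∀ r, V r ∈ Matrix.unitaryGroup (ZMod q) ℂ) → ∀ r : PrepReg n m ℓ,
      Sum.elim (fun _ : ClassReg n m ℓ => (1 : Matrix (ZMod q) (ZMod q) ℂ))
        (fun p : Fin ℓ × SampleReg n m => V p.2) r ∈ Matrix.unitaryGroup (ZMod q) ℂ := by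
    rintro V hV (r | r)
    exacts [one_mem _, hV _]
  -- the sources of the first additions are the registers that do not hold a vector `y`
  let src₁ : PrepReg n m ℓ → Prop := fun r => ∀ i j, r ≠ Sum.inr (i, Sum.inr (Sum.inl j))
  have hmix := qsynth_add hq src₁ (allInstr (mixInstr (n := n) (ℓ := ℓ) δ))
    (by
      intro p hp
      obtain ⟨⟨i, j, _ | l⟩, _, rfl⟩ := List.mem_map.1 hp <;> intro i' j' <;> simp [mixInstr])
    (by
      intro p hp
      obtain ⟨⟨i, j, _ | l⟩, _, rfl⟩ := List.mem_map.1 hp <;> intro i' j' <;> simp [mixInstr])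
    (by
      intro p hp
      obtain ⟨⟨i, j, _ | l⟩, _, rfl⟩ := List.mem_map.1 hp <;> exact fun h => h i j rfl)
  let src₂ : PrepReg n m ℓ → Prop := fun r => ∀ p, r ≠ Sum.inl (Sum.inr p)
  have hcopy := qsynth_add hq src₂ (allInstr (copyInstr (q := q) (n := n) (m := m) (ℓ := ℓ)))
    (by
      intro p hp
      obtain ⟨p' | ⟨i, l | j⟩, _, rfl⟩ := List.mem_map.1 hp <;> intro p'' <;> simp [copyInstr])
    (by
      intro p hp
      obtain ⟨p' | ⟨i, l | j⟩, _, rfl⟩ := List.mem_map.1 hp <;> intro p'' <;> simp [copyInstr])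
    (by
      intro p hp
      obtain ⟨p' | ⟨i, l | j⟩, _, rfl⟩ := List.mem_map.1 hp <;> exact fun h => h _ rfl)
  obtain ⟨gs, hlen, hgs⟩ := (((qsynth_tens (R := PrepReg n m ℓ) hq (hext hUp)).comp hmix).comp
    (qsynth_tens (R := PrepReg n m ℓ) hq (hext hUX))).comp hcopy
  refine ⟨gs, hlen.trans ?_, fun A b => ?_⟩
  · have h1 : (allInstr (mixInstr (n := n) (ℓ := ℓ) δ)).length = ℓ * (m * (n + 1)) := by
      simp [allInstr]
    have h2 : (allInstr (copyInstr (q := q) (n := n) (m := m) (ℓ := ℓ))).length =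
        n * m + ℓ * (n + m) := by simp [allInstr]
    rw [h1, h2]
    have h3 : 72 ^ Nat.clog 2 q ≤ 72 ^ (3 * Nat.clog 2 q) :=
      Nat.pow_le_pow_right (by norm_num) (by omega)
    have h4 : Fintype.card (PrepReg n m ℓ) * 72 ^ Nat.clog 2 q ≤
        Fintype.card (PrepReg n m ℓ) * 72 ^ (3 * Nat.clog 2 q) := Nat.mul_le_mul_left _ h3
    calc _ ≤ Fintype.card (PrepReg n m ℓ) * 72 ^ (3 * Nat.clog 2 q) +
          ℓ * (m * (n + 1)) * 72 ^ (3 * Nat.clog 2 q) +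
          Fintype.card (PrepReg n m ℓ) * 72 ^ (3 * Nat.clog 2 q) +
          (n * m + ℓ * (n + m)) * 72 ^ (3 * Nat.clog 2 q) := by gcongr
      _ = _ := by ring
  rw [hgs]
  congr 1
  -- the four stages of the preparation
  have h1 : (tens (Sum.elim (fun _ : ClassReg n m ℓ => (1 : Matrix (ZMod q) (ZMod q) ℂ))
      (fun p : Fin ℓ × SampleReg n m => Up p.2))).mulVec
        (fun x => if x = startReg A b then 1 else 0) =
      fun x => (if x ∘ Sum.inl = startReg (ℓ := ℓ) A b ∘ Sum.inl then 1 else 0) *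
        ∏ i, ((∏ _l : Fin n, (1 / Real.sqrt q : ℂ)) *
          ((∏ j, h (x (Sum.inr (i, Sum.inr (Sum.inl j))))) *
            g (x (Sum.inr (i, Sum.inr (Sum.inr ())))))) := by
    funext x
    have e1 : (tens (Sum.elim (fun _ : ClassReg n m ℓ => (1 : Matrix (ZMod q) (ZMod q) ℂ))
        (fun p : Fin ℓ × SampleReg n m => Up p.2))).mulVec
          (fun x => if x = startReg A b then 1 else 0) x =
        tens (Sum.elim (fun _ : ClassReg n m ℓ => (1 : Matrix (ZMod q) (ZMod q) ℂ))
        (fun p : Fin ℓ × SampleReg n m => Up p.2)) x (startReg A b) := by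
      simp [Matrix.mulVec, dotProduct]
    rw [e1, tens, Fintype.prod_sum_type, Fintype.prod_prod_type]
    have e2 : ∏ r : ClassReg n m ℓ, (1 : Matrix (ZMod q) (ZMod q) ℂ) (x (Sum.inl r))
        (startReg (ℓ := ℓ) A b (Sum.inl r)) =
        if x ∘ Sum.inl = startReg (ℓ := ℓ) A b ∘ Sum.inl then 1 else 0 := by
      have := congrFun₂ (tens_one (q := q) (R := ClassReg n m ℓ)) (x ∘ Sum.inl)
        (startReg (ℓ := ℓ) A b ∘ Sum.inl)
      rw [Matrix.one_apply] at this
      exact this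
    simp only [Sum.elim_inl, Sum.elim_inr]
    rw [e2]
    congr 1
    refine Finset.prod_congr rfl fun i _ => ?_
    rw [Fintype.prod_sum_type, Fintype.prod_sum_type]
    simp [Up, startReg, hUg', hUh', hUu']
  beta_reduce
  rw [h1]
  have hstart : ∀ x : PrepReg n m ℓ → ZMod q,
      x ∘ Sum.inl = startReg (ℓ := ℓ) A b ∘ Sum.inl ↔
        (∀ p, x (Sum.inl (Sum.inl (Sum.inl p))) = A p.1 p.2) ∧
        (∀ j, x (Sum.inl (Sum.inl (Sum.inr j))) = b j) ∧
        (∀ p, x (Sum.inl (Sum.inr p)) = 0) := by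
    intro x
    constructor
    · intro hx
      exact ⟨fun p => congrFun hx (Sum.inl (Sum.inl p)), fun j => congrFun hx (Sum.inl (Sum.inr j)),
        fun p => congrFun hx (Sum.inr p)⟩
    · rintro ⟨h1, h2, h3⟩
      funext r
      rcases r with (p | j) | p
      exacts [h1 p, h2 j, h3 p]
  have h2 : (fun x : PrepReg n m ℓ → ZMod q => (fun x : PrepReg n m ℓ → ZMod q =>
      (if x ∘ Sum.inl = startReg (ℓ := ℓ) A b ∘ Sum.inl then (1 : ℂ) else 0) *
        ∏ i, ((∏ _l : Fin n, (1 / Real.sqrt q : ℂ)) *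
          ((∏ j, h (x (Sum.inr (i, Sum.inr (Sum.inl j))))) *
            g (x (Sum.inr (i, Sum.inr (Sum.inr ()))))))) (x - totalAdd (allInstr (mixInstr δ)) x)) =
      fun x => (fun c : ClassReg n m ℓ → ZMod q =>
        (if c = startReg (ℓ := ℓ) A b ∘ Sum.inl then (1 : ℂ) else 0)) (x ∘ Sum.inl) *
        (fun z : Fin ℓ × SampleReg n m → ZMod q => ∏ i, mixedSample g h A (b + δ) fun r => z (i, r))
          (x ∘ Sum.inr) := by
    funext x
    have e : (x - totalAdd (allInstr (mixInstr δ)) x) ∘ Sum.inl = x ∘ Sum.inl := by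
      funext r
      simp [totalAdd_mix_inl]
    simp only [e]
    by_cases hx : x ∘ Sum.inl = startReg (ℓ := ℓ) A b ∘ Sum.inl
    · rw [if_pos hx, one_mul, one_mul]
      obtain ⟨hA, hb, -⟩ := (hstart x).1 hx
      refine Finset.prod_congr rfl fun i _ => ?_
      simp only [mixedSample, Pi.sub_apply, totalAdd_mix_y, totalAdd_mix_k, hA, hb, sub_zero,
        Function.comp_apply, Pi.add_apply]
    · rw [if_neg hx, zero_mul, zero_mul]
  rw [h2]
  funext x
  refine (tens_sum_mulVec (fun _ : ClassReg n m ℓ => (1 : Matrix (ZMod q) (ZMod q) ℂ))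
    (fun p : Fin ℓ × SampleReg n m => UX p.2)
    (fun c => if c = startReg (ℓ := ℓ) A b ∘ Sum.inl then (1 : ℂ) else 0)
    (fun z => ∏ i, mixedSample g h A (b + δ) fun r => z (i, r)) _).trans ?_
  rw [tens_one, Matrix.one_mulVec, tens_family_mulVec]
  have e1 : ∀ r, (x - totalAdd (allInstr (copyInstr (q := q) (n := n) (m := m) (ℓ := ℓ))) x)
      (Sum.inr r) = x (Sum.inr r) := by
    intro r
    rw [Pi.sub_apply, totalAdd_copy_of_ne x (by simp), sub_zero]
  have e2 : (x - totalAdd (allInstr (copyInstr (q := q) (n := n) (m := m) (ℓ := ℓ))) x) ∘ Sum.inl =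
      startReg (ℓ := ℓ) A b ∘ Sum.inl ↔ Consistent A b x := by
    rw [hstart]
    have a1 : ∀ r, (x - totalAdd (allInstr (copyInstr (q := q) (n := n) (m := m) (ℓ := ℓ))) x)
        (Sum.inl (Sum.inl r)) = x (Sum.inl (Sum.inl r)) := by
      intro r
      rw [Pi.sub_apply, totalAdd_copy_of_ne x (by simp), sub_zero]
    have a2 : ∀ p, (x - totalAdd (allInstr (copyInstr (q := q) (n := n) (m := m) (ℓ := ℓ))) x)
        (Sum.inl (Sum.inr p)) = x (Sum.inl (Sum.inr p)) -
          x (copyInstr (q := q) (ℓ := ℓ) (n := n) (m := m) p).fst := by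
      intro p
      rw [Pi.sub_apply, totalAdd_copy]
    simp only [a1, a2, sub_eq_zero, Consistent]
    refine and_congr_right fun hA => and_congr_right fun _ => ?_
    constructor
    · intro h
      exact ⟨fun p => (h (Sum.inl p)).trans (hA p), fun i l => h (Sum.inr (i, Sum.inl l)),
        fun i j => h (Sum.inr (i, Sum.inr j))⟩
    · rintro ⟨h1, h2, h3⟩ (p | ⟨i, l | j⟩)
      exacts [(h1 p).trans (hA p).symm, h2 i l, h3 i j]
  by_cases hx : Consistent A b x
  · rw [if_pos (e2.2 hx), if_pos hx, one_mul]
    refine Finset.prod_congr rfl fun i _ => ?_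
    simp only [Function.comp_apply, e1]
    rfl
  · rw [if_neg (fun h => hx (e2.1 h)), if_neg hx, zero_mul]

end Prepare

/-! ### Running an algorithm for samples on prepared samples -/

section Trial

variable {q : ℕ} [NeZero q] {n m ℓ : ℕ}

/-- The basis state of the sample qubits for `A`, the classical parts `a` and `y`, and the
contents `j` of the quantum registers. -/
def slweBits (A : Matrix (Fin n) (Fin m) (ZMod q)) (a : Fin ℓ → Fin n → ZMod q)
    (y : Fin ℓ → Fin m → ZMod q) (j : Fin ℓ → ZMod q) : SLWEWires n m q ℓ → Bool
  | Sum.inl p => encMat A p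
  | Sum.inr (i, Sum.inl p) => encVec (a i) p
  | Sum.inr (i, Sum.inr (Sum.inl p)) => encVec (y i) p
  | Sum.inr (i, Sum.inr (Sum.inr k)) => enc (j i) k

/-- The state with classical parts `A`, `a`, `y` and amplitudes `Φ` on the quantum registers. -/
def slweState (A : Matrix (Fin n) (Fin m) (ZMod q)) (a : Fin ℓ → Fin n → ZMod q)
    (y : Fin ℓ → Fin m → ZMod q) (Φ : (Fin ℓ → ZMod q) → ℂ) : (SLWEWires n m q ℓ → Bool) → ℂ :=
  fun w => ∑ j, if w = slweBits A a y j then Φ j else 0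

theorem slweBits_injective (A : Matrix (Fin n) (Fin m) (ZMod q)) (a : Fin ℓ → Fin n → ZMod q)
    (y : Fin ℓ → Fin m → ZMod q) : Function.Injective (slweBits A a y) := by
  intro j j' h
  funext i
  exact enc_injective (funext fun k => congrFun h (Sum.inr (i, Sum.inr (Sum.inr k))))

theorem slweState_apply (A : Matrix (Fin n) (Fin m) (ZMod q)) (a : Fin ℓ → Fin n → ZMod q)
    (y : Fin ℓ → Fin m → ZMod q) (Φ : (Fin ℓ → ZMod q) → ℂ) (j : Fin ℓ → ZMod q) :
    slweState A a y Φ (slweBits A a y j) = Φ j := by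
  rw [slweState, Finset.sum_eq_single j]
  · rw [if_pos rfl]
  · intro j' _ hj'
    exact if_neg fun h => hj' (slweBits_injective A a y h).symm
  · simp

theorem slweState_of_ne (A : Matrix (Fin n) (Fin m) (ZMod q)) (a : Fin ℓ → Fin n → ZMod q)
    (y : Fin ℓ → Fin m → ZMod q) (Φ : (Fin ℓ → ZMod q) → ℂ) {w : SLWEWires n m q ℓ → Bool}
    (hw : ∀ j, w ≠ slweBits A a y j) : slweState A a y Φ w = 0 :=
  Finset.sum_eq_zero fun j _ => if_neg (hw j)

/-- The input of the algorithm for samples is a product state in the quantum registers. -/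
theorem slweInput_eq (A : Matrix (Fin n) (Fin m) (ZMod q)) (f : ℤ → ℝ)
    (θ : (Fin m → ZMod q) → ℝ) (s : Fin n → ZMod q) (a : Fin ℓ → Fin n → ZMod q)
    (y : Fin ℓ → Fin m → ZMod q) :
    slweInput A f θ s a y = slweState A a y fun j => ∏ i,
      phaseAmp f (θ (y i)) (a i ⬝ᵥ s) (j i) /
        (Real.sqrt (∑ b' : ZMod q, ‖phaseAmp f (θ (y i)) (a i ⬝ᵥ s) b'‖ ^ 2) : ℂ) := by
  funext w
  by_cases hw : ∃ j, w = slweBits A a y j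
  · obtain ⟨j, rfl⟩ := hw
    have hA : (fun p => slweBits A a y j (Sum.inl p)) = encMat A := rfl
    rw [slweState_apply, slweInput, if_pos hA]
    refine Finset.prod_congr rfl fun i _ => ?_
    have ha : (fun p => slweBits A a y j (Sum.inr (i, Sum.inl p))) = encVec (a i) := rfl
    have hy : (fun p => slweBits A a y j (Sum.inr (i, Sum.inr (Sum.inl p)))) = encVec (y i) := rfl
    have hj : enc (j i) = fun k => slweBits A a y j (Sum.inr (i, Sum.inr (Sum.inr k))) := rfl
    rw [sampleState, if_pos ⟨ha, hy⟩, phaseState, Finset.sum_eq_single (j i)]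
    · rw [if_pos hj]
    · intro b _ hb
      exact if_neg fun h => hb (enc_injective h)
    · simp
  · rw [not_exists] at hw
    rw [slweState_of_ne A a y _ hw, slweInput]
    split_ifs with hA
    · by_contra hne
      have hi := Finset.prod_ne_zero_iff.1 hne
      have hex : ∀ i, ∃ b : ZMod q, enc b = fun k => w (Sum.inr (i, Sum.inr (Sum.inr k))) := by
        intro i
        have := hi i (Finset.mem_univ _)
        rw [sampleState] at this
        split_ifs at this
        · obtain ⟨b, -, hb⟩ := Finset.exists_ne_zero_of_sum_ne_zero this
          split_ifs at hb with h
          · exact ⟨b, h⟩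
          · exact absurd rfl hb
        · exact absurd rfl this
      choose j hj using hex
      refine hw j (funext fun p => ?_)
      have hcl : ∀ i, (fun p => w (Sum.inr (i, Sum.inl p))) = encVec (a i) ∧
          (fun p => w (Sum.inr (i, Sum.inr (Sum.inl p)))) = encVec (y i) := by
        intro i
        have := hi i (Finset.mem_univ _)
        rw [sampleState] at this
        split_ifs at this with h
        · exact h
        · exact absurd rfl this
      rcases p with p | ⟨i, p | p | k⟩
      exacts [congrFun hA p, congrFun (hcl i).1 p, congrFun (hcl i).2 p, (congrFun (hj i) k).symm]
    · rfl

/-- The ancillas of the circuit that prepares samples and runs an algorithm with `r` ancillas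
on them. -/
abbrev TrialAnc (n m q ℓ r : ℕ) : Type :=
  ((((Fin n × Fin m) ⊕ (Fin ℓ × (Fin n ⊕ Fin m))) ⊕ (Fin ℓ × SampleReg n m)) × ZReg q) ⊕ Fin r

/-- The place of the preparation registers among the wires. -/
def prepWire (r : ℕ) : PrepReg n m ℓ × ZReg q → LWEWires n m q ⊕ TrialAnc n m q ℓ r
  | (Sum.inl (Sum.inl (Sum.inl p)), k) => Sum.inl (Sum.inl (p, k))
  | (Sum.inl (Sum.inl (Sum.inr j)), k) => Sum.inl (Sum.inr (j, k))
  | (Sum.inl (Sum.inr c), k) => Sum.inr (Sum.inl (Sum.inl c, k))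
  | (Sum.inr t, k) => Sum.inr (Sum.inl (Sum.inr t, k))

/-- The place of the sample qubits and of the ancillas of the algorithm among the wires. -/
def slweWire (r : ℕ) : SLWEWires n m q ℓ ⊕ Fin r → LWEWires n m q ⊕ TrialAnc n m q ℓ r
  | Sum.inl (Sum.inl (p, k)) => Sum.inr (Sum.inl (Sum.inl (Sum.inl p), k))
  | Sum.inl (Sum.inr (i, Sum.inl (l, k))) => Sum.inr (Sum.inl (Sum.inr (i, Sum.inl l), k))
  | Sum.inl (Sum.inr (i, Sum.inr (Sum.inl (j, k)))) =>
      Sum.inr (Sum.inl (Sum.inr (i, Sum.inr (Sum.inl j)), k))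
  | Sum.inl (Sum.inr (i, Sum.inr (Sum.inr k))) =>
      Sum.inr (Sum.inl (Sum.inr (i, Sum.inr (Sum.inr ())), k))
  | Sum.inr t => Sum.inr (Sum.inr t)

theorem prepWire_injective (r : ℕ) :
    Function.Injective (prepWire (n := n) (m := m) (q := q) (ℓ := ℓ) r) := by
  rintro ⟨((p | j) | c) | t, k⟩ ⟨((p' | j') | c') | t', k'⟩ h <;> simp_all [prepWire]

theorem slweWire_injective (r : ℕ) :
    Function.Injective (slweWire (n := n) (m := m) (q := q) (ℓ := ℓ) r) := by
  rintro ((⟨p, k⟩ | ⟨i, ⟨l, k⟩ | ⟨j, k⟩ | k⟩) | t)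
    ((⟨p', k'⟩ | ⟨i', ⟨l', k'⟩ | ⟨j', k'⟩ | k'⟩) | t') h <;>
    simp_all [slweWire]

/-- The content of the wires when the classical values are `A`, `b`, `a`, `y`; the wires of
the samples and of the ancillas of the algorithm are left blank. -/
def trialBits (A : Matrix (Fin n) (Fin m) (ZMod q)) (b : Fin m → ZMod q)
    (a : Fin ℓ → Fin n → ZMod q) (y : Fin ℓ → Fin m → ZMod q) (r : ℕ) :
    LWEWires n m q ⊕ TrialAnc n m q ℓ r → Bool
  | Sum.inl (Sum.inl p) => encMat A p
  | Sum.inl (Sum.inr p) => encVec b p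
  | Sum.inr (Sum.inl (Sum.inl (Sum.inr (i, Sum.inl l)), k)) => enc (a i l) k
  | Sum.inr (Sum.inl (Sum.inl (Sum.inr (i, Sum.inr j)), k)) => enc (y i j) k
  | _ => false

/-- The content of the registers of one sample. -/
def sampleReg (a : Fin n → ZMod q) (y : Fin m → ZMod q) (j : ZMod q) : SampleReg n m → ZMod q :=
  Sum.elim a (Sum.elim y fun _ => j)

theorem sampleReg_eta (x : SampleReg n m → ZMod q) :
    sampleReg (fun l => x (Sum.inl l)) (fun j => x (Sum.inr (Sum.inl j)))
      (x (Sum.inr (Sum.inr ()))) = x := by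
  funext r
  rcases r with l | j | u <;> rfl

/-- The state after the preparation, seen on the wires of the algorithm for samples, when the
registers hold the classical values `a` and `y`. -/
theorem slweWire_slice (A : Matrix (Fin n) (Fin m) (ZMod q)) (b : Fin m → ZMod q)
    (a : Fin ℓ → Fin n → ZMod q) (y : Fin ℓ → Fin m → ZMod q) (r : ℕ)
    (Ψ : (SampleReg n m → ZMod q) → ℂ) (F : (PrepReg n m ℓ → ZMod q) → ℂ)
    (hF : ∀ x, Consistent A b x → F x = ∏ i, Ψ fun r => x (Sum.inr (i, r)))
    (hF' : ∀ x, ¬ Consistent A b x → F x = 0) (c : SLWEWires n m q ℓ → Bool) (t : Fin r → Bool) :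
    encState F (Function.extend (slweWire r) (Sum.elim c t) (trialBits A b a y r) ∘ prepWire r) =
      slweState A a y (fun j => ∏ i, Ψ (sampleReg (a i) (y i) (j i))) c := by
  set v := Function.extend (slweWire r) (Sum.elim c t) (trialBits A b a y r) with hv
  have hv₁ : ∀ p, v (slweWire r p) = Sum.elim c t p := fun p =>
    (slweWire_injective r).extend_apply _ _ p
  have hv₂ : ∀ p, (∀ p', slweWire r p' ≠ p) → v p = trialBits A b a y r p := fun p hp =>
    Function.extend_apply' _ _ _ (by simpa using hp)
  have hvA : ∀ p k, v (prepWire r (Sum.inl (Sum.inl (Sum.inl p)), k)) = enc (A p.1 p.2) k :=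
    fun p k => hv₂ _ (by
      rintro ((⟨p, k⟩ | ⟨i, ⟨l, k⟩ | ⟨j, k⟩ | k⟩) | t) <;> simp [slweWire, prepWire])
  have hvb : ∀ j k, v (prepWire r (Sum.inl (Sum.inl (Sum.inr j)), k)) = enc (b j) k :=
    fun p k => hv₂ _ (by
      rintro ((⟨p, k⟩ | ⟨i, ⟨l, k⟩ | ⟨j, k⟩ | k⟩) | t) <;> simp [slweWire, prepWire])
  have hva : ∀ i l k, v (prepWire r (Sum.inl (Sum.inr (Sum.inr (i, Sum.inl l))), k)) =
      enc (a i l) k :=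
    fun i l k => hv₂ _ (by
      rintro ((⟨p, k⟩ | ⟨i, ⟨l, k⟩ | ⟨j, k⟩ | k⟩) | t) <;> simp [slweWire, prepWire])
  have hvy : ∀ i j k, v (prepWire r (Sum.inl (Sum.inr (Sum.inr (i, Sum.inr j))), k)) =
      enc (y i j) k :=
    fun i j k => hv₂ _ (by
      rintro ((⟨p, k⟩ | ⟨i, ⟨l, k⟩ | ⟨j, k⟩ | k⟩) | t) <;> simp [slweWire, prepWire])
  have hcA : ∀ p k, v (prepWire r (Sum.inl (Sum.inr (Sum.inl p)), k)) = c (Sum.inl (p, k)) :=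
    fun p k => hv₁ (Sum.inl (Sum.inl (p, k)))
  have hca : ∀ i l k, v (prepWire r (Sum.inr (i, Sum.inl l), k)) =
      c (Sum.inr (i, Sum.inl (l, k))) := fun i l k => hv₁ (Sum.inl (Sum.inr (i, Sum.inl (l, k))))
  have hcy : ∀ i j k, v (prepWire r (Sum.inr (i, Sum.inr (Sum.inl j)), k)) =
      c (Sum.inr (i, Sum.inr (Sum.inl (j, k)))) :=
    fun i j k => hv₁ (Sum.inl (Sum.inr (i, Sum.inr (Sum.inl (j, k)))))
  have hcj : ∀ i k, v (prepWire r (Sum.inr (i, Sum.inr (Sum.inr ())), k)) =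
      c (Sum.inr (i, Sum.inr (Sum.inr k))) :=
    fun i k => hv₁ (Sum.inl (Sum.inr (i, Sum.inr (Sum.inr k))))
  by_cases hc : ∃ j, c = slweBits A a y j
  · obtain ⟨j, rfl⟩ := hc
    let x : PrepReg n m ℓ → ZMod q := Sum.elim
      (Sum.elim (Sum.elim (fun p => A p.1 p.2) b) (Sum.elim (fun p => A p.1 p.2) fun p =>
        Sum.elim (a p.1) (y p.1) p.2)) fun p => sampleReg (a p.1) (y p.1) (j p.1) p.2
    have hx : v ∘ prepWire r = encVec x := by
      funext ⟨p, k⟩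
      rw [Function.comp_apply]
      rcases p with ((p | j) | p | ⟨i, l | j⟩) | ⟨i, l | j | u⟩
      exacts [hvA p k, hvb j k, hcA p k, hva i l k, hvy i j k, hca i l k, hcy i j k, hcj i k]
    rw [hx, encState_apply, slweState_apply, hF]
    · rfl
    · exact ⟨fun _ => rfl, fun _ => rfl, fun _ => rfl, fun _ _ => rfl, fun _ _ => rfl⟩
  · rw [not_exists] at hc
    rw [slweState_of_ne A a y _ hc]
    by_contra hne
    have hex : ∃ x : PrepReg n m ℓ → ZMod q, encVec x = v ∘ prepWire r := by
      by_contra h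
      exact hne (encState_of_notMem _ (not_exists.1 h))
    obtain ⟨x, hx⟩ := hex
    rw [← hx, encState_apply] at hne
    have hcons : Consistent A b x := by
      by_contra h
      exact hne (hF' x h)
    have hx' : ∀ p k, enc (x p) k = v (prepWire r (p, k)) := fun p k => congrFun hx (p, k)
    obtain ⟨-, -, h3, h4, h5⟩ := hcons
    refine hc (fun i => x (Sum.inr (i, Sum.inr (Sum.inr ())))) (funext fun p => ?_)
    rcases p with ⟨p, k⟩ | ⟨i, ⟨l, k⟩ | ⟨j, k⟩ | k⟩
    · rw [← hcA, ← hx', h3]; rfl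
    · rw [← hca, ← hx', ← h4, hx', hva]; rfl
    · rw [← hcy, ← hx', ← h5, hx', hvy]; rfl
    · rw [← hcj, ← hx']; rfl

theorem trialBits_injective (A : Matrix (Fin n) (Fin m) (ZMod q)) (b : Fin m → ZMod q) (r : ℕ)
    {a a' : Fin ℓ → Fin n → ZMod q} {y y' : Fin ℓ → Fin m → ZMod q}
    {c c' : SLWEWires n m q ℓ ⊕ Fin r → Bool}
    (h : Function.extend (slweWire r) c (trialBits A b a y r) =
      Function.extend (slweWire r) c' (trialBits A b a' y' r)) : a = a' ∧ y = y' ∧ c = c' := by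
  have h₂ : ∀ p, (∀ p', slweWire r p' ≠ p) → trialBits A b a y r p = trialBits A b a' y' r p := by
    intro p hp
    have := congrFun h p
    rwa [Function.extend_apply' _ _ _ (by simpa using hp),
      Function.extend_apply' _ _ _ (by simpa using hp)] at this
  refine ⟨funext fun i => funext fun l => enc_injective (funext fun k => ?_),
    funext fun i => funext fun j => enc_injective (funext fun k => ?_), funext fun p => ?_⟩
  · exact h₂ (Sum.inr (Sum.inl (Sum.inl (Sum.inr (i, Sum.inl l)), k)))
      (by rintro ((⟨p, k⟩ | ⟨i, ⟨l, k⟩ | ⟨j, k⟩ | k⟩) | t) <;> simp [slweWire])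
  · exact h₂ (Sum.inr (Sum.inl (Sum.inl (Sum.inr (i, Sum.inr j)), k)))
      (by rintro ((⟨p, k⟩ | ⟨i, ⟨l, k⟩ | ⟨j, k⟩ | k⟩) | t) <;> simp [slweWire])
  · have := congrFun h (slweWire r p)
    rwa [(slweWire_injective r).extend_apply, (slweWire_injective r).extend_apply] at this

open Classical in
/-- Samples are prepared from `A` and `b`, their parts `a` and `y` are copied, which has
the effect of a measurement, and `Q` is run on them. The probability of an output is at least
the sum, over the values of `a` and `y`, of the probabilities in the corresponding branches. -/
theorem exists_trial (hq : 2 < q) (g h : ZMod q → ℂ) (hg : ∑ x, ‖g x‖ ^ 2 = 1)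
    (hh : ∑ x, ‖h x‖ ^ 2 = 1) (δ : Fin m → ZMod q)
    (Q : Circuit (SLWEWires n m q ℓ) (Fin n × ZReg q)) :
    ∃ C : Circuit (LWEWires n m q) (Fin n × ZReg q),
      C.size ≤ (2 * Fintype.card (PrepReg n m ℓ) + (ℓ * (m * (n + 1)) +
        (n * m + ℓ * (n + m)))) * 72 ^ (3 * Nat.clog 2 q) + Q.size ∧
      ∀ A b o, ∑ a, ∑ y, Q.prob (slweState A a y fun j => ∏ i,
          (fourierSample n m q).mulVec (mixedSample g h A (b + δ)) (sampleReg (a i) (y i) (j i))) o ≤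
        C.prob (basisState (Sum.elim (encMat A) (encVec b))) o := by
  obtain ⟨gs, hlen, hgs⟩ := exists_prepare (n := n) (m := m) (ℓ := ℓ) hq g h hg hh δ
  let gs' := gs.map (Gate.map (prepWire Q.anc) (prepWire_injective Q.anc)) ++
    Q.gates.map (Gate.map (slweWire Q.anc) (slweWire_injective Q.anc))
  refine ⟨ofGates gs' fun o => slweWire Q.anc (Q.out o), ?_, fun A b o => ?_⟩
  · rw [size_ofGates]
    simp only [gs', List.length_append, List.length_map]
    exact Nat.add_le_add_right hlen _
  set ψ₀ : (LWEWires n m q ⊕ TrialAnc n m q ℓ Q.anc → Bool) → ℂ :=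
    withZero (basisState (Sum.elim (encMat A) (encVec b))) with hψ₀
  -- before the preparation the registers hold `A`, `b` and zeros
  have h₀ : ∀ v : LWEWires n m q ⊕ TrialAnc n m q ℓ Q.anc → Bool, slice (prepWire Q.anc) v ψ₀ =
      (if ∀ t, v (Sum.inr (Sum.inr t)) = false then (1 : ℂ) else 0) •
        encState fun x => if x = startReg A b then 1 else 0 := by
    intro v
    funext d
    have hd₁ : ∀ p, Function.extend (prepWire Q.anc) d v (prepWire Q.anc p) = d p :=
      fun p => (prepWire_injective Q.anc).extend_apply _ _ p
    have hd₂ : ∀ t, Function.extend (prepWire Q.anc) d v (Sum.inr (Sum.inr t)) =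
        v (Sum.inr (Sum.inr t)) := fun t => Function.extend_apply' _ _ _ (by
          rintro ⟨⟨((p | j) | c) | t, k⟩, h⟩ <;> simp [prepWire] at h)
    have hstart : (∀ k, Function.extend (prepWire Q.anc) d v (Sum.inr k) = false) ∧
        (fun i => Function.extend (prepWire Q.anc) d v (Sum.inl i)) =
          Sum.elim (encMat A) (encVec b) ↔
        (∀ t, v (Sum.inr (Sum.inr t)) = false) ∧ d = encVec (startReg (ℓ := ℓ) A b) := by
      constructor
      · rintro ⟨h1, h2⟩
        refine ⟨fun t => by rw [← hd₂]; exact h1 _, funext fun ⟨p, k⟩ => ?_⟩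
        rw [← hd₁]
        rcases p with ((p | j) | c) | t
        · exact congrFun h2 (Sum.inl (p, k))
        · exact congrFun h2 (Sum.inr (j, k))
        · exact (h1 _).trans (enc_zero k).symm
        · exact (h1 _).trans (enc_zero k).symm
      · rintro ⟨h1, rfl⟩
        refine ⟨?_, funext fun i => ?_⟩
        · rintro (⟨c | t, k⟩ | t)
          · exact (hd₁ (Sum.inl (Sum.inr c), k)).trans (enc_zero k)
          · exact (hd₁ (Sum.inr t, k)).trans (enc_zero k)
          · rw [hd₂, h1]
        · rcases i with ⟨p, k⟩ | ⟨j, k⟩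
          · exact hd₁ (Sum.inl (Sum.inl (Sum.inl p)), k)
          · exact hd₁ (Sum.inl (Sum.inl (Sum.inr j)), k)
    have hl : slice (prepWire Q.anc) v ψ₀ d =
        if (∀ k, Function.extend (prepWire Q.anc) d v (Sum.inr k) = false) ∧
          (fun i => Function.extend (prepWire Q.anc) d v (Sum.inl i)) =
          Sum.elim (encMat A) (encVec b) then 1 else 0 := by
      simp only [slice, hψ₀, withZero, basisState, ite_and]
    have hr : encState (fun x => if x = startReg (ℓ := ℓ) A b then (1 : ℂ) else 0) d =
        if d = encVec (startReg (ℓ := ℓ) A b) then 1 else 0 := by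
      by_cases hd : ∃ x : PrepReg n m ℓ → ZMod q, encVec x = d
      · obtain ⟨x, rfl⟩ := hd
        rw [encState_apply]
        simp only [encVec_injective.eq_iff]
      · rw [not_exists] at hd
        rw [encState_of_notMem _ hd, if_neg fun h => hd _ h.symm]
    rw [hl, Pi.smul_apply, hr, smul_eq_mul, ite_zero_mul_ite_zero, one_mul]
    exact if_congr hstart rfl rfl
  set F : (PrepReg n m ℓ → ZMod q) → ℂ := fun x => if Consistent A b x then
    ∏ i, (fourierSample n m q).mulVec (mixedSample g h A (b + δ)) fun r => x (Sum.inr (i, r))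
    else 0 with hF
  have h₁ : ∀ v, run (gs.map (Gate.map (prepWire Q.anc) (prepWire_injective Q.anc))) ψ₀ v =
      (if ∀ t, v (Sum.inr (Sum.inr t)) = false then (1 : ℂ) else 0) *
        encState F (v ∘ prepWire Q.anc) := by
    intro v
    rw [run_map, h₀, run_smul, hgs]
    rfl
  have h₂ : ∀ a y c, run gs' ψ₀ (Function.extend (slweWire Q.anc) c (trialBits A b a y Q.anc)) =
      Q.final (slweState A a y fun j => ∏ i,
        (fourierSample n m q).mulVec (mixedSample g h A (b + δ)) (sampleReg (a i) (y i) (j i))) c := by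
    intro a y c
    rw [Circuit.final_eq_run, run_append, run_map]
    congr 1
    · funext d
      obtain ⟨d₁, d₂, rfl⟩ : ∃ d₁ d₂, d = Sum.elim d₁ d₂ :=
        ⟨d ∘ Sum.inl, d ∘ Sum.inr, (Sum.elim_comp_inl_inr d).symm⟩
      rw [slice, extend_extend (slweWire_injective Q.anc), h₁,
        slweWire_slice A b a y Q.anc _ F (fun x hx => if_pos hx) (fun x hx => if_neg hx) d₁ d₂,
        withZero]
      have : ∀ t, Function.extend (slweWire Q.anc) (Sum.elim d₁ d₂) (trialBits A b a y Q.anc)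
          (Sum.inr (Sum.inr t)) = d₂ t := fun t =>
        (slweWire_injective Q.anc).extend_apply (Sum.elim d₁ d₂) _ (Sum.inr t)
      simp only [this, ite_mul, one_mul, zero_mul, Sum.elim_inr, Sum.elim_inl]
      congr
    · funext p
      exact (slweWire_injective Q.anc).extend_apply _ _ p
  rw [prob_ofGates]
  let ι : ((Fin ℓ → Fin n → ZMod q) × (Fin ℓ → Fin m → ZMod q)) ×
      (SLWEWires n m q ℓ ⊕ Fin Q.anc → Bool) ↪ (LWEWires n m q ⊕ TrialAnc n m q ℓ Q.anc → Bool) :=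
    ⟨fun p => Function.extend (slweWire Q.anc) p.2 (trialBits A b p.1.1 p.1.2 Q.anc), by
      rintro ⟨⟨a, y⟩, c⟩ ⟨⟨a', y'⟩, c'⟩ h
      obtain ⟨rfl, rfl, rfl⟩ := trialBits_injective A b Q.anc h
      rfl⟩
  refine le_trans (le_of_eq ?_) (Finset.sum_le_univ_sum_of_nonneg (s := Finset.univ.map ι) ?_)
  · rw [Finset.sum_map, Fintype.sum_prod_type, Fintype.sum_prod_type]
    refine Finset.sum_congr rfl fun a _ => Finset.sum_congr rfl fun y _ => ?_
    refine Finset.sum_congr rfl fun c _ => ?_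
    have : ∀ p, ι ((a, y), c) (slweWire Q.anc p) = c p := fun p =>
      (slweWire_injective Q.anc).extend_apply _ _ p
    simp only [this]
    rw [show ι ((a, y), c) = Function.extend (slweWire Q.anc) c (trialBits A b a y Q.anc) from rfl,
      h₂]
  · intro v
    split_ifs <;> positivity

end Trial

/-! ### Perturbing the prepared samples -/

section Perturb

theorem Circuit.final_sub {I O : Type} [Fintype I] [DecidableEq I] [Fintype O] (C : Circuit I O)
    (ψ φ : (I → Bool) → ℂ) : C.final (ψ - φ) = C.final ψ - C.final φ := by
  have h : withZero (K := Fin C.anc) (ψ - φ) = withZero ψ - withZero φ := by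
    funext b
    simp only [withZero, Pi.sub_apply]
    split_ifs <;> simp
  rw [Circuit.final_eq_run, Circuit.final_eq_run, Circuit.final_eq_run, h, run_sub]

theorem Circuit.prob_smul {I O : Type} [Fintype I] [DecidableEq I] [Fintype O]
    (C : Circuit I O) (c : ℂ) (ψ : (I → Bool) → ℂ) (o : O → Bool) :
    C.prob (c • ψ) o = ‖c‖ ^ 2 * C.prob ψ o := by
  have h : withZero (K := Fin C.anc) (c • ψ) = c • withZero ψ := by
    funext b
    simp only [withZero, Pi.smul_apply, smul_ite, smul_zero]
  have h' : C.final (c • ψ) = c • C.final ψ := by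
    rw [Circuit.final_eq_run, Circuit.final_eq_run, h, run_smul]
  rw [Circuit.prob, Circuit.prob, h', Finset.mul_sum]
  refine Finset.sum_congr rfl fun b _ => ?_
  rw [Pi.smul_apply, smul_eq_mul, norm_mul, mul_pow, mul_ite, mul_zero]

variable {q : ℕ} [NeZero q] {n m ℓ : ℕ}

theorem slweState_sub (A : Matrix (Fin n) (Fin m) (ZMod q)) (a : Fin ℓ → Fin n → ZMod q)
    (y : Fin ℓ → Fin m → ZMod q) (Φ Φ' : (Fin ℓ → ZMod q) → ℂ) :
    slweState A a y (Φ - Φ') = slweState A a y Φ - slweState A a y Φ' := by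
  funext w
  simp only [slweState, Pi.sub_apply, ← Finset.sum_sub_distrib]
  refine Finset.sum_congr rfl fun j _ => ?_
  split_ifs <;> simp

theorem slweState_smul (A : Matrix (Fin n) (Fin m) (ZMod q)) (a : Fin ℓ → Fin n → ZMod q)
    (y : Fin ℓ → Fin m → ZMod q) (c : ℂ) (Φ : (Fin ℓ → ZMod q) → ℂ) :
    slweState A a y (c • Φ) = c • slweState A a y Φ := by
  funext w
  simp only [slweState, Pi.smul_apply, Finset.smul_sum, smul_ite, smul_zero]

set_option synthInstance.maxSize 512 in
theorem sum_norm_slweState (A : Matrix (Fin n) (Fin m) (ZMod q)) (a : Fin ℓ → Fin n → ZMod q)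
    (y : Fin ℓ → Fin m → ZMod q) (Φ : (Fin ℓ → ZMod q) → ℂ) :
    ∑ w, ‖slweState A a y Φ w‖ ^ 2 = ∑ j, ‖Φ j‖ ^ 2 := by
  refine (Fintype.sum_of_injective (slweBits A a y) (slweBits_injective A a y) _ _ ?_ ?_).symm
  · intro w hw
    rw [slweState_of_ne A a y Φ, norm_zero, zero_pow two_ne_zero]
    rintro j rfl
    exact hw ⟨j, rfl⟩
  · intro j
    rw [slweState_apply]

/-- The contents of the registers of `ℓ` samples, sorted by kind. -/
def sampleEquiv (n m ℓ q : ℕ) [NeZero q] : ((Fin ℓ → Fin n → ZMod q) × (Fin ℓ → Fin m → ZMod q)) ×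
    (Fin ℓ → ZMod q) ≃ (Fin ℓ → SampleReg n m → ZMod q) where
  toFun p i := sampleReg (p.1.1 i) (p.1.2 i) (p.2 i)
  invFun x := ((fun i l => x i (Sum.inl l), fun i j => x i (Sum.inr (Sum.inl j))),
    fun i => x i (Sum.inr (Sum.inr ())))
  left_inv _ := rfl
  right_inv x := funext fun i => sampleReg_eta (x i)

/-- The amplitude on the branch `(a, y)` of a joint state of `ℓ` samples. -/
def branch (Θ : (Fin ℓ → SampleReg n m → ZMod q) → ℂ) (a : Fin ℓ → Fin n → ZMod q)
    (y : Fin ℓ → Fin m → ZMod q) : (Fin ℓ → ZMod q) → ℂ :=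
  fun j => Θ fun i => sampleReg (a i) (y i) (j i)

/-- The probability that `Q` outputs `o` when it is run on a joint state of `ℓ` samples whose
parts `a` and `y` have been measured. -/
def jointProb (Q : Circuit (SLWEWires n m q ℓ) (Fin n × ZReg q))
    (A : Matrix (Fin n) (Fin m) (ZMod q)) (o : Fin n × ZReg q → Bool)
    (Θ : (Fin ℓ → SampleReg n m → ZMod q) → ℂ) : ℝ :=
  ∑ a, ∑ y, Q.prob (slweState A a y (branch Θ a y)) o

theorem jointProb_nonneg (Q : Circuit (SLWEWires n m q ℓ) (Fin n × ZReg q))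
    (A : Matrix (Fin n) (Fin m) (ZMod q)) (o : Fin n × ZReg q → Bool)
    (Θ : (Fin ℓ → SampleReg n m → ZMod q) → ℂ) : 0 ≤ jointProb Q A o Θ :=
  Finset.sum_nonneg fun _ _ => Finset.sum_nonneg fun _ _ => Circuit.prob_nonneg _ _ _

set_option synthInstance.maxSize 512 in
theorem jointProb_le (Q : Circuit (SLWEWires n m q ℓ) (Fin n × ZReg q))
    (A : Matrix (Fin n) (Fin m) (ZMod q)) (o : Fin n × ZReg q → Bool)
    (Θ : (Fin ℓ → SampleReg n m → ZMod q) → ℂ) : jointProb Q A o Θ ≤ ∑ x, ‖Θ x‖ ^ 2 := by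
  rw [← (sampleEquiv n m ℓ q).sum_comp, Fintype.sum_prod_type, Fintype.sum_prod_type]
  refine Finset.sum_le_sum fun a _ => Finset.sum_le_sum fun y _ => ?_
  refine (Circuit.prob_le _ _ _).trans ?_
  rw [sum_norm_slweState]
  rfl

theorem sqrt_jointProb_le (Q : Circuit (SLWEWires n m q ℓ) (Fin n × ZReg q))
    (A : Matrix (Fin n) (Fin m) (ZMod q)) (o : Fin n × ZReg q → Bool)
    (Θ Θ' : (Fin ℓ → SampleReg n m → ZMod q) → ℂ) :
    Real.sqrt (jointProb Q A o Θ') ≤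
      Real.sqrt (jointProb Q A o Θ) + Real.sqrt (jointProb Q A o (Θ' - Θ)) := by
  -- the probability is the squared norm of a vector that depends linearly on the state
  let amp : ((Fin ℓ → SampleReg n m → ZMod q) → ℂ) →
      ((Fin ℓ → Fin n → ZMod q) × (Fin ℓ → Fin m → ZMod q)) ×
        (SLWEWires n m q ℓ ⊕ Fin Q.anc → Bool) → ℂ := fun Θ p =>
    if (fun j => p.2 (Q.out j)) = o then
      Q.final (slweState A p.1.1 p.1.2 (branch Θ p.1.1 p.1.2)) p.2 else 0
  have hamp : ∀ Θ, ∑ p, ‖amp Θ p‖ ^ 2 = jointProb Q A o Θ := by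
    intro Θ
    rw [Fintype.sum_prod_type, Fintype.sum_prod_type, jointProb]
    refine Finset.sum_congr rfl fun a _ => Finset.sum_congr rfl fun y _ => ?_
    rw [Circuit.prob]
    refine Finset.sum_congr rfl fun b _ => ?_
    have : amp Θ ((a, y), b) = if (fun j => b (Q.out j)) = o then
      Q.final (slweState A a y (branch Θ a y)) b else 0 := rfl
    rw [this]
    by_cases h : (fun j => b (Q.out j)) = o
    · rw [if_pos h, if_pos h]
    · rw [if_neg h, if_neg h, norm_zero, zero_pow two_ne_zero]
  have hamp' : ∀ p, amp (Θ' - Θ) p = amp Θ' p - amp Θ p := by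
    intro p
    have : branch (Θ' - Θ) p.1.1 p.1.2 = branch Θ' p.1.1 p.1.2 - branch Θ p.1.1 p.1.2 := rfl
    simp only [amp]
    rw [this, slweState_sub, Circuit.final_sub]
    by_cases h : (fun j => p.2 (Q.out j)) = o
    · rw [if_pos h, if_pos h, if_pos h, Pi.sub_apply]
    · rw [if_neg h, if_neg h, if_neg h, sub_zero]
  clear_value amp
  have htri : ∀ {P : Type} [Fintype P] (u v : P → ℂ), Real.sqrt (∑ p, ‖u p‖ ^ 2) ≤
      Real.sqrt (∑ p, ‖v p‖ ^ 2) + Real.sqrt (∑ p, ‖u p - v p‖ ^ 2) := by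
    intro P _ u v
    have := norm_add_le (WithLp.toLp 2 v : EuclideanSpace ℂ P) (WithLp.toLp 2 (u - v))
    rw [← WithLp.toLp_add, add_sub_cancel] at this
    simpa only [EuclideanSpace.norm_eq, Pi.sub_apply] using this
  rw [← hamp, ← hamp, ← hamp]
  simp only [hamp']
  exact htri _ _

/-- The probability of an output changes by at most twice the distance of the states. -/
theorem jointProb_ge (Q : Circuit (SLWEWires n m q ℓ) (Fin n × ZReg q))
    (A : Matrix (Fin n) (Fin m) (ZMod q)) (o : Fin n × ZReg q → Bool)
    (Θ Θ' : (Fin ℓ → SampleReg n m → ZMod q) → ℂ) (hΘ' : ∑ x, ‖Θ' x‖ ^ 2 = 1) :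
    jointProb Q A o Θ' - 2 * Real.sqrt (∑ x, ‖Θ' x - Θ x‖ ^ 2) ≤ jointProb Q A o Θ := by
  have h1 := sqrt_jointProb_le Q A o Θ Θ'
  have h2 : Real.sqrt (jointProb Q A o (Θ' - Θ)) ≤ Real.sqrt (∑ x, ‖Θ' x - Θ x‖ ^ 2) :=
    Real.sqrt_le_sqrt (jointProb_le Q A o (Θ' - Θ))
  have h3 : jointProb Q A o Θ' ≤ 1 := hΘ' ▸ jointProb_le Q A o Θ'
  have h4 := Real.sq_sqrt (jointProb_nonneg Q A o Θ)
  have h5 := Real.sq_sqrt (jointProb_nonneg Q A o Θ')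
  have h6 := Real.sqrt_nonneg (jointProb Q A o Θ)
  have h7 := Real.sqrt_nonneg (jointProb Q A o Θ')
  have h8 : Real.sqrt (jointProb Q A o Θ') ≤ 1 := Real.sqrt_le_one.2 h3
  have h9 := Real.sqrt_nonneg (∑ x, ‖Θ' x - Θ x‖ ^ 2)
  set u := Real.sqrt (jointProb Q A o Θ)
  set v := Real.sqrt (jointProb Q A o Θ')
  set d := Real.sqrt (∑ x, ‖Θ' x - Θ x‖ ^ 2)
  rcases le_or_gt v d with h | h
  · nlinarith
  · nlinarith [mul_nonneg h9 h9, mul_nonneg h9 (sub_nonneg.2 h8)]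

/-- Replacing each of the `ℓ` samples by a state with overlap at least `1 - ε` changes the
probability of an output by at most `2 √(2 ℓ ε)`. -/
theorem jointProb_prod_ge (Q : Circuit (SLWEWires n m q ℓ) (Fin n × ZReg q))
    (A : Matrix (Fin n) (Fin m) (ZMod q)) (o : Fin n × ZReg q → Bool)
    (Ψ Ψ' : (SampleReg n m → ZMod q) → ℂ) (hΨ : ∑ x, ‖Ψ x‖ ^ 2 = 1) (hΨ' : ∑ x, ‖Ψ' x‖ ^ 2 = 1)
    (ω ε : ℝ) (hω : ∑ x, star (Ψ x) * Ψ' x = ω) (hε : 1 - ε ≤ ω) (hε1 : ε ≤ 1) :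
    jointProb Q A o (fun x => ∏ i, Ψ' (x i)) - 2 * Real.sqrt (2 * ℓ * ε) ≤
      jointProb Q A o (fun x => ∏ i, Ψ (x i)) := by
  have hunit : ∀ Ψ : (SampleReg n m → ZMod q) → ℂ, ∑ x, ‖Ψ x‖ ^ 2 = 1 →
      ∑ x : Fin ℓ → SampleReg n m → ZMod q, ‖∏ i, Ψ (x i)‖ ^ 2 = 1 := by
    intro Ψ hΨ
    have := Finset.prod_univ_sum (fun _ : Fin ℓ => Finset.univ)
      fun (_ : Fin ℓ) (x : SampleReg n m → ZMod q) => ‖Ψ x‖ ^ 2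
    rw [hΨ, Finset.prod_const_one, Fintype.piFinset_univ] at this
    rw [this]
    simp only [norm_prod, Finset.prod_pow]
  have hover : ∑ x : Fin ℓ → SampleReg n m → ZMod q,
      star (∏ i, Ψ (x i)) * ∏ i, Ψ' (x i) = ((ω ^ ℓ : ℝ) : ℂ) := by
    have := Finset.prod_univ_sum (fun _ : Fin ℓ => Finset.univ)
      fun (_ : Fin ℓ) (x : SampleReg n m → ZMod q) => star (Ψ x) * Ψ' x
    rw [hω, Finset.prod_const, Finset.card_univ, Fintype.card_fin, Fintype.piFinset_univ] at this
    rw [Complex.ofReal_pow, this]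
    simp only [star_prod, Finset.prod_mul_distrib]
  have hdist : ∑ x : Fin ℓ → SampleReg n m → ZMod q, ‖∏ i, Ψ' (x i) - ∏ i, Ψ (x i)‖ ^ 2 ≤
      2 * ℓ * ε := by
    have h1 : ∀ u v : ℂ, ‖u - v‖ ^ 2 = ‖u‖ ^ 2 + ‖v‖ ^ 2 - 2 * (star v * u).re := by
      intro u v
      rw [← Complex.normSq_eq_norm_sq, ← Complex.normSq_eq_norm_sq, ← Complex.normSq_eq_norm_sq,
        Complex.normSq_sub, mul_comm (star v)]
      rfl
    simp only [h1]
    rw [Finset.sum_sub_distrib, Finset.sum_add_distrib, hunit Ψ hΨ, hunit Ψ' hΨ',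
      ← Finset.mul_sum, ← Complex.re_sum, hover, Complex.ofReal_re]
    have hpow : 1 - ℓ * ε ≤ ω ^ ℓ := by
      have h2 : (1 - ε) ^ ℓ ≤ ω ^ ℓ := pow_le_pow_left₀ (by linarith) hε ℓ
      have h3 := one_add_mul_le_pow (a := -ε) (by linarith) ℓ
      rw [← sub_eq_add_neg] at h3
      linarith
    linarith
  refine le_trans ?_ (jointProb_ge Q A o _ (fun x => ∏ i, Ψ' (x i)) (hunit Ψ' hΨ'))
  have := Real.sqrt_le_sqrt hdist
  linarith

end Perturb

/-! ### Gaussian sums -/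

section Gauss

/-- The Gaussian function `exp(-π x² / s²)`. -/
def gauss (s x : ℝ) : ℝ := Real.exp (-Real.pi * x ^ 2 / s ^ 2)

/-- The sum of the Gaussian function of width `s` over the integers. -/
def gaussSum (s : ℝ) : ℝ := ∑' k : ℤ, gauss s k

theorem gauss_pos (s x : ℝ) : 0 < gauss s x := Real.exp_pos _

theorem gauss_zero (s : ℝ) : gauss s 0 = 1 := by simp [gauss]

theorem summable_gauss {s : ℝ} (hs : 0 < s) (c : ℝ) : Summable fun k : ℤ => gauss s (k - c) := by
  have h := summable_pow_mul_jacobiTheta₂_term_bound (|c| / s ^ 2) (T := 1 / s ^ 2)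
    (by positivity) 0
  refine Summable.of_nonneg_of_le (fun k => (gauss_pos _ _).le) (fun k => ?_) h
  rw [pow_zero, one_mul, gauss, Real.exp_le_exp]
  have h1 : c * k ≤ |c| * |(k : ℝ)| := by
    rw [← abs_mul]; exact le_abs_self _
  have h2 : -Real.pi * ((k : ℝ) - c) ^ 2 / s ^ 2 = -Real.pi * (1 / s ^ 2 * k ^ 2 -
      2 * (c * k) / s ^ 2) - Real.pi * c ^ 2 / s ^ 2 := by field_simp; ring
  have h3 : 0 ≤ Real.pi * c ^ 2 / s ^ 2 := by positivity
  have h4 : 2 * (c * k) / s ^ 2 ≤ 2 * (|c| / s ^ 2) * |(k : ℝ)| := by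
    rw [show 2 * (|c| / s ^ 2) * |(k : ℝ)| = 2 * (|c| * |(k : ℝ)|) / s ^ 2 by ring]
    gcongr
  rw [h2]
  push_cast
  nlinarith [Real.pi_pos, mul_le_mul_of_nonneg_left h4 Real.pi_pos.le]

theorem summable_gauss_zero {s : ℝ} (hs : 0 < s) : Summable fun k : ℤ => gauss s k := by
  simpa using summable_gauss hs 0

theorem one_le_gaussSum {s : ℝ} (hs : 0 < s) : 1 ≤ gaussSum s := by
  have := (summable_gauss_zero hs).le_tsum 0 fun k _ => (gauss_pos s k).le
  rwa [Int.cast_zero, gauss_zero] at this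

theorem gaussSum_pos {s : ℝ} (hs : 0 < s) : 0 < gaussSum s :=
  one_pos.trans_le (one_le_gaussSum hs)

theorem gauss_poisson {s : ℝ} (hs : 0 < s) (c τ : ℝ) :
    ∑' k : ℤ, (gauss s (k - c) : ℂ) * Complex.exp (-(2 * Real.pi * Complex.I * k * τ)) =
      s * ∑' n : ℤ, (gauss (1 / s) (n + τ) : ℂ) *
        Complex.exp (-(2 * Real.pi * Complex.I * c * (n + τ))) := by
  have hs2 : (s : ℂ) ≠ 0 := by exact_mod_cast hs.ne'
  have ha : 0 < ((1 / s ^ 2 : ℝ) : ℂ).re := by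
    rw [Complex.ofReal_re]; positivity
  have h := Complex.tsum_exp_neg_quadratic ha (c / s ^ 2 - Complex.I * τ)
  have hpow : (((1 / s ^ 2 : ℝ) : ℂ)) ^ (1 / 2 : ℂ) = 1 / s := by
    have : ((1 / 2 : ℝ) : ℂ) = (1 / 2 : ℂ) := by push_cast; rfl
    rw [← this, ← Complex.ofReal_cpow (by positivity), ← Real.sqrt_eq_rpow, Real.sqrt_div zero_le_one,
      Real.sqrt_one, Real.sqrt_sq hs.le]
    push_cast; rfl
  rw [hpow] at h
  have hl : ∀ k : ℤ, (gauss s (k - c) : ℂ) * Complex.exp (-(2 * Real.pi * Complex.I * k * τ)) =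
      Complex.exp (-Real.pi * c ^ 2 / s ^ 2) * Complex.exp (-Real.pi * ((1 / s ^ 2 : ℝ) : ℂ) * k ^ 2 +
        2 * Real.pi * (c / s ^ 2 - Complex.I * τ) * k) := by
    intro k
    rw [gauss, Complex.ofReal_exp, ← Complex.exp_add, ← Complex.exp_add]
    congr 1
    push_cast
    field_simp
    ring
  have hr : ∀ k : ℤ, Complex.exp (-Real.pi * c ^ 2 / s ^ 2) *
      Complex.exp (-Real.pi / ((1 / s ^ 2 : ℝ) : ℂ) *
        (k + Complex.I * (c / s ^ 2 - Complex.I * τ)) ^ 2) =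
      (gauss (1 / s) (k + τ) : ℂ) * Complex.exp (-(2 * Real.pi * Complex.I * c * (k + τ))) := by
    intro k
    rw [gauss, Complex.ofReal_exp, ← Complex.exp_add, ← Complex.exp_add]
    congr 1
    have e : (k + Complex.I * (c / s ^ 2 - Complex.I * τ)) = (k + τ + Complex.I * (c / s ^ 2) : ℂ) := by
      linear_combination (-τ : ℂ) * Complex.I_mul_I
    rw [e]
    push_cast
    field_simp
    linear_combination (-c ^ 2 : ℂ) * Complex.I_sq
  simp only [hl]
  rw [tsum_mul_left, h, ← mul_assoc, mul_comm (Complex.exp _) _, mul_assoc, ← tsum_mul_left]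
  simp only [hr]
  rw [one_div_one_div]

/-- Poisson summation for a shifted Gaussian, in real form. -/
theorem gauss_shift_sum_eq {s : ℝ} (hs : 0 < s) (c : ℝ) :
    ∑' k : ℤ, gauss s (k - c) =
      s * ∑' n : ℤ, gauss (1 / s) n * Real.cos (2 * Real.pi * c * n) := by
  have h := gauss_poisson hs c 0
  simp only [Complex.ofReal_zero, mul_zero, neg_zero, Complex.exp_zero, mul_one, add_zero] at h
  have h1 : ∀ n : ℤ, ‖(gauss (1 / s) n : ℂ) * Complex.exp (-(2 * Real.pi * Complex.I * c * n))‖ =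
      gauss (1 / s) n := by
    intro n
    rw [norm_mul, Complex.norm_real, Real.norm_of_nonneg (gauss_pos _ _).le,
      show -(2 * Real.pi * Complex.I * c * n) = ((-(2 * Real.pi * c * n) : ℝ) : ℂ) * Complex.I by
        push_cast; ring, Complex.norm_exp_ofReal_mul_I, mul_one]
  have h2 : Summable fun n : ℤ => (gauss (1 / s) n : ℂ) *
      Complex.exp (-(2 * Real.pi * Complex.I * c * n)) := by
    refine Summable.of_norm ?_
    simp only [h1]
    exact summable_gauss_zero (by positivity)
  have h3 := congrArg Complex.re h
  rw [← Complex.ofReal_tsum, Complex.ofReal_re, Complex.re_ofReal_mul, Complex.re_tsum h2] at h3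
  rw [h3]
  congr 1
  refine tsum_congr fun n => ?_
  rw [Complex.re_ofReal_mul, show -(2 * Real.pi * Complex.I * c * n) =
    ((-(2 * Real.pi * c * n) : ℝ) : ℂ) * Complex.I by push_cast; ring,
    Complex.exp_ofReal_mul_I_re, Real.cos_neg]

theorem gaussSum_inv {s : ℝ} (hs : 0 < s) : gaussSum s = s * gaussSum (1 / s) := by
  have := gauss_shift_sum_eq hs 0
  simpa [gaussSum] using this

theorem summable_gauss_cos {s : ℝ} (hs : 0 < s) (c : ℝ) :
    Summable fun n : ℤ => gauss s n * Real.cos (2 * Real.pi * c * n) := by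
  refine Summable.of_norm_bounded (summable_gauss_zero hs) fun n => ?_
  rw [norm_mul, Real.norm_of_nonneg (gauss_pos _ _).le]
  exact mul_le_of_le_one_right (gauss_pos _ _).le (Real.abs_cos_le_one _)

/-- By Poisson summation, the sum of a shifted Gaussian is `s` up to terms bounded by those of
`gaussSum (1 / s)`, whatever the shift. -/
theorem gauss_shift_sum_le {s : ℝ} (hs : 0 < s) (c : ℝ) :
    ∑' k : ℤ, gauss s (k - c) ≤ s * gaussSum (1 / s) := by
  rw [gauss_shift_sum_eq hs]
  refine mul_le_mul_of_nonneg_left ?_ hs.le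
  exact (summable_gauss_cos (by positivity) c).tsum_le_tsum (fun n =>
    mul_le_of_le_one_right (gauss_pos _ _).le (Real.cos_le_one _))
    (summable_gauss_zero (by positivity))

theorem le_gauss_shift_sum {s : ℝ} (hs : 0 < s) (c : ℝ) :
    s * (2 - gaussSum (1 / s)) ≤ ∑' k : ℤ, gauss s (k - c) := by
  rw [gauss_shift_sum_eq hs]
  refine mul_le_mul_of_nonneg_left ?_ hs.le
  have hs' : 0 < 1 / s := by positivity
  have h1 : HasSum (fun n : ℤ => if n = 0 then (2 : ℝ) else 0) 2 := by
    simpa using hasSum_ite_eq (0 : ℤ) (2 : ℝ)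
  rw [gaussSum, ← (h1.sub (summable_gauss_zero hs').hasSum).tsum_eq]
  refine (h1.sub (summable_gauss_zero hs').hasSum).summable.tsum_le_tsum (fun n => ?_)
    (summable_gauss_cos hs' c)
  by_cases hn : n = 0
  · subst hn
    norm_num [gauss_zero]
  · rw [if_neg hn]
    nlinarith [gauss_pos (1 / s) n, Real.neg_one_le_cos (2 * Real.pi * c * n)]

theorem gaussSum_mono {s t : ℝ} (hs : 0 < s) (hst : s ≤ t) : gaussSum s ≤ gaussSum t := by
  refine (summable_gauss_zero hs).tsum_le_tsum (fun n => ?_) (summable_gauss_zero (hs.trans_le hst))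
  rw [gauss, gauss, Real.exp_le_exp, neg_mul, neg_div, neg_div, neg_le_neg_iff]
  gcongr

theorem gaussSum_sqrt_two_mul_le {s : ℝ} (hs : 0 < s) :
    gaussSum (Real.sqrt 2 * s) ≤ Real.sqrt 2 * gaussSum s := by
  have h2 : (1 : ℝ) ≤ Real.sqrt 2 := Real.one_le_sqrt.2 one_le_two
  rw [gaussSum_inv (by positivity), gaussSum_inv hs, mul_assoc]
  have : gaussSum (1 / (Real.sqrt 2 * s)) ≤ gaussSum (1 / s) := by
    refine gaussSum_mono (by positivity) ?_
    gcongr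
    nlinarith
  gcongr

/-- The sum over the integers is close to the term at `0` for small widths. -/
theorem gaussSum_sub_one_le {s : ℝ} (hs : 0 < s) (hs1 : s ≤ 1) :
    gaussSum s ≤ 1 + gaussSum 1 * Real.exp (-Real.pi * (1 / s ^ 2 - 1)) := by
  have h1 : HasSum (fun n : ℤ => if n = 0 then (1 : ℝ) else 0) 1 := by
    simpa using hasSum_ite_eq (0 : ℤ) (1 : ℝ)
  have h2 := (summable_gauss_zero one_pos).hasSum.mul_right
    (Real.exp (-Real.pi * (1 / s ^ 2 - 1)))
  rw [gaussSum, gaussSum, ← (h1.add h2).tsum_eq]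
  refine (summable_gauss_zero hs).tsum_le_tsum (fun n => ?_) (h1.add h2).summable
  by_cases hn : n = 0
  · subst hn
    rw [Int.cast_zero, gauss_zero, if_pos rfl]
    have := mul_pos (gauss_pos 1 0) (Real.exp_pos (-Real.pi * (1 / s ^ 2 - 1)))
    linarith
  · rw [if_neg hn, zero_add, gauss, gauss, ← Real.exp_add, Real.exp_le_exp]
    have h3 : (1 : ℝ) ≤ (n : ℝ) ^ 2 := by
      have : 1 ≤ n ^ 2 := by nlinarith [Int.one_le_abs hn, sq_abs n]
      exact_mod_cast this
    have h4 : 0 ≤ 1 / s ^ 2 - 1 := by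
      rw [sub_nonneg, le_div_iff₀ (by positivity)]
      nlinarith
    have h5 : 0 ≤ Real.pi * (((n : ℝ) ^ 2 - 1) * (1 / s ^ 2 - 1)) := by
      have := Real.pi_pos
      have := sub_nonneg.2 h3
      positivity
    have h6 : -Real.pi * (n : ℝ) ^ 2 / s ^ 2 = -Real.pi * ((n : ℝ) ^ 2 * (1 / s ^ 2)) := by ring
    rw [h6]
    nlinarith

theorem hasSum_prod_fin {m : ℕ} (f : Fin m → ℤ → ℝ) (hf0 : ∀ j k, 0 ≤ f j k)
    (hf : ∀ j, Summable (f j)) :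
    HasSum (fun z : Fin m → ℤ => ∏ j, f j (z j)) (∏ j, ∑' k, f j k) := by
  induction m with
  | zero =>
    simp
  | succ m ih =>
    have h1 : HasSum (fun z : Fin m → ℤ => ∏ j, f j.succ (z j)) (∏ j : Fin m, ∑' k, f j.succ k) :=
      ih (fun j => f j.succ) (fun j => hf0 _) (fun j => hf _)
    have h3 : (0 : ℤ → ℝ) ≤ f 0 := fun k => hf0 0 k
    have h4 : (0 : (Fin m → ℤ) → ℝ) ≤ fun z => ∏ j, f j.succ (z j) :=
      fun z => Finset.prod_nonneg fun j _ => hf0 _ _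
    have h5 := Summable.mul_of_nonneg (hf 0) h1.summable h3 h4
    have h2 := (hf 0).hasSum.mul h1 h5
    rw [Fin.prod_univ_succ]
    refine ((Fin.consEquiv fun _ : Fin (m + 1) => ℤ).hasSum_iff).1 ?_
    have h6 : (fun z : Fin (m + 1) → ℤ => ∏ j, f j (z j)) ∘
        (Fin.consEquiv fun _ : Fin (m + 1) => ℤ) =
        fun x : ℤ × (Fin m → ℤ) => f 0 x.1 * ∏ j, f j.succ (x.2 j) := by
      funext p
      rw [Function.comp_apply, Fin.prod_univ_succ]
      rfl
    rw [h6]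
    exact h2

theorem rho_toE {m : ℕ} (s : ℝ) (z : Fin m → ℤ) : rho s (toE z) = ∏ j, gauss s (z j) := by
  simp only [rho, gauss]
  rw [← Real.exp_sum, EuclideanSpace.norm_sq_eq, Finset.mul_sum, Finset.sum_div]
  congr 1
  refine Finset.sum_congr rfl fun j _ => ?_
  rw [Real.norm_eq_abs, sq_abs]
  rfl

theorem hasSum_rho_toE {m : ℕ} {s : ℝ} (hs : 0 < s) :
    HasSum (fun z : Fin m → ℤ => rho s (toE z)) (gaussSum s ^ m) := by
  simp only [rho_toE]
  have := hasSum_prod_fin (fun (_ : Fin m) (k : ℤ) => gauss s k) (fun _ _ => (gauss_pos _ _).le)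
    fun _ => summable_gauss_zero hs
  rwa [Finset.prod_const, Finset.card_univ, Fintype.card_fin] at this

/-- Far from the origin, a Gaussian is much smaller than the Gaussian of width `√2 s`. -/
theorem exp_le_of_tail {s : ℝ} (hs : 0 < s) {T x : ℝ} (h : T * s ^ 2 < x ^ 2) :
    Real.exp (-Real.pi * x ^ 2 / s ^ 2) ≤
      Real.exp (-Real.pi * T / 2) * Real.exp (-Real.pi * x ^ 2 / (Real.sqrt 2 * s) ^ 2) := by
  rw [← Real.exp_add, Real.exp_le_exp, mul_pow, Real.sq_sqrt zero_le_two]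
  have h1 : T ≤ x ^ 2 / s ^ 2 := by
    rw [le_div_iff₀ (by positivity)]; exact h.le
  have h2 : -Real.pi * x ^ 2 / (2 * s ^ 2) = -Real.pi * (x ^ 2 / s ^ 2) / 2 := by field_simp
  have h3 : -Real.pi * x ^ 2 / s ^ 2 = -Real.pi * (x ^ 2 / s ^ 2) := by field_simp
  rw [h2, h3]
  nlinarith [Real.pi_pos, mul_le_mul_of_nonneg_left h1 Real.pi_pos.le]

theorem gaussSum_sqrt_two_pow_le {m : ℕ} {s : ℝ} (hs : 0 < s) :
    gaussSum (Real.sqrt 2 * s) ^ m ≤ Real.sqrt 2 ^ m * gaussSum s ^ m := by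
  rw [← mul_pow]
  exact pow_le_pow_left₀ (gaussSum_pos (by positivity)).le (gaussSum_sqrt_two_mul_le hs) m

open Classical in
/-- The mass of a discrete Gaussian outside a ball. -/
theorem rho_tail_le {m : ℕ} {s : ℝ} (hs : 0 < s) (T : ℝ) :
    Summable (fun z : Fin m → ℤ => if T * s ^ 2 < ‖toE z‖ ^ 2 then rho s (toE z) else 0) ∧
    ∑' z : Fin m → ℤ, (if T * s ^ 2 < ‖toE z‖ ^ 2 then rho s (toE z) else 0) ≤
      Real.exp (-Real.pi * T / 2) * Real.sqrt 2 ^ m * gaussSum s ^ m := by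
  have hle : ∀ z : Fin m → ℤ, (if T * s ^ 2 < ‖toE z‖ ^ 2 then rho s (toE z) else 0) ≤
      Real.exp (-Real.pi * T / 2) * rho (Real.sqrt 2 * s) (toE z) := by
    intro z
    split_ifs with h
    · exact exp_le_of_tail hs h
    · exact mul_nonneg (Real.exp_pos _).le (Real.exp_pos _).le
  have hsum := (hasSum_rho_toE (m := m) (s := Real.sqrt 2 * s) (by positivity)).mul_left
    (Real.exp (-Real.pi * T / 2))
  have h1 : Summable (fun z : Fin m → ℤ => if T * s ^ 2 < ‖toE z‖ ^ 2 then rho s (toE z) else 0) :=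
    Summable.of_nonneg_of_le (fun z => by split_ifs; exacts [(Real.exp_pos _).le, le_rfl]) hle
      hsum.summable
  refine ⟨h1, (h1.tsum_le_tsum hle hsum.summable).trans ?_⟩
  rw [hsum.tsum_eq, mul_assoc]
  exact mul_le_mul_of_nonneg_left (gaussSum_sqrt_two_pow_le hs) (Real.exp_pos _).le

end Gauss

/-! ### Random matrices with no short images -/

section Counting

variable {q : ℕ} [NeZero q] {n m : ℕ}

/-- The distance of an element of `ℤ_q` to `0`. -/
def absq (x : ZMod q) : ℕ := x.valMinAbs.natAbs

theorem absq_add_le (x y : ZMod q) : absq (x + y) ≤ absq x + absq y :=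
  (ZMod.natAbs_valMinAbs_add_le x y).trans (Int.natAbs_add_le _ _)

theorem absq_neg (x : ZMod q) : absq (-x) = absq x := ZMod.natAbs_valMinAbs_neg x

theorem absq_sub_le (x y : ZMod q) : absq (x - y) ≤ absq x + absq y := by
  rw [sub_eq_add_neg, ← absq_neg y]
  exact absq_add_le _ _

theorem absq_eq_zero {x : ZMod q} : absq x = 0 ↔ x = 0 := by
  rw [absq, Int.natAbs_eq_zero, ZMod.valMinAbs_eq_zero]

theorem absq_two_mul {x : ZMod q} (h : 4 * absq x < q) : absq (2 * x) = 2 * absq x := by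
  have hq := NeZero.pos q
  have h1 : (2 * x).valMinAbs = 2 * x.valMinAbs := by
    rw [ZMod.valMinAbs_spec]
    unfold absq at h
    refine ⟨by rw [Int.cast_mul, ZMod.coe_valMinAbs]; norm_cast, ?_, ?_⟩ <;> omega
  rw [absq, h1, Int.natAbs_mul]
  rfl

/-- Doubling a small nonzero element multiplies its distance to `0` by two until it is no longer
small; the first such multiple has a double that is not small either. -/
theorem exists_doubling {y : ZMod q} (hy : y ≠ 0) (hs : 12 * absq y ≤ q) :
    ∃ i : ℕ, q < 12 * absq (2 ^ i * y) ∧ q < 12 * absq (2 * (2 ^ i * y)) := by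
  have hq := NeZero.pos q
  have hex : ∃ i : ℕ, q < 12 * absq (2 ^ i * y) := by
    by_contra! h
    have h1 : ∀ i : ℕ, absq (2 ^ i * y) = 2 ^ i * absq y := by
      intro i
      induction i with
      | zero => simp
      | succ i ih =>
        rw [pow_succ', mul_assoc, absq_two_mul (by have := h i; omega), ih, pow_succ', mul_assoc]
    have h2 := h q
    rw [h1] at h2
    have h3 : 0 < absq y := Nat.pos_of_ne_zero fun h => hy (absq_eq_zero.1 h)
    have h4 : q < 2 ^ q := Nat.lt_two_pow_self
    nlinarith
  classical
  refine ⟨Nat.find hex, Nat.find_spec hex, ?_⟩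
  have h0 : Nat.find hex ≠ 0 := by
    intro h
    have := Nat.find_spec hex
    rw [h, pow_zero, one_mul] at this
    omega
  obtain ⟨i, hi⟩ := Nat.exists_eq_succ_of_ne_zero h0
  have h1 : ¬ q < 12 * absq (2 ^ i * y) := Nat.find_min hex (by omega)
  have h2 := Nat.find_spec hex
  rw [hi, Nat.succ_eq_add_one, pow_succ', mul_assoc] at h2 ⊢
  rw [absq_two_mul (by omega)] at h2
  rw [absq_two_mul (x := 2 * (2 ^ i * y)) (by rw [absq_two_mul (by omega)]; omega),
    absq_two_mul (by omega)]
  omega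

/-- The doubling starts from `t`, or from `2 t` if `t` is not small but `2 t` is. -/
theorem exists_multiple {t : ZMod q} (ht : 2 * t ≠ 0) :
    ∃ k : ZMod q, q < 12 * absq (k * t) ∧ q < 12 * absq (2 * (k * t)) := by
  have ht0 : t ≠ 0 := by rintro rfl; simp at ht
  by_cases h1 : q < 12 * absq t
  · by_cases h2 : q < 12 * absq (2 * t)
    · exact ⟨1, by rwa [one_mul], by rwa [one_mul]⟩
    · obtain ⟨i, hi⟩ := exists_doubling ht (by omega)
      exact ⟨2 ^ i * 2, by rwa [mul_assoc]⟩
  · obtain ⟨i, hi⟩ := exists_doubling ht0 (by omega)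
    exact ⟨2 ^ i, hi⟩

/-- The vectors whose inner product with `s` is small. -/
def smallSet (s : Fin n → ZMod q) : Finset (Fin n → ZMod q) :=
  Finset.univ.filter fun a => 24 * absq (a ⬝ᵥ s) ≤ q

/-- The set of vectors with small inner product is disjoint from its translate by a vector whose
inner product with `s` is not small. -/
theorem disjoint_translates {s b c : Fin n → ZMod q} (h : q < 12 * absq ((b - c) ⬝ᵥ s)) :
    Disjoint ((smallSet s).map (addRightEmbedding b)) ((smallSet s).map (addRightEmbedding c)) := by
  rw [Finset.disjoint_left]
  intro x hx hx'
  obtain ⟨a, ha, rfl⟩ := Finset.mem_map.1 hx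
  obtain ⟨a', ha', he⟩ := Finset.mem_map.1 hx'
  have ha := (Finset.mem_filter.1 ha).2
  have ha' := (Finset.mem_filter.1 ha').2
  rw [addRightEmbedding_apply, addRightEmbedding_apply] at he
  have h1 : b - c = a' - a := by
    rw [sub_eq_sub_iff_add_eq_add, add_comm b, ← he]
  rw [h1, sub_dotProduct] at h
  have := absq_sub_le (a' ⬝ᵥ s) (a ⬝ᵥ s)
  omega

/-- The two-torsion case: the inner products with `s` are `0` or `q / 2`, and two translates of the
set of vectors with small inner product are disjoint. -/
theorem two_mul_card_smallSet_le {s : Fin n → ZMod q} (hs : s ≠ 0) (h2 : 2 • s = 0) :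
    2 * (smallSet s).card ≤ q ^ n := by
  obtain ⟨l, hl⟩ := Function.ne_iff.1 hs
  have h2l : 2 * s l = 0 := by simpa using congrFun h2 l
  have hq := NeZero.pos q
  have habs : q < 12 * absq (s l) := by
    by_contra hcon
    have h3 := absq_two_mul (x := s l) (by omega)
    rw [h2l, absq_eq_zero.2 rfl] at h3
    exact hl (absq_eq_zero.1 (by omega))
  have hd := disjoint_translates (s := s) (b := Pi.single l 1) (c := 0)
    (by rw [sub_zero, single_one_dotProduct]; exact habs)
  have := Finset.card_le_univ (((smallSet s).map (addRightEmbedding (Pi.single l 1))).disjUnion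
    ((smallSet s).map (addRightEmbedding 0)) hd)
  rw [Finset.card_disjUnion, Finset.card_map, Finset.card_map, Fintype.card_fun, ZMod.card,
    Fintype.card_fin] at this
  omega

/-- Outside the two-torsion, three translates of the set of vectors with small inner product are
pairwise disjoint. -/
theorem three_mul_card_smallSet_le {s : Fin n → ZMod q} (h2 : 2 • s ≠ 0) :
    3 * (smallSet s).card ≤ q ^ n := by
  obtain ⟨l, hl⟩ := Function.ne_iff.1 h2
  have h2l : 2 * s l ≠ 0 := by simpa using hl
  obtain ⟨k, hk1, hk2⟩ := exists_multiple h2l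
  have e1 : absq ((Pi.single l k - 0) ⬝ᵥ s) = absq (k * s l) := by
    rw [sub_zero, single_dotProduct]
  have e2 : absq ((Pi.single l k - Pi.single l (-k)) ⬝ᵥ s) = absq (2 * (k * s l)) := by
    rw [sub_dotProduct, single_dotProduct, single_dotProduct]
    congr 1; ring
  have e3 : absq ((Pi.single l (-k) - 0) ⬝ᵥ s) = absq (k * s l) := by
    rw [sub_zero, single_dotProduct, neg_mul, absq_neg]
  have hd1 := disjoint_translates (s := s) (b := Pi.single l k) (c := Pi.single l (-k))
    (by rw [e2]; exact hk2)
  have hd2 := disjoint_translates (s := s) (b := Pi.single l k) (c := 0) (by rw [e1]; exact hk1)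
  have hd3 := disjoint_translates (s := s) (b := Pi.single l (-k)) (c := 0)
    (by rw [e3]; exact hk1)
  have := Finset.card_le_univ ((((smallSet s).map (addRightEmbedding (Pi.single l k))).disjUnion
    ((smallSet s).map (addRightEmbedding (Pi.single l (-k)))) hd1).disjUnion
    ((smallSet s).map (addRightEmbedding 0))
      ((Finset.disjoint_disjUnion_left hd1).2 ⟨hd2, hd3⟩))
  rw [Finset.card_disjUnion, Finset.card_disjUnion, Finset.card_map, Finset.card_map,
    Finset.card_map, Fintype.card_fun, ZMod.card, Fintype.card_fin] at this
  omega

theorem card_two_torsion_le :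
    (Finset.univ.filter fun s : Fin n → ZMod q => 2 • s = 0).card ≤ 2 ^ n := by
  have h1 : (Finset.univ.filter fun x : ZMod q => 2 * x = 0).card ≤ 2 := by
    have : (Finset.univ.filter fun x : ZMod q => 2 * x = 0) ⊆ {0, ((q / 2 : ℕ) : ZMod q)} := by
      intro x hx
      have hx := (Finset.mem_filter.1 hx).2
      have h2 : q ∣ 2 * x.val := by
        rw [← ZMod.natCast_eq_zero_iff]
        push_cast
        rwa [ZMod.natCast_zmod_val]
      obtain ⟨c, hc⟩ := h2
      have hlt := ZMod.val_lt x
      have hc2 : c < 2 := by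
        by_contra h
        nlinarith
      rw [Finset.mem_insert, Finset.mem_singleton]
      interval_cases c
      · left
        rw [← ZMod.val_eq_zero]; omega
      · right
        rw [← ZMod.natCast_zmod_val x]
        congr 1; omega
    exact (Finset.card_le_card this).trans Finset.card_le_two
  have h2 : (Finset.univ.filter fun s : Fin n → ZMod q => 2 • s = 0) =
      Fintype.piFinset fun _ : Fin n => Finset.univ.filter fun x : ZMod q => 2 * x = 0 := by
    ext s
    simp [funext_iff, Fintype.mem_piFinset]
  rw [h2, Fintype.card_piFinset, Finset.prod_const, Finset.card_univ, Fintype.card_fin]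
  exact Nat.pow_le_pow_left h1 n

/-- No nonzero vector has a short image under `Aᵀ`. -/
def NoShort (A : Matrix (Fin n) (Fin m) (ZMod q)) : Prop :=
  ∀ s : Fin n → ZMod q, s ≠ 0 → ∃ j, q < 24 * absq (A.transpose.mulVec s j)

open Classical in
/-- The matrices for which `s` has a short image have all their columns in a small set. -/
theorem card_short_image (s : Fin n → ZMod q) :
    (Finset.univ.filter fun A : Matrix (Fin n) (Fin m) (ZMod q) =>
      ∀ j, 24 * absq (A.transpose.mulVec s j) ≤ q).card ≤ (smallSet s).card ^ m := by
  have h1 : (smallSet s).card ^ m = (Fintype.piFinset fun _ : Fin m => smallSet s).card := by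
    rw [Fintype.card_piFinset, Finset.prod_const, Finset.card_univ, Fintype.card_fin]
  rw [h1]
  refine Finset.card_le_card_of_injOn (fun A j l => A l j) ?_ ?_
  · intro A hA
    have hA := (Finset.mem_filter.1 (Finset.mem_coe.1 hA)).2
    rw [Finset.mem_coe, Fintype.mem_piFinset]
    exact fun j => Finset.mem_filter.2 ⟨Finset.mem_univ _, hA j⟩
  · exact fun A _ B _ h => Matrix.transpose_injective h

/-- Almost all matrices are injective in a strong sense: the union bound over `s`, where
the two-torsion vectors are treated apart. -/
theorem unifProb_short_le :
    unifProb {A : Matrix (Fin n) (Fin m) (ZMod q) | ¬ NoShort A} ≤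
      (2 : ℝ) ^ n / 2 ^ m + (q : ℝ) ^ n / 3 ^ m := by
  classical
  let Z : (Fin n → ZMod q) → Finset (Matrix (Fin n) (Fin m) (ZMod q)) := fun s =>
    Finset.univ.filter fun A => ∀ j, 24 * absq (A.transpose.mulVec s j) ≤ q
  let S₂ : Finset (Fin n → ZMod q) := Finset.univ.filter fun s => 2 • s = 0
  have hsub : {A : Matrix (Fin n) (Fin m) (ZMod q) | ¬ NoShort A} ⊆
      (((S₂.erase 0).biUnion Z ∪ (Finset.univ.filter fun s => ¬ 2 • s = 0).biUnion Z :
        Finset (Matrix (Fin n) (Fin m) (ZMod q))) : Set _) := by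
    intro A hA
    simp only [Set.mem_ofPred_eq, NoShort, not_forall, not_exists, not_lt] at hA
    obtain ⟨s, hs, hA⟩ := hA
    have hZ : A ∈ Z s := Finset.mem_filter.2 ⟨Finset.mem_univ _, hA⟩
    rw [Finset.mem_coe, Finset.mem_union, Finset.mem_biUnion, Finset.mem_biUnion]
    by_cases h : 2 • s = 0
    · exact Or.inl ⟨s, Finset.mem_erase.2 ⟨hs, Finset.mem_filter.2 ⟨Finset.mem_univ _, h⟩⟩, hZ⟩
    · exact Or.inr ⟨s, Finset.mem_filter.2 ⟨Finset.mem_univ _, h⟩, hZ⟩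
  have hq : (0 : ℝ) < q := by exact_mod_cast NeZero.pos q
  have hb : ∀ (S : Finset (Fin n → ZMod q)) (c N : ℝ), 0 < c → (S.card : ℝ) ≤ N →
      (∀ s ∈ S, c * (smallSet s).card ≤ (q : ℝ) ^ n) →
      ((S.biUnion Z).card : ℝ) ≤ N * ((q : ℝ) ^ (n * m) / c ^ m) := by
    intro S c N hc hN hS
    have h1 : ∀ s ∈ S, ((Z s).card : ℝ) ≤ (q : ℝ) ^ (n * m) / c ^ m := by
      intro s hs
      have h2 : ((Z s).card : ℝ) ≤ ((smallSet s).card : ℝ) ^ m := by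
        exact_mod_cast card_short_image s
      refine h2.trans ?_
      rw [pow_mul, ← div_pow]
      refine pow_le_pow_left₀ (Nat.cast_nonneg _) ?_ m
      rw [le_div_iff₀ hc, mul_comm]
      exact hS s hs
    have h3 : ((S.biUnion Z).card : ℝ) ≤ ∑ s ∈ S, ((Z s).card : ℝ) := by
      exact_mod_cast Finset.card_biUnion_le
    refine h3.trans ((Finset.sum_le_card_nsmul _ _ _ h1).trans ?_)
    rw [nsmul_eq_mul]
    gcongr
  have hcard : Nat.card (Matrix (Fin n) (Fin m) (ZMod q)) = q ^ (n * m) := by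
    rw [Nat.card_eq_fintype_card, show Fintype.card (Matrix (Fin n) (Fin m) (ZMod q)) =
      Fintype.card (Fin n → Fin m → ZMod q) from rfl, Fintype.card_fun, Fintype.card_fun, ZMod.card,
      Fintype.card_fin, Fintype.card_fin, ← pow_mul, mul_comm]
  rw [unifProb, hcard, Nat.cast_pow, div_le_iff₀ (by positivity)]
  have h1 := Set.ncard_le_ncard hsub (Finset.finite_toSet _)
  rw [Set.ncard_coe_finset] at h1
  have h2 : ({A : Matrix (Fin n) (Fin m) (ZMod q) | ¬ NoShort A}.ncard : ℝ) ≤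
      ((S₂.erase 0).biUnion Z).card +
        ((Finset.univ.filter fun s : Fin n → ZMod q => ¬ 2 • s = 0).biUnion Z).card := by
    exact_mod_cast h1.trans (Finset.card_union_le _ _)
  have h3 := hb (S₂.erase 0) 2 (2 ^ n) two_pos
    (by
      have : (S₂.erase 0).card ≤ 2 ^ n := (Finset.card_erase_le).trans card_two_torsion_le
      exact_mod_cast this)
    (by
      intro s hs
      obtain ⟨hs0, hs2⟩ := Finset.mem_erase.1 hs
      exact_mod_cast two_mul_card_smallSet_le hs0 (Finset.mem_filter.1 hs2).2)
  have h4 := hb (Finset.univ.filter fun s : Fin n → ZMod q => ¬ 2 • s = 0) 3 ((q : ℝ) ^ n)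
    three_pos
    (by
      have : (Finset.univ.filter fun s : Fin n → ZMod q => ¬ 2 • s = 0).card ≤ q ^ n := by
        refine (Finset.card_le_univ _).trans (le_of_eq ?_)
        rw [Fintype.card_fun, ZMod.card, Fintype.card_fin]
      exact_mod_cast this)
    (by
      intro s hs
      exact_mod_cast three_mul_card_smallSet_le (Finset.mem_filter.1 hs).2)
  refine h2.trans ((add_le_add h3 h4).trans (le_of_eq ?_))
  ring

end Counting

/-! ### Decoding in the lattice -/

section Lattice

variable {q : ℕ} [NeZero q] {n m : ℕ}

theorem toE_sub (z w : Fin m → ℤ) : toE (z - w) = toE z - toE w := by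
  ext j
  simp [toE]

theorem toE_add (z w : Fin m → ℤ) : toE (z + w) = toE z + toE w := by
  ext j
  simp [toE]

theorem toE_zsmul (k : ℤ) (z : Fin m → ℤ) : toE (k • z) = (k : ℝ) • toE z := by
  ext j
  simp [toE]

theorem toE_injective : Function.Injective (toE (m := m)) := by
  intro z w h
  funext j
  have : (toE z).ofLp j = (toE w).ofLp j := by rw [h]
  simpa [toE] using this

theorem norm_toE_sq (z : Fin m → ℤ) : ‖toE z‖ ^ 2 = ((∑ j, z j ^ 2 : ℤ) : ℝ) := by
  rw [EuclideanSpace.norm_sq_eq]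
  push_cast
  exact Finset.sum_congr rfl fun j _ => by rw [Real.norm_eq_abs, sq_abs]; rfl

theorem abs_le_norm_toE (z : Fin m → ℤ) (j : Fin m) : |(z j : ℝ)| ≤ ‖toE z‖ :=
  PiLp.norm_apply_le (toE z) j

/-- `valMinAbs` has least absolute value among all representatives of a residue. -/
theorem absq_intCast_le (k : ℤ) : (absq (k : ZMod q) : ℝ) ≤ |(k : ℝ)| := by
  have h := ZMod.natAbs_min_of_le_div_two q (k : ZMod q).valMinAbs k (by simp)
    (ZMod.natAbs_valMinAbs_le _)
  have h2 : (absq (k : ZMod q) : ℤ) ≤ |k| := by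
    rw [Int.abs_eq_natAbs]
    exact Int.ofNat_le.2 h
  exact_mod_cast h2

/-- A lattice vector is either a lift of a vector `Aᵀ s` with `s ≠ 0`, or has all coordinates
divisible by `q`. -/
theorem norm_of_mem_qLattice {A : Matrix (Fin n) (Fin m) (ZMod q)} (hA : NoShort A)
    {x : EuclideanSpace ℝ (Fin m)} (hx : x ∈ qLattice A) (hx0 : x ≠ 0) : (q : ℝ) / 24 ≤ ‖x‖ := by
  obtain ⟨z, rfl, s, hs⟩ := hx
  by_cases h : s = 0
  · -- the coordinates of `z` are multiples of `q`
    obtain ⟨j, hj⟩ : ∃ j, z j ≠ 0 := by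
      by_contra! h0
      refine hx0 ?_
      have : z = 0 := funext h0
      ext j
      simp [toE, this]
    rw [h, Matrix.mulVec_zero] at hs
    obtain ⟨c, hc⟩ := (ZMod.intCast_zmod_eq_zero_iff_dvd (z j) q).1 (congrFun hs j)
    have h1 : (q : ℝ) ≤ |(z j : ℝ)| := by
      have hc0 : c ≠ 0 := by rintro rfl; exact hj (by simpa using hc)
      have : (q : ℤ) ≤ |z j| := by
        rw [hc, abs_mul, abs_of_nonneg (Int.natCast_nonneg q)]
        exact le_mul_of_one_le_right (Int.natCast_nonneg q) (Int.one_le_abs hc0)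
      exact_mod_cast this
    have h2 := abs_le_norm_toE z j
    have h3 : (0 : ℝ) ≤ q := Nat.cast_nonneg q
    linarith
  · obtain ⟨j, hj⟩ := hA s h
    rw [← hs] at hj
    have h1 : (q : ℝ) < 24 * absq ((z j : ℤ) : ZMod q) := by exact_mod_cast hj
    have h2 := absq_intCast_le (q := q) (z j)
    have h3 := abs_le_norm_toE z j
    linarith

theorem le_lambda1 (hm : 0 < m) {A : Matrix (Fin n) (Fin m) (ZMod q)} (hA : NoShort A) :
    (q : ℝ) / 24 ≤ lambda1 (qLattice A) := by
  refine le_csInf ?_ ?_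
  · -- the multiples of `q` are lattice vectors
    refine ⟨_, toE (fun _ => (q : ℤ)), ⟨_, rfl, 0, ?_⟩, ?_, rfl⟩
    · rw [Matrix.mulVec_zero]
      funext j
      simp
    · intro h
      have := congrArg (fun v : EuclideanSpace ℝ (Fin m) => v ⟨0, hm⟩) h
      simp [toE, NeZero.ne q] at this
  · rintro r ⟨x, hx, hx0, rfl⟩
    exact norm_of_mem_qLattice hA hx hx0

theorem sub_mem_qLattice {A : Matrix (Fin n) (Fin m) (ZMod q)} {x y : EuclideanSpace ℝ (Fin m)}
    (hx : x ∈ qLattice A) (hy : y ∈ qLattice A) : x - y ∈ qLattice A := by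
  obtain ⟨z, rfl, s, hs⟩ := hx
  obtain ⟨w, rfl, t, ht⟩ := hy
  refine ⟨z - w, (toE_sub z w).symm, s - t, ?_⟩
  rw [Matrix.mulVec_sub, ← hs, ← ht]
  funext j
  simp

/-- Every point has a closest lattice vector, because squared distances to points of `ℤ^m` are
integers. -/
theorem closest_spec (A : Matrix (Fin n) (Fin m) (ZMod q)) (y : Fin m → ZMod q) :
    closest (qLattice A) (lift y) ∈ qLattice A ∧
      ∀ z ∈ qLattice A, ‖lift y - closest (qLattice A) (lift y)‖ ≤ ‖lift y - z‖ := by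
  refine Classical.epsilon_spec (p := fun x => x ∈ qLattice A ∧ ∀ z ∈ qLattice A,
    ‖lift y - x‖ ≤ ‖lift y - z‖) ?_
  let N : (Fin m → ℤ) → ℕ := fun z => (∑ j, (((y j).val : ℤ) - z j) ^ 2).toNat
  have hN : ∀ z, ‖lift y - toE z‖ ^ 2 = N z := by
    intro z
    rw [lift, ← toE_sub, norm_toE_sq]
    have : (0 : ℤ) ≤ ∑ j, (((y j).val : ℤ) - z j) ^ 2 := Finset.sum_nonneg fun j _ => sq_nonneg _
    have h2 : ((N z : ℕ) : ℤ) = ∑ j, (((y j).val : ℤ) - z j) ^ 2 := Int.toNat_of_nonneg this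
    rw [← Int.cast_natCast (R := ℝ), h2]
    rfl
  have hne : ∃ z, toE z ∈ qLattice A := ⟨0, 0, rfl, 0, by rw [Matrix.mulVec_zero]; simp; rfl⟩
  have hwf := (measure N).wf.has_min {z | toE z ∈ qLattice A} hne
  obtain ⟨z, hz, hmin⟩ := hwf
  refine ⟨toE z, hz, ?_⟩
  rintro x ⟨w, rfl, s, hs⟩
  have h1 : N z ≤ N w := not_lt.1 (hmin w ⟨w, rfl, s, hs⟩)
  refine le_of_sq_le_sq ?_ (norm_nonneg _)
  rw [hN, hN]
  exact_mod_cast h1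

/-- A point minus its closest lattice vector is an integer vector, and the lattice vector comes
from some coordinates. -/
theorem exists_residual (A : Matrix (Fin n) (Fin m) (ZMod q)) (y : Fin m → ZMod q) :
    ∃ (u : Fin n → ZMod q) (z : Fin m → ℤ), residual A y = toE z ∧
      y = A.transpose.mulVec u + fun j => ((z j : ℤ) : ZMod q) := by
  obtain ⟨w, hw, u, hu⟩ := (closest_spec A y).1
  refine ⟨u, fun j => ((y j).val : ℤ) - w j, ?_, ?_⟩
  · rw [residual, hw, lift, ← toE_sub]
    rfl
  · rw [← hu]
    funext j
    simp

/-- Bounded distance decoding: a point that is close to a lattice vector has that vector as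
closest lattice vector. -/
theorem residual_eq (hm : 0 < m) {A : Matrix (Fin n) (Fin m) (ZMod q)} (hA : NoShort A)
    {y : Fin m → ZMod q} {u : Fin n → ZMod q} {z : Fin m → ℤ}
    (hy : y = A.transpose.mulVec u + fun j => ((z j : ℤ) : ZMod q)) (hz : 48 * ‖toE z‖ < q) :
    lift y ∈ latticeBall (qLattice A) ∧ residual A y = toE z := by
  set w : Fin m → ℤ := fun j => ((y j).val : ℤ) - z j with hw
  have hwL : toE w ∈ qLattice A := by
    refine ⟨w, rfl, u, ?_⟩
    funext j
    have := congrFun hy j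
    simp only [hw, Int.cast_sub, Int.cast_natCast, ZMod.natCast_zmod_val]
    rw [this, Pi.add_apply, add_sub_cancel_right]
  have hyz : lift y - toE w = toE z := by
    rw [lift, ← toE_sub]
    congr 1
    funext j
    simp [hw]
  have hl := le_lambda1 hm hA
  obtain ⟨hc, hmin⟩ := closest_spec A y
  constructor
  · have h1 := Metric.infDist_le_dist_of_mem (x := lift y) hwL
    rw [dist_eq_norm, hyz] at h1
    show Metric.infDist _ _ < _
    linarith
  · have h1 := hmin _ hwL
    rw [hyz] at h1
    have h2 : closest (qLattice A) (lift y) = toE w := by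
      by_contra hne
      have h3 := norm_of_mem_qLattice hA (sub_mem_qLattice hc hwL) (sub_ne_zero.2 hne)
      have h4 : closest (qLattice A) (lift y) - toE w =
          (lift y - toE w) - (lift y - closest (qLattice A) (lift y)) := by abel
      have h5 := norm_sub_le (lift y - toE w) (lift y - closest (qLattice A) (lift y))
      rw [← h4, hyz] at h5
      linarith
    rw [residual, h2, hyz]

theorem NoShort.injective {A : Matrix (Fin n) (Fin m) (ZMod q)} (hA : NoShort A)
    {u u' : Fin n → ZMod q} (h : A.transpose.mulVec u = A.transpose.mulVec u') : u = u' := by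
  by_contra hne
  obtain ⟨j, hj⟩ := hA (u - u') (sub_ne_zero.2 hne)
  rw [Matrix.mulVec_sub, h, sub_self, Pi.zero_apply, absq_eq_zero.2 rfl] at hj
  omega

/-- The coordinates of the closest lattice vector. -/
def coords (A : Matrix (Fin n) (Fin m) (ZMod q)) (y : Fin m → ZMod q) : Fin n → ZMod q :=
  (exists_residual A y).choose

/-- The residual as an integer vector. -/
def resid (A : Matrix (Fin n) (Fin m) (ZMod q)) (y : Fin m → ZMod q) : Fin m → ℤ :=
  (exists_residual A y).choose_spec.choose

theorem residual_eq_resid (A : Matrix (Fin n) (Fin m) (ZMod q)) (y : Fin m → ZMod q) :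
    residual A y = toE (resid A y) := (exists_residual A y).choose_spec.choose_spec.1

theorem eq_coords_add_resid (A : Matrix (Fin n) (Fin m) (ZMod q)) (y : Fin m → ZMod q) :
    y = A.transpose.mulVec (coords A y) + fun j => ((resid A y j : ℤ) : ZMod q) :=
  (exists_residual A y).choose_spec.choose_spec.2

theorem resid_eq (hm : 0 < m) {A : Matrix (Fin n) (Fin m) (ZMod q)} (hA : NoShort A)
    {y : Fin m → ZMod q} {u : Fin n → ZMod q} {z : Fin m → ℤ}
    (hy : y = A.transpose.mulVec u + fun j => ((z j : ℤ) : ZMod q)) (hz : 48 * ‖toE z‖ < q) :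
    resid A y = z ∧ coords A y = u := by
  have h1 := (residual_eq hm hA hy hz).2
  rw [residual_eq_resid] at h1
  have h2 := toE_injective h1
  refine ⟨h2, hA.injective ?_⟩
  have h3 := eq_coords_add_resid A y
  rw [h2] at h3
  exact add_right_cancel (h3.symm.trans hy)

end Lattice

/-! ### The Gaussian weights -/

section Weights

variable {q : ℕ} [NeZero q] {n m : ℕ}

/-- The exponential of the quadratic form of the covariance matrix, in closed form. -/
def wt (α B : ℝ) (e z : Fin m → ℤ) : ℝ :=
  Real.exp (-(2 * Real.pi / B ^ 2) * (‖toE z‖ ^ 2 -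
    α ^ 2 * inner ℝ (toE z) (toE e) ^ 2 / (α ^ 2 * ‖toE e‖ ^ 2 + B ^ 2)))

/-- The centre of the Gaussian on the multiplier, given the residual. -/
def centre (α B : ℝ) (e z : Fin m → ℤ) : ℝ :=
  α ^ 2 * inner ℝ (toE z) (toE e) / (α ^ 2 * ‖toE e‖ ^ 2 + B ^ 2)

/-- The width `σ` as a function of the squared norm of the error. -/
def width (α B E : ℝ) : ℝ := α * B / Real.sqrt (α ^ 2 * E + B ^ 2)

theorem sigma_eq_width (α β : ℝ) (E : ℝ) : sigma α β q E = width α (β * q) E := by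
  rw [sigma, width, mul_pow, mul_assoc]

theorem width_pos {α B E : ℝ} (hα : 0 < α) (hB : 0 < B) (hE : 0 ≤ E) : 0 < width α B E := by
  have : 0 < α ^ 2 * E + B ^ 2 := by positivity
  rw [width]; positivity

theorem width_sq {α B E : ℝ} (hB : 0 < B) (hE : 0 ≤ E) :
    width α B E ^ 2 = α ^ 2 * B ^ 2 / (α ^ 2 * E + B ^ 2) := by
  rw [width, div_pow, Real.sq_sqrt (by positivity), mul_pow]

/-- The Sherman–Morrison formula for the inverse covariance matrix. -/
theorem inv_covariance {α β : ℝ} (hβ : 0 < β) (e : Fin m → ℤ) :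
    ((β ^ 2 * q ^ 2 / 2) • covariance α β q e)⁻¹ =
      (2 / (β * q) ^ 2) • ((1 : Matrix (Fin m) (Fin m) ℝ) -
        (α ^ 2 / (α ^ 2 * ‖toE e‖ ^ 2 + (β * q) ^ 2)) •
          Matrix.vecMulVec (toE e).ofLp (toE e).ofLp) := by
  have hq : (0 : ℝ) < q := by exact_mod_cast NeZero.pos q
  refine Matrix.inv_eq_right_inv ?_
  have hE : (toE e).ofLp ⬝ᵥ (toE e).ofLp = ‖toE e‖ ^ 2 := by
    rw [EuclideanSpace.norm_sq_eq, dotProduct]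
    exact Finset.sum_congr rfl fun j _ => by rw [Real.norm_eq_abs, sq_abs, sq]
  have hv : Matrix.vecMulVec (toE e).ofLp (toE e).ofLp *
      Matrix.vecMulVec (toE e).ofLp (toE e).ofLp =
      ‖toE e‖ ^ 2 • Matrix.vecMulVec (toE e).ofLp (toE e).ofLp := by
    rw [Matrix.vecMulVec_mul_vecMulVec, hE, Matrix.vecMulVec_smul]
  have hG : 0 < α ^ 2 * ‖toE e‖ ^ 2 + (β * q) ^ 2 := by positivity
  rw [covariance, Matrix.smul_mul, Matrix.mul_smul, smul_smul, Matrix.add_mul, Matrix.mul_sub,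
    Matrix.mul_sub, Matrix.one_mul, Matrix.one_mul, Matrix.mul_one, Matrix.smul_mul,
    Matrix.mul_smul, hv]
  set V := Matrix.vecMulVec (toE e).ofLp (toE e).ofLp
  set G := α ^ 2 * ‖toE e‖ ^ 2 + (β * q) ^ 2 with hGdef
  have h1 : β ^ 2 * q ^ 2 / 2 * (2 / (β * q) ^ 2) = 1 := by field_simp
  have h2 : (1 : Matrix (Fin m) (Fin m) ℝ) - (α ^ 2 / G) • V + ((α ^ 2 / (β ^ 2 * q ^ 2)) • V -
      (α ^ 2 / (β ^ 2 * q ^ 2)) • (α ^ 2 / G) • ‖toE e‖ ^ 2 • V) =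
      1 + (α ^ 2 / (β ^ 2 * q ^ 2) - α ^ 2 / G -
        α ^ 2 / (β ^ 2 * q ^ 2) * (α ^ 2 / G * ‖toE e‖ ^ 2)) • V := by
    module
  have h3 : α ^ 2 / (β ^ 2 * q ^ 2) - α ^ 2 / G -
      α ^ 2 / (β ^ 2 * q ^ 2) * (α ^ 2 / G * ‖toE e‖ ^ 2) = 0 := by
    field_simp
    rw [hGdef]
    ring
  rw [h1, one_smul]
  rw [h3, zero_smul, add_zero] at h2
  exact h2

theorem rhoCov_eq {α β : ℝ} (hβ : 0 < β) (e z : Fin m → ℤ) :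
    rhoCov ((β ^ 2 * q ^ 2 / 2) • covariance α β q e) (toE z) = wt α (β * q) e z := by
  have hz : (toE z).ofLp ⬝ᵥ (toE z).ofLp = ‖toE z‖ ^ 2 := by
    rw [EuclideanSpace.norm_sq_eq, dotProduct]
    exact Finset.sum_congr rfl fun j _ => by rw [Real.norm_eq_abs, sq_abs, sq]
  have hi : (toE z).ofLp ⬝ᵥ (toE e).ofLp = inner ℝ (toE z) (toE e) := by
    rw [EuclideanSpace.inner_eq_star_dotProduct, dotProduct_comm]
    rfl
  have hi' : (toE e).ofLp ⬝ᵥ (toE z).ofLp = inner ℝ (toE z) (toE e) := by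
    rw [dotProduct_comm, hi]
  rw [rhoCov, inv_covariance hβ, wt, Matrix.smul_mulVec, dotProduct_smul, Matrix.sub_mulVec,
    Matrix.one_mulVec, dotProduct_sub, Matrix.smul_mulVec, dotProduct_smul,
    Matrix.vecMulVec_mulVec, dotProduct_smul, hz, hi, hi']
  congr 1
  simp only [smul_eq_mul, MulOpposite.smul_eq_mul_unop, MulOpposite.unop_op]
  ring

/-- Completing the square: the weight of the residual times the Gaussian on the multiplier is
a product of Gaussians. -/
theorem wt_mul_gauss {α B : ℝ} (hα : 0 < α) (hB : 0 < B) (e z : Fin m → ℤ) (k : ℤ) :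
    wt α B e z * gauss (width α B (‖toE e‖ ^ 2) / Real.sqrt 2) (k - centre α B e z) =
      gauss (α / Real.sqrt 2) k * rho (B / Real.sqrt 2) (toE (z - k • e)) := by
  have hG : 0 < α ^ 2 * ‖toE e‖ ^ 2 + B ^ 2 := by positivity
  rw [wt, gauss, gauss, rho, ← Real.exp_add, ← Real.exp_add, div_pow, div_pow, div_pow,
    Real.sq_sqrt zero_le_two, width_sq hB (by positivity), toE_sub, toE_zsmul, norm_sub_sq_real,
    norm_smul, inner_smul_right, mul_pow, Real.norm_eq_abs, sq_abs, centre]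
  congr 1
  field_simp
  ring

end Weights

/-! ### The Fourier transform of a folded Gaussian -/

section Folded

variable {q : ℕ} [NeZero q]

/-- The sum of a shifted Gaussian over a residue class modulo `q`. -/
def folded (σ c : ℝ) (κ : ZMod q) : ℝ := ∑' k : ℤ, if (k : ZMod q) = κ then gauss σ (k - c) else 0

theorem summable_folded {σ : ℝ} (hσ : 0 < σ) (c : ℝ) (κ : ZMod q) :
    Summable fun k : ℤ => if (k : ZMod q) = κ then gauss σ (k - c) else 0 := by
  refine Summable.of_nonneg_of_le (fun k => ?_) (fun k => ?_) (summable_gauss hσ c)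
  · split_ifs
    exacts [(gauss_pos _ _).le, le_rfl]
  · split_ifs
    exacts [le_rfl, (gauss_pos _ _).le]

theorem gauss_le_folded {σ : ℝ} (hσ : 0 < σ) (c : ℝ) (k : ℤ) :
    gauss σ (k - c) ≤ folded σ c (k : ZMod q) := by
  have := (summable_folded hσ c (k : ZMod q)).le_tsum k fun j _ => by
    split_ifs
    exacts [(gauss_pos _ _).le, le_rfl]
  rwa [if_pos rfl] at this

theorem folded_pos {σ : ℝ} (hσ : 0 < σ) (c : ℝ) (κ : ZMod q) : 0 < folded σ c κ := by
  have := gauss_le_folded (q := q) hσ c κ.valMinAbs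
  rw [ZMod.coe_valMinAbs] at this
  exact (gauss_pos _ _).trans_le this

theorem sum_folded_sq_pos {σ : ℝ} (hσ : 0 < σ) (c : ℝ) : 0 < ∑ κ : ZMod q, folded σ c κ ^ 2 :=
  Finset.sum_pos (fun κ _ => pow_pos (folded_pos hσ c κ) 2) Finset.univ_nonempty

theorem tsum_residue_class {M : Type*} [AddCommMonoid M] [TopologicalSpace M] (F : ℤ → M) (a : ℤ) :
    ∑' e : ℤ, (if (e : ZMod q) = (a : ZMod q) then F e else 0) = ∑' w : ℤ, F (a + q * w) := by
  have hq : (q : ℤ) ≠ 0 := by exact_mod_cast NeZero.ne q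
  have hi : Function.Injective fun w : ℤ => a + q * w := by
    intro w w' h
    exact mul_left_cancel₀ hq (add_left_cancel h)
  rw [← hi.tsum_eq]
  · refine tsum_congr fun w => if_pos ?_
    push_cast
    simp
  · intro e he
    rw [Function.mem_support] at he
    have h : (e : ZMod q) = (a : ZMod q) := by
      by_contra h
      exact he (if_neg h)
    obtain ⟨w, hw⟩ := (ZMod.intCast_eq_intCast_iff_dvd_sub a e q).1 h.symm
    exact ⟨w, by show a + q * w = e; rw [← hw]; ring⟩

theorem sum_chi_folded {σ : ℝ} (hσ : 0 < σ) (c : ℝ) (t : ZMod q) :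
    ∑ κ, chi (-(κ * t)) * (folded σ c κ : ℂ) =
      ∑' k : ℤ, (gauss σ (k - c) : ℂ) *
        Complex.exp (-(2 * Real.pi * Complex.I * k * ((t.val / q : ℝ) : ℂ))) := by
  have h1 : ∀ κ : ZMod q, HasSum (fun k : ℤ => if (k : ZMod q) = κ then
      chi (-(κ * t)) * (gauss σ (k - c) : ℂ) else 0) (chi (-(κ * t)) * (folded σ c κ : ℂ)) := by
    intro κ
    have := (Complex.hasSum_ofReal.2 (summable_folded hσ c κ).hasSum).mul_left (chi (-(κ * t)))
    refine this.congr_fun ?_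
    intro k
    split_ifs <;> simp
  have h2 := hasSum_sum (s := Finset.univ) fun κ _ => h1 κ
  rw [← h2.tsum_eq]
  refine tsum_congr fun k => ?_
  rw [Finset.sum_ite_eq, if_pos (Finset.mem_univ _), mul_comm]
  congr 1
  have h3 : -((k : ZMod q) * t) = ((-(k * t.val) : ℤ) : ZMod q) := by
    push_cast
    rw [ZMod.natCast_zmod_val]
  rw [h3, chi, ZMod.stdAddChar_coe]
  congr 1
  push_cast
  ring

/-- Poisson summation: the amplitudes of the phase state are the Fourier coefficients of
a folded Gaussian. -/
theorem phaseAmp_eq {σ : ℝ} (hσ : 0 < σ) (c : ℝ) (u b : ZMod q) :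
    phaseAmp (fun x : ℤ => rho (q / σ) (x : ℝ)) (-c / q) u b =
      (1 / σ : ℂ) * ∑ κ, chi (-(κ * (b - u))) * (folded σ c κ : ℂ) := by
  have hq : (0 : ℝ) < q := by exact_mod_cast NeZero.pos q
  have hqc : (q : ℂ) ≠ 0 := by exact_mod_cast hq.ne'
  have hσc : (σ : ℂ) ≠ 0 := by exact_mod_cast hσ.ne'
  rw [sum_chi_folded hσ, gauss_poisson hσ, ← mul_assoc, one_div_mul_cancel hσc, one_mul, phaseAmp]
  have h1 : ∀ e : ℤ, u + (e : ZMod q) = b ↔ (e : ZMod q) = (((b - u).val : ℤ) : ZMod q) := by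
    intro e
    rw [Int.cast_natCast, ZMod.natCast_zmod_val, eq_sub_iff_add_eq, add_comm]
  simp only [h1]
  rw [tsum_residue_class]
  refine tsum_congr fun w => ?_
  congr 1
  · rw [rho, gauss, Real.norm_eq_abs, sq_abs]
    congr 2
    push_cast
    field_simp
    ring
  · congr 1
    push_cast
    field_simp
    ring

/-- Parseval for the Fourier transform on `ℤ_q`. -/
theorem sum_norm_fourier (f : ZMod q → ℂ) (u : ZMod q) :
    ∑ b, ‖∑ κ, chi (-(κ * (b - u))) * f κ‖ ^ 2 = q * ∑ κ, ‖f κ‖ ^ 2 := by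
  have hq : (0 : ℝ) < q := by exact_mod_cast NeZero.pos q
  have hs : (Real.sqrt q : ℂ) ≠ 0 := by exact_mod_cast (Real.sqrt_pos.2 hq).ne'
  have h1 := norm_mulVec_of_unitary (fourierMat_mem (q := q)) f f
  have h2 : ∀ g : ZMod q → ℂ, star g ⬝ᵥ g = ((∑ x, ‖g x‖ ^ 2 : ℝ) : ℂ) := by
    intro g
    rw [dotProduct, Complex.ofReal_sum]
    refine Finset.sum_congr rfl fun x _ => ?_
    rw [Pi.star_apply, ← Complex.normSq_eq_norm_sq, Complex.normSq_eq_conj_mul_self]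
    rfl
  rw [h2, h2, Complex.ofReal_inj] at h1
  rw [← Equiv.sum_comp (Equiv.addRight u), ← h1, Finset.mul_sum]
  refine Finset.sum_congr rfl fun x _ => ?_
  have h3 : (fourierMat q).mulVec f x =
      (∑ κ, chi (-(κ * x)) * f κ) / (Real.sqrt q : ℂ) := by
    rw [Matrix.mulVec, dotProduct, Finset.sum_div]
    refine Finset.sum_congr rfl fun κ _ => ?_
    rw [fourierMat, mul_comm x κ]
    ring
  rw [h3, norm_div, div_pow, Complex.norm_real, Real.norm_of_nonneg (Real.sqrt_nonneg _),
    Real.sq_sqrt hq.le, mul_div_cancel₀ _ hq.ne']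
  simp

/-- The normalized amplitudes of the phase state. -/
theorem phaseAmp_div_norm {σ : ℝ} (hσ : 0 < σ) (c : ℝ) (u b : ZMod q) :
    phaseAmp (fun x : ℤ => rho (q / σ) (x : ℝ)) (-c / q) u b /
      (Real.sqrt (∑ b' : ZMod q,
        ‖phaseAmp (fun x : ℤ => rho (q / σ) (x : ℝ)) (-c / q) u b'‖ ^ 2) : ℂ) =
      ∑ κ, (chi (-(κ * (b - u))) / (Real.sqrt q : ℂ)) *
        ((folded σ c κ / Real.sqrt (∑ κ' : ZMod q, folded σ c κ' ^ 2) : ℝ) : ℂ) := by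
  have hq : (0 : ℝ) < q := by exact_mod_cast NeZero.pos q
  have hsq : (Real.sqrt q : ℂ) ≠ 0 := by exact_mod_cast (Real.sqrt_pos.2 hq).ne'
  have hσc : (σ : ℂ) ≠ 0 := by exact_mod_cast hσ.ne'
  have hN : (Real.sqrt (∑ κ' : ZMod q, folded σ c κ' ^ 2) : ℂ) ≠ 0 := by
    exact_mod_cast (Real.sqrt_pos.2 (sum_folded_sq_pos hσ c)).ne'
  have h1 : ∑ b' : ZMod q, ‖phaseAmp (fun x : ℤ => rho (q / σ) (x : ℝ)) (-c / q) u b'‖ ^ 2 =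
      (1 / σ) ^ 2 * (q * ∑ κ : ZMod q, folded σ c κ ^ 2) := by
    have h2 : ∀ b' : ZMod q, ‖phaseAmp (fun x : ℤ => rho (q / σ) (x : ℝ)) (-c / q) u b'‖ ^ 2 =
        (1 / σ) ^ 2 * ‖∑ κ, chi (-(κ * (b' - u))) * (folded σ c κ : ℂ)‖ ^ 2 := by
      intro b'
      rw [phaseAmp_eq hσ, norm_mul, mul_pow, norm_div, norm_one, Complex.norm_real,
        Real.norm_of_nonneg hσ.le]
    simp only [h2]
    rw [← Finset.mul_sum, sum_norm_fourier]
    congr 2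
    exact Finset.sum_congr rfl fun κ _ => by
      rw [Complex.norm_real, Real.norm_eq_abs, sq_abs]
  rw [h1, Real.sqrt_mul (by positivity), Real.sqrt_sq (by positivity), Real.sqrt_mul hq.le,
    phaseAmp_eq hσ, Finset.mul_sum, Finset.sum_div]
  refine Finset.sum_congr rfl fun κ _ => ?_
  push_cast
  field_simp

theorem gauss_mul_gauss (σ x d : ℝ) :
    gauss σ x * gauss σ (x + d) =
      gauss (σ / Real.sqrt 2) (x + d / 2) * gauss (Real.sqrt 2 * σ) d := by
  rw [gauss, gauss, gauss, gauss, ← Real.exp_add, ← Real.exp_add, div_pow, mul_pow,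
    Real.sq_sqrt zero_le_two]
  congr 1
  by_cases h : σ = 0
  · simp [h]
  · field_simp
    ring

/-- Folding a Gaussian that is narrow compared with `q` hardly changes its `ℓ²` norm. -/
theorem sum_folded_sq_le {σ : ℝ} (hσ : 0 < σ) (c : ℝ) :
    ∑ κ : ZMod q, folded σ c κ ^ 2 ≤
      σ / Real.sqrt 2 * gaussSum (1 / (σ / Real.sqrt 2)) * gaussSum (Real.sqrt 2 * σ / q) := by
  have hq : (0 : ℝ) < q := by exact_mod_cast NeZero.pos q
  have hs : 0 < σ / Real.sqrt 2 := by positivity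
  have h1 : ∀ κ : ZMod q, HasSum (fun k : ℤ => if (k : ZMod q) = κ then
      gauss σ (k - c) * folded σ c κ else 0) (folded σ c κ ^ 2) := by
    intro κ
    have := (summable_folded hσ c κ).hasSum.mul_right (folded σ c κ)
    rw [sq]
    refine this.congr_fun ?_
    intro k
    split_ifs <;> simp
  have h2 := hasSum_sum (s := Finset.univ) fun κ _ => h1 κ
  simp only [Finset.sum_ite_eq, Finset.mem_univ, if_true] at h2
  let F : ℤ → ℤ → ℝ := fun j k => gauss σ (k - c) * gauss σ (k - c + q * j)
  have hF : ∀ j k, F j k = gauss (Real.sqrt 2 * σ / q) j *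
      gauss (σ / Real.sqrt 2) (k - (c - q * j / 2)) := by
    intro j k
    simp only [F]
    rw [gauss_mul_gauss, mul_comm]
    congr 1
    · rw [gauss, gauss]
      congr 1
      field_simp
    · congr 1
      ring
  have hF0 : ∀ p : ℤ × ℤ, 0 ≤ Function.uncurry F p := fun p =>
    mul_nonneg (gauss_pos _ _).le (gauss_pos _ _).le
  have hFk : ∀ j, Summable (F j) := by
    intro j
    simp only [funext (hF j)]
    exact (summable_gauss hs _).mul_left _
  have hFj : ∀ j, ∑' k, F j k ≤ gauss (Real.sqrt 2 * σ / q) j *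
      (σ / Real.sqrt 2 * gaussSum (1 / (σ / Real.sqrt 2))) := by
    intro j
    simp only [hF]
    rw [tsum_mul_left]
    exact mul_le_mul_of_nonneg_left (gauss_shift_sum_le hs _) (gauss_pos _ _).le
  have hbound := (summable_gauss_zero (s := Real.sqrt 2 * σ / q) (by positivity)).hasSum.mul_right
    (σ / Real.sqrt 2 * gaussSum (1 / (σ / Real.sqrt 2)))
  have hsum1 : Summable fun j => ∑' k, F j k :=
    Summable.of_nonneg_of_le (fun j => tsum_nonneg fun k => hF0 (j, k)) hFj hbound.summable
  have hsum : Summable (Function.uncurry F) :=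
    (summable_prod_of_nonneg hF0).2 ⟨hFk, hsum1⟩
  have hfold : ∀ k : ℤ, gauss σ (k - c) * folded σ c (k : ZMod q) = ∑' j, F j k := by
    intro k
    rw [folded, tsum_residue_class, ← tsum_mul_left]
    refine tsum_congr fun j => ?_
    simp only [F]
    congr 2
    push_cast
    ring
  rw [← h2.tsum_eq]
  simp only [hfold]
  rw [hsum.tsum_comm]
  refine (hsum1.tsum_le_tsum hFj hbound.summable).trans (le_of_eq ?_)
  rw [hbound.tsum_eq, mul_comm]
  rfl

end Folded

/-! ### The ideal samples -/

section Ideal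

variable {q : ℕ} [NeZero q] {n m ℓ : ℕ}

/-- The contents of the registers of one sample, sorted by kind. -/
def sampleEquivOne (n m q : ℕ) [NeZero q] :
    ((Fin n → ZMod q) × (Fin m → ZMod q)) × ZMod q ≃ (SampleReg n m → ZMod q) where
  toFun p := sampleReg p.1.1 p.1.2 p.2
  invFun x := ((fun l => x (Sum.inl l), fun j => x (Sum.inr (Sum.inl j))), x (Sum.inr (Sum.inr ())))
  left_inv _ := rfl
  right_inv x := sampleReg_eta x

theorem sum_sampleReg {M : Type*} [AddCommMonoid M] (F : (SampleReg n m → ZMod q) → M) :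
    ∑ x, F x = ∑ y, ∑ κ, ∑ u, F (sampleReg u y κ) := by
  rw [← (sampleEquivOne n m q).sum_comp, Fintype.sum_prod_type, Fintype.sum_prod_type,
    Finset.sum_comm]
  refine Finset.sum_congr rfl fun y _ => ?_
  rw [Finset.sum_comm]
  rfl

/-- The normalized amplitudes of the multiplier, given `y`. -/
def multiplierAmp (α B : ℝ) (A : Matrix (Fin n) (Fin m) (ZMod q)) (e : Fin m → ℤ)
    (y : Fin m → ZMod q) (κ : ZMod q) : ℝ :=
  folded (width α B (‖toE e‖ ^ 2)) (centre α B e (resid A y)) κ /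
    Real.sqrt (∑ κ' : ZMod q,
      folded (width α B (‖toE e‖ ^ 2)) (centre α B e (resid A y)) κ' ^ 2)

/-- The state of one sample whose Fourier transform is exactly the superposition, over the
distributions of `a` and `y`, of the phase states: the secret register holds `u - κ s`, where
`Aᵀ u` is the lattice vector closest to `y`. -/
def idealAmp (α β : ℝ) (A : Matrix (Fin n) (Fin m) (ZMod q)) (e : Fin m → ℤ)
    (s : Fin n → ZMod q) (w : SampleReg n m → ZMod q) : ℝ :=
  if (fun l => w (Sum.inl l)) = coords A (fun j => w (Sum.inr (Sum.inl j))) -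
      w (Sum.inr (Sum.inr ())) • s then
    Real.sqrt (distribution α β A e fun j => w (Sum.inr (Sum.inl j))) *
      multiplierAmp α (β * q) A e (fun j => w (Sum.inr (Sum.inl j))) (w (Sum.inr (Sum.inr ())))
  else 0

theorem idealAmp_sampleReg (α β : ℝ) (A : Matrix (Fin n) (Fin m) (ZMod q)) (e : Fin m → ℤ)
    (s u : Fin n → ZMod q) (y : Fin m → ZMod q) (κ : ZMod q) :
    idealAmp α β A e s (sampleReg u y κ) = if u = coords A y - κ • s then
      Real.sqrt (distribution α β A e y) * multiplierAmp α (β * q) A e y κ else 0 := rfl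

theorem weight_nonneg (α β : ℝ) (A : Matrix (Fin n) (Fin m) (ZMod q)) (e : Fin m → ℤ)
    (y : Fin m → ZMod q) : 0 ≤ weight α β A e y := by
  rw [weight]
  split_ifs
  exacts [(Real.exp_pos _).le, le_rfl]

theorem distribution_nonneg (α β : ℝ) (A : Matrix (Fin n) (Fin m) (ZMod q)) (e : Fin m → ℤ)
    (y : Fin m → ZMod q) : 0 ≤ distribution α β A e y :=
  div_nonneg (weight_nonneg _ _ _ _ _) (Finset.sum_nonneg fun _ _ => weight_nonneg _ _ _ _ _)

theorem sum_weight_pos (hm : 0 < m) {A : Matrix (Fin n) (Fin m) (ZMod q)} (hA : NoShort A)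
    (α β : ℝ) (e : Fin m → ℤ) : 0 < ∑ y, weight α β A e y := by
  have hq : (0 : ℝ) < q := by exact_mod_cast NeZero.pos q
  refine Finset.sum_pos' (fun y _ => weight_nonneg _ _ _ _ _) ⟨0, Finset.mem_univ _, ?_⟩
  have h := residual_eq hm hA (y := 0) (u := 0) (z := 0)
    (by rw [Matrix.mulVec_zero]; funext j; simp) (by
      have : toE (0 : Fin m → ℤ) = 0 := by ext j; simp [toE]
      rw [this, norm_zero, mul_zero]
      exact hq)
  rw [weight, if_pos h.1]
  exact Real.exp_pos _

theorem sum_multiplierAmp_sq {α B : ℝ} (hα : 0 < α) (hB : 0 < B)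
    (A : Matrix (Fin n) (Fin m) (ZMod q)) (e : Fin m → ℤ) (y : Fin m → ZMod q) :
    ∑ κ, multiplierAmp α B A e y κ ^ 2 = 1 := by
  have hσ := width_pos hα hB (sq_nonneg ‖toE e‖)
  have := sum_folded_sq_pos (q := q) hσ (centre α B e (resid A y))
  simp only [multiplierAmp, div_pow]
  rw [← Finset.sum_div, Real.sq_sqrt this.le, div_self this.ne']

theorem sum_idealAmp_sq (hm : 0 < m) {α β : ℝ} (hα : 0 < α) (hβ : 0 < β)
    {A : Matrix (Fin n) (Fin m) (ZMod q)} (hA : NoShort A) (e : Fin m → ℤ) (s : Fin n → ZMod q) :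
    ∑ w, idealAmp α β A e s w ^ 2 = 1 := by
  have hq : (0 : ℝ) < q := by exact_mod_cast NeZero.pos q
  have hW := sum_weight_pos hm hA α β e
  rw [sum_sampleReg]
  have h1 : ∀ y κ, ∑ u, idealAmp α β A e s (sampleReg u y κ) ^ 2 =
      distribution α β A e y * multiplierAmp α (β * q) A e y κ ^ 2 := by
    intro y κ
    simp only [idealAmp_sampleReg]
    rw [Finset.sum_eq_single (coords A y - κ • s)]
    · rw [if_pos rfl, mul_pow, Real.sq_sqrt (distribution_nonneg _ _ _ _ _)]
    · intro u _ hu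
      rw [if_neg hu, zero_pow two_ne_zero]
    · simp
  simp only [h1, ← Finset.mul_sum]
  have h2 : ∀ y, ∑ κ, multiplierAmp α (β * q) A e y κ ^ 2 = 1 := fun y =>
    sum_multiplierAmp_sq hα (by positivity) A e y
  simp only [h2, mul_one, distribution]
  rw [← Finset.sum_div, div_self hW.ne']

theorem phase_eq (α β : ℝ) (A : Matrix (Fin n) (Fin m) (ZMod q)) (e : Fin m → ℤ)
    (y : Fin m → ZMod q) : phase α β A e y = -centre α (β * q) e (resid A y) / q := by
  rw [phase, centre, residual_eq_resid, mul_pow, neg_div, neg_div, div_div, mul_comm (q : ℝ)]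

theorem amplitude_eq (α β E : ℝ) :
    amplitude α β q E = fun x : ℤ => rho (q / width α (β * q) E) (x : ℝ) := by
  funext x
  rw [amplitude, sigma_eq_width]

theorem prod_chi {ι : Type*} (S : Finset ι) (f : ι → ZMod q) :
    ∏ l ∈ S, ZMod.stdAddChar (f l) = chi (∑ l ∈ S, f l) := by
  classical
  induction S using Finset.induction_on with
  | empty => simp [chi]
  | insert l S hl ih =>
    rw [Finset.prod_insert hl, Finset.sum_insert hl, ih, chi, chi, ← AddChar.map_add_eq_mul]

/-- The Fourier transform of the ideal state is, up to a phase on each branch, the superposition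
of the phase states. -/
theorem fourierSample_idealAmp {α β : ℝ} (hα : 0 < α) (hβ : 0 < β)
    (A : Matrix (Fin n) (Fin m) (ZMod q)) (e : Fin m → ℤ) (s a : Fin n → ZMod q)
    (y : Fin m → ZMod q) (j : ZMod q) :
    (fourierSample n m q).mulVec (fun w => (idealAmp α β A e s w : ℂ)) (sampleReg a y j) =
      (chi (-(a ⬝ᵥ coords A y)) * (Real.sqrt (1 / (q : ℝ) ^ n * distribution α β A e y) : ℂ)) *
        (phaseAmp (amplitude α β q (‖toE e‖ ^ 2)) (phase α β A e y) (a ⬝ᵥ s) j /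
          (Real.sqrt (∑ b' : ZMod q,
            ‖phaseAmp (amplitude α β q (‖toE e‖ ^ 2)) (phase α β A e y) (a ⬝ᵥ s) b'‖ ^ 2) : ℂ)) := by
  have hq : (0 : ℝ) < q := by exact_mod_cast NeZero.pos q
  have hB : 0 < β * q := by positivity
  have hσ := width_pos hα hB (sq_nonneg ‖toE e‖)
  rw [amplitude_eq, phase_eq, phaseAmp_div_norm hσ, Matrix.mulVec, dotProduct, sum_sampleReg]
  have h1 : ∀ u y' κ, fourierSample n m q (sampleReg a y j) (sampleReg u y' κ) =
      (∏ l, fourierMat q (a l) (u l)) * ((if y = y' then 1 else 0) * fourierMat q j κ) := by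
    intro u y' κ
    rw [fourierSample, tens, Fintype.prod_sum_type, Fintype.prod_sum_type]
    have := congrFun₂ (tens_one (q := q) (R := Fin m)) y y'
    rw [Matrix.one_apply] at this
    rw [← this]
    simp [sampleReg, tens]
  have h2 : ∀ y' κ, ∑ u, fourierSample n m q (sampleReg a y j) (sampleReg u y' κ) *
      ((idealAmp α β A e s (sampleReg u y' κ) : ℝ) : ℂ) = if y = y' then
        (∏ l, fourierMat q (a l) (coords A y l - κ * s l)) * (fourierMat q j κ *
          ((Real.sqrt (distribution α β A e y) * multiplierAmp α (β * q) A e y κ : ℝ) : ℂ))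
        else 0 := by
    intro y' κ
    simp only [h1, idealAmp_sampleReg]
    rw [Finset.sum_eq_single (coords A y' - κ • s)]
    · rw [if_pos rfl]
      by_cases hy : y = y'
      · subst hy
        rw [if_pos rfl, if_pos rfl, one_mul, mul_assoc]
        rfl
      · rw [if_neg hy, if_neg hy, zero_mul, mul_zero, zero_mul]
    · intro u _ hu
      rw [if_neg hu, Complex.ofReal_zero, mul_zero]
    · simp
  simp only [h2]
  have h3 : ∀ κ : ZMod q, ∏ l, fourierMat q (a l) (coords A y l - κ * s l) =
      chi (-(a ⬝ᵥ coords A y)) * chi (κ * (a ⬝ᵥ s)) * (1 / Real.sqrt q : ℂ) ^ n := by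
    intro κ
    have : ∀ l, fourierMat q (a l) (coords A y l - κ * s l) =
        chi (-(a l * coords A y l) + κ * (a l * s l)) * (1 / Real.sqrt q : ℂ) := by
      intro l
      rw [fourierMat, div_eq_mul_one_div]
      congr 2
      ring
    simp only [this]
    rw [Finset.prod_mul_distrib, Finset.prod_const, Finset.card_univ, Fintype.card_fin, chi, chi,
      ← AddChar.map_add_eq_mul]
    congr 1
    simp only [chi]
    rw [prod_chi]
    congr 1
    rw [Finset.sum_add_distrib, Finset.sum_neg_distrib, ← Finset.mul_sum]
    rfl
  have h4 : (Real.sqrt (1 / (q : ℝ) ^ n * distribution α β A e y) : ℂ) =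
      (1 / Real.sqrt q : ℂ) ^ n * (Real.sqrt (distribution α β A e y) : ℂ) := by
    have : Real.sqrt (1 / (q : ℝ) ^ n) = (1 / Real.sqrt q) ^ n := by
      rw [Real.sqrt_eq_iff_mul_self_eq (by positivity) (by positivity), ← mul_pow, div_mul_div_comm,
        Real.mul_self_sqrt hq.le, one_mul, one_div_pow]
    rw [Real.sqrt_mul (by positivity), this]
    push_cast
    rfl
  rw [Finset.sum_comm]
  simp only [Finset.sum_ite_eq, Finset.mem_univ, if_true]
  rw [Finset.mul_sum]
  refine Finset.sum_congr rfl fun κ _ => ?_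
  have h5 : chi (-(κ * (j - a ⬝ᵥ s))) = chi (κ * (a ⬝ᵥ s)) * chi (-(j * κ)) := by
    rw [chi, chi, chi, ← AddChar.map_add_eq_mul]
    congr 1
    ring
  rw [h3, h4, h5, fourierMat, multiplierAmp]
  push_cast
  ring

/-- On ideal samples, the algorithm has exactly its success probability. -/
theorem jointProb_ideal {α β : ℝ} (hα : 0 < α) (hβ : 0 < β)
    (Q : Circuit (SLWEWires n m q ℓ) (Fin n × ZReg q))
    (A : Matrix (Fin n) (Fin m) (ZMod q)) (o : Fin n × ZReg q → Bool) (e : Fin m → ℤ)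
    (s : Fin n → ZMod q) :
    jointProb Q A o (fun x => ∏ i, (fourierSample n m q).mulVec
      (fun w => (idealAmp α β A e s w : ℂ)) (x i)) =
      ∑ a : Fin ℓ → Fin n → ZMod q, ∑ y : Fin ℓ → Fin m → ZMod q,
        (∏ i, ((1 / (q : ℝ) ^ n) * distribution α β A e (y i))) *
          Q.prob (slweInput A (amplitude α β q (‖toE e‖ ^ 2)) (phase α β A e) s a y) o := by
  refine Finset.sum_congr rfl fun a _ => Finset.sum_congr rfl fun y _ => ?_
  have h1 : branch (fun x : Fin ℓ → SampleReg n m → ZMod q => ∏ i, (fourierSample n m q).mulVec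
      (fun w => (idealAmp α β A e s w : ℂ)) (x i)) a y =
      (∏ i, chi (-(a i ⬝ᵥ coords A (y i))) *
        (Real.sqrt (1 / (q : ℝ) ^ n * distribution α β A e (y i)) : ℂ)) • fun j => ∏ i,
          (phaseAmp (amplitude α β q (‖toE e‖ ^ 2)) (phase α β A e (y i)) (a i ⬝ᵥ s) (j i) /
            (Real.sqrt (∑ b' : ZMod q, ‖phaseAmp (amplitude α β q (‖toE e‖ ^ 2))
              (phase α β A e (y i)) (a i ⬝ᵥ s) b'‖ ^ 2) : ℂ)) := by
    funext j
    rw [Pi.smul_apply, smul_eq_mul, ← Finset.prod_mul_distrib, branch]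
    exact Finset.prod_congr rfl fun i _ => fourierSample_idealAmp hα hβ A e s (a i) (y i) (j i)
  rw [h1, slweState_smul, Circuit.prob_smul, slweInput_eq]
  congr 1
  rw [norm_prod, ← Finset.prod_pow]
  refine Finset.prod_congr rfl fun i _ => ?_
  have h2 : ‖chi (-(a i ⬝ᵥ coords A (y i)))‖ = 1 := AddChar.norm_apply _ _
  rw [norm_mul, h2, one_mul, Complex.norm_real, Real.norm_of_nonneg (Real.sqrt_nonneg _),
    Real.sq_sqrt]
  have := distribution_nonneg α β A e (y i)
  positivity

end Ideal

/-! ### The overlap of the prepared samples with the ideal samples -/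

section Overlap

variable {q : ℕ} [NeZero q] {n m ℓ : ℕ}

theorem gauss_sq (s x : ℝ) : gauss s x ^ 2 = gauss (s / Real.sqrt 2) x := by
  rw [gauss, gauss, ← Real.exp_nat_mul, div_pow, Real.sq_sqrt zero_le_two]
  congr 1
  by_cases h : s = 0
  · simp [h]
  · push_cast
    field_simp

theorem wt_pos (α B : ℝ) (e z : Fin m → ℤ) : 0 < wt α B e z := Real.exp_pos _

theorem rho_sq (s : ℝ) (z : Fin m → ℤ) : rho s (toE z) ^ 2 = rho (s / Real.sqrt 2) (toE z) := by
  rw [rho_toE, rho_toE, ← Finset.prod_pow]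
  exact Finset.prod_congr rfl fun j _ => gauss_sq s _

/-- The squared norm of the Gaussian function on `ℤ_q`. -/
def gaussNorm (q : ℕ) [NeZero q] (s : ℝ) : ℝ := ∑ x : ZMod q, gauss s x.valMinAbs ^ 2

/-- The normalized Gaussian state on `ℤ_q`. -/
def gaussAmp (s : ℝ) (x : ZMod q) : ℂ :=
  ((gauss s x.valMinAbs / Real.sqrt (gaussNorm q s) : ℝ) : ℂ)

theorem gaussNorm_pos (s : ℝ) : 0 < gaussNorm q s :=
  Finset.sum_pos (fun _ _ => pow_pos (gauss_pos _ _) 2) Finset.univ_nonempty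

theorem sum_gaussAmp_sq (s : ℝ) : ∑ x : ZMod q, ‖gaussAmp s x‖ ^ 2 = 1 := by
  simp only [gaussAmp, Complex.norm_real, Real.norm_eq_abs, sq_abs, div_pow]
  rw [← Finset.sum_div, Real.sq_sqrt (gaussNorm_pos s).le]
  exact div_self (gaussNorm_pos s).ne'

/-- The square of a Gaussian is a Gaussian of smaller width, and restricting the sum to one
representative of each residue only decreases it. -/
theorem gaussNorm_le {s : ℝ} (hs : 0 < s) : gaussNorm q s ≤ gaussSum (s / Real.sqrt 2) := by
  have hs' : 0 < s / Real.sqrt 2 := by positivity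
  have := (summable_gauss_zero hs').sum_le_tsum
    (Finset.univ.map ⟨ZMod.valMinAbs (n := q), ZMod.injective_valMinAbs⟩)
    fun k _ => (gauss_pos _ _).le
  rw [Finset.sum_map] at this
  simp only [gaussNorm, gauss_sq]
  exact this

/-- The normalization of the distribution of `y`. Each weight times the sum over `k` of a Gaussian
of width `σ / √2` factors by completing the square, and the pairs of a residual and a multiplier
correspond to pairs of independent Gaussian variables. -/
theorem sum_weight_le {α β : ℝ} (hα : 0 < α) (hβ : 0 < β)
    {A : Matrix (Fin n) (Fin m) (ZMod q)} (e : Fin m → ℤ)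
    (hϑ : gaussSum (1 / (width α (β * q) (‖toE e‖ ^ 2) / Real.sqrt 2)) < 2) :
    (∑ y, weight α β A e y) * (width α (β * q) (‖toE e‖ ^ 2) / Real.sqrt 2 *
      (2 - gaussSum (1 / (width α (β * q) (‖toE e‖ ^ 2) / Real.sqrt 2)))) ≤
      (q : ℝ) ^ n * (gaussSum (α / Real.sqrt 2) * gaussSum (β * q / Real.sqrt 2) ^ m) := by
  have hq : (0 : ℝ) < q := by exact_mod_cast NeZero.pos q
  have hB : 0 < β * q := by positivity
  have hσ := width_pos hα hB (sq_nonneg ‖toE e‖)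
  set t := width α (β * q) (‖toE e‖ ^ 2) / Real.sqrt 2 with ht
  have ht0 : 0 < t := by positivity
  have hα' : 0 < α / Real.sqrt 2 := by positivity
  have hB' : 0 < β * q / Real.sqrt 2 := by positivity
  set K := t * (2 - gaussSum (1 / t)) with hK
  let G : (Fin m → ℤ) → ℤ → ℝ := fun z k =>
    gauss (α / Real.sqrt 2) k * rho (β * q / Real.sqrt 2) (toE (z - k • e))
  have hG : ∀ z k, G z k = wt α (β * q) e z * gauss t (k - centre α (β * q) e z) :=
    fun z k => (wt_mul_gauss hα hB e z k).symm
  have hGs : ∀ z, Summable (G z) := by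
    intro z
    simp only [funext (hG z)]
    exact (summable_gauss ht0 _).mul_left _
  have h1 : ∀ z, wt α (β * q) e z * K ≤ ∑' k, G z k := by
    intro z
    simp only [hG]
    rw [tsum_mul_left]
    exact mul_le_mul_of_nonneg_left (le_gauss_shift_sum ht0 _) (Real.exp_pos _).le
  have h2 : ∀ y, weight α β A e y * K ≤ ∑' k, G (resid A y) k := by
    intro y
    refine le_trans ?_ (h1 _)
    refine mul_le_mul_of_nonneg_right ?_ (mul_nonneg ht0.le (by linarith))
    rw [weight]
    split_ifs
    · rw [residual_eq_resid, rhoCov_eq hβ]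
    · exact (Real.exp_pos _).le
  classical
  have h3 : ∀ z, (Finset.univ.filter fun y => resid A y = z).card ≤ q ^ n := by
    intro z
    have : (Finset.univ : Finset (Fin n → ZMod q)).card = q ^ n := by
      rw [Finset.card_univ, Fintype.card_fun, ZMod.card, Fintype.card_fin]
    rw [← this]
    refine Finset.card_le_card_of_injOn (coords A) (fun _ _ => Finset.mem_coe.2 (Finset.mem_univ _))
      fun y hy y' hy' h => ?_
    have hy := (Finset.mem_filter.1 (Finset.mem_coe.1 hy)).2
    have hy' := (Finset.mem_filter.1 (Finset.mem_coe.1 hy')).2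
    rw [eq_coords_add_resid A y, eq_coords_add_resid A y', hy, hy', h]
  have h4 : ∀ Z : Finset (Fin m → ℤ), ∑ z ∈ Z, ∑' k, G z k ≤
      gaussSum (α / Real.sqrt 2) * gaussSum (β * q / Real.sqrt 2) ^ m := by
    intro Z
    have hsum := (summable_gauss_zero hα').hasSum.mul_right (gaussSum (β * q / Real.sqrt 2) ^ m)
    rw [← Summable.tsum_finsetSum fun z _ => hGs z]
    refine ((summable_sum fun z _ => hGs z).tsum_le_tsum (fun k => ?_) hsum.summable).trans
      (le_of_eq hsum.tsum_eq)
    rw [← Finset.mul_sum]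
    refine mul_le_mul_of_nonneg_left ?_ (gauss_pos _ _).le
    have := (hasSum_rho_toE (m := m) hB').summable.sum_le_tsum
      (Z.map ⟨fun z => z - k • e, sub_left_injective⟩) fun z _ =>
        show 0 ≤ rho (β * q / Real.sqrt 2) (toE z) from (Real.exp_pos _).le
    rwa [Finset.sum_map, (hasSum_rho_toE (m := m) hB').tsum_eq] at this
  rw [Finset.sum_mul]
  refine (Finset.sum_le_sum fun y _ => h2 y).trans ?_
  rw [Finset.sum_comp (fun z => ∑' k, G z k) (resid A)]
  refine le_trans ?_ (mul_le_mul_of_nonneg_left (h4 (Finset.univ.image (resid A)))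
    (by positivity))
  rw [Finset.mul_sum]
  refine Finset.sum_le_sum fun z _ => ?_
  rw [nsmul_eq_mul]
  refine mul_le_mul_of_nonneg_right ?_ (tsum_nonneg fun k =>
    mul_nonneg (gauss_pos _ _).le (Real.exp_pos _).le)
  exact_mod_cast h3 z

theorem valMinAbs_intCast {k : ℤ} (h : 2 * |k| < q) : (k : ZMod q).valMinAbs = k := by
  rw [ZMod.valMinAbs_spec]
  have := abs_lt.1 (show |k| < (q : ℤ) by have := abs_nonneg k; omega)
  refine ⟨rfl, ?_, ?_⟩ <;> rcases abs_cases k with h' | h' <;> omega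

/-- The prepared state at a point that comes from an error vector `v` and a multiplier `k`. -/
theorem mixedSample_gauss (α B : ℝ) (A : Matrix (Fin n) (Fin m) (ZMod q)) (e : Fin m → ℤ)
    (s u : Fin n → ZMod q) (k : ℤ) (v : Fin m → ℤ) (hk : 2 * |k| < q) (hv : ∀ j, 2 * |v j| < q) :
    mixedSample (gaussAmp α) (gaussAmp B) A (A.transpose.mulVec s + fun j => ((e j : ℤ) : ZMod q))
      (sampleReg (u - (k : ZMod q) • s)
        (A.transpose.mulVec u + fun j => (((v + k • e) j : ℤ) : ZMod q)) (k : ZMod q)) =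
      (((1 / Real.sqrt q) ^ n * (rho B (toE v) * gauss α k) /
        (Real.sqrt (gaussNorm q B) ^ m * Real.sqrt (gaussNorm q α)) : ℝ) : ℂ) := by
  have h1 : ∀ j, (A.transpose.mulVec u + fun j => (((v + k • e) j : ℤ) : ZMod q)) j -
      ((k : ZMod q) * (A.transpose.mulVec s + fun j => ((e j : ℤ) : ZMod q)) j +
        ∑ l, A l j * (u - (k : ZMod q) • s) l) = ((v j : ℤ) : ZMod q) := by
    intro j
    have h2 : ∑ l, A l j * (u - (k : ZMod q) • s) l =
        A.transpose.mulVec u j - (k : ZMod q) * A.transpose.mulVec s j := by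
      have : ∑ l, A l j * (u - (k : ZMod q) • s) l =
          A.transpose.mulVec (u - (k : ZMod q) • s) j := rfl
      rw [this, Matrix.mulVec_sub, Matrix.mulVec_smul]
      rfl
    rw [h2]
    have h3 : (v + k • e) j = v j + k * e j := rfl
    simp only [Pi.add_apply]
    rw [← Pi.add_apply v, h3]
    push_cast
    ring
  have h3 : mixedSample (gaussAmp α) (gaussAmp B) A
      (A.transpose.mulVec s + fun j => ((e j : ℤ) : ZMod q)) (sampleReg (u - (k : ZMod q) • s)
        (A.transpose.mulVec u + fun j => (((v + k • e) j : ℤ) : ZMod q)) (k : ZMod q)) =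
      (∏ _l : Fin n, (1 / Real.sqrt q : ℂ)) *
        ((∏ j, gaussAmp B ((v j : ℤ) : ZMod q)) * gaussAmp α (k : ZMod q)) := by
    simp only [mixedSample, sampleReg, Sum.elim_inl, Sum.elim_inr]
    simp only [h1]
  rw [h3, rho_toE]
  simp only [gaussAmp, valMinAbs_intCast hk, valMinAbs_intCast (hv _), Finset.prod_const,
    Finset.card_univ, Fintype.card_fin]
  rw [← Complex.ofReal_prod, Finset.prod_div_distrib, Finset.prod_const, Finset.card_univ,
    Fintype.card_fin]
  push_cast
  field_simp

theorem mixedSample_nonneg (α B : ℝ) (A : Matrix (Fin n) (Fin m) (ZMod q)) (b : Fin m → ZMod q)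
    (w : SampleReg n m → ZMod q) :
    ∃ r : ℝ, 0 ≤ r ∧ mixedSample (gaussAmp α) (gaussAmp B) A b w = r := by
  refine ⟨(∏ _l : Fin n, (1 / Real.sqrt q)) * ((∏ j, gauss B (ZMod.valMinAbs
    (w (Sum.inr (Sum.inl j)) - (w (Sum.inr (Sum.inr ())) * b j + ∑ l, A l j * w (Sum.inl l)))) /
      Real.sqrt (gaussNorm q B)) *
        (gauss α (w (Sum.inr (Sum.inr ()))).valMinAbs / Real.sqrt (gaussNorm q α))), ?_, ?_⟩
  · refine mul_nonneg (Finset.prod_nonneg fun _ _ => by positivity) (mul_nonneg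
      (Finset.prod_nonneg fun _ _ => ?_) ?_)
    · exact div_nonneg (gauss_pos _ _).le (Real.sqrt_nonneg _)
    · exact div_nonneg (gauss_pos _ _).le (Real.sqrt_nonneg _)
  · simp only [mixedSample, gaussAmp]
    push_cast
    rfl

theorem idealAmp_nonneg {α β : ℝ} (hα : 0 < α) (hβ : 0 < β)
    (A : Matrix (Fin n) (Fin m) (ZMod q)) (e : Fin m → ℤ)
    (s : Fin n → ZMod q) (w : SampleReg n m → ZMod q) : 0 ≤ idealAmp α β A e s w := by
  have hq : (0 : ℝ) < q := by exact_mod_cast NeZero.pos q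
  rw [idealAmp]
  split_ifs
  · exact mul_nonneg (Real.sqrt_nonneg _) (div_nonneg (folded_pos (width_pos hα (by positivity)
      (sq_nonneg _)) _ _).le (Real.sqrt_nonneg _))
  · exact le_rfl

/-- The overlap of the prepared sample with the ideal sample is real and, up to the mass of
a set `S` of multipliers and error vectors that stay within the decoding radius, it is bounded
below by a ratio of Gaussian sums. -/
theorem le_overlap (hm : 0 < m) {α β : ℝ} (hα : 0 < α) (hβ : 0 < β)
    {A : Matrix (Fin n) (Fin m) (ZMod q)} (hA : NoShort A) (e : Fin m → ℤ) (s : Fin n → ZMod q)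
    (S : Finset (ℤ × (Fin m → ℤ)))
    (hS : ∀ p ∈ S, 2 * |p.1| < q ∧ (∀ j, 2 * |p.2 j| < q) ∧ 48 * ‖toE (p.2 + p.1 • e)‖ < q)
    {t : ℝ} (ht : t = width α (β * q) (‖toE e‖ ^ 2) / Real.sqrt 2) (hϑ : gaussSum (1 / t) < 2) :
    ∃ ω : ℝ, ∑ w, star (mixedSample (gaussAmp α) (gaussAmp (β * q)) A
        (A.transpose.mulVec s + fun j => ((e j : ℤ) : ZMod q)) w) * (idealAmp α β A e s w : ℂ) = ω ∧
      (∑ p ∈ S, gauss (α / Real.sqrt 2) p.1 * rho (β * q / Real.sqrt 2) (toE p.2)) /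
        (gaussSum (α / Real.sqrt 2) * gaussSum (β * q / Real.sqrt 2) ^ m) *
        Real.sqrt ((2 - gaussSum (1 / t)) / (gaussSum (1 / t) * gaussSum (2 * t / q))) ≤ ω := by
  have hq : (0 : ℝ) < q := by exact_mod_cast NeZero.pos q
  have hB : 0 < β * q := by positivity
  have hσ := width_pos hα hB (sq_nonneg ‖toE e‖)
  have ht0 : 0 < t := by rw [ht]; positivity
  have hα' : 0 < α / Real.sqrt 2 := by positivity
  have hB' : 0 < β * q / Real.sqrt 2 := by positivity
  choose r hr0 hr using mixedSample_nonneg α (β * q) A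
    (A.transpose.mulVec s + fun j => ((e j : ℤ) : ZMod q))
  refine ⟨∑ w, r w * idealAmp α β A e s w, ?_, ?_⟩
  · rw [Complex.ofReal_sum]
    refine Finset.sum_congr rfl fun w _ => ?_
    rw [hr, Complex.ofReal_mul]
    congr 1
    exact Complex.conj_ofReal _
  set W := ∑ y, weight α β A e y with hWdef
  have hW0 : 0 < W := sum_weight_pos hm hA α β e
  have hW := sum_weight_le (A := A) hα hβ e (by rw [← ht]; exact hϑ)
  rw [← ht, ← hWdef] at hW
  set N := gaussSum (α / Real.sqrt 2) * gaussSum (β * q / Real.sqrt 2) ^ m with hN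
  have hN0 : 0 < N := mul_pos (gaussSum_pos hα') (pow_pos (gaussSum_pos hB') m)
  set θ := gaussSum (1 / t) with hθ
  set θ' := gaussSum (2 * t / q) with hθ'
  have hθ0 : 0 < θ := gaussSum_pos (by positivity)
  have hθ'0 : 0 < θ' := gaussSum_pos (by positivity)
  -- the points of `S`, together with the lattice vectors, as points of the register space
  let ι : (Fin n → ZMod q) × (ℤ × (Fin m → ℤ)) → SampleReg n m → ZMod q := fun p =>
    sampleReg (p.1 - (p.2.1 : ZMod q) • s)
      (A.transpose.mulVec p.1 + fun j => (((p.2.2 + p.2.1 • e) j : ℤ) : ZMod q)) (p.2.1 : ZMod q)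
  have hdec : ∀ u, ∀ p ∈ S, resid A (A.transpose.mulVec u +
      fun j => (((p.2 + p.1 • e) j : ℤ) : ZMod q)) = p.2 + p.1 • e ∧
      coords A (A.transpose.mulVec u + fun j => (((p.2 + p.1 • e) j : ℤ) : ZMod q)) = u :=
    fun u p hp => resid_eq hm hA rfl (hS p hp).2.2
  have hinj : Set.InjOn ι (((Finset.univ : Finset (Fin n → ZMod q)) ×ˢ S : Finset _) : Set _) := by
    rintro ⟨u, k, v⟩ hp ⟨u', k', v'⟩ hp' h
    have hp := (Finset.mem_product.1 (Finset.mem_coe.1 hp)).2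
    have hp' := (Finset.mem_product.1 (Finset.mem_coe.1 hp')).2
    have hk : (k : ZMod q) = k' := congrFun h (Sum.inr (Sum.inr ()))
    have hy : (A.transpose.mulVec u + fun j => (((v + k • e) j : ℤ) : ZMod q)) =
        A.transpose.mulVec u' + fun j => (((v' + k' • e) j : ℤ) : ZMod q) :=
      funext fun j => congrFun h (Sum.inr (Sum.inl j))
    have hk' : k = k' := by
      have h1 : (k : ZMod q).valMinAbs = k := valMinAbs_intCast (hS _ hp).1
      have h2 : (k' : ZMod q).valMinAbs = k' := valMinAbs_intCast (hS _ hp').1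
      rw [← h1, hk, h2]
    subst hk'
    have h1 := hdec u _ hp
    have h2 := hdec u' _ hp'
    simp only at h1 h2
    rw [hy] at h1
    have h3 := add_right_cancel (h1.1.symm.trans h2.1)
    have h4 := h1.2.symm.trans h2.2
    rw [h3, h4]
  -- the contribution of each point
  have hterm : ∀ u, ∀ p ∈ S, (1 / Real.sqrt q) ^ n *
      (gauss (α / Real.sqrt 2) p.1 * rho (β * q / Real.sqrt 2) (toE p.2)) /
        (Real.sqrt N * (Real.sqrt W * Real.sqrt (t * θ * θ'))) ≤
      r (ι (u, p)) * idealAmp α β A e s (ι (u, p)) := by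
    rintro u ⟨k, v⟩ hp
    obtain ⟨hk, hv, hz⟩ := hS _ hp
    obtain ⟨hres, hco⟩ := hdec u _ hp
    simp only at hk hv hz hres hco
    have hr' : r (ι (u, (k, v))) = (1 / Real.sqrt q) ^ n * (rho (β * q) (toE v) * gauss α k) /
        (Real.sqrt (gaussNorm q (β * q)) ^ m * Real.sqrt (gaussNorm q α)) := by
      have h1 := hr (ι (u, (k, v)))
      simp only [ι] at h1 ⊢
      rw [mixedSample_gauss α (β * q) A e s u k v hk hv] at h1
      exact (Complex.ofReal_injective h1).symm
    have hball := (residual_eq hm hA (u := u) rfl hz).1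
    have hi : idealAmp α β A e s (ι (u, (k, v))) =
        Real.sqrt (wt α (β * q) e (v + k • e) / W) *
          (folded (width α (β * q) (‖toE e‖ ^ 2)) (centre α (β * q) e (v + k • e)) (k : ZMod q) /
          Real.sqrt (∑ κ' : ZMod q, folded (width α (β * q) (‖toE e‖ ^ 2))
            (centre α (β * q) e (v + k • e)) κ' ^ 2)) := by
      simp only [ι]
      rw [idealAmp_sampleReg, hco, if_pos rfl, multiplierAmp, hres, distribution, weight,
        if_pos hball, residual_eq_resid, hres, rhoCov_eq hβ]
    have hsqrtN : Real.sqrt (gaussNorm q (β * q)) ^ m * Real.sqrt (gaussNorm q α) ≤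
        Real.sqrt N := by
      refine Real.le_sqrt_of_sq_le ?_
      rw [mul_pow, ← pow_mul, mul_comm m 2, pow_mul, Real.sq_sqrt (gaussNorm_pos _).le,
        Real.sq_sqrt (gaussNorm_pos _).le, hN, mul_comm]
      exact mul_le_mul (gaussNorm_le hα) (pow_le_pow_left₀ (gaussNorm_pos _).le (gaussNorm_le hB) m)
        (pow_nonneg (gaussNorm_pos _).le m) (gaussSum_pos hα').le
    have hF := sum_folded_sq_le (q := q) hσ (centre α (β * q) e (v + k • e))
    have h2t : Real.sqrt 2 * width α (β * q) (‖toE e‖ ^ 2) = 2 * t := by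
      rw [ht, mul_div_assoc']
      rw [eq_div_iff (by positivity)]
      nlinarith [Real.mul_self_sqrt (show (0 : ℝ) ≤ 2 by norm_num)]
    rw [← ht, h2t] at hF
    have hH : rho (β * q) (toE v) * gauss α k ≤ Real.sqrt (wt α (β * q) e (v + k • e)) *
        folded (width α (β * q) (‖toE e‖ ^ 2)) (centre α (β * q) e (v + k • e)) (k : ZMod q) := by
      refine le_trans (le_of_sq_le_sq ?_ (mul_nonneg (Real.sqrt_nonneg _) (gauss_pos _ _).le))
        (mul_le_mul_of_nonneg_left (gauss_le_folded hσ _ k) (Real.sqrt_nonneg _))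
      rw [mul_pow, mul_pow, Real.sq_sqrt (wt_pos _ _ _ _).le, gauss_sq, gauss_sq, rho_sq,
        wt_mul_gauss hα hB, add_sub_cancel_right, mul_comm]
    rw [hr', hi, Real.sqrt_div (wt_pos _ _ _ _).le, ← gauss_sq, ← rho_sq, div_mul_div_comm,
      div_mul_div_comm]
    have hrv : 0 < rho (β * q) (toE v) := Real.exp_pos _
    have hgk := gauss_pos α k
    have hFpos := sum_folded_sq_pos (q := q) hσ (centre α (β * q) e (v + k • e))
    have hgN := gaussNorm_pos (q := q) (β * q)
    have hgN' := gaussNorm_pos (q := q) α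
    refine div_le_div₀ ?_ ?_ (by positivity) ?_
    · have := folded_pos hσ (centre α (β * q) e (v + k • e)) (k : ZMod q)
      positivity
    · calc (1 / Real.sqrt q) ^ n * (gauss α k ^ 2 * rho (β * q) (toE v) ^ 2)
          = (1 / Real.sqrt q) ^ n * (rho (β * q) (toE v) * gauss α k) *
            (rho (β * q) (toE v) * gauss α k) := by ring
        _ ≤ _ := mul_le_mul_of_nonneg_left hH (by positivity)
    · gcongr
  -- summing the contributions
  have hsum : ∑ p ∈ (Finset.univ ×ˢ S : Finset ((Fin n → ZMod q) × (ℤ × (Fin m → ℤ)))),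
      r (ι p) * idealAmp α β A e s (ι p) ≤ ∑ w, r w * idealAmp α β A e s w := by
    classical
    rw [← Finset.sum_image (f := fun w => r w * idealAmp α β A e s w) hinj]
    exact Finset.sum_le_univ_sum_of_nonneg fun w => mul_nonneg (hr0 w) (idealAmp_nonneg hα hβ A e s w)
  refine le_trans ?_ hsum
  rw [Finset.sum_product]
  refine le_trans ?_ (Finset.sum_le_sum fun u _ => Finset.sum_le_sum fun p hp => hterm u p hp)
  rw [Finset.sum_const, Finset.card_univ, Fintype.card_fun, ZMod.card, Fintype.card_fin,
    nsmul_eq_mul, ← Finset.sum_div, ← Finset.mul_sum]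
  set Y := ∑ p ∈ S, gauss (α / Real.sqrt 2) p.1 * rho (β * q / Real.sqrt 2) (toE p.2)
  have hY : 0 ≤ Y := Finset.sum_nonneg fun p _ => mul_nonneg (gauss_pos _ _).le (Real.exp_pos _).le
  have hkey : Real.sqrt W * (Real.sqrt t * Real.sqrt (2 - θ)) ≤ Real.sqrt q ^ n * Real.sqrt N := by
    refine le_of_sq_le_sq ?_ (by positivity)
    rw [mul_pow, mul_pow, mul_pow, Real.sq_sqrt hW0.le, Real.sq_sqrt ht0.le,
      Real.sq_sqrt (by linarith), Real.sq_sqrt hN0.le, ← pow_mul, mul_comm n 2, pow_mul,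
      Real.sq_sqrt hq.le]
    exact hW
  have hc : ((q ^ n : ℕ) : ℝ) * (1 / Real.sqrt q) ^ n = Real.sqrt q ^ n := by
    rw [Nat.cast_pow, ← mul_pow]
    congr 1
    rw [mul_one_div, Real.div_sqrt]
  rw [Real.sqrt_div (by linarith), mul_assoc t, Real.sqrt_mul ht0.le,
    div_mul_div_comm, ← mul_div_assoc (((q ^ n : ℕ) : ℝ)), ← mul_assoc (((q ^ n : ℕ) : ℝ)), hc,
    div_le_div_iff₀ (by positivity) (by positivity)]
  have hNN := Real.mul_self_sqrt hN0.le
  calc Y * Real.sqrt (2 - θ) * (Real.sqrt N * (Real.sqrt W * (Real.sqrt t * Real.sqrt (θ * θ'))))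
      = (Real.sqrt W * (Real.sqrt t * Real.sqrt (2 - θ))) *
        (Y * Real.sqrt N * Real.sqrt (θ * θ')) := by ring
    _ ≤ (Real.sqrt q ^ n * Real.sqrt N) * (Y * Real.sqrt N * Real.sqrt (θ * θ')) :=
        mul_le_mul_of_nonneg_right hkey (by positivity)
    _ = Real.sqrt q ^ n * Y * ((Real.sqrt N * Real.sqrt N) * Real.sqrt (θ * θ')) := by ring
    _ = _ := by rw [hNN]

end Overlap

/-! ### Quantitative bounds for one trial -/

section Estimates

variable {q : ℕ} [NeZero q] {n m ℓ : ℕ}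

theorem exp_mul_sqrt_two_le {k : ℕ} (hk : 0 < k) :
    Real.exp (-Real.pi * k / 2) * Real.sqrt 2 ^ k ≤ (1 / 2) ^ k ∧
      Real.exp (-Real.pi * k / 2) * Real.sqrt 2 ≤ (1 / 2) ^ k := by
  have h1 : (3 : ℝ) ≤ Real.exp (Real.pi / 2) := by
    have h2 : Real.exp (3 / 4) * Real.exp (3 / 4) ≤ Real.exp (Real.pi / 2) := by
      rw [← Real.exp_add, Real.exp_le_exp]
      linarith [Real.pi_gt_three]
    nlinarith [Real.add_one_le_exp (3 / 4 : ℝ)]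
  have h2 : Real.sqrt 2 ≤ 3 / 2 := by
    rw [Real.sqrt_le_left (by norm_num)]; norm_num
  have h3 : Real.exp (-Real.pi * k / 2) = (Real.exp (Real.pi / 2))⁻¹ ^ k := by
    rw [← Real.exp_neg, ← Real.exp_nat_mul]
    congr 1; ring
  have h4 : (Real.exp (Real.pi / 2))⁻¹ * Real.sqrt 2 ≤ 1 / 2 := by
    rw [inv_mul_le_iff₀ (Real.exp_pos _)]
    linarith
  have h5 : Real.exp (-Real.pi * k / 2) * Real.sqrt 2 ^ k ≤ (1 / 2) ^ k := by
    rw [h3, ← mul_pow]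
    exact pow_le_pow_left₀ (by positivity) h4 k
  refine ⟨h5, le_trans (mul_le_mul_of_nonneg_left ?_ (Real.exp_pos _).le) h5⟩
  exact le_self_pow₀ (Real.one_le_sqrt.2 one_le_two) hk.ne'

/-- A bound on the loss of overlap of one sample: the mass of multipliers and error vectors of
untypical size, and the deviations of two Gaussian sums from their leading terms. -/
def overlapLoss (n : ℕ) (α : ℝ) : ℝ :=
  2 * (1 / 2) ^ n + (2 * (gaussSum 1 * Real.exp (-Real.pi * (α ^ 2 / 4 - 1))) +
    gaussSum 1 * Real.exp (-Real.pi * (n - 1)))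

/-- The relations between the parameters under which the prepared samples are almost ideal; `B` stands
for `β q` and `E` for the squared length of the error. The bound `radius_lt` makes error vectors of
length up to `2 B √m` decodable, and `theta_lt` keeps the sums of shifted Gaussians away from `0`. -/
structure Regime (n m q : ℕ) (α B E : ℝ) : Prop where
  n_pos : 0 < n
  n_le : n ≤ m
  two_le : 2 ≤ α
  alpha_le : α ≤ B
  error_le : α ^ 2 * E ≤ B ^ 2
  error_nonneg : 0 ≤ E
  radius_lt : 96 * B * Real.sqrt m < q
  theta_lt : gaussSum 1 * Real.exp (-Real.pi * (α ^ 2 / 4 - 1)) < 1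

theorem width_bounds {α B E : ℝ} (hα : 0 < α) (hB : 0 < B) (hE : 0 ≤ E) (h : α ^ 2 * E ≤ B ^ 2) :
    α ^ 2 / 4 ≤ (width α B E / Real.sqrt 2) ^ 2 ∧ (width α B E / Real.sqrt 2) ^ 2 ≤ α ^ 2 / 2 := by
  rw [div_pow, Real.sq_sqrt zero_le_two, width_sq hB hE]
  have hG : 0 < α ^ 2 * E + B ^ 2 := by positivity
  constructor
  · rw [div_div, le_div_iff₀ (by positivity)]
    nlinarith [mul_le_mul_of_nonneg_left h (sq_nonneg α)]
  · rw [div_div, div_le_iff₀ (by positivity)]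
    nlinarith [mul_nonneg (sq_nonneg α) (mul_nonneg (sq_nonneg α) hE)]

/-- Multipliers and error vectors of typical size stay within the decoding radius: `v` and `k e`
both have length at most `B √m`. -/
theorem Regime.decodable {α B : ℝ} {e : Fin m → ℤ} (h : Regime n m q α B (‖toE e‖ ^ 2)) {k : ℤ}
    {v : Fin m → ℤ} (hk : (k : ℝ) ^ 2 ≤ n * (α / Real.sqrt 2) ^ 2)
    (hv : ‖toE v‖ ^ 2 ≤ m * (B / Real.sqrt 2) ^ 2) :
    2 * |k| < q ∧ (∀ j, 2 * |v j| < q) ∧ 48 * ‖toE (v + k • e)‖ < q := by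
  have hα : 0 < α := by linarith [h.two_le]
  have hB : 0 < B := by linarith [h.alpha_le]
  have hm0 : (0 : ℝ) ≤ m := Nat.cast_nonneg m
  have hnm : (n : ℝ) ≤ m := by exact_mod_cast h.n_le
  have hsm := Real.sq_sqrt hm0
  have hsm0 := Real.sqrt_nonneg (m : ℝ)
  rw [div_pow, Real.sq_sqrt zero_le_two] at hk hv
  have hk1 : |(k : ℝ)| ≤ Real.sqrt m * α := by
    refine abs_le_of_sq_le_sq ?_ (by positivity)
    rw [mul_pow, hsm]
    nlinarith [sq_nonneg α, mul_le_mul_of_nonneg_right hnm (sq_nonneg α)]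
  have hv1 : ‖toE v‖ ≤ Real.sqrt m * B := by
    refine le_of_sq_le_sq ?_ (by positivity)
    rw [mul_pow, hsm]
    nlinarith [mul_nonneg hm0 (sq_nonneg B)]
  have hαe : α * ‖toE e‖ ≤ B := by
    refine le_of_sq_le_sq ?_ hB.le
    rw [mul_pow]
    exact h.error_le
  have hR := h.radius_lt
  have hx : 0 ≤ Real.sqrt m * B := by positivity
  have hy : Real.sqrt m * α ≤ Real.sqrt m * B := mul_le_mul_of_nonneg_left h.alpha_le hsm0
  refine ⟨?_, fun j => ?_, ?_⟩
  · have : 2 * |(k : ℝ)| < q := by linarith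
    exact_mod_cast this
  · have h1 := abs_le_norm_toE v j
    have : 2 * |(v j : ℝ)| < q := by linarith
    exact_mod_cast this
  · rw [toE_add, toE_zsmul]
    have h1 := norm_add_le (toE v) ((k : ℝ) • toE e)
    rw [norm_smul, Real.norm_eq_abs] at h1
    have h2 : |(k : ℝ)| * ‖toE e‖ ≤ Real.sqrt m * B := by
      calc |(k : ℝ)| * ‖toE e‖ ≤ Real.sqrt m * α * ‖toE e‖ :=
            mul_le_mul_of_nonneg_right hk1 (norm_nonneg _)
        _ = Real.sqrt m * (α * ‖toE e‖) := by ring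
        _ ≤ _ := mul_le_mul_of_nonneg_left hαe hsm0
    linarith

/-- Typical multipliers and error vectors carry almost all the mass. -/
theorem typical_mass {a b : ℝ} (ha : 0 < a) (hb : 0 < b) (hn : 0 < n) (hnm : n ≤ m) {C : ℝ}
    (hC : ∀ S : Finset (ℤ × (Fin m → ℤ)),
      (∀ p ∈ S, (p.1 : ℝ) ^ 2 ≤ n * a ^ 2 ∧ ‖toE p.2‖ ^ 2 ≤ m * b ^ 2) →
      ∑ p ∈ S, gauss a p.1 * rho b (toE p.2) ≤ C) :
    gaussSum a * gaussSum b ^ m * (1 - 2 * (1 / 2) ^ n) ≤ C := by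
  classical
  let γ : ℤ × (Fin m → ℤ) → ℝ := fun p => gauss a p.1 * rho b (toE p.2)
  let F₁ : ℤ × (Fin m → ℤ) → ℝ := fun p =>
    Real.exp (-Real.pi * n / 2) * (gauss (Real.sqrt 2 * a) p.1 * rho b (toE p.2))
  let F₂ : ℤ × (Fin m → ℤ) → ℝ := fun p =>
    Real.exp (-Real.pi * m / 2) * (gauss a p.1 * rho (Real.sqrt 2 * b) (toE p.2))
  have hprod : ∀ {x y : ℝ}, 0 < x → 0 < y → HasSum (fun p : ℤ × (Fin m → ℤ) =>
      gauss x p.1 * rho y (toE p.2)) (gaussSum x * gaussSum y ^ m) := by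
    intro x y hx hy
    have h1 : (0 : ℤ → ℝ) ≤ fun k : ℤ => gauss x k := fun k => (gauss_pos _ _).le
    have h2 : (0 : (Fin m → ℤ) → ℝ) ≤ fun z => rho y (toE z) := fun z => (Real.exp_pos _).le
    have h3 := hasSum_rho_toE (m := m) hy
    have h4 := Summable.mul_of_nonneg (summable_gauss_zero hx) h3.summable h1 h2
    have h5 := (summable_gauss_zero hx).hasSum.mul h3 h4
    exact h5
  have hγ : HasSum γ (gaussSum a * gaussSum b ^ m) := hprod ha hb
  have hF₁ := (hprod (x := Real.sqrt 2 * a) (by positivity) hb).mul_left (Real.exp (-Real.pi * n / 2))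
  have hF₂ := (hprod ha (y := Real.sqrt 2 * b) (by positivity)).mul_left (Real.exp (-Real.pi * m / 2))
  have hall := (hγ.sub hF₁).sub hF₂
  have hle : ∑' p, (γ p - F₁ p - F₂ p) ≤ C := by
    refine hall.summable.tsum_le_of_sum_le fun S => ?_
    refine le_trans ?_ (hC (S.filter fun p => (p.1 : ℝ) ^ 2 ≤ n * a ^ 2 ∧ ‖toE p.2‖ ^ 2 ≤ m * b ^ 2)
      fun p hp => (Finset.mem_filter.1 hp).2)
    rw [Finset.sum_filter]
    refine Finset.sum_le_sum fun p _ => ?_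
    have h1 : 0 ≤ F₁ p := mul_nonneg (Real.exp_pos _).le (mul_nonneg (gauss_pos _ _).le
      (Real.exp_pos _).le)
    have h2 : 0 ≤ F₂ p := mul_nonneg (Real.exp_pos _).le (mul_nonneg (gauss_pos _ _).le
      (Real.exp_pos _).le)
    split_ifs with h
    · show γ p - F₁ p - F₂ p ≤ γ p
      linarith
    · rw [not_and_or, not_le, not_le] at h
      rcases h with h | h
      · have : γ p ≤ F₁ p := by
          simp only [γ, F₁]
          rw [← mul_assoc]
          exact mul_le_mul_of_nonneg_right (exp_le_of_tail ha h) (Real.exp_pos _).le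
        linarith
      · have : γ p ≤ F₂ p := by
          simp only [γ, F₂]
          rw [mul_left_comm]
          exact mul_le_mul_of_nonneg_left (exp_le_of_tail hb h) (gauss_pos _ _).le
        linarith
  rw [hall.tsum_eq] at hle
  refine le_trans ?_ hle
  have ha' := gaussSum_pos ha
  have hb' := pow_pos (gaussSum_pos hb) m
  have h1 : Real.exp (-Real.pi * n / 2) * (gaussSum (Real.sqrt 2 * a) * gaussSum b ^ m) ≤
      (1 / 2) ^ n * (gaussSum a * gaussSum b ^ m) := by
    calc _ ≤ Real.exp (-Real.pi * n / 2) * ((Real.sqrt 2 * gaussSum a) * gaussSum b ^ m) := by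
          gcongr
          exact gaussSum_sqrt_two_mul_le ha
      _ = (Real.exp (-Real.pi * n / 2) * Real.sqrt 2) * (gaussSum a * gaussSum b ^ m) := by ring
      _ ≤ _ := mul_le_mul_of_nonneg_right (exp_mul_sqrt_two_le hn).2 (by positivity)
  have h2 : Real.exp (-Real.pi * m / 2) * (gaussSum a * gaussSum (Real.sqrt 2 * b) ^ m) ≤
      (1 / 2) ^ n * (gaussSum a * gaussSum b ^ m) := by
    calc _ ≤ Real.exp (-Real.pi * m / 2) * (gaussSum a * (Real.sqrt 2 ^ m * gaussSum b ^ m)) := by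
          gcongr
          exact gaussSum_sqrt_two_pow_le hb
      _ = (Real.exp (-Real.pi * m / 2) * Real.sqrt 2 ^ m) * (gaussSum a * gaussSum b ^ m) := by ring
      _ ≤ (1 / 2) ^ m * (gaussSum a * gaussSum b ^ m) :=
          mul_le_mul_of_nonneg_right (exp_mul_sqrt_two_le (hn.trans_le hnm)).1 (by positivity)
      _ ≤ _ := mul_le_mul_of_nonneg_right
          (pow_le_pow_of_le_one (by norm_num) (by norm_num) hnm) (by positivity)
  linarith

/-- The overlap bound of `le_overlap`, linearized in the deviations of the two Gaussian sums from `1`. -/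
theorem ratio_ge {θ θ' a a' : ℝ} (h1 : 1 ≤ θ) (h1' : 1 ≤ θ') (h2 : θ ≤ 1 + a) (h2' : θ' ≤ 1 + a')
    (ha : a < 1) : 1 - (2 * a + a') ≤ Real.sqrt ((2 - θ) / (θ * θ')) := by
  have h3 : (2 - θ) / (θ * θ') ≤ 1 := by
    rw [div_le_one (by positivity)]
    nlinarith
  have h4 : 0 ≤ (2 - θ) / (θ * θ') := div_nonneg (by linarith) (by positivity)
  have h5 : (2 - θ) / (θ * θ') ≤ Real.sqrt ((2 - θ) / (θ * θ')) := by
    refine Real.le_sqrt_of_sq_le ?_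
    nlinarith
  refine le_trans ?_ h5
  rw [le_div_iff₀ (by positivity)]
  rcases le_or_gt (1 - (2 * a + a')) 0 with h | h
  · nlinarith [mul_nonneg (show (0 : ℝ) ≤ θ by linarith) (show (0 : ℝ) ≤ θ' by linarith)]
  · have h6 : θ * θ' ≤ (1 + a) * (1 + a') := mul_le_mul h2 h2' (by linarith) (by linarith)
    have h7 : (1 - (2 * a + a')) * ((1 + a) * (1 + a')) ≤ 1 - a := by
      have h8 : 0 ≤ a := by linarith
      have h9 : 0 ≤ a' := by linarith
      nlinarith [mul_nonneg h8 h9, mul_nonneg h8 h8, mul_nonneg h9 h9,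
        mul_nonneg (mul_nonneg h8 h8) h9, mul_nonneg (mul_nonneg h9 h9) h8]
    nlinarith

/-- The prepared samples are close to the ideal samples. -/
theorem overlap_ge {α β : ℝ} (hβ : 0 < β)
    {A : Matrix (Fin n) (Fin m) (ZMod q)} (hA : NoShort A) {e : Fin m → ℤ}
    (h : Regime n m q α (β * q) (‖toE e‖ ^ 2)) (s : Fin n → ZMod q) :
    ∃ ω : ℝ, ∑ w, star (mixedSample (gaussAmp α) (gaussAmp (β * q)) A
        (A.transpose.mulVec s + fun j => ((e j : ℤ) : ZMod q)) w) * (idealAmp α β A e s w : ℂ) = ω ∧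
      1 - overlapLoss n α ≤ ω := by
  have hα : 0 < α := by linarith [h.two_le]
  have hq : (0 : ℝ) < q := by exact_mod_cast NeZero.pos q
  have hB : 0 < β * q := by positivity
  have hm : 0 < m := h.n_pos.trans_le h.n_le
  obtain ⟨t, ht⟩ : ∃ t, t = width α (β * q) (‖toE e‖ ^ 2) / Real.sqrt 2 := ⟨_, rfl⟩
  have ht0 : 0 < t := by
    rw [ht]
    exact div_pos (width_pos hα hB (sq_nonneg _)) (by positivity)
  obtain ⟨hb1, hb2⟩ := width_bounds hα hB h.error_nonneg h.error_le
  rw [← ht] at hb1 hb2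
  set a := gaussSum 1 * Real.exp (-Real.pi * (α ^ 2 / 4 - 1)) with ha
  set a' := gaussSum 1 * Real.exp (-Real.pi * (n - 1)) with ha'
  have hC0 : 0 < gaussSum 1 := gaussSum_pos one_pos
  have ha1 := h.theta_lt
  -- the width `t` is at least `α / 2`, so that shifting a Gaussian hardly changes its sum
  have hθ : gaussSum (1 / t) ≤ 1 + a := by
    have h1 : 1 / t ≤ 1 := by
      rw [div_le_one ht0]
      nlinarith [h.two_le]
    refine (gaussSum_sub_one_le (by positivity) h1).trans ?_
    rw [one_div_pow, one_div_one_div]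
    have h2 : gaussSum 1 * Real.exp (-Real.pi * (t ^ 2 - 1)) ≤ a :=
      mul_le_mul_of_nonneg_left (Real.exp_le_exp.2 (by nlinarith [Real.pi_pos])) hC0.le
    linarith
  -- and it is small compared with `q`, so that folding modulo `q` hardly changes the norm
  have hθ' : gaussSum (2 * t / q) ≤ 1 + a' := by
    have hm1 : (1 : ℝ) ≤ m := by exact_mod_cast hm
    have hnm : (n : ℝ) ≤ m := by exact_mod_cast h.n_le
    have h1 : α ^ 2 * (96 ^ 2 * m) ≤ (q : ℝ) ^ 2 := by
      have h2 : 96 * (β * q) * Real.sqrt m ≤ q := h.radius_lt.le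
      have h3 : (96 * (β * q) * Real.sqrt m) ^ 2 ≤ (q : ℝ) ^ 2 := pow_le_pow_left₀ (by positivity) h2 2
      rw [mul_pow, Real.sq_sqrt (by linarith)] at h3
      have h4 : α ^ 2 ≤ (β * q) ^ 2 := pow_le_pow_left₀ hα.le h.alpha_le 2
      nlinarith [mul_le_mul_of_nonneg_right h4 (show (0 : ℝ) ≤ 96 ^ 2 * m by positivity)]
    have h2 : (m : ℝ) ≤ 1 / (2 * t / q) ^ 2 := by
      rw [div_pow, one_div_div, le_div_iff₀ (by positivity)]
      nlinarith [mul_le_mul_of_nonneg_left hb2 (show (0 : ℝ) ≤ m by linarith),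
        mul_nonneg (sq_nonneg α) (show (0 : ℝ) ≤ m by linarith)]
    have h3 : 2 * t / q ≤ 1 := by
      by_contra hc
      rw [not_le] at hc
      have : 1 / (2 * t / q) ^ 2 < 1 := by
        rw [div_lt_one (by positivity)]
        nlinarith
      linarith
    refine (gaussSum_sub_one_le (by positivity) h3).trans ?_
    have h4 : gaussSum 1 * Real.exp (-Real.pi * (1 / (2 * t / q) ^ 2 - 1)) ≤ a' :=
      mul_le_mul_of_nonneg_left (Real.exp_le_exp.2 (by nlinarith [Real.pi_pos])) hC0.le
    linarith
  have h1 : 1 ≤ gaussSum (1 / t) := one_le_gaussSum (by positivity)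
  have h1' : 1 ≤ gaussSum (2 * t / q) := one_le_gaussSum (by positivity)
  have hratio := ratio_ge h1 h1' hθ hθ' ha1
  set ratio := Real.sqrt ((2 - gaussSum (1 / t)) / (gaussSum (1 / t) * gaussSum (2 * t / q)))
    with hr
  have hα' : 0 < α / Real.sqrt 2 := by positivity
  have hB' : 0 < β * q / Real.sqrt 2 := by positivity
  set N := gaussSum (α / Real.sqrt 2) * gaussSum (β * q / Real.sqrt 2) ^ m with hN
  have hN0 : 0 < N := mul_pos (gaussSum_pos hα') (pow_pos (gaussSum_pos hB') m)
  have hr0 : 0 < ratio := by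
    rw [hr]
    refine Real.sqrt_pos.2 (div_pos (by linarith) (by positivity))
  have hr1 : ratio ≤ 1 := by
    rw [hr]
    refine Real.sqrt_le_one.2 ?_
    rw [div_le_one (by positivity)]
    nlinarith
  obtain ⟨ω, hω, -⟩ := le_overlap hm hα hβ hA e s ∅ (by simp) ht (by linarith)
  refine ⟨ω, hω, ?_⟩
  have hmass := typical_mass (n := n) (m := m) hα' hB' h.n_pos h.n_le (C := ω * N / ratio) (by
    intro S hS
    obtain ⟨ω', hω', hle⟩ := le_overlap hm hα hβ hA e s S
      (fun p hp => h.decodable (hS p hp).1 (hS p hp).2) ht (by linarith)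
    have : ω' = ω := Complex.ofReal_injective (hω'.symm.trans hω)
    rw [this, ← hN, ← hr, div_mul_eq_mul_div, div_le_iff₀ hN0] at hle
    rwa [le_div_iff₀ hr0])
  rw [← hN, le_div_iff₀ hr0, mul_assoc, mul_comm ω, mul_le_mul_iff_right₀ hN0] at hmass
  refine le_trans ?_ hmass
  have h2 : (0 : ℝ) < (1 / 2) ^ n := by positivity
  rw [overlapLoss, ← ha, ← ha']
  nlinarith

theorem sum_mixedSample_sq {g h : ZMod q → ℂ} (hg : ∑ x, ‖g x‖ ^ 2 = 1)
    (hh : ∑ x, ‖h x‖ ^ 2 = 1) (A : Matrix (Fin n) (Fin m) (ZMod q)) (b : Fin m → ZMod q) :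
    ∑ w, ‖mixedSample g h A b w‖ ^ 2 = 1 := by
  have hq : (0 : ℝ) < q := by exact_mod_cast NeZero.pos q
  have h1 : ∀ u y κ, ‖mixedSample g h A b (sampleReg u y κ)‖ ^ 2 =
      (1 / q) ^ n * ‖g κ‖ ^ 2 * ∏ j, ‖h (y j - (κ * b j + ∑ l, A l j * u l))‖ ^ 2 := by
    intro u y κ
    have : ‖(1 / Real.sqrt q : ℂ)‖ ^ 2 = 1 / q := by
      rw [norm_div, norm_one, Complex.norm_real, Real.norm_of_nonneg (Real.sqrt_nonneg _),
        div_pow, one_pow, Real.sq_sqrt hq.le]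
    simp only [mixedSample, sampleReg, Sum.elim_inl, Sum.elim_inr, norm_mul, norm_prod, mul_pow,
      Finset.prod_const, Finset.card_univ, Fintype.card_fin, ← Finset.prod_pow]
    rw [norm_pow, ← pow_mul, mul_comm n 2, pow_mul, this]
    ring
  have h2 : ∀ c : Fin m → ZMod q, ∑ y : Fin m → ZMod q, ∏ j, ‖h (y j - c j)‖ ^ 2 = 1 := by
    intro c
    have h3 := Finset.prod_univ_sum (fun _ : Fin m => Finset.univ)
      fun (j : Fin m) (x : ZMod q) => ‖h (x - c j)‖ ^ 2
    rw [Fintype.piFinset_univ] at h3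
    rw [← h3]
    refine Finset.prod_eq_one fun j _ => ?_
    rw [← hh]
    exact (Equiv.subRight (c j)).sum_comp fun x => ‖h x‖ ^ 2
  rw [sum_sampleReg, Finset.sum_comm]
  simp only [h1]
  have h4 : ∀ κ : ZMod q, ∑ y : Fin m → ZMod q, ∑ u : Fin n → ZMod q, (1 / q : ℝ) ^ n *
      ‖g κ‖ ^ 2 * ∏ j, ‖h (y j - (κ * b j + ∑ l, A l j * u l))‖ ^ 2 = ‖g κ‖ ^ 2 := by
    intro κ
    rw [Finset.sum_comm]
    simp only [← Finset.mul_sum, h2]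
    rw [Finset.sum_const, Finset.card_univ, Fintype.card_fun, ZMod.card,
      Fintype.card_fin, nsmul_eq_mul, mul_one, Nat.cast_pow, one_div, inv_pow]
    field_simp
  simp only [h4, hg]

/-- The gates that prepare the samples. -/
def prepCost (n m ℓ q : ℕ) : ℕ :=
  (2 * Fintype.card (PrepReg n m ℓ) + (ℓ * (m * (n + 1)) + (n * m + ℓ * (n + m)))) *
    72 ^ (3 * Nat.clog 2 q)

/-- One trial of the reduction: an algorithm for samples is turned into an algorithm that finds
the secret when the error, shifted by `δ`, has the norm expected by the algorithm. -/
theorem exists_solver (hq : 2 < q) {α β : ℝ} (hβ : 0 < β) (δ : Fin m → ZMod q)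
    (Q : Circuit (SLWEWires n m q ℓ) (Fin n × ZReg q)) :
    ∃ C : Circuit (LWEWires n m q) (Fin n × ZReg q), C.size ≤ prepCost n m ℓ q + Q.size ∧
      ∀ (A : Matrix (Fin n) (Fin m) (ZMod q)) (b : Fin m → ZMod q) (s : Fin n → ZMod q)
        (e : Fin m → ℤ) (ε : ℝ), NoShort A → Regime n m q α (β * q) (‖toE e‖ ^ 2) →
        overlapLoss n α ≤ 1 →
        (b + δ = A.transpose.mulVec s + fun j => ((e j : ℤ) : ZMod q)) →
        SolvesSLWEPhase Q A (amplitude α β q (‖toE e‖ ^ 2)) (phase α β A e)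
          (distribution α β A e) ε →
        1 - ε - 2 * Real.sqrt (2 * ℓ * overlapLoss n α) ≤
          C.prob (basisState (Sum.elim (encMat A) (encVec b))) (encVec s) := by
  obtain ⟨C, hsize, hC⟩ := exists_trial hq (gaussAmp α) (gaussAmp (β * q)) (sum_gaussAmp_sq α)
    (sum_gaussAmp_sq _) δ Q
  refine ⟨C, hsize, fun A b s e ε hA hreg hloss hb hsol => le_trans ?_ (hC A b (encVec s))⟩
  have hα : 0 < α := by linarith [hreg.two_le]
  have hm : 0 < m := hreg.n_pos.trans_le hreg.n_le
  rw [hb]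
  set Ψ₁ := mixedSample (gaussAmp α) (gaussAmp (β * q)) A
    (A.transpose.mulVec s + fun j => ((e j : ℤ) : ZMod q)) with hΨ₁
  set Ψ₂ : (SampleReg n m → ZMod q) → ℂ := fun w => (idealAmp α β A e s w : ℂ) with hΨ₂
  -- the Fourier transform is unitary, so overlaps may be computed before it
  have hU : fourierSample n m q ∈ Matrix.unitaryGroup (SampleReg n m → ZMod q) ℂ := by
    refine tens_mem_unitary ?_
    rintro (l | j | u)
    exacts [fourierMat_mem, one_mem _, fourierMat_mem]
  have hsq : ∀ g : (SampleReg n m → ZMod q) → ℂ,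
      star g ⬝ᵥ g = ((∑ x, ‖g x‖ ^ 2 : ℝ) : ℂ) := by
    intro g
    rw [dotProduct, Complex.ofReal_sum]
    refine Finset.sum_congr rfl fun x _ => ?_
    rw [Pi.star_apply, ← Complex.normSq_eq_norm_sq, Complex.normSq_eq_conj_mul_self]
    rfl
  have hnorm : ∀ g : (SampleReg n m → ZMod q) → ℂ,
      ∑ x, ‖(fourierSample n m q).mulVec g x‖ ^ 2 = ∑ x, ‖g x‖ ^ 2 := by
    intro g
    have := norm_mulVec_of_unitary hU g g
    rwa [hsq, hsq, Complex.ofReal_inj] at this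
  have hn₂ : ∑ x, ‖Ψ₂ x‖ ^ 2 = 1 := by
    rw [← sum_idealAmp_sq hm hα hβ hA e s]
    exact Finset.sum_congr rfl fun w _ => by
      rw [hΨ₂, Complex.norm_real, Real.norm_eq_abs, sq_abs]
  have hn₁ : ∑ x, ‖Ψ₁ x‖ ^ 2 = 1 :=
    sum_mixedSample_sq (sum_gaussAmp_sq α) (sum_gaussAmp_sq _) A _
  obtain ⟨ω, hω, hωle⟩ := overlap_ge hβ hA hreg s
  have hover : ∑ x, star ((fourierSample n m q).mulVec Ψ₁ x) * (fourierSample n m q).mulVec Ψ₂ x =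
      ω := by
    rw [← hω]
    exact norm_mulVec_of_unitary hU Ψ₁ Ψ₂
  have hfinal := jointProb_prod_ge (ℓ := ℓ) Q A (encVec s) _ _ ((hnorm Ψ₁).trans hn₁)
    ((hnorm Ψ₂).trans hn₂) ω (overlapLoss n α) hover hωle hloss
  rw [jointProb_ideal hα hβ] at hfinal
  have := hsol s
  refine le_trans ?_ hfinal
  linarith

end Estimates

/-! ### The reduction for fixed parameters -/

section Reduction

variable {q : ℕ} [NeZero q] {n m ℓ : ℕ}

/-- The number of gates that suffice to verify one candidate secret and to select it. -/
def checkCost (n m q : ℕ) : ℕ :=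
  (2 * Fintype.card (LWEWires n m q) +
    (Fintype.card (CheckWires n m q) + Fintype.card (Fin n × ZReg q))) *
      72 ^ (3 * Nat.clog 2 q + 2)

theorem lweInput_eq_basisState (A : Matrix (Fin n) (Fin m) (ZMod q)) (b : Fin m → ZMod q) :
    lweInput A b = basisState (Sum.elim (encMat A) (encVec b)) := by
  funext w
  simp only [lweInput, basisState]

/-- If no secret has a short image, then at most one candidate leaves a small residue. -/
theorem NoShort.unique {A : Matrix (Fin n) (Fin m) (ZMod q)} (hA : NoShort A)
    {b : Fin m → ZMod q} {s s' : Fin n → ZMod q}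
    (h : ∀ j, 48 * absq ((b - A.transpose.mulVec s) j) ≤ q)
    (h' : ∀ j, 48 * absq ((b - A.transpose.mulVec s') j) ≤ q) : s' = s := by
  by_contra hne
  obtain ⟨j, hj⟩ := hA (s - s') fun h0 => hne (sub_eq_zero.1 h0).symm
  have h1 := absq_sub_le ((b - A.transpose.mulVec s') j) ((b - A.transpose.mulVec s) j)
  have h2 : (b - A.transpose.mulVec s') j - (b - A.transpose.mulVec s) j =
      A.transpose.mulVec (s - s') j := by
    rw [Matrix.mulVec_sub]
    simp only [Pi.sub_apply]
    ring
  rw [h2] at h1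
  have h3 := h j
  have h4 := h' j
  omega

/-- One circuit succeeds on all errors of squared length at most `M`: it runs the solver once for
every possible squared length and keeps the candidate that passes the verification. There is no
solver for the zero error, so in one further run the input is shifted by a unit vector. -/
theorem exists_reduction (hq : 2 < q) (hm : 0 < m) {α β : ℝ} (hβ : 0 < β) {M T : ℕ} (hM : 1 ≤ M)
    (hreg : ∀ t : ℕ, 1 ≤ t → t ≤ M → Regime n m q α (β * q) t) (hloss : overlapLoss n α ≤ 1)
    (hMq : 48 * Real.sqrt M ≤ q) (Q : ℕ → Circuit (SLWEWires n m q ℓ) (Fin n × ZReg q))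
    (hQ : ∀ t, 1 ≤ t → t ≤ M → (Q t).size ≤ T) :
    ∃ R : Circuit (LWEWires n m q) (Fin n × ZReg q),
      R.size ≤ (M + 1) * (prepCost n m ℓ q + T + checkCost n m q) ∧
      ∀ e : Fin m → ℤ, ‖toE e‖ ^ 2 ≤ M → ∃ t : ℕ, 1 ≤ t ∧ t ≤ M ∧
        ∀ (A : Matrix (Fin n) (Fin m) (ZMod q)) (s : Fin n → ZMod q) (ε : ℝ), NoShort A →
        (∀ e' : Fin m → ℤ, ‖toE e'‖ ^ 2 = t → SolvesSLWEPhase (Q t) A (amplitude α β q t)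
          (phase α β A e') (distribution α β A e') ε) →
        1 - ε - 2 * Real.sqrt (2 * ℓ * overlapLoss n α) ≤
          R.prob (lweInput A (A.transpose.mulVec s + fun j => (e j : ZMod q))) (encVec s) := by
  have hclog : 2 ≤ Nat.clog 2 q := by
    by_contra h
    have h1 := Nat.le_pow_clog one_lt_two q
    have h2 : 2 ^ Nat.clog 2 q ≤ 2 ^ 1 := Nat.pow_le_pow_right two_pos (by omega)
    omega
  -- trial `0` runs the solver for squared length `1` on the input shifted by a unit vector
  let δ : ℕ → Fin m → ZMod q := fun t => if t = 0 then Pi.single ⟨0, hm⟩ 1 else 0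
  choose C hCsize hC using fun t => exists_solver hq (α := α) hβ (δ t) (Q (max 1 t))
  have hB : ∀ t ≤ M, (C t).size ≤ prepCost n m ℓ q + T := fun t ht =>
    (hCsize t).trans (Nat.add_le_add_left (hQ _ (le_max_left _ _) (max_le hM ht)) _)
  -- two residues below `q / 48` differ by at most `q / 24`, the bound in `NoShort`
  let good : ZMod q → Prop := fun x => 48 * absq x ≤ q
  let w₀ : LWEWires n m q := Sum.inr (⟨0, hm⟩, ⟨0, by omega⟩)
  obtain ⟨R, hsize, hR⟩ := exists_combine_family (lweChecker good w₀) (lweChecker_decides good w₀)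
    (3 * Nat.clog 2 q + 1) (by omega) (lweChecker_src_card good w₀) _ M C hB
  refine ⟨R, hsize, fun e he => ?_⟩
  obtain ⟨N, hN⟩ : ∃ N : ℕ, ‖toE e‖ ^ 2 = N := by
    refine ⟨(∑ j, e j ^ 2).toNat, ?_⟩
    rw [norm_toE_sq]
    have : ((∑ j, e j ^ 2).toNat : ℤ) = ∑ j, e j ^ 2 :=
      Int.toNat_of_nonneg (Finset.sum_nonneg fun _ _ => sq_nonneg _)
    exact_mod_cast this.symm
  have hNM : N ≤ M := by
    rw [hN] at he
    exact_mod_cast he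
  refine ⟨max 1 N, le_max_left _ _, max_le hM hNM, fun A s ε hA hsol => ?_⟩
  rw [lweInput_eq_basisState]
  set b : Fin m → ZMod q := A.transpose.mulVec s + fun j => (e j : ZMod q) with hb
  have hgood : ∀ j, good ((b - A.transpose.mulVec s) j) := by
    intro j
    have h1 : (b - A.transpose.mulVec s) j = (e j : ZMod q) := by
      rw [hb, add_sub_cancel_left]
    have h2 : (absq (e j : ZMod q) : ℝ) ≤ Real.sqrt M :=
      (absq_intCast_le (e j)).trans ((abs_le_norm_toE e j).trans (Real.le_sqrt_of_sq_le he))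
    have h3 : 48 * (absq (e j : ZMod q) : ℝ) ≤ q := by linarith
    rw [h1]
    exact_mod_cast h3
  refine le_trans ?_ (hR _ (encVec s) ((accepts_iff good A b _).2 ⟨s, rfl, hgood⟩) ?_ N hNM)
  · -- the error vector seen by the solver is never zero
    obtain ⟨e', he', hbe⟩ : ∃ e' : Fin m → ℤ, ‖toE e'‖ ^ 2 = (max 1 N : ℕ) ∧
        b + δ N = A.transpose.mulVec s + fun j => ((e' j : ℤ) : ZMod q) := by
      rcases Nat.eq_zero_or_pos N with h0 | h0
      · refine ⟨Pi.single ⟨0, hm⟩ 1, ?_, ?_⟩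
        · rw [norm_toE_sq, Finset.sum_eq_single ⟨0, hm⟩]
          · simp [h0]
          · intro j _ hj
            simp [Pi.single_eq_of_ne hj]
          · simp
        · have he0 : e = 0 := by
            refine toE_injective ?_
            rw [h0, Nat.cast_zero, sq_eq_zero_iff, norm_eq_zero] at hN
            rw [hN]
            ext j
            simp [toE]
          funext j
          simp only [hb, δ, if_pos h0, he0, Pi.add_apply, Pi.zero_apply, Int.cast_zero, add_zero]
          congr 1
          by_cases hj : j = ⟨0, hm⟩
          · subst hj
            simp
          · simp [Pi.single_eq_of_ne hj]
      · refine ⟨e, by rw [max_eq_right h0, hN], ?_⟩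
        simp only [δ, if_neg h0.ne', add_zero, hb]
    have hreg' := hreg (max 1 N) (le_max_left _ _) (max_le hM hNM)
    have hsol' := hsol e' he'
    rw [← he'] at hreg' hsol'
    exact hC N A b s e' ε hA hreg' hloss hbe hsol'
  · intro c hc
    obtain ⟨s', rfl, hs'⟩ := (accepts_iff good A b c).1 hc
    rw [hA.unique hgood hs']

theorem prob_lweInput_le_one (C : Circuit (LWEWires n m q) (Fin n × ZReg q))
    (A : Matrix (Fin n) (Fin m) (ZMod q)) (b : Fin m → ZMod q) (o : Fin n × ZReg q → Bool) :
    C.prob (lweInput A b) o ≤ 1 := by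
  refine (C.prob_le _ _).trans (le_of_eq ?_)
  rw [lweInput_eq_basisState]
  simp [basisState, apply_ite, ite_pow]

theorem unifProb_compl {Ω : Type} [Finite Ω] [Nonempty Ω] (S : Set Ω) :
    unifProb Sᶜ = 1 - unifProb S := by
  have h := Set.ncard_add_ncard_compl S
  have h0 : (0 : ℝ) < Nat.card Ω := by exact_mod_cast Nat.card_pos
  rw [unifProb, unifProb, eq_sub_iff_add_eq, ← add_div, div_eq_one_iff_eq h0.ne', add_comm]
  exact_mod_cast h

theorem unifProb_union_le {Ω : Type} (S S' : Set Ω) :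
    unifProb (S ∪ S') ≤ unifProb S + unifProb S' := by
  rw [unifProb, unifProb, unifProb, ← add_div]
  refine div_le_div_of_nonneg_right ?_ (Nat.cast_nonneg _)
  exact_mod_cast Set.ncard_union_le S S'

theorem natCard_matrix : Nat.card (Matrix (Fin n) (Fin m) (ZMod q)) = q ^ (n * m) := by
  have h : Nat.card (Fin n → Fin m → ZMod q) = q ^ (n * m) := by
    rw [Nat.card_fun, Nat.card_fun, Nat.card_zmod, Nat.card_fin, Nat.card_fin, ← pow_mul, mul_comm]
  exact h

/-- A circuit that succeeds with probability `p` on every matrix outside a set `S` succeeds on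
average with probability at least `p - Pr(S)`. -/
theorem average_ge (F : Matrix (Fin n) (Fin m) (ZMod q) → ℝ)
    (S : Set (Matrix (Fin n) (Fin m) (ZMod q))) {p : ℝ} (hp : p ≤ 1) (h0 : ∀ A, 0 ≤ F A)
    (h : ∀ A ∉ S, p ≤ F A) : p - unifProb S ≤ (∑ A, F A) / (q : ℝ) ^ (n * m) := by
  classical
  have hq : (0 : ℝ) < q := by exact_mod_cast NeZero.pos q
  have hcard := natCard_matrix (q := q) (n := n) (m := m)
  have hsum : ∑ A : Matrix (Fin n) (Fin m) (ZMod q), (p - if A ∈ S then (1 : ℝ) else 0) =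
      (q : ℝ) ^ (n * m) * p - S.ncard := by
    rw [Finset.sum_sub_distrib, Finset.sum_const, Finset.card_univ, ← Nat.card_eq_fintype_card,
      hcard, nsmul_eq_mul, Finset.sum_boole, Set.ncard_eq_toFinset_card' S]
    push_cast
    congr 3
    ext A
    simp
  rw [le_div_iff₀ (by positivity), unifProb, hcard, Nat.cast_pow, sub_mul,
    div_mul_cancel₀ _ (by positivity), mul_comm p, ← hsum]
  refine Finset.sum_le_sum fun A _ => ?_
  split_ifs with hA
  · linarith [h0 A]
  · linarith [h A hA]

/-- Errors of more than typical length contribute an exponentially small amount. -/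
theorem le_lweSuccess (hm : 0 < m) {γ : ℝ} (hγ : 0 < γ) {κ : ℝ} (hκ : κ ≤ 1)
    (R : Circuit (LWEWires n m q) (Fin n × ZReg q)) (s : Fin n → ZMod q)
    (h : ∀ e : Fin m → ℤ, ‖toE e‖ ^ 2 ≤ m * (γ * q) ^ 2 →
      κ ≤ (∑ A : Matrix (Fin n) (Fin m) (ZMod q),
        R.prob (lweInput A (A.transpose.mulVec s + fun j => (e j : ZMod q))) (encVec s)) /
          (q : ℝ) ^ (n * m)) :
    κ - (1 / 2) ^ m ≤ lweSuccess R γ s := by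
  classical
  have hq : (0 : ℝ) < q := by exact_mod_cast NeZero.pos q
  have hγq : 0 < γ * q := by positivity
  set G := gaussSum (γ * q) ^ m with hG
  have hG0 : 0 < G := pow_pos (gaussSum_pos hγq) m
  have hsum := hasSum_rho_toE (m := m) hγq
  have hD : HasSum (fun e : Fin m → ℤ => discreteGaussian (γ * q) e) 1 := by
    have := hsum.div_const G
    rw [div_self hG0.ne'] at this
    simpa only [discreteGaussian, hsum.tsum_eq] using this
  obtain ⟨htail, htail_le⟩ := rho_tail_le (m := m) hγq m
  have htail' := htail.div_const G
  have hbound : (∑' e : Fin m → ℤ, (if m * (γ * q) ^ 2 < ‖toE e‖ ^ 2 then rho (γ * q) (toE e)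
      else 0)) / G ≤ (1 / 2) ^ m := by
    rw [div_le_iff₀ hG0]
    exact htail_le.trans (mul_le_mul_of_nonneg_right (exp_mul_sqrt_two_le hm).1 hG0.le)
  set F : (Fin m → ℤ) → ℝ := fun e => (∑ A : Matrix (Fin n) (Fin m) (ZMod q),
        R.prob (lweInput A (A.transpose.mulVec s + fun j => (e j : ZMod q))) (encVec s)) /
          (q : ℝ) ^ (n * m) with hF
  have hF0 : ∀ e, 0 ≤ F e := fun e =>
    div_nonneg (Finset.sum_nonneg fun _ _ => Circuit.prob_nonneg _ _ _) (by positivity)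
  have hF1 : ∀ e, F e ≤ 1 := by
    intro e
    rw [hF]
    refine div_le_one_of_le₀ ?_ (by positivity)
    refine (Finset.sum_le_card_nsmul _ _ 1 fun A _ => prob_lweInput_le_one R A _ _).trans ?_
    rw [Finset.card_univ, ← Nat.card_eq_fintype_card, natCard_matrix, nsmul_eq_mul, mul_one,
      Nat.cast_pow]
  have hD0 : ∀ e : Fin m → ℤ, 0 ≤ discreteGaussian (γ * q) e := fun e =>
    div_nonneg (Real.exp_pos _).le (tsum_nonneg fun _ => (Real.exp_pos _).le)
  have hlow := (hD.mul_left κ).sub htail'.hasSum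
  have hup : Summable fun e : Fin m → ℤ => discreteGaussian (γ * q) e * F e :=
    Summable.of_nonneg_of_le (fun e => mul_nonneg (hD0 e) (hF0 e))
      (fun e => mul_le_of_le_one_right (hD0 e) (hF1 e)) hD.summable
  have hle := hlow.summable.tsum_le_tsum (g := fun e => discreteGaussian (γ * q) e * F e)
    (fun e => ?_) hup
  · rw [hlow.tsum_eq, tsum_div_const] at hle
    refine le_trans ?_ hle
    linarith
  · by_cases he : m * (γ * q) ^ 2 < ‖toE e‖ ^ 2
    · have h1 : rho (γ * q) (toE e) / G = discreteGaussian (γ * q) e := by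
        rw [discreteGaussian, hsum.tsum_eq]
      rw [if_pos he, h1]
      nlinarith [mul_nonneg (hD0 e) (hF0 e), hD0 e]
    · rw [if_neg he, zero_div, sub_zero, mul_comm]
      exact mul_le_mul_of_nonneg_left (h e (not_lt.1 he)) (hD0 e)

/-- The reduction for fixed parameters, with an explicit bound on its error probability. -/
theorem exists_lwe_circuit (hq : 2 < q) (hm : 0 < m) {α β γ : ℝ} (hβ : 0 < β) (hγ : 0 < γ)
    {M T : ℕ} (hM : 1 ≤ M) (hMle : m * (γ * q) ^ 2 < M + 1)
    (hreg : ∀ t : ℕ, 1 ≤ t → t ≤ M → Regime n m q α (β * q) t)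
    (hloss : overlapLoss n α ≤ 1) (hMq : 48 * Real.sqrt M ≤ q) {ε : ℝ} (hε : 0 ≤ ε)
    (hQ : ∀ t : ℕ, 1 ≤ t → t ≤ M → ∃ Q : Circuit (SLWEWires n m q ℓ) (Fin n × ZReg q),
      Q.size ≤ T ∧ 1 - ε ≤ unifProb {A : Matrix (Fin n) (Fin m) (ZMod q) |
        ∀ e : Fin m → ℤ, ‖toE e‖ ^ 2 = t → SolvesSLWEPhase Q A (amplitude α β q t)
          (phase α β A e) (distribution α β A e) ε}) :
    ∃ R : Circuit (LWEWires n m q) (Fin n × ZReg q),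
      R.size ≤ (M + 1) * (prepCost n m ℓ q + T + checkCost n m q) ∧
      ∀ s : Fin n → ZMod q, 1 - (2 * ε + 2 * Real.sqrt (2 * ℓ * overlapLoss n α) +
        ((2 : ℝ) ^ n / 2 ^ m + (q : ℝ) ^ n / 3 ^ m) + (1 / 2) ^ m) ≤ lweSuccess R γ s := by
  classical
  obtain ⟨Q₁, -⟩ := hQ 1 le_rfl hM
  have : Nonempty (Circuit (SLWEWires n m q ℓ) (Fin n × ZReg q)) := ⟨Q₁⟩
  choose! Q hQsize hQ using hQ
  obtain ⟨R, hRsize, hR⟩ := exists_reduction (ℓ := ℓ) hq hm hβ hM hreg hloss hMq Q hQsize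
  refine ⟨R, hRsize, fun s => ?_⟩
  have hsqrt := Real.sqrt_nonneg (2 * ℓ * overlapLoss n α)
  have hbad : (0 : ℝ) ≤ (2 : ℝ) ^ n / 2 ^ m + (q : ℝ) ^ n / 3 ^ m := by positivity
  refine le_trans (le_of_eq ?_) (le_lweSuccess hm hγ (κ := 1 - ε -
    2 * Real.sqrt (2 * ℓ * overlapLoss n α) - (ε + ((2 : ℝ) ^ n / 2 ^ m + (q : ℝ) ^ n / 3 ^ m)))
    (by linarith) R s fun e he => ?_)
  · ring
  have heM : ‖toE e‖ ^ 2 ≤ M := by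
    have h1 := he.trans_lt hMle
    rw [norm_toE_sq] at h1 ⊢
    have h2 : ∑ j, e j ^ 2 < (M : ℤ) + 1 := by exact_mod_cast h1
    exact_mod_cast Int.lt_add_one_iff.1 h2
  obtain ⟨t, ht1, htM, ht⟩ := hR e heM
  let S : Set (Matrix (Fin n) (Fin m) (ZMod q)) := {A | ∀ e' : Fin m → ℤ, ‖toE e'‖ ^ 2 = t →
    SolvesSLWEPhase (Q t) A (amplitude α β q t) (phase α β A e') (distribution α β A e') ε}
  have hS : unifProb (Sᶜ ∪ {A | ¬ NoShort A}) ≤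
      ε + ((2 : ℝ) ^ n / 2 ^ m + (q : ℝ) ^ n / 3 ^ m) := by
    refine (unifProb_union_le _ _).trans (add_le_add ?_ unifProb_short_le)
    rw [unifProb_compl]
    have := hQ t ht1 htM
    linarith
  refine le_trans (sub_le_sub_left hS _) (average_ge _ _ (by linarith)
    (fun A => Circuit.prob_nonneg _ _ _) fun A hA => ?_)
  rw [Set.mem_union, not_or, Set.notMem_compl_iff] at hA
  exact ht A s ε (not_not.1 hA.2) hA.1

end Reduction

/-! ### Polynomial bounds on the number of gates -/

theorem pow_clog_le {q N : ℕ} (hq : 2 < q) (hN : q ≤ N) : 72 ^ Nat.clog 2 q ≤ N ^ 14 := by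
  have h1 : 2 ^ Nat.clog 2 q ≤ N ^ 2 := by
    have h2 := Nat.pow_pred_clog_lt_self one_lt_two (x := q) (by omega)
    have h3 : 0 < Nat.clog 2 q := Nat.clog_pos one_lt_two (by omega)
    obtain ⟨k, hk⟩ := Nat.exists_eq_succ_of_ne_zero h3.ne'
    rw [hk, Nat.pred_succ] at h2
    calc 2 ^ Nat.clog 2 q = 2 * 2 ^ k := by rw [hk, Nat.succ_eq_add_one, pow_succ']
      _ ≤ N * N := Nat.mul_le_mul (by omega) (by omega)
      _ = N ^ 2 := (sq N).symm
  -- `72 ≤ 2 ^ 7`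
  calc 72 ^ Nat.clog 2 q ≤ (2 ^ 7) ^ Nat.clog 2 q := Nat.pow_le_pow_left (by norm_num) _
    _ = (2 ^ Nat.clog 2 q) ^ 7 := by rw [← pow_mul, ← pow_mul, mul_comm]
    _ ≤ (N ^ 2) ^ 7 := Nat.pow_le_pow_left h1 7
    _ = N ^ 14 := by rw [← pow_mul]

/-- All numbers of registers are polynomial in `n` and `q` because `m ≤ q ^ 2`, and operations on
logarithmically many qubits cost polynomially many gates. -/
theorem cost_le {n m q ℓ : ℕ} [NeZero q] (hq : 2 < q) (hm : m ≤ q ^ 2) (hℓ : 1 ≤ ℓ) :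
    prepCost n m ℓ q + checkCost n m q ≤ 10 ^ 6 * (ℓ * (n + q) ^ 50) := by
  obtain ⟨N, hN⟩ : ∃ N, N = n + q := ⟨_, rfl⟩
  have hN1 : 1 ≤ N := by omega
  have hnN : n ≤ N := by omega
  have hmN : m ≤ N ^ 2 := hm.trans (Nat.pow_le_pow_left (by omega) 2)
  have hc : Nat.clog 2 q ≤ N :=
    (Nat.clog_le_of_le_pow (Nat.lt_two_pow_self (n := q)).le).trans (by omega)
  have hp := pow_clog_le hq (show q ≤ N by omega)
  have h3 : 72 ^ (3 * Nat.clog 2 q) ≤ N ^ 42 := by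
    rw [mul_comm, pow_mul]
    exact (Nat.pow_le_pow_left hp 3).trans (by rw [← pow_mul])
  -- `72 ^ 2` gates for the two further qubits of an instruction of the verification network
  have h3' : 72 ^ (3 * Nat.clog 2 q + 2) ≤ N ^ 42 * 72 ^ 2 := by
    rw [pow_add]
    exact Nat.mul_le_mul_right _ h3
  obtain ⟨P, hP⟩ : ∃ P, P = N ^ 4 := ⟨_, rfl⟩
  have hP1 : 1 ≤ P := hP ▸ Nat.one_le_pow _ _ hN1
  have hpow : ∀ k ≤ 4, N ^ k ≤ P := fun k hk => hP ▸ Nat.pow_le_pow_right hN1 hk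
  have e1 : n ≤ P := hnN.trans (by simpa using hpow 1 (by norm_num))
  have e2 : m ≤ P := hmN.trans (hpow 2 (by norm_num))
  have e3 : n * m ≤ P := (Nat.mul_le_mul hnN hmN).trans (by
    rw [← pow_succ']; exact hpow 3 (by norm_num))
  have e4 : n * m * Nat.clog 2 q ≤ P := (Nat.mul_le_mul (Nat.mul_le_mul hnN hmN) hc).trans (by
    rw [← pow_succ', ← pow_succ]; exact hpow 4 le_rfl)
  have e5 : m * Nat.clog 2 q ≤ P := (Nat.mul_le_mul hmN hc).trans (by
    rw [← pow_succ]; exact hpow 3 (by norm_num))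
  have e6 : n * Nat.clog 2 q ≤ P := (Nat.mul_le_mul hnN hc).trans (by
    rw [← sq]; exact hpow 2 (by norm_num))
  have hℓP : P ≤ ℓ * P := Nat.le_mul_of_pos_left P (by omega)
  have f1 : ℓ * n ≤ ℓ * P := Nat.mul_le_mul_left ℓ e1
  have f2 : ℓ * m ≤ ℓ * P := Nat.mul_le_mul_left ℓ e2
  have f3 : ℓ * (n * m) ≤ ℓ * P := Nat.mul_le_mul_left ℓ e3
  have f4 : ℓ ≤ ℓ * P := Nat.le_mul_of_pos_right ℓ hP1
  have hprep : 2 * Fintype.card (PrepReg n m ℓ) +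
      (ℓ * (m * (n + 1)) + (n * m + ℓ * (n + m))) ≤ 30 * (ℓ * P) := by
    simp only [PrepReg, ClassReg, SampleReg, Fintype.card_sum, Fintype.card_prod, Fintype.card_fin,
      Fintype.card_unit]
    nlinarith
  have hcheck : 2 * Fintype.card (LWEWires n m q) +
      (Fintype.card (CheckWires n m q) + Fintype.card (Fin n × ZReg q)) ≤ 30 * (ℓ * P) := by
    simp only [LWEWires, CheckWires, ZReg, Fintype.card_sum, Fintype.card_prod, Fintype.card_fin]
    nlinarith
  rw [prepCost, checkCost, ← hN]
  calc _ ≤ 30 * (ℓ * P) * N ^ 42 + 30 * (ℓ * P) * (N ^ 42 * 72 ^ 2) :=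
        Nat.add_le_add (Nat.mul_le_mul hprep h3) (Nat.mul_le_mul hcheck h3')
    _ = (30 + 30 * 72 ^ 2) * (ℓ * N ^ 46) := by rw [hP]; ring
    _ ≤ 10 ^ 6 * (ℓ * N ^ 50) :=
        Nat.mul_le_mul (by norm_num) (Nat.mul_le_mul_left _ (Nat.pow_le_pow_right hN1 (by norm_num)))

/-! ### Asymptotics -/

/-- A sequence of reals that is eventually bounded above by an exponentially small one. -/
def ExpSmall (f : ℕ → ℝ) : Prop :=
  ∃ K a : ℝ, 0 ≤ K ∧ 0 < a ∧ ∀ᶠ n : ℕ in Filter.atTop, f n ≤ K * Real.exp (-(a * n))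

theorem ExpSmall.add {f g : ℕ → ℝ} (hf : ExpSmall f) (hg : ExpSmall g) :
    ExpSmall fun n => f n + g n := by
  obtain ⟨K, a, hK, ha, h⟩ := hf
  obtain ⟨K', a', hK', ha', h'⟩ := hg
  refine ⟨K + K', min a a', by positivity, lt_min ha ha', ?_⟩
  filter_upwards [h, h'] with n h1 h2
  have hn : (0 : ℝ) ≤ n := Nat.cast_nonneg n
  have e1 : K * Real.exp (-(a * n)) ≤ K * Real.exp (-(min a a' * n)) := by
    gcongr
    exact min_le_left _ _
  have e2 : K' * Real.exp (-(a' * n)) ≤ K' * Real.exp (-(min a a' * n)) := by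
    gcongr
    exact min_le_right _ _
  rw [add_mul]
  linarith

theorem ExpSmall.const_mul {f : ℕ → ℝ} (hf : ExpSmall f) {C : ℝ} (hC : 0 ≤ C) :
    ExpSmall fun n => C * f n := by
  obtain ⟨K, a, hK, ha, h⟩ := hf
  refine ⟨C * K, a, by positivity, ha, ?_⟩
  filter_upwards [h] with n h1
  rw [mul_assoc]
  exact mul_le_mul_of_nonneg_left h1 hC

theorem ExpSmall.mono {f g : ℕ → ℝ} (hf : ExpSmall f) (h : ∀ᶠ n in Filter.atTop, g n ≤ f n) :
    ExpSmall g := by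
  obtain ⟨K, a, hK, ha, h1⟩ := hf
  refine ⟨K, a, hK, ha, ?_⟩
  filter_upwards [h, h1] with n h2 h3 using h2.trans h3

theorem ExpSmall.sqrt {f : ℕ → ℝ} (hf : ExpSmall f) : ExpSmall fun n => Real.sqrt (f n) := by
  obtain ⟨K, a, hK, ha, h⟩ := hf
  refine ⟨Real.sqrt K, a / 2, Real.sqrt_nonneg _, by positivity, ?_⟩
  filter_upwards [h] with n h1
  refine (Real.sqrt_le_sqrt h1).trans (le_of_eq ?_)
  rw [Real.sqrt_mul hK, ← Real.exp_half]
  congr 2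
  ring

theorem expSmall_exp {a : ℝ} (ha : 0 < a) : ExpSmall fun n => Real.exp (-(a * n)) :=
  ⟨1, a, zero_le_one, ha, Filter.Eventually.of_forall fun n => by rw [one_mul]⟩

theorem expSmall_pow {r : ℝ} (h0 : 0 < r) (h1 : r < 1) : ExpSmall fun n => r ^ n := by
  refine (expSmall_exp (a := -Real.log r) (by linarith [Real.log_neg h0 h1])).mono
    (Filter.Eventually.of_forall fun n => ?_)
  rw [neg_mul, neg_neg, mul_comm, Real.exp_nat_mul, Real.exp_log h0]

theorem expSmall_two_rpow {c : ℝ} (hc : 0 < c) : ExpSmall fun n => (2 : ℝ) ^ (-(c * n)) := by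
  refine (expSmall_exp (a := Real.log 2 * c) (mul_pos (Real.log_pos one_lt_two) hc)).mono
    (Filter.Eventually.of_forall fun n => ?_)
  rw [Real.rpow_def_of_pos two_pos]
  exact le_of_eq (by congr 1; ring)

/-- Subexponential factors keep a sequence exponentially small. -/
theorem ExpSmall.mul_subexponential {f : ℕ → ℝ} (hf : ExpSmall f) {ℓ : ℕ → ℕ}
    (hℓ1 : ∀ᶠ n in Filter.atTop, 1 ≤ ℓ n)
    (hℓ : (fun n => Real.logb 2 (ℓ n)) =o[Filter.atTop] (fun n : ℕ => (n : ℝ))) :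
    ExpSmall fun n => ℓ n * f n := by
  obtain ⟨K, a, hK, ha, h⟩ := hf
  refine ⟨K, a / 2, hK, by positivity, ?_⟩
  filter_upwards [h, hℓ1, hℓ.bound (show 0 < a / 2 by positivity)] with n h1 h2 h3
  have hℓ0 : (0 : ℝ) < ℓ n := by exact_mod_cast h2
  have hn : (0 : ℝ) ≤ n := Nat.cast_nonneg n
  have h4 : Real.log (ℓ n) ≤ a / 2 * n := by
    rw [Real.norm_eq_abs, Real.norm_eq_abs, abs_of_nonneg hn] at h3
    have h5 := (le_abs_self _).trans h3
    rw [Real.logb, div_le_iff₀ (Real.log_pos one_lt_two)] at h5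
    have h6 : Real.log 2 ≤ 1 := by linarith [Real.log_two_lt_d9]
    have h7 : 0 ≤ a / 2 * n := by positivity
    nlinarith
  have h5 : (ℓ n : ℝ) ≤ Real.exp (a / 2 * n) := by
    rw [← Real.exp_log hℓ0]
    exact Real.exp_le_exp.2 h4
  calc ℓ n * f n ≤ ℓ n * (K * Real.exp (-(a * n))) := mul_le_mul_of_nonneg_left h1 hℓ0.le
    _ ≤ Real.exp (a / 2 * n) * (K * Real.exp (-(a * n))) :=
        mul_le_mul_of_nonneg_right h5 (by positivity)
    _ = K * (Real.exp (a / 2 * n) * Real.exp (-(a * n))) := by ring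
    _ = K * Real.exp (-(a / 2 * n)) := by
        rw [← Real.exp_add]
        congr 2
        ring

theorem ExpSmall.exists_le_two_rpow {f : ℕ → ℝ} (hf : ExpSmall f) :
    ∃ c : ℝ, 0 < c ∧ ∀ᶠ n : ℕ in Filter.atTop, f n ≤ (2 : ℝ) ^ (-(c * n)) := by
  obtain ⟨K, a, hK, ha, h⟩ := hf
  refine ⟨a / 2, by positivity, ?_⟩
  have hlim : Filter.Tendsto (fun n : ℕ => a / 2 * (n : ℝ)) Filter.atTop Filter.atTop :=
    tendsto_natCast_atTop_atTop.const_mul_atTop (by positivity)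
  filter_upwards [h, hlim.eventually_ge_atTop K] with n h1 h2
  refine h1.trans ?_
  have hn : (0 : ℝ) ≤ a / 2 * n := by positivity
  have h3 : K ≤ Real.exp (a / 2 * n) := by linarith [Real.add_one_le_exp (a / 2 * (n : ℝ))]
  calc K * Real.exp (-(a * n)) ≤ Real.exp (a / 2 * n) * Real.exp (-(a * n)) :=
        mul_le_mul_of_nonneg_right h3 (Real.exp_pos _).le
    _ = Real.exp (-(a / 2 * n)) := by
        rw [← Real.exp_add]
        congr 1
        ring
    _ ≤ (2 : ℝ) ^ (-(a / 2 * n)) := by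
        rw [Real.rpow_def_of_pos two_pos]
        refine Real.exp_le_exp.2 ?_
        nlinarith [Real.log_two_lt_d9]

theorem expSmall_overlapLoss {α : ℕ → ℝ}
    (hα : ∃ c : ℝ, 0 < c ∧ ∀ᶠ n : ℕ in Filter.atTop, c * Real.sqrt n ≤ α n) :
    ExpSmall fun n => overlapLoss n (α n) := by
  obtain ⟨c, hc, hα⟩ := hα
  have hC : 0 < gaussSum 1 := gaussSum_pos one_pos
  have hπ := Real.pi_pos
  refine ((expSmall_pow (r := 1 / 2) (by norm_num) (by norm_num)).const_mul zero_le_two).add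
    (ExpSmall.add ?_ ?_)
  · refine (((expSmall_exp (a := Real.pi * c ^ 2 / 4) (by positivity)).const_mul
      (Real.exp_pos Real.pi).le).const_mul hC.le).const_mul zero_le_two |>.mono ?_
    filter_upwards [hα] with n hn
    have h1 : c ^ 2 * n ≤ α n ^ 2 := by
      have := pow_le_pow_left₀ (by positivity) hn 2
      rwa [mul_pow, Real.sq_sqrt (Nat.cast_nonneg n)] at this
    rw [← Real.exp_add]
    gcongr
    nlinarith
  · refine ((expSmall_exp hπ).const_mul (Real.exp_pos Real.pi).le).const_mul hC.le |>.mono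
      (Filter.Eventually.of_forall fun n => ?_)
    rw [← Real.exp_add]
    exact le_of_eq (by congr 2; ring)

/-! ### The reduction for growing parameters -/

/-- The relations between the parameters, for one large `n`, on which the reduction rests. The error
bound `α √(m γ² q²) < β q` and `m γ² q² ≥ 1` give `α < β q`, so `β q` is large; then the logarithm
in the bound on `β` supplies the constant of the decoding radius. -/
theorem regime_of_parameters {n m q : ℕ} {α β γ : ℝ} (hn : 0 < n) (hγ : 0 < γ)
    (hα : 2 ≤ α) (hlog : Real.exp 36 ≤ α) (h1 : (n : ℝ) * Real.log q ≤ m)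
    (h2 : α * γ * Real.sqrt m < β) (h3 : 1 < β * q)
    (h4 : β < 1 / (16 * Real.sqrt (m * Real.log (β * q))))
    (h5 : 1 ≤ (m : ℝ) * γ ^ 2 * (q : ℝ) ^ 2)
    (hloss : overlapLoss n α ≤ 1) :
    0 < m ∧ 2 < q ∧ m ≤ q ^ 2 ∧ 2 * n ≤ m ∧ 48 * Real.sqrt (m * γ ^ 2 * q ^ 2) ≤ q ∧
      ∀ E : ℝ, 0 ≤ E → E ≤ m * γ ^ 2 * q ^ 2 → Regime n m q α (β * q) E := by
  have hα0 : 0 < α := by linarith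
  have hm : 0 < m := by
    rcases Nat.eq_zero_or_pos m with h | h
    · rw [h] at h5; norm_num at h5
    · exact h
  have hm1 : (1 : ℝ) ≤ m := by exact_mod_cast hm
  have hq0 : (0 : ℝ) < q := by
    rcases Nat.eq_zero_or_pos q with h | h
    · rw [h] at h5; norm_num at h5
    · exact_mod_cast h
  obtain ⟨B, hB⟩ : ∃ B, B = β * q := ⟨_, rfl⟩
  have hX : Real.sqrt (m * γ ^ 2 * q ^ 2) = γ * Real.sqrt m * q := by
    rw [show (m : ℝ) * γ ^ 2 * q ^ 2 = m * (γ * q) ^ 2 by ring, Real.sqrt_mul (by linarith),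
      Real.sqrt_sq (by positivity)]
    ring
  have hX1 : 1 ≤ γ * Real.sqrt m * q := by
    rw [← hX]
    exact Real.one_le_sqrt.2 h5
  have hXB : α * (γ * Real.sqrt m * q) ≤ B := by
    rw [hB]
    nlinarith [mul_le_mul_of_nonneg_right h2.le hq0.le]
  have hαB : α ≤ B := by nlinarith
  have hlogB : 36 ≤ Real.log B := by
    rw [Real.le_log_iff_exp_le (by linarith)]
    exact hlog.trans hαB
  have hsm : 1 ≤ Real.sqrt m := Real.one_le_sqrt.2 hm1
  have hrad : 96 * B * Real.sqrt m < q := by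
    -- `16 * 6 = 96`
    have h6 : 6 ≤ Real.sqrt (Real.log B) := Real.le_sqrt_of_sq_le (by norm_num; linarith)
    rw [← hB, Real.sqrt_mul (by linarith), lt_div_iff₀ (by positivity)] at h4
    have h7 : B * (16 * (Real.sqrt m * Real.sqrt (Real.log B))) < q := by
      have := mul_lt_mul_of_pos_right h4 hq0
      rw [hB]
      rw [hB] at this
      linarith
    have h8 : 0 ≤ B * Real.sqrt m := mul_nonneg (by linarith) (by linarith)
    nlinarith
  have hB2 : 2 ≤ B := hα.trans hαB
  have hqm : Real.sqrt m ≤ q / 96 := by nlinarith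
  have hq192 : (192 : ℝ) < q := by nlinarith
  have hlogq : 2 ≤ Real.log q := by
    rw [Real.le_log_iff_exp_le hq0, show (2 : ℝ) = 1 + 1 by norm_num, Real.exp_add]
    nlinarith [Real.exp_one_lt_d9, Real.exp_pos 1]
  have hnm : 2 * n ≤ m := by
    have : 2 * (n : ℝ) ≤ m := by
      have hn0 : (0 : ℝ) ≤ n := Nat.cast_nonneg n
      nlinarith
    exact_mod_cast this
  refine ⟨hm, by exact_mod_cast (show (2 : ℝ) < q by linarith), ?_, hnm, ?_, fun E hE0 hE => ?_⟩
  · have h6 : (m : ℝ) ≤ (q : ℝ) ^ 2 := by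
      rw [← Real.sq_sqrt (show (0 : ℝ) ≤ m by linarith)]
      exact pow_le_pow_left₀ (by linarith) (by linarith) 2
    exact_mod_cast h6
  · rw [hX]
    nlinarith
  · rw [← hB]
    refine ⟨hn, by omega, hα, hαB, ?_, hE0, hrad, ?_⟩
    · calc α ^ 2 * E ≤ α ^ 2 * (m * γ ^ 2 * q ^ 2) := mul_le_mul_of_nonneg_left hE (sq_nonneg _)
        _ = (α * (γ * Real.sqrt m * q)) ^ 2 := by
            rw [← hX, mul_pow, Real.sq_sqrt (by positivity)]
        _ ≤ B ^ 2 := pow_le_pow_left₀ (by positivity) hXB 2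
    · have hC : 0 < gaussSum 1 := gaussSum_pos one_pos
      have h6 : 0 ≤ gaussSum 1 * Real.exp (-Real.pi * (n - 1)) :=
        mul_nonneg hC.le (Real.exp_pos _).le
      have h7 : (0 : ℝ) < (1 / 2) ^ n := by positivity
      rw [overlapLoss] at hloss
      linarith

/-- Since `q ^ n ≤ exp m`, the base `3` in the bound on the bad matrices wins over `e`. -/
theorem bad_matrix_le {n m q : ℕ} (hq : 2 < q) (h : (n : ℝ) * Real.log q ≤ m) (hnm : 2 * n ≤ m) :
    (2 : ℝ) ^ n / 2 ^ m + (q : ℝ) ^ n / 3 ^ m + (1 / 2) ^ m ≤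
      2 * (1 / 2) ^ n + (Real.exp 1 / 3) ^ n := by
  have h1 : (2 : ℝ) ^ n / 2 ^ m ≤ (1 / 2) ^ n := by
    rw [one_div_pow, div_le_div_iff₀ (by positivity) (by positivity), one_mul, ← pow_add]
    exact pow_le_pow_right₀ one_le_two (by omega)
  have h2 : (q : ℝ) ^ n ≤ Real.exp 1 ^ m := by
    rw [← Real.exp_log (show (0 : ℝ) < q by positivity), ← Real.exp_nat_mul, ← Real.exp_nat_mul,
      mul_one]
    exact Real.exp_le_exp.2 h
  have h3 : Real.exp 1 / 3 ≤ 1 := by linarith [Real.exp_one_lt_d9]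
  have h4 : (q : ℝ) ^ n / 3 ^ m ≤ (Real.exp 1 / 3) ^ n := by
    refine (div_le_div_of_nonneg_right h2 (by positivity)).trans ?_
    rw [← div_pow]
    exact pow_le_pow_of_le_one (by positivity) h3 (by omega)
  have h5 : (1 / 2 : ℝ) ^ m ≤ (1 / 2) ^ n :=
    pow_le_pow_of_le_one (by norm_num) (by norm_num) (by omega)
  linarith

/-- The reduction, with all error terms exponentially small. -/
theorem reduction_asymptotic (m q ℓ T : ℕ → ℕ) [∀ n, NeZero (q n)] (α β γ : ℕ → ℝ)
    (hα : ∃ c : ℝ, 0 < c ∧ ∀ᶠ n : ℕ in Filter.atTop, c * Real.sqrt n ≤ α n)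
    (hpar : ∀ᶠ n : ℕ in Filter.atTop,
      (0 < β n ∧ β n < 1) ∧ (0 < γ n ∧ γ n < 1) ∧
      (n : ℝ) * Real.log (q n) ≤ m n ∧
      α n * γ n * Real.sqrt (m n) < β n ∧
      1 < β n * q n ∧
      β n < 1 / (16 * Real.sqrt (m n * Real.log (β n * q n))) ∧
      1 ≤ (m n : ℝ) * γ n ^ 2 * (q n : ℝ) ^ 2 ∧
      1 ≤ ℓ n)
    (hℓ : (fun n => Real.logb 2 (ℓ n)) =o[Filter.atTop] (fun n : ℕ => (n : ℝ)))
    (hQ : ∃ c : ℝ, 0 < c ∧ ∀ᶠ n : ℕ in Filter.atTop,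
      ∀ E : ℕ, 1 ≤ E → (E : ℝ) ≤ (m n : ℝ) * γ n ^ 2 * (q n : ℝ) ^ 2 →
        ∃ Q : Circuit (SLWEWires n (m n) (q n) (ℓ n)) (Fin n × ZReg (q n)),
          Q.size ≤ T n ∧
          1 - (2 : ℝ) ^ (-(c * n)) ≤
            unifProb {A : Matrix (Fin n) (Fin (m n)) (ZMod (q n)) |
              ∀ e : Fin (m n) → ℤ, ‖toE e‖ ^ 2 = (E : ℝ) →
                SolvesSLWEPhase Q A (amplitude (α n) (β n) (q n) E)
                  (phase (α n) (β n) A e) (distribution (α n) (β n) A e)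
                  ((2 : ℝ) ^ (-(c * n)))}) :
    ∃ c : ℝ, 0 < c ∧ ∀ᶠ n : ℕ in Filter.atTop,
      ∃ R : Circuit (LWEWires n (m n) (q n)) (Fin n × ZReg (q n)),
        (R.size : ℝ) ≤ 2 * 10 ^ 6 * ((T n + ℓ n * ((n : ℝ) + q n) ^ 50) *
          ((m n : ℝ) * γ n ^ 2 * (q n : ℝ) ^ 2)) ∧
        ∀ s : Fin n → ZMod (q n), 1 - (2 : ℝ) ^ (-(c * n)) ≤ lweSuccess R (γ n) s := by
  obtain ⟨c, hc, hQ⟩ := hQ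
  have hloss := expSmall_overlapLoss hα
  have hℓ1 : ∀ᶠ n in Filter.atTop, 1 ≤ ℓ n := hpar.mono fun n h => h.2.2.2.2.2.2.2
  have herr := (((expSmall_two_rpow hc).const_mul zero_le_two).add
    (((hloss.mul_subexponential hℓ1 hℓ).const_mul zero_le_two).sqrt.const_mul zero_le_two)).add
    (((expSmall_pow (r := 1 / 2) (by norm_num) (by norm_num)).const_mul zero_le_two).add
      (expSmall_pow (r := Real.exp 1 / 3) (by positivity) (by linarith [Real.exp_one_lt_d9])))
  obtain ⟨c', hc', herr⟩ := herr.exists_le_two_rpow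
  obtain ⟨c₁, hc₁, hloss1⟩ := hloss.exists_le_two_rpow
  obtain ⟨c₂, hc₂, hα⟩ := hα
  have hlarge : Filter.Tendsto (fun n : ℕ => c₂ * Real.sqrt n) Filter.atTop Filter.atTop :=
    (Real.tendsto_sqrt_atTop.comp tendsto_natCast_atTop_atTop).const_mul_atTop hc₂
  refine ⟨c', hc', ?_⟩
  filter_upwards [hpar, hQ, herr, hloss1, hα, hlarge.eventually_ge_atTop (Real.exp 36),
    Filter.eventually_gt_atTop 0] with n hp hQn herrn hlossn hαn hexp hn
  obtain ⟨⟨hβ, -⟩, ⟨hγ, -⟩, h1, h2, h3, h4, h5, hℓn⟩ := hp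
  have hlog : Real.exp 36 ≤ α n := hexp.trans hαn
  have hα2 : 2 ≤ α n := by linarith [Real.add_one_le_exp (36 : ℝ)]
  have hloss1 : overlapLoss n (α n) ≤ 1 := by
    refine hlossn.trans (Real.rpow_le_one_of_one_le_of_nonpos one_le_two ?_)
    have : 0 ≤ c₁ * (n : ℝ) := by positivity
    linarith
  obtain ⟨hm, hq, hmq, hnm, hXq, hreg⟩ :=
    regime_of_parameters hn hγ hα2 hlog h1 h2 h3 h4 h5 hloss1
  obtain ⟨X, hX⟩ : ∃ X, X = (m n : ℝ) * γ n ^ 2 * (q n : ℝ) ^ 2 := ⟨_, rfl⟩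
  rw [← hX] at h5 hQn hXq hreg ⊢
  have hMX : (⌊X⌋₊ : ℝ) ≤ X := Nat.floor_le (by linarith)
  have hle : ∀ t : ℕ, t ≤ ⌊X⌋₊ → (t : ℝ) ≤ X := fun t ht =>
    (Nat.cast_le.2 ht).trans hMX
  obtain ⟨R, hsize, hR⟩ := exists_lwe_circuit (ℓ := ℓ n) (T := T n) hq hm hβ hγ (M := ⌊X⌋₊)
    ((Nat.one_le_floor_iff X).2 h5)
    (by
      rw [show (m n : ℝ) * (γ n * q n) ^ 2 = X by rw [hX]; ring]
      exact Nat.lt_floor_add_one X)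
    (fun t _ ht => hreg t (Nat.cast_nonneg t) (hle t ht)) hloss1
    ((mul_le_mul_of_nonneg_left (Real.sqrt_le_sqrt hMX) (by norm_num)).trans hXq)
    (Real.rpow_nonneg zero_le_two _) (fun t h1t ht => hQn t h1t (hle t ht))
  refine ⟨R, ?_, fun s => le_trans ?_ (hR s)⟩
  · have hcost := cost_le (n := n) hq hmq hℓn
    have h6 : R.size ≤ (⌊X⌋₊ + 1) * (T n + 10 ^ 6 * (ℓ n * (n + q n) ^ 50)) :=
      hsize.trans (Nat.mul_le_mul_left _ (by omega))
    have h7 : (R.size : ℝ) ≤ (⌊X⌋₊ + 1) * (T n + 10 ^ 6 * (ℓ n * ((n : ℝ) + q n) ^ 50)) := by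
      exact_mod_cast h6
    have hT : (0 : ℝ) ≤ T n := Nat.cast_nonneg _
    have hS : 0 ≤ ℓ n * ((n : ℝ) + q n) ^ 50 := by positivity
    calc (R.size : ℝ) ≤ (⌊X⌋₊ + 1) * (T n + 10 ^ 6 * (ℓ n * ((n : ℝ) + q n) ^ 50)) := h7
      -- here `1 ≤ X` absorbs the additional trial
      _ ≤ (2 * X) * (10 ^ 6 * (T n + ℓ n * ((n : ℝ) + q n) ^ 50)) := by
          refine mul_le_mul (by linarith) (by linarith) (by positivity) (by linarith)
      _ = _ := by ring
  · have h8 := bad_matrix_le hq h1 hnm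
    rw [← mul_assoc] at herrn
    linarith

end QLWE

end

theorem mainTheorem3 :
    ∃ (K : ℝ) (d : ℕ), 0 < K ∧
      ∀ (m q ℓ T : ℕ → ℕ) [∀ n, NeZero (q n)] (α β γ : ℕ → ℝ),
        (∃ c : ℝ, 0 < c ∧ ∀ᶠ n : ℕ in Filter.atTop, c * Real.sqrt n ≤ α n) →
        (∀ᶠ n : ℕ in Filter.atTop,
          (0 < β n ∧ β n < 1) ∧ (0 < γ n ∧ γ n < 1) ∧
          (n : ℝ) * Real.log (q n) ≤ m n ∧
          α n * γ n * Real.sqrt (m n) < β n ∧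
          1 < β n * q n ∧
          β n < 1 / (16 * Real.sqrt (m n * Real.log (β n * q n))) ∧
          1 ≤ (m n : ℝ) * γ n ^ 2 * (q n : ℝ) ^ 2 ∧
          1 ≤ ℓ n) →
        (fun n => Real.logb 2 (ℓ n)) =o[Filter.atTop] (fun n : ℕ => (n : ℝ)) →
        (fun n => Real.logb 2 (T n)) =o[Filter.atTop] (fun n : ℕ => (n : ℝ)) →
        (∃ c : ℝ, 0 < c ∧ ∀ᶠ n : ℕ in Filter.atTop,
          ∀ E : ℕ, 1 ≤ E → (E : ℝ) ≤ (m n : ℝ) * γ n ^ 2 * (q n : ℝ) ^ 2 →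
            ∃ Q : QLWE.Circuit (QLWE.SLWEWires n (m n) (q n) (ℓ n)) (Fin n × QLWE.ZReg (q n)),
              Q.size ≤ T n ∧
              1 - (2 : ℝ) ^ (-(c * n)) ≤
                QLWE.unifProb {A : Matrix (Fin n) (Fin (m n)) (ZMod (q n)) |
                  ∀ e : Fin (m n) → ℤ, ‖QLWE.toE e‖ ^ 2 = (E : ℝ) →
                    QLWE.SolvesSLWEPhase Q A (QLWE.amplitude (α n) (β n) (q n) E)
                      (QLWE.phase (α n) (β n) A e) (QLWE.distribution (α n) (β n) A e)
                      ((2 : ℝ) ^ (-(c * n)))}) →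
        ∃ c : ℝ, 0 < c ∧ ∀ᶠ n : ℕ in Filter.atTop,
          ∃ R : QLWE.Circuit (QLWE.LWEWires n (m n) (q n)) (Fin n × QLWE.ZReg (q n)),
            (R.size : ℝ) ≤ K * ((T n + ℓ n * ((n : ℝ) + q n) ^ d) *
              ((m n : ℝ) * γ n ^ 2 * (q n : ℝ) ^ 2)) ∧
            ∀ s : Fin n → ZMod (q n),
              1 - (2 : ℝ) ^ (-(c * n)) ≤ QLWE.lweSuccess R (γ n) s := by
  refine ⟨2 * 10 ^ 6, 50, by norm_num, ?_⟩
  intro m q ℓ T _ α β γ hα hpar hℓ _ hQ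
  exact QLWE.reduction_asymptotic m q ℓ T α β γ hα hpar hℓ hQ
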